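/- \textbf{Diagrams.} A \emph{cup diagram} $\underline\lambda$ is a partition of $\mathbb Z+\frac12$ into one-element sets (drawn as vertical rays) and finitely many two-element sets (drawn as cups) such that whenever $\{i,j\}$ is a cup and $i<k<j$, then $k$ is the endpoint of a cup $\{k,k'\}$ with $i<k'<j$. The \emph{cap diagram} $\overline\lambda$ is the mirror image of $\underline\lambda$ in a horizontal line, shifted one to the right (a cup $\{a,b\}$ gives a cap $\{a+1,b+1\}$). The \emph{circle diagram} $\underline\lambda\overline\mu$ is $\underline\lambda$ drawn under $\overline\mu$. The \emph{middle section} of a cup diagram $\sigma$ has $\overline\sigma$ at its bottom and $\underline\sigma$ at its top; the ray of $\overline\sigma$ at $x$ is connected to the ray of $\underline\sigma$ at the first $y\ge x$ that is not an endpoint of a cup of $\underline\sigma$ (so $y=x$ unless $x$ is directly to the left of a cap). A \emph{stacked diagram} consists, from bottom to top, of a cup diagram $\underline\lambda$, the middle sections of finitely many cup diagrams $\sigma_1,\dots,\sigma_m$ ($m\ge 0$), and a cap diagram $\overline\nu$. For $m=0$ it is the circle diagram $\underline\lambda\overline\nu$. \textbf{Orientability.} If $\underline\lambda$ has $k$ cups,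 redraw its rays, preserving their order and fixing all rays far to the left and far to the right, so that their bottom endpoints occupy all positions except $-k-\frac12,-k+\frac12,\dots,k-\frac32$. If $\overline\nu$ has $k$ caps, redraw its rays in the same way, so that their top endpoints occupy all positions except $-k+\frac12,\dots,k-\frac12$. A stacked diagram is \emph{orientable} if it contains no circle, every line with both ends at the bottom has one redrawn endpoint to the left and one to the right of $-1$, and every line with both ends at the top has one redrawn endpoint to the left and one to the right of $0$. \textbf{Surgery.} In the middle section of $\sigma$ let $\{a,b\}$, $a<b$, be a cup that is not nested in another cup. Let $p\to q$ be the line that runs between this cup and the corresponding cap $\{a+1,b+1\}$. The \emph{surgery} at this cup replaces the cup, the cap and the line by the three lines $p\to a$, $a+1\to b$, $b+1\to q$ from the bottom to the top of the section; the result is the middle section of $\sigma$ with the cup $\{a,b\}$ deleted. If the stacked diagram after the surgery is not orientable, the result of the surgery procedure is defined to be $0$. \textbf{The algebra.} Let $k$ be a field and let $\mathbb K$ be the $k$-vector space with basis all orientable circle diagrams. The product of two basis vectors is prescribed as follows: $\underline\lambda\overline\mu\cdot\underline{\mu'}\overline\nu=0$ if $\mu\neq\mu'$. For $\mu=\mu'$,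 start with the stacked diagram $\underline\lambda$, middle section of $\mu$, $\overline\nu$, and perform surgeries, in some order, until no cup is left in the middle section; the product is $0$ if some intermediate result is $0$ (i.e. not orientable), and $\underline\lambda\overline\nu$ otherwise. \textbf{Theorem.} \begin{enumerate} \item If $\nu_1,\dots,\nu_r$ ($r\ge2$) are cup diagrams such that $\underline{\nu_i}\overline{\nu_{i+1}}$ is orientable for all $i$, then the stacked diagram formed by $\underline{\nu_1}$, the middle sections of $\nu_2,\dots,\nu_{r-1}$, and $\overline{\nu_r}$ is orientable. \item Any two potential surgeries $D$, $D'$ on an orientable stacked diagram commute: $D\circ D'=D'\circ D$ (where either side may be $0$). \item The multiplication on $\mathbb K$ is well defined: there is exactly one bilinear map $\mathbb K\times\mathbb K\to\mathbb K$ that satisfies the prescription above for every order in which the surgeries can be performed; in particular the result does not depend on the order, and it is again $0$ or a basis vector. \item This multiplication is associative. \end{enumerate} -/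

import Mathlib

/-! Half-integers are indexed by integers throughout: `n : ℤ` stands for `n + 1/2`. -/

/-- A cup diagram: a partition of `ℤ + 1/2` into sets of size one (rays) and finitely many sets of
size two (cups), encoded by the involution `mate` exchanging the two endpoints of each cup and
fixing the endpoints of rays. Cups do not cross and no ray starts below a cup. -/
@[ext]
structure CupDiagram where
  mate : ℤ → ℤ
  mate_mate : ∀ i, mate (mate i) = i
  finite_cups : {i | mate i ≠ i}.Finite
  nested : ∀ i k, i < k → k < mate i → mate k ≠ k ∧ i < mate k ∧ mate k < mate i

namespace CupDiagram

/-- The number of cups. -/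
noncomputable def numCups (σ : CupDiagram) : ℕ := {i | i < σ.mate i}.ncard

/-- The involution of the cap diagram attached to `σ`: the mirror image of `σ` in a horizontal
line, shifted one to the right. -/
def capMate (σ : CupDiagram) (x : ℤ) : ℤ := σ.mate (x - 1) + 1

/-- The number of endpoints of cups to the left of `x`. -/
noncomputable def numCupEndsBefore (σ : CupDiagram) (x : ℤ) : ℕ :=
  {i | i < x ∧ σ.mate i ≠ i}.ncard

/-- The position of the bottom endpoint of the ray starting at `x` in the redrawn cup diagram:
if there are `k` cups, the rays are redrawn, preserving their order and without moving rays far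
to the left or far to the right, so that exactly the positions
`-k - 1/2, -k + 1/2, …, k - 3/2` are free; see `rayPos_spec`. -/
noncomputable def rayPos (σ : CupDiagram) (x : ℤ) : ℤ :=
  if x - σ.numCupEndsBefore x < -(σ.numCups : ℤ) - 1 then x - σ.numCupEndsBefore x
  else x - σ.numCupEndsBefore x + 2 * σ.numCups

/-- In the redrawn cup diagram the ray at `x` ends to the left of `-1`. -/
def BottomLeft (σ : CupDiagram) (x : ℤ) : Prop := σ.rayPos x < -1

/-- In the redrawn cap diagram (everything is shifted one to the right) the ray at `x` ends to the
left of `0`. -/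
def TopLeft (σ : CupDiagram) (x : ℤ) : Prop := σ.rayPos (x - 1) + 1 < 0

/-- In the middle section, with the cap diagram of `σ` at its bottom and the cup diagram `σ` at its
top, the ray of the cap diagram at `x` is connected with the ray of the cup diagram at `y`, the
first free endpoint that is not to the left of `x`. So `y = x` unless `x` is directly to the
left of a cap, in which case `y` is the first free endpoint right of the corresponding cup. -/
def IsRay (σ : CupDiagram) (x y : ℤ) : Prop :=
  σ.capMate x = x ∧ σ.mate y = y ∧ x ≤ y ∧ ∀ z, x ≤ z → z < y → σ.mate z ≠ z

/-- The strands of the middle section of `σ`. The point `(false, x)` is the point `x` on its bottom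
line, `(true, x)` is the point `x` on its top line. -/
inductive Strand (σ : CupDiagram) : Bool × ℤ → Bool × ℤ → Prop
  | cap (x : ℤ) (h : σ.capMate x ≠ x) : Strand σ (false, x) (false, σ.capMate x)
  | cup (x : ℤ) (h : σ.mate x ≠ x) : Strand σ (true, x) (true, σ.mate x)
  | ray (x y : ℤ) (h : σ.IsRay x y) : Strand σ (false, x) (true, y)

/-- `a` is the left endpoint of a cup that is not nested in another cup. -/
def IsOutermost (σ : CupDiagram) (a : ℤ) : Prop :=
  a < σ.mate a ∧ ∀ i, i < a → σ.mate i < a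

open Classical in
/-- Delete the outermost cup with left endpoint `a`. For the middle section of `σ` this is the
surgery procedure at this cup, the corresponding cap and the line running between the two;
see `strand_erase`. -/
noncomputable def erase (σ : CupDiagram) (a : ℤ) : CupDiagram :=
  if h : σ.IsOutermost a then
    { mate := fun x => if x = a ∨ x = σ.mate a then x else σ.mate x
      mate_mate := by
        intro i
        have h1 := σ.mate_mate i
        have h2 := σ.mate_mate a
        grind
      finite_cups := σ.finite_cups.subset (by
        intro i hi
        simp only [Set.mem_ofPred_eq] at hi ⊢
        grind)
      nested := by
        intro i k hik hk
        have h1 := σ.mate_mate i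
        have h2 := σ.mate_mate a
        have h3 := σ.nested i k hik
        have h4 := h.2 i
        have h5 := h.1
        have h6 := σ.mate_mate k
        have h7 := σ.nested a i
        grind }
  else σ

/-- The redrawing of the rays is the one that is described at `rayPos`. -/
theorem rayPos_spec (σ : CupDiagram) :
    StrictMonoOn σ.rayPos {x | σ.mate x = x} ∧
    σ.rayPos '' {x | σ.mate x = x} =
      {y | ¬ (-(σ.numCups : ℤ) - 1 ≤ y ∧ y ≤ (σ.numCups : ℤ) - 2)} ∧
    {x | σ.mate x = x ∧ σ.rayPos x ≠ x}.Finite := by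
  have hfin : ∀ x, {i | i < x ∧ σ.mate i ≠ i}.Finite := fun x =>
    σ.finite_cups.subset fun i hi => hi.2
  have hs1 : ∀ x, σ.mate x = x → σ.numCupEndsBefore (x + 1) = σ.numCupEndsBefore x := by
    intro x hx
    unfold numCupEndsBefore
    congr 1
    ext i
    constructor
    · rintro ⟨h1, h2⟩
      exact ⟨by grind, h2⟩
    · rintro ⟨h1, h2⟩
      exact ⟨by omega, h2⟩
  have hs2 : ∀ x, σ.mate x ≠ x → σ.numCupEndsBefore (x + 1) = σ.numCupEndsBefore x + 1 := by
    intro x hx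
    unfold numCupEndsBefore
    rw [← Set.ncard_insert_of_notMem (a := x) _ (hfin x)]
    · congr 1
      ext i
      constructor
      · rintro ⟨h1, h2⟩
        by_cases h3 : i = x
        · exact Or.inl h3
        · exact Or.inr ⟨by omega, h2⟩
      · rintro (rfl | ⟨h1, h2⟩)
        · exact ⟨by omega, hx⟩
        · exact ⟨by omega, h2⟩
    · rintro ⟨h1, -⟩
      omega
  obtain ⟨B, hB⟩ := σ.finite_cups.bddAbove
  obtain ⟨A, hA⟩ := σ.finite_cups.bddBelow
  have hA0 : ∀ x, x ≤ A → σ.numCupEndsBefore x = 0 := by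
    intro x hx
    unfold numCupEndsBefore
    rw [Set.ncard_eq_zero (hfin x)]
    ext i
    constructor
    · rintro ⟨h1, h2⟩
      exact absurd (hA h2) (by omega)
    · intro hi
      exact hi.elim
  have htot : {i | σ.mate i ≠ i}.ncard = 2 * σ.numCups := by
    have e : {i | σ.mate i ≠ i} = {i | i < σ.mate i} ∪ {i | σ.mate i < i} := by
      ext i
      exact ⟨fun hi => (lt_or_gt_of_ne hi).symm, fun hi => hi.elim (fun h => h.ne') (fun h => h.ne)⟩
    have e2 : {i | σ.mate i < i} = σ.mate '' {i | i < σ.mate i} := by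
      ext i
      constructor
      · intro hi
        exact ⟨σ.mate i, by
          change σ.mate i < σ.mate (σ.mate i)
          rwa [σ.mate_mate], σ.mate_mate i⟩
      · rintro ⟨j, hj, rfl⟩
        change σ.mate (σ.mate j) < σ.mate j
        rwa [σ.mate_mate]
    have hinj : Function.Injective σ.mate := fun x y hxy => by
      rw [← σ.mate_mate x, hxy, σ.mate_mate]
    have f1 : {i | i < σ.mate i}.Finite :=
      σ.finite_cups.subset fun i (hi : i < σ.mate i) => hi.ne'
    have f2 : {i | σ.mate i < i}.Finite :=
      σ.finite_cups.subset fun i (hi : σ.mate i < i) => hi.ne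
    have hd : Disjoint {i | i < σ.mate i} {i | σ.mate i < i} := by
      rw [Set.disjoint_left]
      intro i (h1 : i < σ.mate i) (h2 : σ.mate i < i)
      omega
    rw [e, Set.ncard_union_eq hd f1 f2, e2, Set.ncard_image_of_injective _ hinj, two_mul]
    rfl
  have hB0 : ∀ x, B < x → σ.numCupEndsBefore x = 2 * σ.numCups := by
    intro x hx
    rw [← htot]
    unfold numCupEndsBefore
    congr 1
    ext i
    constructor
    · rintro ⟨h1, h2⟩
      exact h2
    · intro hi
      exact ⟨by have := hB hi; omega, hi⟩
  have hmono : Monotone fun x : ℤ => x - (σ.numCupEndsBefore x : ℤ) := by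
    refine monotone_int_of_le_succ fun x => ?_
    by_cases hx : σ.mate x = x
    · simp only [hs1 x hx]
      omega
    · simp only [hs2 x hx]
      omega
  refine ⟨?_, ?_, ?_⟩
  · intro x (hx : σ.mate x = x) y _ hxy
    have h1 : x + 1 - (σ.numCupEndsBefore (x + 1) : ℤ) ≤ y - σ.numCupEndsBefore y :=
      hmono (show x + 1 ≤ y by omega)
    rw [hs1 x hx] at h1
    unfold rayPos
    split_ifs <;> omega
  · ext y
    constructor
    · rintro ⟨x, -, rfl⟩
      change ¬ _
      unfold rayPos
      split_ifs <;> omega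
    · intro (hy : ¬ _)
      obtain ⟨w, hw⟩ : ∃ w : ℤ, w = if y < -(σ.numCups : ℤ) - 1 then y else y - 2 * σ.numCups :=
        ⟨_, rfl⟩
      obtain ⟨x, hx1, hx2⟩ := Int.exists_greatest_of_bdd
        (P := fun x => x - (σ.numCupEndsBefore x : ℤ) ≤ w)
        ⟨max (B + 1) (w + 2 * σ.numCups), fun z hz => by
          by_contra hc
          have := hB0 z (by omega)
          omega⟩
        ⟨min A w, by
          have := hA0 (min A w) (by omega)
          omega⟩
      have hx3 : ¬ (x + 1 - (σ.numCupEndsBefore (x + 1) : ℤ) ≤ w) := fun hc => by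
        have := hx2 _ hc
        omega
      have hx4 : σ.mate x = x := by
        by_contra hc
        rw [hs2 x hc] at hx3
        omega
      rw [hs1 x hx4] at hx3
      refine ⟨x, hx4, ?_⟩
      unfold rayPos
      split_ifs at hw ⊢ <;> omega
  · refine (Set.finite_Icc (min A (-(σ.numCups : ℤ) - 1)) (max B (σ.numCups - 1))).subset ?_
    rintro x ⟨-, hx⟩
    rw [Set.mem_Icc]
    have h1 := hA0 x
    have h2 := hB0 x
    unfold rayPos at hx
    split_ifs at hx <;> omega

/-- Deleting an outermost cup `{a, b}` replaces, in the middle section, the cup `{a, b}`, the cap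
`{a + 1, b + 1}` and the line from `p` to `q` between them by the three lines from `p` to `a`,
from `a + 1` to `b` and from `b + 1` to `q`, and it changes nothing else. -/
theorem strand_erase (σ : CupDiagram) (a b : ℤ) (h : σ.IsOutermost a) (hb : b = σ.mate a) :
    ∃ p q, σ.IsRay p q ∧ p ≤ a ∧ b < q ∧ ∀ s t, (σ.erase a).Strand s t ↔
      (σ.Strand s t ∧
        s ∉ ({(false, p), (false, a + 1), (false, b + 1), (true, a), (true, b), (true, q)} :
          Set (Bool × ℤ))) ∨
      (s = (false, p) ∧ t = (true, a)) ∨ (s = (false, a + 1) ∧ t = (true, b)) ∨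
      (s = (false, b + 1) ∧ t = (true, q)) := by
  have hm : ∀ x, (σ.erase a).mate x = if x = a ∨ x = b then x else σ.mate x := by
    intro x
    simp only [erase, h, dif_pos, hb]
  have hab : a < b := hb ▸ h.1
  have hba : σ.mate b = a := by rw [hb, σ.mate_mate]
  have hin : ∀ z, a ≤ z → z ≤ b → σ.mate z ≠ z := by
    intro z h1 h2
    have := σ.nested a z
    grind
  obtain ⟨B, hB⟩ := σ.finite_cups.bddAbove
  obtain ⟨A, hA⟩ := σ.finite_cups.bddBelow
  have hB' : ∀ x, B < x → σ.mate x = x := fun x hx => by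
    by_contra hc
    exact absurd (hB hc) (by omega)
  have hA' : ∀ x, x < A → σ.mate x = x := fun x hx => by
    by_contra hc
    exact absurd (hA hc) (by omega)
  obtain ⟨q, ⟨hq1, hq2⟩, hq3⟩ := Int.exists_least_of_bdd (P := fun y => b < y ∧ σ.mate y = y)
    ⟨b, fun z hz => hz.1.le⟩ ⟨max (b + 1) (B + 1), by omega, hB' _ (by omega)⟩
  obtain ⟨p, ⟨hp1, hp2⟩, hp3⟩ := Int.exists_greatest_of_bdd
    (P := fun y => y ≤ a ∧ σ.mate (y - 1) = y - 1)
    ⟨a, fun z hz => hz.1⟩ ⟨min a A, by omega, hA' _ (by omega)⟩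
  have hpa : ∀ z, p ≤ z → z < a → σ.mate z ≠ z := by
    intro z h1 h2 h3
    have := hp3 (z + 1) ⟨by omega, by simpa using h3⟩
    omega
  have hbq : ∀ z, b < z → z < q → σ.mate z ≠ z := by
    intro z h1 h2 h3
    have := hq3 z ⟨h1, h3⟩
    omega
  refine ⟨p, q, ⟨by simp [capMate, hp2], hq2, by omega, ?_⟩, hp1, hq1, ?_⟩
  · intro z h1 h2
    by_cases h3 : z < a
    · exact hpa z h1 h3
    · by_cases h4 : z ≤ b
      · exact hin z (by omega) h4
      · exact hbq z (by omega) h2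
  have hray : ∀ x y, (σ.erase a).IsRay x y ↔ (σ.IsRay x y ∧ x ≠ p) ∨ (x = p ∧ y = a) ∨
      (x = a + 1 ∧ y = b) ∨ (x = b + 1 ∧ y = q) := by
    intro x y
    simp only [IsRay, capMate, hm]
    constructor
    · rintro ⟨h1, h2, h3, h4⟩
      have ha := h4 a
      have hb2 := h4 b
      have h5 := hin (x - 1)
      by_cases e1 : x = a + 1
      · have := hin y
        grind
      · by_cases e2 : x = b + 1
        · have := h4 q
          have := hbq y
          grind
        · have e3 : σ.mate (x - 1) = x - 1 := by grind
          by_cases e4 : x = p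
          · have := hpa y
            grind
          · have e5 := h4 (p - 1)
            have e6 := hp3 x
            left
            refine ⟨⟨by omega, ?_, h3, ?_⟩, e4⟩
            · grind
            · intro z hz1 hz2
              have := h4 z hz1 hz2
              grind
    · rintro (⟨⟨h1, h2, h3, h4⟩, h5⟩ | ⟨rfl, rfl⟩ | ⟨rfl, rfl⟩ | ⟨rfl, rfl⟩)
      · have h0 : σ.mate (x - 1) = x - 1 := by omega
        have e6 := hp3 x
        have e5 := h4 (p - 1)
        have e7 := hin (x - 1)
        have e8 := hin y
        refine ⟨by grind, by grind, h3, ?_⟩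
        intro z hz1 hz2
        have := h4 z hz1 hz2
        grind
      · refine ⟨by grind, by grind, by omega, ?_⟩
        intro z hz1 hz2
        have := hpa z hz1 hz2
        grind
      · refine ⟨by grind, by grind, by omega, ?_⟩
        intro z hz1 hz2
        have := hin z (by omega) (by omega)
        grind
      · refine ⟨by grind, by grind, by omega, ?_⟩
        intro z hz1 hz2
        have := hbq z (by omega) (by omega)
        grind
  have hcap : ∀ x, (σ.erase a).capMate x = if x = a + 1 ∨ x = b + 1 then x else σ.capMate x := by
    intro x
    simp only [capMate, hm]
    grind
  have hpc : σ.capMate p = p := by simp [capMate, hp2]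
  intro s t
  simp only [Set.mem_insert_iff, Set.mem_singleton_iff]
  constructor
  · rintro (⟨x, hx⟩ | ⟨x, hx⟩ | ⟨x, y, hx⟩)
    · rw [hcap] at hx ⊢
      split_ifs at hx ⊢ with hc
      · exact absurd rfl hx
      · exact Or.inl ⟨.cap x hx, by grind⟩
    · rw [hm] at hx ⊢
      split_ifs at hx ⊢ with hc
      · exact absurd rfl hx
      · exact Or.inl ⟨.cup x hx, by grind⟩
    · rcases (hray x y).1 hx with h1 | h1 | h1 | h1
      · refine Or.inl ⟨.ray x y h1.1, ?_⟩
        have h2 := h1.1.1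
        have h3 := hin a
        have h4 := hin b
        have h5 : σ.mate (x - 1) = x - 1 := by
          unfold capMate at h2
          omega
        grind
      · grind
      · grind
      · grind
  · rintro (⟨⟨x, hx⟩ | ⟨x, hx⟩ | ⟨x, y, hx⟩, hs⟩ | ⟨rfl, rfl⟩ | ⟨rfl, rfl⟩ | ⟨rfl, rfl⟩)
    · have e : (σ.erase a).capMate x = σ.capMate x := by
        rw [hcap]
        grind
      rw [← e] at hx ⊢
      exact .cap x hx
    · have e : (σ.erase a).mate x = σ.mate x := by
        rw [hm]
        grind
      rw [← e] at hx ⊢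
      exact .cup x hx
    · exact .ray x y ((hray x y).2 (Or.inl ⟨hx, by grind⟩))
    · exact .ray _ _ ((hray _ _).2 (by simp))
    · exact .ray _ _ ((hray _ _).2 (by simp))
    · exact .ray _ _ ((hray _ _).2 (by simp))

end CupDiagram

/-- A stacked diagram: the cup diagram `bottom` at the bottom, then, from bottom to top, the middle
sections of the cup diagrams in the list `middle`, and the cap diagram of `top` at the top. -/
@[ext]
structure StackedDiagram where
  bottom : CupDiagram
  middle : List CupDiagram
  top : CupDiagram

namespace StackedDiagram

/-- The arcs of a stacked diagram. The point `(j, x)` is the point `x` on the `j`-th horizontal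
line, where the lines `j` and `j + 1` bound the `j`-th middle section. -/
inductive Arc (E : StackedDiagram) : ℕ × ℤ → ℕ × ℤ → Prop
  | bottomCup (x : ℤ) (h : E.bottom.mate x ≠ x) : Arc E (0, x) (0, E.bottom.mate x)
  | strand (j : ℕ) (σ : CupDiagram) (hj : E.middle[j]? = some σ) (s t : Bool × ℤ)
      (h : σ.Strand s t) : Arc E (j + s.1.toNat, s.2) (j + t.1.toNat, t.2)
  | topCap (x : ℤ) (h : E.top.capMate x ≠ x) :
      Arc E (E.middle.length, x) (E.middle.length, E.top.capMate x)

/-- Two points lie on the same connected component. -/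
def Connected (E : StackedDiagram) : ℕ × ℤ → ℕ × ℤ → Prop := Relation.EqvGen E.Arc

/-- The point `x` on the lowest line is the start of a ray going down. -/
def IsBottomEnd (E : StackedDiagram) (x : ℤ) : Prop := E.bottom.mate x = x

/-- The point `x` on the highest line is the start of a ray going up. -/
def IsTopEnd (E : StackedDiagram) (x : ℤ) : Prop := E.top.capMate x = x

/-- There is no circle, that is, every component has an end. -/
def NoCircle (E : StackedDiagram) : Prop :=
  ∀ v : ℕ × ℤ, v.1 ≤ E.middle.length →
    (∃ x, E.IsBottomEnd x ∧ E.Connected v (0, x)) ∨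
    (∃ x, E.IsTopEnd x ∧ E.Connected v (E.middle.length, x))

/-- There is no circle and every non-propagating line has one endpoint to each side of `0`. -/
def Orientable (E : StackedDiagram) : Prop :=
  E.NoCircle ∧
  (∀ x y, x ≠ y → E.IsBottomEnd x → E.IsBottomEnd y → E.Connected (0, x) (0, y) →
    ¬ (E.bottom.BottomLeft x ↔ E.bottom.BottomLeft y)) ∧
  (∀ x y, x ≠ y → E.IsTopEnd x → E.IsTopEnd y →
    E.Connected (E.middle.length, x) (E.middle.length, y) →
    ¬ (E.top.TopLeft x ↔ E.top.TopLeft y))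

/-- There is a potential surgery at the cup with left endpoint `a` of the `j`-th middle section. -/
def IsPotentialSurgery (E : StackedDiagram) (j : ℕ) (a : ℤ) : Prop :=
  ∃ σ, E.middle[j]? = some σ ∧ σ.IsOutermost a

/-- The diagram after the surgery at the cup with left endpoint `a` of the `j`-th middle section. -/
noncomputable def replace (E : StackedDiagram) (j : ℕ) (a : ℤ) : StackedDiagram :=
  { E with middle := E.middle.modify j (fun σ => σ.erase a) }

open Classical in
/-- The surgery procedure; `none` stands for the result `0`, which is the result if the diagram
after the surgery is not orientable. -/
noncomputable def surgery (j : ℕ) (a : ℤ) (E : StackedDiagram) : Option StackedDiagram :=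
  if E.IsPotentialSurgery j a ∧ (E.replace j a).Orientable then some (E.replace j a) else none

/-- `E.Outcome r`: performing surgery procedures on `E`, in some order, until no potential surgery
is left or the result is `0`, can lead to the result `r`. -/
inductive Outcome : StackedDiagram → Option StackedDiagram → Prop
  | done (E : StackedDiagram) (h : ∀ j a, ¬ E.IsPotentialSurgery j a) : Outcome E (some E)
  | zero (E : StackedDiagram) (j : ℕ) (a : ℤ) (h : E.IsPotentialSurgery j a)
      (h0 : surgery j a E = none) : Outcome E none
  | step (E F : StackedDiagram) (r : Option StackedDiagram) (j : ℕ) (a : ℤ)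
      (h : E.IsPotentialSurgery j a) (hF : surgery j a E = some F) (hr : Outcome F r) :
      Outcome E r

end StackedDiagram

/-- The circle diagram with the cup diagram `lam` under the cap diagram of `mu`. -/
def circleDiagram (lam mu : CupDiagram) : StackedDiagram := ⟨lam, [], mu⟩

/-- An orientable circle diagram. -/
@[ext]
structure OrientableCircleDiagram where
  lower : CupDiagram
  upper : CupDiagram
  orientable : (circleDiagram lower upper).Orientable

/-- Circle diagrams that are orientable are drawn above each other: consecutive entries of the list
`bottom, middle, top` form orientable circle diagrams. -/
def StackedDiagram.IsStackOfOrientable (E : StackedDiagram) : Prop :=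
  List.IsChain (fun lam mu => (circleDiagram lam mu).Orientable)
    (E.bottom :: (E.middle ++ [E.top]))

/-- The underlying vector space of the Khovanov algebra of type `P`, with basis all orientable
circle diagrams. -/
abbrev KhovanovP (k : Type*) [Field k] : Type _ := OrientableCircleDiagram →₀ k

/-- A basis vector of the Khovanov algebra of type `P`. -/
noncomputable def KhovanovP.basisVec (k : Type*) [Field k] (x : OrientableCircleDiagram) :
    KhovanovP k := Finsupp.single x 1

/-- The bilinear map `m` is the multiplication of the Khovanov algebra: the product of two basis
vectors is `0` if the inner diagrams differ, and otherwise it is what the surgery procedures,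
performed in whatever order, make of the two circle diagrams stacked above each other. -/
def IsSurgeryMultiplication {k : Type*} [Field k]
    (m : KhovanovP k →ₗ[k] KhovanovP k →ₗ[k] KhovanovP k) : Prop :=
  ∀ x y : OrientableCircleDiagram,
    (x.upper ≠ y.lower → m (KhovanovP.basisVec k x) (KhovanovP.basisVec k y) = 0) ∧
    (x.upper = y.lower →
      (StackedDiagram.Outcome ⟨x.lower, [x.upper], y.upper⟩ none →
        m (KhovanovP.basisVec k x) (KhovanovP.basisVec k y) = 0) ∧
      (∀ F, StackedDiagram.Outcome ⟨x.lower, [x.upper], y.upper⟩ (some F) →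
        ∃ z : OrientableCircleDiagram, z.lower = x.lower ∧ z.upper = y.upper ∧
          m (KhovanovP.basisVec k x) (KhovanovP.basisVec k y) = KhovanovP.basisVec k z))

/-! Orientability is traded for connectedness of a closed-up planar curve, which behaves well both
under gluing and under surgery.

Numbering. The rays of a cup diagram are numbered from left to right so that exactly the rays
redrawn to the left get negative numbers. A middle section joins ray `n` of its cap diagram to ray
`n + 1` of its cup diagram, and a diagram of vertical lines carries ray `v` at the bottom to ray `v
- 1` at the top. In this language a diagram is orientable if it has no circle and every line with
both ends on one side joins a negative to a nonnegative number.

The criterion (`orientable_iff_topCrit`). In an orientable diagram the noncrossing condition and the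
signs force the lines returning to one side to be concentric: they join `n` with `-1 - n` for `-p ≤
n < p`. If the bottom rays `v` and `1 - v` are joined, the returning lines and these joins wind up
into a spiral, and the diagram seen from the top is the standard matching `u ↔ -1 - u`. `TopCrit`
asks for this and for the absence of components that do not reach the top. Conversely `TopCrit`, for
the diagram and for its rotation by 180 degrees, gives orientability. The standard matching at the
top of one diagram is the closing `v ↔ 1 - v` at the bottom of the next, so a diagram with `TopCrit`
may be glued below another one in place of the closing (`TopCrit.glue`). The first assertion follows
by induction.

Connectedness. If the top is closed as well, by `u ↔ -3 - u`, an orientable diagram becomes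
connected (`TopCrit.connInf`). After a surgery on an orientable diagram the converse holds too
(`Orientable.of_replace`). All parity arguments need finite diagrams, so they take place in large
windows, where the top is closed by `closing p n`. These closings contain small arcs at different
places on the left; the matching at the top is standard as soon as it shares none of these arcs
(`eq_of_no_small_arc`), and sharing one would create a circle. Consecutive closings differ by a move
that looks just like a surgery.

The core is therefore a statement about two surgeries at disjoint places,
`Darts.Planar.connected_of_connected`: if a connected diagram stays connected under the second
surgery, and also under both, then it stays connected under the first alone. A surgery exchanges two
perfect matchings of the corners of a hexagon. Outside of two hexagons the diagram is a bijection
between the even and the odd corners, by a checkerboard argument. Running through all 720 bijections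
shows that a counterexample would have two gaps of different colour separating the same two
components of an auxiliary diagram; the Jordan curve theorem, in the form of a parity count,
excludes this (`Darts.Planar.tau_eq`).

Consequences. With this, for two surgeries in different sections, orientability of the results of
the second one and of both implies orientability of the result of the first one. Two surgeries in
one section are reduced to this case by cutting the section between the two cups
(`orientable_split`). So surgeries commute, even when one side is zero, and a diamond argument on
the number of cups makes the product well defined. For associativity both bracketings are compared
with the diagram having two middle sections: gluing an orientable circle diagram on top does not
change which surgeries below it give zero (`nonZero_glue_iff`), and the other bracketing follows by
rotation. -/

set_option linter.unusedSectionVars false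

/-! ### Orbits of two involutions. -/

/-- Two points are linked if one can get from one to the other by applying `f` and `g`. -/
def Link {A : Type*} (f g : A → A) : A → A → Prop :=
  Relation.EqvGen fun x y => y = f x ∨ y = g x

namespace Link

variable {A : Type*} {f g : A → A}

theorem refl (x : A) : Link f g x x := Relation.EqvGen.refl x
theorem symm {x y : A} (h : Link f g x y) : Link f g y x := Relation.EqvGen.symm _ _ h
theorem trans {x y z : A} (h : Link f g x y) (h' : Link f g y z) : Link f g x z := Relation.EqvGen.trans _ _ _ h h'
theorem left (x : A) : Link f g x (f x) := Relation.EqvGen.rel _ _ (Or.inl rfl)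
theorem right (x : A) : Link f g x (g x) := Relation.EqvGen.rel _ _ (Or.inr rfl)

/-- A predicate that is preserved in both directions along the arcs is constant on components. -/
theorem iff_of_invariant {p : A → Prop} (hf : ∀ x, p (f x) ↔ p x) (hg : ∀ x, p (g x) ↔ p x)
    {x y : A} (h : Link f g x y) : p x ↔ p y := by
  induction h with
  | rel x y h => rcases h with rfl | rfl
                 · exact (hf x).symm
                 · exact (hg x).symm
  | refl => rfl
  | symm _ _ _ ih => exact ih.symm
  | trans _ _ _ _ _ ih ih' => exact ih.trans ih'

theorem eq_of_invariant {B : Type*} {p : A → B} (hf : ∀ x, p (f x) = p x) (hg : ∀ x, p (g x) = p x)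
    {x y : A} (h : Link f g x y) : p x = p y := by
  induction h with
  | rel x y h => rcases h with rfl | rfl
                 · exact (hf x).symm
                 · exact (hg x).symm
  | refl => rfl
  | symm _ _ _ ih => exact ih.symm
  | trans _ _ _ _ _ ih ih' => exact ih.trans ih'

theorem of_rel {r : A → A → Prop} (hr : Equivalence r) (hf : ∀ x, r x (f x)) (hg : ∀ x, r x (g x))
    {x y : A} (h : Link f g x y) : r x y := by
  induction h with
  | rel x y h => rcases h with rfl | rfl
                 · exact hf x
                 · exact hg x
  | refl => exact hr.refl _
  | symm _ _ _ ih => exact hr.symm ih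
  | trans _ _ _ _ _ ih ih' => exact hr.trans ih ih'

/-- Two involutions generate a dihedral group. Conjugation by `g` inverts the rotation `g ∘ f`, so
the orbit of a fixed point of `g` is already its orbit under rotations. -/
theorem exists_zpow (hf : Function.Involutive f) (hg : Function.Involutive g)
    {x : A} (hx : g x = x) {y : A} (h : Link f g x y) :
    ∃ n : ℤ, y = ((hg.toPerm * hf.toPerm) ^ n) x := by
  set ρ := hg.toPerm * hf.toPerm with hρ
  have hF : ∀ z, f z = ρ⁻¹ (g z) := fun z => by
    rw [Equiv.Perm.eq_inv_iff_eq]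
    change g (f (f z)) = g z
    rw [hf]
  have hgr : ∀ (n : ℤ) z, g ((ρ ^ n) z) = (ρ ^ (-n)) (g z) := by
    have h1 : ∀ z, g (ρ z) = ρ⁻¹ (g z) := fun z => by
      rw [← hF]
      change g (g (f z)) = f z
      rw [hg]
    have h2 : hg.toPerm * ρ * hg.toPerm⁻¹ = ρ⁻¹ := by
      rw [mul_inv_eq_iff_eq_mul]
      ext z
      exact h1 z
    intro n z
    have h3 : hg.toPerm * ρ ^ n * hg.toPerm⁻¹ = ρ ^ (-n) := by
      rw [← conj_zpow, h2, inv_zpow, zpow_neg]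
    rw [mul_inv_eq_iff_eq_mul] at h3
    exact congrArg (fun e : Equiv.Perm A => e z) h3
  have hgx : ∀ n : ℤ, g ((ρ ^ n) x) = (ρ ^ (-n)) x := fun n => by rw [hgr, hx]
  have hfx : ∀ n : ℤ, f ((ρ ^ n) x) = (ρ ^ (-n - 1)) x := fun n => by
    rw [hF, hgx, ← Equiv.Perm.mul_apply, ← zpow_neg_one, ← zpow_add]
    congr 2
    ring
  have key : ∀ a b, Link f g a b → ((∃ n : ℤ, a = (ρ ^ n) x) ↔ ∃ n : ℤ, b = (ρ ^ n) x) := by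
    intro a b hab
    refine iff_of_invariant (p := fun a => ∃ n : ℤ, a = (ρ ^ n) x) ?_ ?_ hab
    · intro z
      constructor
      · rintro ⟨n, hn⟩
        exact ⟨-n - 1, by rw [← hf z, hn, hfx]⟩
      · rintro ⟨n, rfl⟩
        exact ⟨-n - 1, hfx n⟩
    · intro z
      constructor
      · rintro ⟨n, hn⟩
        exact ⟨-n, by rw [← hg z, hn, hgx]⟩
      · rintro ⟨n, rfl⟩
        exact ⟨-n, hgx n⟩
  exact (key x y h).1 ⟨0, by simp⟩

/-- Since `g` inverts the rotation and fixes `x`, it sends the point with exponent `n` to the point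
with exponent `-n`. -/
theorem zpow_fixed_iff (hf : Function.Involutive f) (hg : Function.Involutive g)
    {x : A} (hx : g x = x) (n : ℤ) :
    g (((hg.toPerm * hf.toPerm) ^ n) x) = ((hg.toPerm * hf.toPerm) ^ n) x ↔
      ((hg.toPerm * hf.toPerm) ^ (2 * n)) x = x := by
  set ρ := hg.toPerm * hf.toPerm with hρ
  have h2 : hg.toPerm * ρ * hg.toPerm⁻¹ = ρ⁻¹ := by
    rw [mul_inv_eq_iff_eq_mul, hρ, mul_inv_rev]
    ext z
    change g (g (f z)) = hf.toPerm⁻¹ (hg.toPerm⁻¹ (g z))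
    rw [hg, Equiv.Perm.eq_inv_iff_eq, Equiv.Perm.eq_inv_iff_eq]
    change g (f (f z)) = g z
    rw [hf]
  have h3 : hg.toPerm * ρ ^ n * hg.toPerm⁻¹ = ρ ^ (-n) := by
    rw [← conj_zpow, h2, inv_zpow, zpow_neg]
  rw [mul_inv_eq_iff_eq_mul] at h3
  have h4 : g ((ρ ^ n) x) = (ρ ^ (-n)) (g x) := congrArg (fun e : Equiv.Perm A => e x) h3
  rw [h4, hx, zpow_neg, Equiv.Perm.inv_eq_iff_eq, ← Equiv.Perm.mul_apply, ← zpow_add, ← two_mul,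
    eq_comm]

theorem zpow_eq_iff (ρ : Equiv.Perm A) (x : A) (n : ℤ) :
    (ρ ^ n) x = x ↔ (Function.minimalPeriod ρ x : ℤ) ∣ n :=
  MulAction.zpow_smul_eq_iff_minimalPeriod_dvd (a := ρ) (b := x)

/-- A line has at most two ends: if `N` is the period of `x`, a fixed point with exponent `n` needs
`N ∣ 2 * n`, which modulo `N` leaves `0` and `N / 2`. -/
theorem eq_of_fixed (hf : Function.Involutive f) (hg : Function.Involutive g)
    {x y z : A} (hx : g x = x) (hy : g y = y) (hz : g z = z)
    (hxy : Link f g x y) (hxz : Link f g x z) (hyx : y ≠ x) (hzx : z ≠ x) : y = z := by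
  obtain ⟨n, rfl⟩ := exists_zpow hf hg hx hxy
  obtain ⟨m, rfl⟩ := exists_zpow hf hg hx hxz
  rw [zpow_fixed_iff hf hg hx, zpow_eq_iff] at hy hz
  rw [Ne, zpow_eq_iff] at hyx hzx
  set N := Function.minimalPeriod (hg.toPerm * hf.toPerm) x
  obtain ⟨a, ha⟩ := hy
  obtain ⟨b, hb⟩ := hz
  have ha' : ¬ Even a := by
    rintro ⟨c, rfl⟩
    exact hyx ⟨c, by linarith⟩
  have hb' : ¬ Even b := by
    rintro ⟨c, rfl⟩
    exact hzx ⟨c, by linarith⟩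
  rw [Int.not_even_iff_odd] at ha' hb'
  obtain ⟨c, hc⟩ := ha'.sub_odd hb'
  have : (((hg.toPerm * hf.toPerm) ^ (n - m)) x) = x := by
    rw [zpow_eq_iff]
    refine ⟨c, ?_⟩
    have : 2 * (n - m) = N * (a - b) := by linarith
    rw [hc] at this
    linarith
  rw [show n = m + (n - m) by ring, zpow_add, Equiv.Perm.mul_apply, this]

/-- A finite line that starts somewhere also ends. For an even period the second end is half way
around; for an odd period the middle of the orbit would be fixed by `f`. -/
theorem exists_fixed [Finite A] (hf : Function.Involutive f) (hg : Function.Involutive g)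
    {x : A} (hx : g x = x) (hne : ∀ y, f y ≠ y) :
    ∃ y, y ≠ x ∧ g y = y ∧ Link f g x y := by
  set ρ := hg.toPerm * hf.toPerm with hρ
  have hpos : 0 < Function.minimalPeriod ρ x :=
    Function.minimalPeriod_pos_of_mem_periodicPts
      (Function.Injective.mem_periodicPts ρ.injective x)
  have hl : ∀ n : ℕ, Link f g x ((ρ ^ n) x) := by
    intro n
    induction n with
    | zero => exact .refl x
    | succ n ih =>
      rw [pow_succ', Equiv.Perm.mul_apply]
      exact (ih.trans (left _)).trans (right _)
  rcases Nat.even_or_odd (Function.minimalPeriod ρ x) with ⟨h, hh⟩ | ⟨h, hh⟩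
  · refine ⟨(ρ ^ h) x, ?_, ?_, hl h⟩
    · rw [Ne, ← zpow_natCast, zpow_eq_iff]
      intro hd
      have := Int.le_of_dvd (by omega) hd
      omega
    · rw [← zpow_natCast, zpow_fixed_iff hf hg hx, zpow_eq_iff, hh]
      exact ⟨1, by push_cast; ring⟩
  · exfalso
    have e : (ρ ^ (2 * h + 1)) x = x := by
      rw [← zpow_natCast, zpow_eq_iff, hh]
    have e2 : g ((ρ ^ (h + 1)) x) = (ρ ^ h) x := by
      have h3 := zpow_fixed_iff hf hg hx
      have h2 : hg.toPerm * ρ * hg.toPerm⁻¹ = ρ⁻¹ := by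
        rw [mul_inv_eq_iff_eq_mul, hρ, mul_inv_rev]
        ext z
        change g (g (f z)) = hf.toPerm⁻¹ (hg.toPerm⁻¹ (g z))
        rw [hg, Equiv.Perm.eq_inv_iff_eq, Equiv.Perm.eq_inv_iff_eq]
        change g (f (f z)) = g z
        rw [hf]
      have h3 : hg.toPerm * ρ ^ (h + 1) * hg.toPerm⁻¹ = (ρ ^ (h + 1))⁻¹ := by
        rw [← conj_pow, h2, inv_pow]
      rw [mul_inv_eq_iff_eq_mul] at h3
      have h4 : g ((ρ ^ (h + 1)) x) = (ρ ^ (h + 1))⁻¹ (g x) :=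
        congrArg (fun e : Equiv.Perm A => e x) h3
      rw [h4, hx, Equiv.Perm.inv_eq_iff_eq, ← Equiv.Perm.mul_apply, ← pow_add]
      rw [show h + 1 + h = 2 * h + 1 by ring, e]
    refine hne ((ρ ^ h) x) ?_
    have e3 : g (f ((ρ ^ h) x)) = (ρ ^ (h + 1)) x := by
      rw [pow_succ', Equiv.Perm.mul_apply]
      rfl
    rw [← hg (f ((ρ ^ h) x)), e3, e2]

end Link

/-! ### Planar diagrams, parity counts and the checkerboard colouring. -/

/-- Points of a planar diagram that is cut by horizontal lines. A point of a line carries two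
darts, one pointing up and one pointing down, and `flip` exchanges them. `left x y` is `1` if `x`
and `y` point in the same direction from the same line and `x` is to the left of `y`. -/
structure Darts (A : Type*) where
  flip : A → A
  flip_flip : Function.Involutive flip
  left : A → A → ZMod 2
  left_flip : ∀ x y, left (flip x) (flip y) = left x y
  left_self : ∀ x, left x x = 0
  up : A → ZMod 2
  up_flip : ∀ x, up (flip x) = up x + 1

/-- The involution `μ` exchanging the endpoints of arcs describes a planar diagram: arcs do not
cross each other, and they do not cross the rays starting at the fixed points. -/
structure Darts.Planar {A : Type*} (S : Darts A) (μ : A → A) : Prop where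
  invol : Function.Involutive μ
  nc : ∀ d e, μ d ≠ d → μ e ≠ e → e ≠ d → e ≠ μ d →
    S.left e d + S.left e (μ d) + S.left (μ e) d + S.left (μ e) (μ d) = 0
  nc_left : ∀ d e, μ d ≠ d → μ e = e → S.left e d + S.left e (μ d) = 0
  nc_right : ∀ d e, μ d = d → μ e ≠ e → S.left e d + S.left (μ e) d = 0
  turn : ∀ d, μ d ≠ d → S.left d (μ d) + S.left (μ d) d = 1 + S.up d + S.up (μ d)

theorem sum_eq_zero_of_involutive {A : Type*} {X : Finset A} {ν : A → A}
    (hν : Function.Involutive ν) (hX : ∀ x ∈ X, ν x ∈ X) {g : A → ZMod 2}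
    (hg : ∀ x ∈ X, g x + g (ν x) = 0) (hfix : ∀ x ∈ X, ν x = x → g x = 0) :
    ∑ x ∈ X, g x = 0 :=
  Finset.sum_involution (fun x _ => ν x) hg (fun x hx h0 h => h0 (hfix x hx h)) hX
    (fun x _ => hν x)

namespace Darts

variable {A : Type*} [Fintype A] [DecidableEq A] (S : Darts A)

theorem flip_ne (x : A) : S.flip x ≠ x := by
  intro h
  have := S.up_flip x
  rw [h] at this
  simp at this

/-- The number of points of `X` to the left of `d`, modulo two. -/
def count (X : Finset A) (d : A) : ZMod 2 := ∑ e ∈ X, S.left e d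

/-- The number modulo two of points to the left of `d` that are not on the same side
of the partition `X`, `Xᶜ`. -/
def side (X : Finset A) (d : A) : ZMod 2 := if d ∈ X then S.count Xᶜ d else S.count X d

/-- The orientation of the dart `d` in the checkerboard colouring. -/
def tau (d : A) : ZMod 2 := S.count Finset.univ d + S.up d

/-- Closed subdiagrams are Jordan curves: the other arcs do not cross them. -/
def Jordan (ν : A → A) : Prop :=
  Function.Involutive ν ∧ ∀ X : Finset A, (∀ x ∈ X, S.flip x ∈ X) → (∀ x ∈ X, ν x ∈ X) →
    ∀ d, d ∉ X → S.count X (ν d) = S.count X d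

theorem count_flip {X : Finset A} (hX : ∀ x ∈ X, S.flip x ∈ X) (d : A) :
    S.count X (S.flip d) = S.count X d := by
  unfold count
  refine Finset.sum_nbij' S.flip S.flip hX hX (fun x _ => S.flip_flip x) (fun x _ => S.flip_flip x)
    (fun x _ => ?_)
  rw [← S.left_flip x, S.flip_flip]

theorem zmod_eq_of_add {a b : ZMod 2} (h : a + b = 0) : a = b := by
  revert a b
  decide

variable {S}

/-- Each arc of `X` crosses the given arc an even number of times, and the rays of `X` do not cross
it. -/
theorem Planar.count_arc {μ : A → A} (hμ : S.Planar μ) {X : Finset A} (hX : ∀ x ∈ X, μ x ∈ X)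
    {d : A} (hd : d ∉ X) (hd' : μ d ≠ d) : S.count X (μ d) = S.count X d := by
  refine (zmod_eq_of_add ?_).symm
  unfold count
  rw [← Finset.sum_add_distrib]
  refine sum_eq_zero_of_involutive hμ.invol hX ?_ ?_
  · intro x hx
    by_cases hxx : μ x = x
    · rw [hxx, hμ.nc_left d x hd' hxx, add_zero]
    · rw [← add_assoc]
      refine hμ.nc d x hd' hxx ?_ ?_
      · rintro rfl
        exact hd hx
      · rintro rfl
        refine hd ?_
        rw [← hμ.invol d]
        exact hX _ hx
  · intro x hx hxx
    exact hμ.nc_left d x hd' hxx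

/-- The points other than the two ends pair up along arcs and contribute evenly, so only the two
ends themselves count; their share is prescribed by `turn`. -/
theorem Planar.tau_arc {μ : A → A} (hμ : S.Planar μ) {d : A} (hd : μ d ≠ d) :
    S.tau (μ d) = S.tau d + 1 := by
  have h1 : ∑ x ∈ Finset.univ.filter (fun x => x ≠ d ∧ x ≠ μ d),
      (S.left x d + S.left x (μ d)) = 0 := by
    refine sum_eq_zero_of_involutive hμ.invol ?_ ?_ ?_
    · intro x hx
      simp only [Finset.mem_filter, Finset.mem_univ, true_and] at hx ⊢
      refine ⟨fun h => hx.2 ?_, fun h => hx.1 (hμ.invol.injective h)⟩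
      rw [← h, hμ.invol]
    · intro x hx
      simp only [Finset.mem_filter, Finset.mem_univ, true_and] at hx
      by_cases hxx : μ x = x
      · rw [hxx, hμ.nc_left d x hd hxx, add_zero]
      · rw [← add_assoc]
        exact hμ.nc d x hd hxx hx.1 hx.2
    · intro x _ hxx
      exact hμ.nc_left d x hd hxx
  have h2 : ∑ x, (S.left x d + S.left x (μ d)) = 1 + S.up d + S.up (μ d) := by
    rw [← Finset.sum_filter_add_sum_filter_not Finset.univ (fun x => x ≠ d ∧ x ≠ μ d), h1, zero_add]
    have e : Finset.univ.filter (fun x => ¬ (x ≠ d ∧ x ≠ μ d)) = {d, μ d} := by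
      ext x
      simp only [Finset.mem_filter, Finset.mem_univ, true_and, Finset.mem_insert,
        Finset.mem_singleton]
      tauto
    rw [e, Finset.sum_pair hd.symm, S.left_self, S.left_self, ← hμ.turn d hd]
    ring
  rw [Finset.sum_add_distrib] at h2
  unfold tau count
  generalize ∑ x, S.left x d = a at *
  generalize ∑ x, S.left x (μ d) = b at *
  generalize S.up d = c at *
  generalize S.up (μ d) = e at *
  revert a b c e
  decide

theorem tau_flip (d : A) : S.tau (S.flip d) = S.tau d + 1 := by
  unfold tau
  rw [S.count_flip (fun _ _ => Finset.mem_univ _), S.up_flip, add_assoc]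

/-- This is the Jordan curve theorem modulo two: following a line, the number of points of the other
part to its left keeps its parity, because neither part crosses the other. -/
theorem Jordan.side_eq {ν : A → A} (hν : S.Jordan ν) {X : Finset A}
    (hX : ∀ x ∈ X, S.flip x ∈ X) (hX' : ∀ x ∈ X, ν x ∈ X) {x y : A} (h : Link S.flip ν x y) :
    S.side X x = S.side X y := by
  have c1 : ∀ x ∈ Xᶜ, S.flip x ∈ Xᶜ := fun x hx => by
    rw [Finset.mem_compl] at hx ⊢
    intro h
    exact hx (by simpa only [S.flip_flip x] using hX _ h)
  have c2 : ∀ x ∈ Xᶜ, ν x ∈ Xᶜ := fun x hx => by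
    rw [Finset.mem_compl] at hx ⊢
    intro h
    exact hx (by simpa only [hν.1 x] using hX' _ h)
  refine Link.eq_of_invariant (p := S.side X) (fun z => ?_) (fun z => ?_) h
  · unfold side
    by_cases hz : z ∈ X
    · rw [if_pos hz, if_pos (hX z hz), S.count_flip c1]
    · rw [if_neg hz, if_neg (Finset.mem_compl.1 (c1 z (Finset.mem_compl.2 hz))), S.count_flip hX]
  · unfold side
    by_cases hz : z ∈ X
    · rw [if_pos hz, if_pos (hX' z hz), hν.2 Xᶜ c1 c2 z (by simpa using hz)]
    · rw [if_neg hz, if_neg (Finset.mem_compl.1 (c2 z (Finset.mem_compl.2 hz))), hν.2 X hX hX' z hz]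

theorem side_compl (X : Finset A) (d : A) : S.side Xᶜ d = S.side X d := by
  unfold side
  by_cases h : d ∈ X <;> simp [h]

end Darts

/-! ### Surgeries as moves on hexagons. -/

/-- The matchings of a hexagon with vertices `0, …, 5`: `hexBefore` and `hexAfter` are the strands
before and after a surgery, the other two connect neighbours. -/
def hexBefore : Fin 6 → Fin 6 := ![3, 2, 1, 0, 5, 4]
def hexAfter : Fin 6 → Fin 6 := ![5, 4, 3, 2, 1, 0]
def hexEven : Fin 6 → Fin 6 := ![1, 0, 3, 2, 5, 4]
def hexOdd : Fin 6 → Fin 6 := ![5, 2, 1, 4, 3, 0]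

/-- The edges of the two matchings together form one cycle through all six corners. -/
theorem eq_of_hex {B : Type*} {f : Fin 6 → B} (h0 : ∀ i, f (hexBefore i) = f i)
    (h1 : ∀ i, f (hexAfter i) = f i) (i j : Fin 6) : f i = f j := by
  have a0 : f 3 = f 0 := h0 0
  have a1 : f 2 = f 1 := h0 1
  have a2 : f 5 = f 4 := h0 4
  have b0 : f 5 = f 0 := h1 0
  have b1 : f 4 = f 1 := h1 1
  have b2 : f 3 = f 2 := h1 2
  fin_cases i <;> fin_cases j <;> simp <;> grind

section Rewire

variable {A : Type*}

open Classical in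
/-- Replace the strands at the points of `h` by the matching `m`. -/
noncomputable def rewire (h : Fin 6 → A) (m : Fin 6 → Fin 6) (μ : A → A) (x : A) : A :=
  if hx : ∃ i, h i = x then h (m hx.choose) else μ x

variable {h : Fin 6 → A} (hh : Function.Injective h) (m : Fin 6 → Fin 6) (μ : A → A)

theorem rewire_apply (hh : Function.Injective h) (i : Fin 6) : rewire h m μ (h i) = h (m i) := by
  unfold rewire
  have hx : ∃ j, h j = h i := ⟨i, rfl⟩
  rw [dif_pos hx, hh hx.choose_spec]

theorem rewire_of_notMem {x : A} (hx : ∀ i, h i ≠ x) : rewire h m μ x = μ x := by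
  unfold rewire
  rw [dif_neg]
  rintro ⟨i, hi⟩
  exact hx i hi

variable {m μ}

theorem rewire_involutive (hh : Function.Injective h) (hm : ∀ i, m (m i) = i)
    (hμ : Function.Involutive μ) {m' : Fin 6 → Fin 6} (hμh : ∀ i, μ (h i) = h (m' i)) :
    Function.Involutive (rewire h m μ) := by
  intro x
  by_cases hx : ∃ i, h i = x
  · obtain ⟨i, rfl⟩ := hx
    rw [rewire_apply _ _ hh, rewire_apply _ _ hh, hm]
  · have hx' : ∀ i, h i ≠ x := fun i hi => hx ⟨i, hi⟩
    have hx2 : ∀ i, h i ≠ μ x := fun i hi => by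
      refine hx' (m' i) ?_
      rw [← hμh, hi, hμ]
    rw [rewire_of_notMem _ _ hx', rewire_of_notMem _ _ hx2, hμ]

theorem rewire_ne (hh : Function.Injective h) (hm : ∀ i, m i ≠ i) (hμ : ∀ x, μ x ≠ x) (x : A) :
    rewire h m μ x ≠ x := by
  by_cases hx : ∃ i, h i = x
  · obtain ⟨i, rfl⟩ := hx
    rw [rewire_apply _ _ hh]
    exact fun h => hm i (hh h)
  · rw [rewire_of_notMem _ _ fun i hi => hx ⟨i, hi⟩]
    exact hμ x

end Rewire

/-- The vertices of a hexagon that carry the dart `i` and the mutual positions of its vertices. -/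
structure HexShape where
  left : Fin 6 → Fin 6 → ZMod 2
  up : Fin 6 → ZMod 2

/-- The six points at a surgery: three on the lower line and three, in the opposite
direction, on the upper line. -/
def HexShape.surgery : HexShape where
  left a b := if (a < b ∧ b ≤ 2) ∨ (3 ≤ b ∧ b < a) then 1 else 0
  up a := if a ≤ 2 then 1 else 0

/-- Six points on a line. -/
def HexShape.line : HexShape where
  left a b := if a < b then 1 else 0
  up _ := 1

/-- In the state `m`, the arc between neighbours `i` and `i + 1` separates components
according to its colour. -/
def HexShape.GapOK (t : HexShape) (m : Fin 6 → Fin 6) (i : Fin 6) : Prop :=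
  ∀ P : Fin 6 → Bool, (∀ a, P (m a) = P a) → P i = true → P (i + 1) = false →
    ∑ a, (if P a = true then t.left a i + t.left a (i + 1) else 0) = t.up i

/-- `P` stands for the corners lying in a closed part. The condition says that an arc of the
matching `m` outside of that part does not cross the arcs of `m` inside of it. -/
def HexShape.ShortOK (t : HexShape) (m : Fin 6 → Fin 6) : Prop :=
  ∀ P : Fin 6 → Bool, (∀ a, P (m a) = P a) → ∀ i, P i = false →
    ∑ a, (if P a = true then t.left a i + t.left a (m i) else 0) = 0

instance (t : HexShape) (m : Fin 6 → Fin 6) (i : Fin 6) : Decidable (t.GapOK m i) := by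
  unfold HexShape.GapOK
  infer_instance

instance (t : HexShape) (m : Fin 6 → Fin 6) : Decidable (t.ShortOK m) := by
  unfold HexShape.ShortOK
  infer_instance

set_option maxRecDepth 100000 in
theorem HexShape.surgery_shortOK_even : surgery.ShortOK hexEven := by decide

set_option maxRecDepth 100000 in
theorem HexShape.surgery_shortOK_odd : surgery.ShortOK hexOdd := by decide

set_option maxRecDepth 100000 in
theorem HexShape.surgery_gapOK_even : surgery.GapOK hexEven 1 := by decide

set_option maxRecDepth 100000 in
theorem HexShape.surgery_gapOK_odd : surgery.GapOK hexOdd 4 := by decide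

set_option maxRecDepth 100000 in
theorem HexShape.surgery_gapOK : surgery.GapOK hexBefore 0 ∧ surgery.GapOK hexBefore 3 := by
  decide

set_option maxRecDepth 100000 in
theorem HexShape.line_gapOK : line.GapOK hexBefore 0 ∧ line.GapOK hexBefore 3 := by
  decide

namespace Darts

variable {A : Type*} [Fintype A] [DecidableEq A] {S : Darts A}

/-- The points of `h` form a hexagon of the given shape. -/
structure IsHex (S : Darts A) (t : HexShape) (h : Fin 6 → A) : Prop where
  inj : Function.Injective h
  left : ∀ a b, S.left (h a) (h b) = t.left a b
  up : ∀ a, S.up (h a) = t.up a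

/-- An arc away from the hexagon crosses neither the strands before nor those after the surgery.
These connect all corners, so every corner lies on the same side of the arc. -/
theorem Planar.nc_off {μ : A → A} (hμ : S.Planar μ) (hne : ∀ x, μ x ≠ x) {h : Fin 6 → A}
    (hh : Function.Injective h) (hμ' : S.Planar (rewire h hexAfter μ))
    (h0 : ∀ i, μ (h i) = h (hexBefore i)) {x : A} (hx : ∀ i, h i ≠ x) (i j : Fin 6) :
    S.left x (h i) + S.left (μ x) (h i) = S.left x (h j) + S.left (μ x) (h j) := by
  have hx2 : ∀ i, h i ≠ μ x := fun i hi => by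
    refine hx (hexBefore i) ?_
    rw [← h0, hi, hμ.invol]
  have hne' := rewire_ne hh (m := hexAfter) (by decide) hne
  refine eq_of_hex (f := fun i => S.left x (h i) + S.left (μ x) (h i)) (fun i => ?_) (fun i => ?_) i j
  · have := hμ.nc (h i) x (hne _) (hne _) (hx i).symm (by rw [h0]; exact (hx _).symm)
    rw [h0] at this
    refine (zmod_eq_of_add ?_).symm
    rw [← this]
    ring
  · have := hμ'.nc (h i) x (hne' _) (hne' _) (hx i).symm
      (by rw [rewire_apply _ _ hh]; exact (hx _).symm)
    rw [rewire_apply _ _ hh, rewire_of_notMem _ _ hx] at this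
    refine (zmod_eq_of_add ?_).symm
    rw [← this]
    ring

/-- The mirror version of `Planar.nc_off`, with the corners being counted to the left of the ends of
an arc instead of the other way round. -/
theorem Planar.nc_off' {μ : A → A} (hμ : S.Planar μ) (hne : ∀ x, μ x ≠ x) {h : Fin 6 → A}
    (hh : Function.Injective h) (hμ' : S.Planar (rewire h hexAfter μ))
    (h0 : ∀ i, μ (h i) = h (hexBefore i)) {d : A} (hd : ∀ i, h i ≠ d) (i j : Fin 6) :
    S.left (h i) d + S.left (h i) (μ d) = S.left (h j) d + S.left (h j) (μ d) := by
  have hd2 : ∀ i, h i ≠ μ d := fun i hi => by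
    refine hd (hexBefore i) ?_
    rw [← h0, hi, hμ.invol]
  have hne' := rewire_ne hh (m := hexAfter) (by decide) hne
  refine eq_of_hex (f := fun i => S.left (h i) d + S.left (h i) (μ d)) (fun i => ?_) (fun i => ?_) i j
  · have := hμ.nc d (h i) (hne _) (hne _) (hd i) (hd2 i)
    rw [h0] at this
    refine (zmod_eq_of_add ?_).symm
    rw [← this]
    ring
  · have := hμ'.nc d (h i) (hne' _) (hne' _) (hd i)
      (by rw [rewire_of_notMem _ _ hd]; exact hd2 i)
    rw [rewire_apply _ _ hh, rewire_of_notMem _ _ hd] at this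
    refine (zmod_eq_of_add ?_).symm
    rw [← this]
    ring

/-- Away from the hexagon the contributions cancel in pairs along arcs, which reduces a parity count
to the six corners. -/
theorem sum_eq_sum_hex {h : Fin 6 → A} (hh : Function.Injective h) {ν : A → A}
    (hν : Function.Involutive ν) (hνh : ∀ x, (∀ i, h i ≠ x) → ∀ i, h i ≠ ν x)
    (hne : ∀ x, ν x ≠ x) {X : Finset A} (hX : ∀ x ∈ X, ν x ∈ X) {g : A → ZMod 2}
    (hg : ∀ x ∈ X, (∀ i, h i ≠ x) → g x + g (ν x) = 0) :
    ∑ x ∈ X, g x = ∑ a, if h a ∈ X then g (h a) else 0 := by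
  rw [← Finset.sum_filter_add_sum_filter_not X (fun x => ∀ i, h i ≠ x)]
  have e1 : ∑ x ∈ X with (∀ i, h i ≠ x), g x = 0 := by
    refine sum_eq_zero_of_involutive hν ?_ ?_ ?_
    · intro x hx
      rw [Finset.mem_filter] at hx ⊢
      exact ⟨hX _ hx.1, hνh _ hx.2⟩
    · intro x hx
      rw [Finset.mem_filter] at hx
      exact hg x hx.1 hx.2
    · intro x _ hx
      exact absurd hx (hne x)
  rw [e1, zero_add, ← Finset.sum_filter]
  refine (Finset.sum_bij (fun a _ => h a) ?_ ?_ ?_ ?_).symm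
  · intro a ha
    simp only [Finset.mem_filter, Finset.mem_univ, true_and] at ha
    simp [ha]
  · intro a _ b _ hab
    exact hh hab
  · intro x hx
    simp only [Finset.mem_filter, not_forall, not_not] at hx
    obtain ⟨hx, i, hi⟩ := hx
    exact ⟨i, by simp [hi, hx], hi⟩
  · intro a _
    rfl

/-- The rewired diagram need not be compared with a drawing: arcs away from the hexagon cannot
distinguish its corners, so the only possible crossings are among the six corners, and there
`ShortOK` excludes them. -/
theorem Planar.jordan_rewire {μ : A → A} (hμ : S.Planar μ) (hne : ∀ x, μ x ≠ x) {h : Fin 6 → A}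
    {t : HexShape} (hh : S.IsHex t h) (hμ' : S.Planar (rewire h hexAfter μ))
    (h0 : ∀ i, μ (h i) = h (hexBefore i)) {m : Fin 6 → Fin 6} (hm : ∀ i, m (m i) = i)
    (hmi : ∀ i, m i ≠ i) (ht : t.ShortOK m) : S.Jordan (rewire h m μ) := by
  have hν := rewire_involutive hh.inj hm hμ.invol h0
  have hνh : ∀ x, (∀ i, h i ≠ x) → ∀ i, h i ≠ rewire h m μ x := fun x hx i hi => by
    have := hx (m i)
    rw [← rewire_apply m μ hh.inj, hi, hν] at this
    exact this rfl
  refine ⟨hν, fun X _ hX d hd => (zmod_eq_of_add ?_).symm⟩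
  unfold count
  rw [← Finset.sum_add_distrib]
  have hmem : ∀ x, rewire h m μ x ∈ X ↔ x ∈ X := fun x =>
    ⟨fun h' => by simpa only [hν x] using hX _ h', hX x⟩
  by_cases hdh : ∃ i, h i = d
  · obtain ⟨i, rfl⟩ := hdh
    rw [rewire_apply m μ hh.inj, sum_eq_sum_hex hh.inj hν hνh (rewire_ne hh.inj hmi hne) hX]
    · have := ht (fun a => decide (h a ∈ X)) (fun a => by
        have := hmem (h a)
        rw [rewire_apply m μ hh.inj] at this
        simp [this]) i (by simpa using hd)
      simpa [hh.left] using this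
    · intro x _ hx
      rw [rewire_of_notMem _ _ hx]
      have := hμ.nc_off hne hh.inj hμ' h0 hx i (m i)
      have e : ∀ a b c d : ZMod 2, a + c = b + d → a + b + (c + d) = 0 := by decide
      exact e _ _ _ _ this
  · have hdh' : ∀ i, h i ≠ d := fun i hi => hdh ⟨i, hi⟩
    rw [rewire_of_notMem _ _ hdh']
    have hd2 : μ d ∉ X := by
      rw [← rewire_of_notMem m μ hdh', hmem]
      exact hd
    refine sum_eq_zero_of_involutive hν hX ?_ ?_
    · intro x hx
      by_cases hxh : ∃ i, h i = x
      · obtain ⟨i, rfl⟩ := hxh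
        rw [rewire_apply m μ hh.inj, hμ.nc_off' hne hh.inj hμ' h0 hdh' i (m i)]
        exact CharTwo.add_self_eq_zero _
      · rw [rewire_of_notMem _ _ fun i hi => hxh ⟨i, hi⟩, ← add_assoc]
        exact hμ.nc d x (hne _) (hne _) (fun e => hd (e ▸ hx)) (fun e => hd2 (e ▸ hx))
    · intro x _ hx
      exact absurd hx (rewire_ne hh.inj hmi hne x)

/-- If neighbours in a hexagon lie on different sides, the colour of the gap between
them determines the number of points to the left. -/
theorem side_add_side {h : Fin 6 → A} {t : HexShape} (hh : S.IsHex t h) {ν : A → A}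
    (hν : Function.Involutive ν) (hne : ∀ x, ν x ≠ x) {m : Fin 6 → Fin 6}
    (hm : ∀ i, ν (h i) = h (m i)) (i : Fin 6) (ht : t.GapOK m i)
    (hg : ∀ x, (∀ i, h i ≠ x) → S.left x (h i) + S.left x (h (i + 1)) +
      (S.left (ν x) (h i) + S.left (ν x) (h (i + 1))) = 0)
    {X : Finset A} (hX : ∀ x ∈ X, ν x ∈ X) (hi : h i ∈ X ↔ h (i + 1) ∉ X) :
    S.side X (h i) + S.side X (h (i + 1)) = S.tau (h i) := by
  have main : ∀ X : Finset A, (∀ x ∈ X, ν x ∈ X) → h i ∈ X → h (i + 1) ∉ X →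
      S.side X (h i) + S.side X (h (i + 1)) = S.tau (h i) := by
    intro X hX hi hi'
    have hmem : ∀ x, ν x ∈ X ↔ x ∈ X := fun x =>
      ⟨fun h' => by simpa only [hν x] using hX _ h', hX x⟩
    have hνh : ∀ x, (∀ i, h i ≠ x) → ∀ i, h i ≠ ν x := fun x hx i hi => by
      have := hx (m i)
      rw [← hm, hi, hν] at this
      exact this rfl
    unfold side tau
    rw [if_pos hi, if_neg hi']
    have e1 : S.count X (h i) + S.count X (h (i + 1)) = S.up (h i) := by
      unfold count
      rw [← Finset.sum_add_distrib, sum_eq_sum_hex hh.inj hν hνh hne hX (fun x _ hx => hg x hx),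
        hh.up]
      have := ht (fun a => decide (h a ∈ X)) (fun a => by
        have := hmem (h a)
        rw [hm] at this
        simp [this]) (by simpa using hi) (by simpa using hi')
      simpa [hh.left] using this
    have e2 : S.count Finset.univ (h i) = S.count X (h i) + S.count Xᶜ (h i) := by
      unfold count
      exact (Finset.sum_add_sum_compl X _).symm
    -- The two sides add up to the count of `Xᶜ` at one corner plus the count of `X` at the next.
    -- Moving the second count to the first corner costs `up`, which completes the total count to
    -- `tau`.
    rw [e2, ← e1]
    generalize S.count X (h i) = a
    generalize S.count X (h (i + 1)) = b
    generalize S.count Xᶜ (h i) = c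
    revert a b c
    decide
  by_cases h1 : h i ∈ X
  · exact main X hX h1 (hi.1 h1)
  · have h2 : h (i + 1) ∈ X := by
      by_contra hc
      exact h1 (hi.2 hc)
    rw [← S.side_compl, ← S.side_compl X]
    refine main Xᶜ ?_ (by simpa using h1) (by simpa using h2)
    intro x hx
    rw [Finset.mem_compl] at hx ⊢
    intro hc
    exact hx (by simpa only [hν x] using hX _ hc)

/-! ### Two hexagons: gaps that separate the same components have the same colour. -/

section TwoHexagons

variable {μ : A → A} {h k : Fin 6 → A} {t t' : HexShape}

/-- No strand of one hexagon crosses a strand of the other, whatever the states of the two. Joining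
up the edges, first in one hexagon and then in the other, makes the mixed second difference of
`left` vanish. -/
theorem Planar.nc_hex (hμ : S.Planar μ) (hne : ∀ x, μ x ≠ x)
    (hh : S.IsHex t h) (hk : S.IsHex t' k) (hhk : ∀ i j, h i ≠ k j)
    (h0 : ∀ i, μ (h i) = h (hexBefore i)) (k0 : ∀ i, μ (k i) = k (hexBefore i))
    (hμh : S.Planar (rewire h hexAfter μ)) (hμk : S.Planar (rewire k hexAfter μ))
    (hμhk : S.Planar (rewire h hexAfter (rewire k hexAfter μ))) (a b i j : Fin 6) :
    S.left (h a) (k i) + S.left (h a) (k j) = S.left (h b) (k i) + S.left (h b) (k j) := by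
  have e : ∀ x y z w : ZMod 2, x + y = z + w → y + w = x + z := by decide
  have e' : ∀ x y z w : ZMod 2, x + z = y + w → x + y = z + w := by decide
  refine e' _ _ _ _ (eq_of_hex (f := fun i => S.left (h a) (k i) + S.left (h b) (k i)) ?_ ?_ i j)
  · intro i
    have := hμ.nc_off' hne hh.inj hμh h0 (d := k i) (fun j => hhk j i) a b
    rw [k0] at this
    exact e _ _ _ _ this
  · intro i
    have h0' : ∀ i, rewire k hexAfter μ (h i) = h (hexBefore i) := fun i => by
      rw [rewire_of_notMem _ _ (fun j => (hhk i j).symm), h0]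
    have := hμk.nc_off' (rewire_ne hk.inj (by decide) hne) hh.inj hμhk h0' (d := k i)
      (fun j => hhk j i) a b
    rw [rewire_apply _ _ hk.inj] at this
    exact e _ _ _ _ this

/-- Two gaps of different colour cannot separate the same two components. -/
theorem Planar.tau_eq (hμ : S.Planar μ) (hne : ∀ x, μ x ≠ x)
    (hh : S.IsHex t h) (hk : S.IsHex t' k) (hhk : ∀ i j, h i ≠ k j)
    (h0 : ∀ i, μ (h i) = h (hexBefore i)) (k0 : ∀ i, μ (k i) = k (hexBefore i))
    (hμh : S.Planar (rewire h hexAfter μ)) (hμk : S.Planar (rewire k hexAfter μ))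
    (hμhk : S.Planar (rewire h hexAfter (rewire k hexAfter μ)))
    {m : Fin 6 → Fin 6} (hm : ∀ i, m (m i) = i) (hmi : ∀ i, m i ≠ i) (hts : t.ShortOK m)
    {i j : Fin 6} (ht : t.GapOK m i) (ht' : t'.GapOK hexBefore j)
    (hl : ¬ Link S.flip (rewire h m μ) (h i) (h (i + 1)))
    (hij : (Link S.flip (rewire h m μ) (h i) (k j) ∧
        Link S.flip (rewire h m μ) (h (i + 1)) (k (j + 1))) ∨
      (Link S.flip (rewire h m μ) (h i) (k (j + 1)) ∧
        Link S.flip (rewire h m μ) (h (i + 1)) (k j))) :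
    S.tau (h i) = S.tau (k j) := by
  classical
  set ν := rewire h m μ with hνdef
  have hJ : S.Jordan ν := hμ.jordan_rewire hne hh hμh h0 hm hmi hts
  have hνne := rewire_ne hh.inj hmi hne
  -- `X` is one of the two separated components; being closed, it cuts the diagram into two sides.
  set X : Finset A := Finset.univ.filter fun x => Link S.flip ν (h i) x with hX
  have memX : ∀ x, x ∈ X ↔ Link S.flip ν (h i) x := fun x => by simp [hX]
  have X1 : ∀ x ∈ X, S.flip x ∈ X := fun x hx => by
    rw [memX] at hx ⊢
    exact hx.trans (.left x)
  have X2 : ∀ x ∈ X, ν x ∈ X := fun x hx => by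
    rw [memX] at hx ⊢
    exact hx.trans (.right x)
  have s1 : S.side X (h i) + S.side X (h (i + 1)) = S.tau (h i) := by
    refine side_add_side hh hJ.1 hνne (fun i => rewire_apply m μ hh.inj i) i ht ?_ X2 ?_
    · intro x hx
      rw [hνdef, rewire_of_notMem _ _ hx]
      have := hμ.nc_off hne hh.inj hμh h0 hx i (i + 1)
      have e : ∀ a b c d : ZMod 2, a + c = b + d → a + b + (c + d) = 0 := by decide
      exact e _ _ _ _ this
    · rw [memX, memX]
      exact ⟨fun _ => hl, fun _ => .refl _⟩
  have s2 : S.side X (k j) + S.side X (k (j + 1)) = S.tau (k j) := by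
    refine side_add_side hk hJ.1 hνne (m := hexBefore) ?_ j ht' ?_ X2 ?_
    · intro a
      rw [hνdef, rewire_of_notMem _ _ (fun i => hhk i a), k0]
    · intro x hx
      by_cases hxh : ∃ a, h a = x
      · obtain ⟨a, rfl⟩ := hxh
        rw [hνdef, rewire_apply _ _ hh.inj,
          hμ.nc_hex hne hh hk hhk h0 k0 hμh hμk hμhk a (m a) j (j + 1)]
        exact CharTwo.add_self_eq_zero _
      · rw [hνdef, rewire_of_notMem _ _ fun a ha => hxh ⟨a, ha⟩]
        have := hμ.nc_off hne hk.inj hμk k0 hx j (j + 1)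
        have e : ∀ a b c d : ZMod 2, a + c = b + d → a + b + (c + d) = 0 := by decide
        exact e _ _ _ _ this
    · rw [memX, memX]
      rcases hij with ⟨h1, h2⟩ | ⟨h1, h2⟩
      · exact ⟨fun _ h3 => hl (h3.trans h2.symm), fun _ => h1⟩
      · exact ⟨fun h3 => (hl (h3.trans h2.symm)).elim, fun h3 => (h3 h1).elim⟩
  rcases hij with ⟨h1, h2⟩ | ⟨h1, h2⟩
  -- Each gap has one neighbour in each of the two components, and `side` is constant on components,
  -- so both colours are the same sum of two values.
  · rw [← s1, ← s2, hJ.side_eq X1 X2 h1, hJ.side_eq X1 X2 h2]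
  · rw [← s1, ← s2, hJ.side_eq X1 X2 h1, hJ.side_eq X1 X2 h2, add_comm]

end TwoHexagons

end Darts

/-! ### The finite check over the bijections outside of two hexagons. -/

/-- `b` is reached from `a` in at most five steps. -/
def reachFive (P : Fin 6 → Fin 6) (a b : Fin 6) : Bool :=
  a == b || (P a == b || (P (P a) == b || (P (P (P a)) == b || (P (P (P (P a))) == b ||
    P (P (P (P (P a)))) == b))))

/-- The odd vertices `1, 3, 5` of two hexagons are joined with the even vertices `0, 2, 4`. -/
def matchBB : Fin 6 → Fin 6 := ![1, 0, 2, 4, 3, 5]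
def matchAB : Fin 6 → Fin 6 := ![2, 1, 0, 4, 3, 5]
def matchBA : Fin 6 → Fin 6 := ![1, 0, 2, 5, 4, 3]
def matchAA : Fin 6 → Fin 6 := ![2, 1, 0, 5, 4, 3]
def matchEB : Fin 6 → Fin 6 := ![0, 1, 2, 4, 3, 5]
def matchOB : Fin 6 → Fin 6 := ![1, 2, 0, 4, 3, 5]

def reachAll (P : Fin 6 → Fin 6) : Bool :=
  reachFive P 0 1 && (reachFive P 0 2 && (reachFive P 0 3 && (reachFive P 0 4 && reachFive P 0 5)))

/-- `a` and `b` lie on different components, and `c`, `d` lie on the same two components, in some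
order. -/
def separates (P : Fin 6 → Fin 6) (a b c d : Fin 6) : Bool :=
  !reachFive P a b && ((reachFive P a c && reachFive P b d) || (reachFive P a d && reachFive P b c))

/-- The bijection `f` follows the outer paths from even to odd corners; composed with a matching
back to the even corners, its cycles are the components. The letters `B` and `A` are the states
before and after a surgery at the two hexagons, `E` and `O` the matchings of neighbours. The
disjunction says: a hypothesis fails, or the conclusion holds, or two gaps of different colour
separate the same components. -/
def outerCheck (f : Fin 6 → Fin 6) : Bool :=
  !reachAll (fun a => matchBB (f a)) || (!reachAll (fun a => matchBA (f a)) ||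
    (!reachAll (fun a => matchAA (f a)) || (reachAll (fun a => matchAB (f a)) ||
      (separates (fun a => matchEB (f a)) 0 1 3 4 || separates (fun a => matchOB (f a)) 2 0 3 5))))

-- The inequalities stand right behind each quantifier so that `decide` visits the 720 permutations
-- instead of all functions.
set_option maxRecDepth 1000000 in
set_option maxHeartbeats 4000000 in
theorem outerCheck_vec : ∀ a b : Fin 6, b ≠ a → ∀ c, c ≠ a ∧ c ≠ b → ∀ d, d ≠ a ∧ d ≠ b ∧ d ≠ c →
    ∀ e, e ≠ a ∧ e ≠ b ∧ e ≠ c ∧ e ≠ d → ∀ f, f ≠ a ∧ f ≠ b ∧ f ≠ c ∧ f ≠ d ∧ f ≠ e →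
    outerCheck ![a, b, c, d, e, f] = true := by
  decide

theorem outerCheck_eq_true {f : Fin 6 → Fin 6} (hf : Function.Injective f) :
    outerCheck f = true := by
  have h := outerCheck_vec (f 0) (f 1) (hf.ne (by decide)) (f 2)
    ⟨hf.ne (by decide), hf.ne (by decide)⟩ (f 3)
    ⟨hf.ne (by decide), hf.ne (by decide), hf.ne (by decide)⟩ (f 4)
    ⟨hf.ne (by decide), hf.ne (by decide), hf.ne (by decide), hf.ne (by decide)⟩ (f 5)
    ⟨hf.ne (by decide), hf.ne (by decide), hf.ne (by decide), hf.ne (by decide), hf.ne (by decide)⟩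
  have e : f = ![f 0, f 1, f 2, f 3, f 4, f 5] := by
    funext i
    fin_cases i <;> rfl
  rw [e]
  exact h

/-- A cycle of a permutation of six elements has length at most six. -/
theorem reachFive_iff {P : Fin 6 → Fin 6} (hP : Function.Injective P) (a b : Fin 6) :
    reachFive P a b = true ↔ ∃ n : ℕ, P^[n] a = b := by
  constructor
  · intro h
    simp only [reachFive, Bool.or_eq_true, beq_iff_eq] at h
    rcases h with h | h | h | h | h | h
    · exact ⟨0, h⟩
    · exact ⟨1, h⟩
    · exact ⟨2, h⟩
    · exact ⟨3, h⟩
    · exact ⟨4, h⟩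
    · exact ⟨5, h⟩
  · rintro ⟨n, rfl⟩
    have h1 : Function.minimalPeriod P a ≤ 6 := by
      have := Function.minimalPeriod_le_card (f := P) (x := a)
      simpa using this
    have h0 : 0 < Function.minimalPeriod P a :=
      Function.minimalPeriod_pos_of_mem_periodicPts (Function.Injective.mem_periodicPts hP a)
    rw [← Function.iterate_mod_minimalPeriod_eq]
    have h2 := Nat.mod_lt n h0
    generalize n % Function.minimalPeriod P a = m at h2 ⊢
    have h3 : m < 6 := by omega
    simp only [reachFive, Bool.or_eq_true, beq_iff_eq]
    interval_cases m <;> simp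

theorem reachFive_succ {P : Fin 6 → Fin 6} (hP : Function.Injective P) (a b : Fin 6) :
    reachFive P a (P b) = true ↔ reachFive P a b = true := by
  rw [reachFive_iff hP, reachFive_iff hP]
  constructor
  · rintro ⟨n, hn⟩
    cases n with
    | zero =>
      obtain ⟨m, hm, hm'⟩ := Function.Injective.mem_periodicPts hP b
      refine ⟨m - 1, ?_⟩
      rw [Function.iterate_zero, id] at hn
      rw [hn, ← Function.iterate_succ_apply, Nat.succ_eq_add_one, Nat.sub_add_cancel hm]
      exact hm'
    | succ n =>
      rw [Function.iterate_succ_apply'] at hn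
      exact ⟨n, hP hn⟩
  · rintro ⟨n, rfl⟩
    exact ⟨n + 1, Function.iterate_succ_apply' _ _ _⟩

/-- The arcs outside of two hexagons join the even vertices `ev` with the odd vertices `od`. -/
structure OuterMatching {A : Type*} (flip μ : A → A) (ev od : Fin 6 → A) (f : Fin 6 → Fin 6)
    (cls : A → Fin 6) : Prop where
  inj : Function.Injective f
  link : ∀ ν : A → A, (∀ x, (∀ i, ev i ≠ x) → (∀ i, od i ≠ x) → ν x = μ x) →
    ∀ x, Link flip ν (ev (cls x)) x
  cls_flip : ∀ x, cls (flip x) = cls x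
  cls_off : ∀ x, (∀ i, ev i ≠ x) → (∀ i, od i ≠ x) → cls (μ x) = cls x
  cls_ev : ∀ i, cls (ev i) = i
  cls_od : ∀ i, cls (od (f i)) = i

namespace OuterMatching

variable {A : Type*} {flip μ : A → A} {ev od : Fin 6 → A} {f : Fin 6 → Fin 6} {cls : A → Fin 6}

/-- A component alternates between outer paths, which `f` records, and strands at the hexagons,
which `g` records. So components correspond to the cycles of the composite on even corners. -/
theorem link_iff (hO : OuterMatching flip μ ev od f cls) {ν : A → A}
    (hν : ∀ x, (∀ i, ev i ≠ x) → (∀ i, od i ≠ x) → ν x = μ x) (hi : Function.Involutive ν)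
    {g : Fin 6 → Fin 6} (hg : Function.Injective g) (hνg : ∀ b, ν (od b) = ev (g b)) (x y : A) :
    Link flip ν x y ↔ reachFive (fun a => g (f a)) (cls x) (cls y) = true := by
  have hP : Function.Injective fun a => g (f a) := hg.comp hO.inj
  have hfs : Function.Surjective f := Finite.surjective_of_injective hO.inj
  have step : ∀ a, Link flip ν (ev a) (ev (g (f a))) := by
    intro a
    have h1 := hO.link ν hν (od (f a))
    rw [hO.cls_od] at h1
    refine h1.trans ?_
    rw [← hνg]
    exact .right _
  constructor
  · intro h
    have key := Link.iff_of_invariant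
      (p := fun z => reachFive (fun a => g (f a)) (cls x) (cls z) = true) ?_ ?_ h
    · exact key.1 ((reachFive_iff hP _ _).2 ⟨0, rfl⟩)
    · intro z
      rw [hO.cls_flip]
    · have hod : ∀ b, reachFive (fun a => g (f a)) (cls x) (cls (ν (od b))) = true ↔
          reachFive (fun a => g (f a)) (cls x) (cls (od b)) = true := by
        intro b
        obtain ⟨a, rfl⟩ := hfs b
        rw [hνg, hO.cls_ev, hO.cls_od]
        exact reachFive_succ hP (cls x) a
      intro z
      by_cases h1 : ∃ i, od i = z
      · obtain ⟨b, rfl⟩ := h1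
        exact hod b
      · by_cases h2 : ∃ i, ev i = z
        · obtain ⟨a, rfl⟩ := h2
          obtain ⟨b, rfl⟩ := Finite.surjective_of_injective hg a
          rw [← hνg, hi]
          exact (hod b).symm
        · have h1' : ∀ i, od i ≠ z := fun i hi => h1 ⟨i, hi⟩
          have h2' : ∀ i, ev i ≠ z := fun i hi => h2 ⟨i, hi⟩
          rw [hν z h2' h1', hO.cls_off z h2' h1']
  · intro h
    rw [reachFive_iff hP] at h
    obtain ⟨n, hn⟩ := h
    have : ∀ n : ℕ, ∀ a, Link flip ν (ev a) (ev ((fun a => g (f a))^[n] a)) := by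
      intro n
      induction n with
      | zero => exact fun a => .refl _
      | succ n ih =>
        intro a
        rw [Function.iterate_succ_apply']
        exact (ih a).trans (step _)
    refine (hO.link ν hν x).symm.trans ((this n (cls x)).trans ?_)
    rw [hn]
    exact hO.link ν hν y

end OuterMatching

/-! ### Outer paths join even corners to odd corners. -/

namespace Darts

variable {A : Type*} [Fintype A] [DecidableEq A] {S : Darts A}

theorem Link.mono {f g g' : A → A} (hg : ∀ x, g x = x ∨ g x = g' x) {x y : A}
    (h : Link f g x y) : Link f g' x y := by
  refine _root_.Link.of_rel (r := Link f g') ⟨.refl, .symm, .trans⟩ (fun x => .left x) (fun x => ?_) h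
  rcases hg x with h | h
  · rw [h]
    exact .refl x
  · rw [h]
    exact .right x

-- Cut all strands at the twelve corners. Each corner becomes the end of an outer path, and the
-- colour `tau` differs at the two ends of a path. All even corners have one colour and all odd ones
-- the other, so outer paths match even with odd.
open Classical in
theorem Planar.exists_outerMatching {μ : A → A} (hμ : S.Planar μ) (hne : ∀ x, μ x ≠ x)
    (hconn : ∀ x y, Link S.flip μ x y) {ev od : Fin 6 → A} (hev : Function.Injective ev)
    (hod : Function.Injective od) (heo : ∀ i j, ev i ≠ od j)
    {g : Fin 6 → Fin 6} (hg : Function.Bijective g) (hμg : ∀ b, μ (od b) = ev (g b))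
    (htau : ∀ i j, S.tau (ev i) = S.tau (ev j)) :
    ∃ f cls, OuterMatching S.flip μ ev od f cls := by
  obtain ⟨μ', hμ'⟩ : ∃ μ' : A → A, μ' = fun x => if (∃ i, ev i = x) ∨ ∃ i, od i = x then x else μ x :=
    ⟨_, rfl⟩
  have hμev : ∀ i, ∃ j, μ (ev i) = od j := fun i => by
    obtain ⟨b, rfl⟩ := hg.2 i
    exact ⟨b, by rw [← hμg, hμ.invol]⟩
  have htodd : ∀ i j, S.tau (od i) = S.tau (ev j) + 1 := fun i j => by
    have := hμ.tau_arc (hne (od i))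
    rw [hμg, htau _ j] at this
    rw [this, add_assoc]
    simp [CharTwo.add_self_eq_zero]
  have m_ev : ∀ i, μ' (ev i) = ev i := fun i => by
    rw [hμ']
    exact if_pos (Or.inl ⟨i, rfl⟩)
  have m_od : ∀ i, μ' (od i) = od i := fun i => by
    rw [hμ']
    exact if_pos (Or.inr ⟨i, rfl⟩)
  have m_off : ∀ x, (∀ i, ev i ≠ x) → (∀ i, od i ≠ x) → μ' x = μ x := fun x h1 h2 => by
    rw [hμ']
    refine if_neg ?_
    rintro (⟨i, hi⟩ | ⟨i, hi⟩)
    · exact h1 i hi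
    · exact h2 i hi
  have off_off : ∀ x, (∀ i, ev i ≠ x) → (∀ i, od i ≠ x) →
      (∀ i, ev i ≠ μ x) ∧ (∀ i, od i ≠ μ x) := fun x h1 h2 => by
    constructor
    · intro i hi
      obtain ⟨j, hj⟩ := hμev i
      refine h2 j ?_
      rw [← hj, hi, hμ.invol]
    · intro i hi
      refine h1 (g i) ?_
      rw [← hμg, hi, hμ.invol]
  have fixed_iff : ∀ x, μ' x = x ↔ (∃ i, ev i = x) ∨ ∃ i, od i = x := fun x => by
    by_cases hx : (∃ i, ev i = x) ∨ ∃ i, od i = x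
    · exact ⟨fun _ => hx, fun _ => by rw [hμ']; exact if_pos hx⟩
    · refine ⟨fun h => (hne x ?_).elim, fun h => absurd h hx⟩
      rw [← h, hμ']
      dsimp only
      rw [if_neg hx]
      rw [hμ'] at h
      dsimp only at h
      rw [if_neg hx] at h
      rw [h]
      try exact h
  have hinv : Function.Involutive μ' := fun x => by
    by_cases hx : (∃ i, ev i = x) ∨ ∃ i, od i = x
    · rw [(fixed_iff x).2 hx, (fixed_iff x).2 hx]
    · have h1 : ∀ i, ev i ≠ x := fun i hi => hx (Or.inl ⟨i, hi⟩)
      have h2 : ∀ i, od i ≠ x := fun i hi => hx (Or.inr ⟨i, hi⟩)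
      rw [m_off x h1 h2, m_off _ (off_off x h1 h2).1 (off_off x h1 h2).2, hμ.invol]
  have two : ∀ x y z, μ' x = x → μ' y = y → μ' z = z → Link S.flip μ' x y → Link S.flip μ' x z →
      y ≠ x → z ≠ x → y = z := fun x y z hx hy hz h1 h2 h3 h4 =>
    Link.eq_of_fixed S.flip_flip hinv hx hy hz h1 h2 h3 h4
  -- the two ends of an outer path have different orientations
  have parity : ∀ x y, μ' x = x → μ' y = y → Link S.flip μ' x y → x ≠ y →
      S.tau x ≠ S.tau y := by
    intro x y hx hy hxy hne'
    obtain ⟨X, hX⟩ : ∃ X : Finset A, X = Finset.univ.filter fun z => Link S.flip μ' x z := ⟨_, rfl⟩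
    have memX : ∀ z, z ∈ X ↔ Link S.flip μ' x z := fun z => by simp [hX]
    -- The colour as an integer sign. On a path the signs cancel along `flip`, and along the
    -- remaining arcs they cancel except at the two ends, whose signs must then be opposite; over
    -- the integers this gives a contradiction for equal colours.
    obtain ⟨w, hw⟩ : ∃ w : A → ℤ, w = fun z => if S.tau z = 0 then 1 else -1 := ⟨_, rfl⟩
    have wflip : ∀ a b, S.tau b = S.tau a + 1 → w a + w b = 0 := by
      intro a b hab
      simp only [hw, hab]
      have : ∀ c : ZMod 2, (if c = 0 then (1 : ℤ) else -1) + (if c + 1 = 0 then 1 else -1) = 0 := by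
        decide
      exact this _
    have wne : ∀ a, w a ≠ 0 := fun a => by
      simp only [hw]
      split_ifs <;> norm_num
    have s1 : ∑ z ∈ X, w z = 0 :=
      Finset.sum_involution (fun z _ => S.flip z) (fun z _ => wflip _ _ (S.tau_flip z))
        (fun z _ _ => S.flip_ne z) (fun z hz => by
          rw [memX] at hz ⊢
          exact hz.trans (.left z)) (fun z _ => S.flip_flip z)
    have s2 : ∑ z ∈ X with μ' z ≠ z, w z = 0 := by
      refine Finset.sum_involution (fun z _ => μ' z) (fun z hz => wflip _ _ ?_)
        (fun z hz _ => ?_) (fun z hz => ?_) (fun z _ => hinv z)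
      · rw [Finset.mem_filter] at hz
        have hz2 : ¬ ((∃ i, ev i = z) ∨ ∃ i, od i = z) := fun h => hz.2 ((fixed_iff z).2 h)
        rw [m_off z (fun i hi => hz2 (Or.inl ⟨i, hi⟩)) (fun i hi => hz2 (Or.inr ⟨i, hi⟩))]
        exact hμ.tau_arc (hne z)
      · rw [Finset.mem_filter] at hz
        exact hz.2
      · rw [Finset.mem_filter, memX] at hz ⊢
        refine ⟨hz.1.trans (.right z), fun h => hz.2 ?_⟩
        rw [hinv] at h
        exact h.symm
    have e : X.filter (fun z => ¬ μ' z ≠ z) = {x, y} := by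
      ext z
      simp only [Finset.mem_filter, memX, not_not, Finset.mem_insert, Finset.mem_singleton]
      constructor
      · rintro ⟨h1, h2⟩
        by_contra hc
        push Not at hc
        exact hc.2 (two x z y hx h2 hy h1 hxy hc.1 hne'.symm)
      · rintro (rfl | rfl)
        · exact ⟨.refl _, hx⟩
        · exact ⟨hxy, hy⟩
    rw [← Finset.sum_filter_add_sum_filter_not X (fun z => μ' z ≠ z), s2, zero_add, e,
      Finset.sum_pair hne'] at s1
    intro hc
    have : w x = w y := by simp only [hw, hc]
    have := wne x
    omega
  have hf : ∀ a, ∃ b, Link S.flip μ' (ev a) (od b) := by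
    intro a
    obtain ⟨y, hy1, hy2, hy3⟩ := Link.exists_fixed S.flip_flip hinv (m_ev a) (fun y => S.flip_ne y)
    rcases (fixed_iff y).1 hy2 with ⟨i, rfl⟩ | ⟨i, rfl⟩
    · exact absurd (htau _ _) (parity _ _ (m_ev a) hy2 hy3 hy1.symm)
    · exact ⟨i, hy3⟩
  choose f hf using hf
  have finj : Function.Injective f := by
    intro a a' haa
    by_contra hc
    have h1 := hf a'
    rw [← haa] at h1
    have := two (od (f a)) (ev a) (ev a') (m_od _) (m_ev _) (m_ev _) (hf a).symm h1.symm
      (heo _ _) (heo _ _)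
    exact hc (hev this)
  have fsurj : Function.Surjective f := Finite.surjective_of_injective finj
  -- A component without a corner would not notice that the strands were cut, so it would be a
  -- component of the whole connected diagram.
  have hcls : ∀ x, ∃ a, Link S.flip μ' (ev a) x := by
    intro x
    by_contra hc
    push Not at hc
    have key := Link.iff_of_invariant (p := fun z => Link S.flip μ' x z) (f := S.flip) (g := μ)
      (fun z => ⟨fun h => h.trans (by
        have := Link.left (f := S.flip) (g := μ') (S.flip z)
        rwa [S.flip_flip] at this), fun h => h.trans (.left z)⟩)
      (fun z => ?_) (hconn x (ev 0))
    · exact hc 0 ((key.1 (.refl x)).symm)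
    · by_cases h1 : ∃ i, ev i = z
      · obtain ⟨i, rfl⟩ := h1
        obtain ⟨j, hj⟩ := hμev i
        rw [hj]
        obtain ⟨a, rfl⟩ := fsurj j
        exact ⟨fun h => (hc a ((hf a).trans h.symm)).elim, fun h => (hc i h.symm).elim⟩
      · by_cases h2 : ∃ i, od i = z
        · obtain ⟨i, rfl⟩ := h2
          rw [hμg]
          obtain ⟨a, rfl⟩ := fsurj i
          exact ⟨fun h => (hc _ h.symm).elim, fun h => (hc a ((hf a).trans h.symm)).elim⟩
        · have h1' : ∀ i, ev i ≠ z := fun i hi => h1 ⟨i, hi⟩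
          have h2' : ∀ i, od i ≠ z := fun i hi => h2 ⟨i, hi⟩
          have h3 := Link.right (f := S.flip) (g := μ') z
          rw [m_off z h1' h2'] at h3
          exact ⟨fun h => h.trans h3.symm, fun h => h.trans h3⟩
  choose cls hcls using hcls
  have ev_eq : ∀ a a', Link S.flip μ' (ev a) (ev a') → a = a' := by
    intro a a' h
    by_contra hc
    exact parity _ _ (m_ev a) (m_ev a') h (fun h => hc (hev h)) (htau _ _)
  have cls_eq : ∀ x y, Link S.flip μ' x y → cls x = cls y := fun x y h =>
    ev_eq _ _ ((hcls x).trans (h.trans (hcls y).symm))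
  refine ⟨f, cls, finj, ?_, ?_, ?_, ?_, ?_⟩
  · intro ν hν x
    refine Link.mono (fun z => ?_) (hcls x)
    by_cases hz : (∃ i, ev i = z) ∨ ∃ i, od i = z
    · exact Or.inl ((fixed_iff z).2 hz)
    · have h1 : ∀ i, ev i ≠ z := fun i hi => hz (Or.inl ⟨i, hi⟩)
      have h2 : ∀ i, od i ≠ z := fun i hi => hz (Or.inr ⟨i, hi⟩)
      rw [m_off z h1 h2, hν z h1 h2]
      exact Or.inr rfl
  · exact fun x => (cls_eq _ _ (.left x)).symm
  · intro x h1 h2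
    rw [← m_off x h1 h2]
    exact (cls_eq _ _ (.right x)).symm
  · exact fun i => ev_eq _ _ (hcls (ev i))
  · exact fun i => ev_eq _ _ ((hcls _).trans (hf i).symm)

end Darts

/-! ### Connectedness under two surgeries. -/

/-- Rotate a hexagon by 180 degrees. -/
def HexShape.rotate (t : HexShape) : HexShape where
  left a b := t.left (a + 3) (b + 3)
  up a := t.up (a + 3)

theorem HexShape.GapOK.rotate {t : HexShape} {m : Fin 6 → Fin 6} {i : Fin 6}
    (hm : ∀ a, m (a + 3) = m a + 3) (h : t.GapOK m (i + 3)) : t.rotate.GapOK m i := by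
  have e33 : ∀ a : Fin 6, a + 3 + 3 = a := by decide
  have e31 : ∀ a : Fin 6, a + 3 + 1 = a + 1 + 3 := by decide
  intro P hP h1 h2
  have := h (fun a => P (a + 3)) (fun a => by rw [← hm, hP]) (by rwa [e33]) (by rwa [e31, e33])
  rw [e31] at this
  change _ = t.up (i + 3)
  rw [← this]
  refine Fintype.sum_equiv (Equiv.addRight 3) _ _ (fun a => ?_)
  simp only [Equiv.coe_addRight, e33]
  rfl

namespace Darts

variable {A : Type*} [Fintype A] [DecidableEq A] {S : Darts A}

/-- Every strand before and after the surgery changes the colour, so the colour alternates with the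
parity of the corner. -/
theorem Planar.tau_hex {μ : A → A} (hμ : S.Planar μ) (hne : ∀ x, μ x ≠ x) {h : Fin 6 → A}
    (hh : Function.Injective h) (h0 : ∀ i, μ (h i) = h (hexBefore i))
    (hμh : S.Planar (rewire h hexAfter μ)) :
    S.tau (h 1) = S.tau (h 0) + 1 ∧ S.tau (h 2) = S.tau (h 0) ∧ S.tau (h 3) = S.tau (h 0) + 1 ∧
      S.tau (h 4) = S.tau (h 0) ∧ S.tau (h 5) = S.tau (h 0) + 1 := by
  have hne' := rewire_ne hh (m := hexAfter) (by decide) hne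
  have a : ∀ i, S.tau (h (hexBefore i)) = S.tau (h i) + 1 := fun i => by
    rw [← h0]
    exact hμ.tau_arc (hne _)
  have b : ∀ i, S.tau (h (hexAfter i)) = S.tau (h i) + 1 := fun i => by
    rw [← rewire_apply hexAfter μ hh]
    exact hμh.tau_arc (hne' _)
  have a0 : S.tau (h 3) = S.tau (h 0) + 1 := a 0
  have b0 : S.tau (h 5) = S.tau (h 0) + 1 := b 0
  have b3 : S.tau (h 2) = S.tau (h 3) + 1 := b 3
  have a5 : S.tau (h 4) = S.tau (h 5) + 1 := a 5
  have a2 : S.tau (h 1) = S.tau (h 2) + 1 := a 2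
  have e : ∀ c : ZMod 2, c + 1 + 1 = c := by decide
  rw [a0, e] at b3
  rw [b0, e] at a5
  rw [b3] at a2
  exact ⟨a2, b3, a0, a5, b0⟩

section TwoHexagons

variable {μ : A → A} {h k : Fin 6 → A} {t t' : HexShape}

/-- The points of two hexagons with even, and with odd, numbers. -/
def evenPoints (h k : Fin 6 → A) : Fin 6 → A := ![h 0, h 2, h 4, k 0, k 2, k 4]
def oddPoints (h k : Fin 6 → A) : Fin 6 → A := ![h 1, h 3, h 5, k 1, k 3, k 5]

theorem evenPoints_injective (hh : Function.Injective h) (hk : Function.Injective k)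
    (hhk : ∀ i j, h i ≠ k j) : Function.Injective (evenPoints h k) := by
  have h1 := fun a b => hh.eq_iff (a := a) (b := b)
  have h2 := fun a b => hk.eq_iff (a := a) (b := b)
  intro i j
  fin_cases i <;> fin_cases j <;> simp [evenPoints, h1, h2, hhk, (hhk _ _).symm]

theorem oddPoints_injective (hh : Function.Injective h) (hk : Function.Injective k)
    (hhk : ∀ i j, h i ≠ k j) : Function.Injective (oddPoints h k) := by
  have h1 := fun a b => hh.eq_iff (a := a) (b := b)
  have h2 := fun a b => hk.eq_iff (a := a) (b := b)
  intro i j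
  fin_cases i <;> fin_cases j <;> simp [oddPoints, h1, h2, hhk, (hhk _ _).symm]

theorem evenPoints_ne_oddPoints (hh : Function.Injective h) (hk : Function.Injective k)
    (hhk : ∀ i j, h i ≠ k j) (i j : Fin 6) : evenPoints h k i ≠ oddPoints h k j := by
  have h1 := fun a b => hh.eq_iff (a := a) (b := b)
  have h2 := fun a b => hk.eq_iff (a := a) (b := b)
  fin_cases i <;> fin_cases j <;> simp [evenPoints, oddPoints, h1, h2, hhk, (hhk _ _).symm]

theorem off_of_off {x : A} (h1 : ∀ i, evenPoints h k i ≠ x) (h2 : ∀ i, oddPoints h k i ≠ x) :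
    (∀ i, h i ≠ x) ∧ ∀ i, k i ≠ x := by
  constructor <;> intro i
  · fin_cases i
    exacts [h1 0, h2 0, h1 1, h2 1, h1 2, h2 2]
  · fin_cases i
    exacts [h1 3, h2 3, h1 4, h2 4, h1 5, h2 5]

theorem rewire_states {ν : A → A} (a b : Fin 6 → Fin 6) (g : Fin 6 → Fin 6)
    (ha : ∀ i, ν (h i) = h (a i)) (hb : ∀ i, ν (k i) = k (b i))
    (hg : ∀ i, (![h (a 1), h (a 3), h (a 5), k (b 1), k (b 3), k (b 5)] : Fin 6 → A) i =
      evenPoints h k (g i)) (i : Fin 6) : ν (oddPoints h k i) = evenPoints h k (g i) := by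
  rw [← hg]
  fin_cases i
  exacts [ha 1, ha 3, ha 5, hb 1, hb 3, hb 5]

theorem statesBB (h k : Fin 6 → A) (i : Fin 6) : (![h (hexBefore 1), h (hexBefore 3), h (hexBefore 5),
    k (hexBefore 1), k (hexBefore 3), k (hexBefore 5)] : Fin 6 → A) i = evenPoints h k (matchBB i) := by
  fin_cases i <;> simp [evenPoints, matchBB, hexBefore]

theorem statesBA (h k : Fin 6 → A) (i : Fin 6) : (![h (hexBefore 1), h (hexBefore 3), h (hexBefore 5),
    k (hexAfter 1), k (hexAfter 3), k (hexAfter 5)] : Fin 6 → A) i = evenPoints h k (matchBA i) := by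
  fin_cases i <;> simp [evenPoints, matchBA, hexBefore, hexAfter]

theorem statesAA (h k : Fin 6 → A) (i : Fin 6) : (![h (hexAfter 1), h (hexAfter 3), h (hexAfter 5),
    k (hexAfter 1), k (hexAfter 3), k (hexAfter 5)] : Fin 6 → A) i = evenPoints h k (matchAA i) := by
  fin_cases i <;> simp [evenPoints, matchAA, hexBefore, hexAfter]

theorem statesAB (h k : Fin 6 → A) (i : Fin 6) : (![h (hexAfter 1), h (hexAfter 3), h (hexAfter 5),
    k (hexBefore 1), k (hexBefore 3), k (hexBefore 5)] : Fin 6 → A) i = evenPoints h k (matchAB i) := by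
  fin_cases i <;> simp [evenPoints, matchAB, hexBefore, hexAfter]

theorem statesEB (h k : Fin 6 → A) (i : Fin 6) : (![h (hexEven 1), h (hexEven 3), h (hexEven 5),
    k (hexBefore 1), k (hexBefore 3), k (hexBefore 5)] : Fin 6 → A) i = evenPoints h k (matchEB i) := by
  fin_cases i <;> simp [evenPoints, matchEB, hexBefore, hexEven]

theorem statesOB (h k : Fin 6 → A) (i : Fin 6) : (![h (hexOdd 1), h (hexOdd 3), h (hexOdd 5),
    k (hexBefore 1), k (hexBefore 3), k (hexBefore 5)] : Fin 6 → A) i = evenPoints h k (matchOB i) := by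
  fin_cases i <;> simp [evenPoints, matchOB, hexBefore, hexOdd]

/-- With equal colours at the corners `0` the even corners of both hexagons form one colour class,
so the outer matching exists and the finite check applies. Its last two alternatives contradict
`Planar.tau_eq`. -/
theorem Planar.connected_of_tau_eq (hμ : S.Planar μ) (hne : ∀ x, μ x ≠ x)
    (hh : S.IsHex t h) (hk : S.IsHex t' k) (hhk : ∀ i j, h i ≠ k j)
    (h0 : ∀ i, μ (h i) = h (hexBefore i)) (k0 : ∀ i, μ (k i) = k (hexBefore i))
    (hμh : S.Planar (rewire h hexAfter μ)) (hμk : S.Planar (rewire k hexAfter μ))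
    (hμhk : S.Planar (rewire h hexAfter (rewire k hexAfter μ)))
    (ht1 : t.ShortOK hexEven) (ht2 : t.ShortOK hexOdd) (ht3 : t.GapOK hexEven 1)
    (ht4 : t.GapOK hexOdd 4) (ht5 : t'.GapOK hexBefore 0) (ht6 : t'.GapOK hexBefore 3)
    (c0 : ∀ x y, Link S.flip μ x y) (ck : ∀ x y, Link S.flip (rewire k hexAfter μ) x y)
    (chk : ∀ x y, Link S.flip (rewire h hexAfter (rewire k hexAfter μ)) x y)
    (htau : S.tau (k 0) = S.tau (h 0)) (x y : A) :
    Link S.flip (rewire h hexAfter μ) x y := by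
  obtain ⟨u1, u2, u3, u4, u5⟩ := hμ.tau_hex hne hh.inj h0 hμh
  obtain ⟨v1, v2, v3, v4, v5⟩ := hμ.tau_hex hne hk.inj k0 hμk
  have hkh : ∀ i j, k i ≠ h j := fun i j => (hhk j i).symm
  have hn : ∀ (m : Fin 6 → Fin 6) (ν : A → A) (i : Fin 6), rewire h m ν (k i) = ν (k i) :=
    fun m ν i => rewire_of_notMem _ _ (fun j => hhk j i)
  have kn : ∀ (m : Fin 6 → Fin 6) (ν : A → A) (i : Fin 6), rewire k m ν (h i) = ν (h i) :=
    fun m ν i => rewire_of_notMem _ _ (fun j => hkh j i)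
  have hy : ∀ (m : Fin 6 → Fin 6) (ν : A → A) (i : Fin 6), rewire h m ν (h i) = h (m i) :=
    fun m ν i => rewire_apply _ _ hh.inj i
  have ky : ∀ (m : Fin 6 → Fin 6) (ν : A → A) (i : Fin 6), rewire k m ν (k i) = k (m i) :=
    fun m ν i => rewire_apply _ _ hk.inj i
  obtain ⟨f, cls, hO⟩ := hμ.exists_outerMatching hne c0 (evenPoints_injective hh.inj hk.inj hhk)
    (oddPoints_injective hh.inj hk.inj hhk) (evenPoints_ne_oddPoints hh.inj hk.inj hhk)
    (g := matchBB) (by decide)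
    (rewire_states hexBefore hexBefore matchBB h0 k0 (statesBB h k)) (by
      have : ∀ i, S.tau (evenPoints h k i) = S.tau (h 0) := by
        intro i
        fin_cases i
        exacts [rfl, u2, u4, htau, v2.trans htau, v4.trans htau]
      intro i j
      rw [this, this])
  have offh : ∀ (m : Fin 6 → Fin 6) x, (∀ i, evenPoints h k i ≠ x) → (∀ i, oddPoints h k i ≠ x) →
      rewire h m μ x = μ x := fun m x h1 h2 => rewire_of_notMem _ _ (off_of_off h1 h2).1
  have offk : ∀ (m : Fin 6 → Fin 6) x, (∀ i, evenPoints h k i ≠ x) → (∀ i, oddPoints h k i ≠ x) →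
      rewire k m μ x = μ x := fun m x h1 h2 => rewire_of_notMem _ _ (off_of_off h1 h2).2
  have lBB := fun x y => hO.link_iff (ν := μ) (g := matchBB) (fun _ _ _ => rfl) hμ.invol (by decide)
    (rewire_states hexBefore hexBefore matchBB h0 k0 (statesBB h k)) x y
  have lBA := fun x y => hO.link_iff (ν := rewire k hexAfter μ) (g := matchBA) (offk _) hμk.invol
    (by decide) (rewire_states hexBefore hexAfter matchBA (fun i => (kn _ _ i).trans (h0 i))
      (ky _ _) (statesBA h k)) x y
  have lAA := fun x y => hO.link_iff (ν := rewire h hexAfter (rewire k hexAfter μ)) (g := matchAA)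
    (fun x h1 h2 => by rw [rewire_of_notMem _ _ (off_of_off h1 h2).1, offk _ x h1 h2]) hμhk.invol
    (by decide) (rewire_states hexAfter hexAfter matchAA (hy _ _)
      (fun i => (hn _ _ i).trans (ky _ _ i)) (statesAA h k)) x y
  have lAB := fun x y => hO.link_iff (ν := rewire h hexAfter μ) (g := matchAB) (offh _) hμh.invol
    (by decide) (rewire_states hexAfter hexBefore matchAB (hy _ _)
      (fun i => (hn _ _ i).trans (k0 i)) (statesAB h k)) x y
  have lEB := fun x y => hO.link_iff (ν := rewire h hexEven μ) (g := matchEB) (offh _)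
    (rewire_involutive hh.inj (by decide) hμ.invol h0)
    (by decide) (rewire_states hexEven hexBefore matchEB (hy _ _)
      (fun i => (hn _ _ i).trans (k0 i)) (statesEB h k)) x y
  have lOB := fun x y => hO.link_iff (ν := rewire h hexOdd μ) (g := matchOB) (offh _)
    (rewire_involutive hh.inj (by decide) hμ.invol h0)
    (by decide) (rewire_states hexOdd hexBefore matchOB (hy _ _)
      (fun i => (hn _ _ i).trans (k0 i)) (statesOB h k)) x y
  have all : ∀ {ν : A → A} {g : Fin 6 → Fin 6},
      (∀ x y, Link S.flip ν x y ↔ reachFive (fun a => g (f a)) (cls x) (cls y) = true) →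
      (∀ x y, Link S.flip ν x y) → reachAll (fun a => g (f a)) = true := by
    intro ν g h1 h2
    have : ∀ i, reachFive (fun a => g (f a)) 0 i = true := fun i => by
      have := (h1 (evenPoints h k 0) (evenPoints h k i)).1 (h2 _ _)
      rwa [hO.cls_ev, hO.cls_ev] at this
    simp [reachAll, this]
  have check := outerCheck_eq_true hO.inj
  simp only [outerCheck, all lBB c0, all lBA ck, all lAA chk, Bool.not_true, Bool.false_or,
    Bool.or_eq_true] at check
  rcases check with h1 | h1 | h1
  · have : ∀ z, Link S.flip (rewire h hexAfter μ) (evenPoints h k 0) z := by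
      intro z
      rw [lAB, hO.cls_ev]
      simp only [reachAll, Bool.and_eq_true] at h1
      generalize cls z = i
      fin_cases i
      exacts [by simp [reachFive], h1.1, h1.2.1, h1.2.2.1, h1.2.2.2.1, h1.2.2.2.2]
    exact (this x).symm.trans (this y)
  · exfalso
    have od : ∀ i, Link S.flip (rewire h hexEven μ) (evenPoints h k (matchEB i))
      (oddPoints h k i) := fun i => by
        have := Link.right (f := S.flip) (g := rewire h hexEven μ) (oddPoints h k i)
        rw [rewire_states hexEven hexBefore matchEB (hy _ _)
          (fun i => (hn _ _ i).trans (k0 i)) (statesEB h k)] at this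
        exact this.symm
    have ev : ∀ i j, Link S.flip (rewire h hexEven μ) (evenPoints h k i) (evenPoints h k j) ↔
        reachFive (fun a => matchEB (f a)) i j = true := fun i j => by
      rw [lEB, hO.cls_ev, hO.cls_ev]
    simp only [separates, Bool.and_eq_true, Bool.or_eq_true, ← ev, Bool.not_eq_true',
      ← Bool.not_eq_true] at h1
    have o0 : Link S.flip (rewire h hexEven μ) (h 0) (h 1) := od 0
    have o4 : Link S.flip (rewire h hexEven μ) (k 2) (k 1) := od 3
    obtain ⟨w1, w2⟩ := h1
    have w1' : ¬ Link S.flip (rewire h hexEven μ) (h 0) (h 2) := w1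
    have w2' : (Link S.flip (rewire h hexEven μ) (h 0) (k 0) ∧
      Link S.flip (rewire h hexEven μ) (h 2) (k 2)) ∨
      (Link S.flip (rewire h hexEven μ) (h 0) (k 2) ∧
      Link S.flip (rewire h hexEven μ) (h 2) (k 0)) := w2
    -- In the even state corner `1` of `h` is joined to corner `0`, and corner `1` of `k` to corner
    -- `2`. So the gaps after `h 1` and after `k 0` separate the same components, although their
    -- colours differ.
    have := hμ.tau_eq hne hh hk hhk h0 k0 hμh hμk hμhk (m := hexEven) (by decide) (by decide) ht1
      (i := 1) (j := 0) ht3 ht5 (fun hc => w1' (o0.trans hc)) (by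
        rcases w2' with ⟨p1, p2⟩ | ⟨p1, p2⟩
        · exact Or.inl ⟨o0.symm.trans p1, p2.trans o4⟩
        · exact Or.inr ⟨o0.symm.trans (p1.trans o4), p2⟩)
    rw [u1, htau] at this
    simp at this
  · exfalso
    have od : ∀ i, Link S.flip (rewire h hexOdd μ) (evenPoints h k (matchOB i))
      (oddPoints h k i) := fun i => by
        have := Link.right (f := S.flip) (g := rewire h hexOdd μ) (oddPoints h k i)
        rw [rewire_states hexOdd hexBefore matchOB (hy _ _)
          (fun i => (hn _ _ i).trans (k0 i)) (statesOB h k)] at this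
        exact this.symm
    have ev : ∀ i j, Link S.flip (rewire h hexOdd μ) (evenPoints h k i) (evenPoints h k j) ↔
        reachFive (fun a => matchOB (f a)) i j = true := fun i j => by
      rw [lOB, hO.cls_ev, hO.cls_ev]
    simp only [separates, Bool.and_eq_true, Bool.or_eq_true, ← ev, Bool.not_eq_true',
      ← Bool.not_eq_true] at h1
    have o2 : Link S.flip (rewire h hexOdd μ) (h 0) (h 5) := od 2
    have o4 : Link S.flip (rewire h hexOdd μ) (k 0) (k 3) := od 4
    obtain ⟨w1, w2⟩ := h1
    have w1' : ¬ Link S.flip (rewire h hexOdd μ) (h 4) (h 0) := w1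
    have w2' : (Link S.flip (rewire h hexOdd μ) (h 4) (k 0) ∧
      Link S.flip (rewire h hexOdd μ) (h 0) (k 4)) ∨
      (Link S.flip (rewire h hexOdd μ) (h 4) (k 4) ∧
      Link S.flip (rewire h hexOdd μ) (h 0) (k 0)) := w2
    -- In the odd state corner `5` of `h` is joined to corner `0`, and corner `3` of `k` to corner
    -- `0`. The gaps after `h 4` and after `k 3` have different colours.
    have := hμ.tau_eq hne hh hk hhk h0 k0 hμh hμk hμhk (m := hexOdd) (by decide) (by decide) ht2
      (i := 4) (j := 3) ht4 ht6 (fun hc => w1' (hc.trans o2.symm)) (by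
        rcases w2' with ⟨p1, p2⟩ | ⟨p1, p2⟩
        · exact Or.inl ⟨p1.trans o4, o2.symm.trans p2⟩
        · exact Or.inr ⟨p1, o2.symm.trans (p2.trans o4)⟩)
    rw [u4, v3, htau] at this
    simp at this

/-- If a diagram stays connected under one surgery, and the result of it does so under another
surgery, then the diagram stays connected under that surgery. -/
theorem Planar.connected_of_connected (hμ : S.Planar μ) (hne : ∀ x, μ x ≠ x)
    (hh : S.IsHex t h) (hk : S.IsHex t' k) (hhk : ∀ i j, h i ≠ k j)
    (h0 : ∀ i, μ (h i) = h (hexBefore i)) (k0 : ∀ i, μ (k i) = k (hexBefore i))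
    (hμh : S.Planar (rewire h hexAfter μ)) (hμk : S.Planar (rewire k hexAfter μ))
    (hμhk : S.Planar (rewire h hexAfter (rewire k hexAfter μ)))
    (ht1 : t.ShortOK hexEven) (ht2 : t.ShortOK hexOdd) (ht3 : t.GapOK hexEven 1)
    (ht4 : t.GapOK hexOdd 4) (ht5 : t'.GapOK hexBefore 0) (ht6 : t'.GapOK hexBefore 3)
    (c0 : ∀ x y, Link S.flip μ x y) (ck : ∀ x y, Link S.flip (rewire k hexAfter μ) x y)
    (chk : ∀ x y, Link S.flip (rewire h hexAfter (rewire k hexAfter μ)) x y) (x y : A) :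
    Link S.flip (rewire h hexAfter μ) x y := by
  by_cases htau : S.tau (k 0) = S.tau (h 0)
  · exact hμ.connected_of_tau_eq hne hh hk hhk h0 k0 hμh hμk hμhk ht1 ht2 ht3 ht4 ht5 ht6 c0 ck chk
      htau x y
  -- If the colours disagree, rotating the second hexagon by three corners makes them agree. Both
  -- states are symmetric under this rotation, which exchanges the gaps `0` and `3`.
  · have v3 := (hμ.tau_hex hne hk.inj k0 hμk).2.2.1
    have eB : ∀ a, hexBefore (a + 3) = hexBefore a + 3 := by decide
    have eA : ∀ a, hexAfter (a + 3) = hexAfter a + 3 := by decide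
    have e33 : ∀ a : Fin 6, a + 3 + 3 = a := by decide
    have hk' : S.IsHex t'.rotate fun i => k (i + 3) :=
      ⟨hk.inj.comp (add_left_injective 3), fun a b => hk.left _ _, fun a => hk.up _⟩
    have er : rewire (fun i => k (i + 3)) hexAfter μ = rewire k hexAfter μ := by
      funext x
      by_cases hx : ∃ i, k i = x
      · obtain ⟨i, rfl⟩ := hx
        have := rewire_apply hexAfter μ hk'.inj (i + 3)
        rw [e33] at this
        rw [this, rewire_apply _ _ hk.inj, eA, e33]
      · rw [rewire_of_notMem _ _ (fun i hi => hx ⟨_, hi⟩),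
          rewire_of_notMem _ _ (fun i hi => hx ⟨_, hi⟩)]
    rw [← er] at hμk hμhk ck chk
    refine hμ.connected_of_tau_eq hne hh hk' (fun i j => hhk _ _) h0 (fun i => ?_) hμh hμk hμhk ht1
      ht2 ht3 ht4 (.rotate eB ht6) (.rotate eB ht5) c0 ck chk ?_ x y
    · rw [k0, eB]
    · change S.tau (k 3) = _
      rw [v3]
      have : ∀ a b : ZMod 2, a ≠ b → a + 1 = b := by decide
      exact this _ _ htau

end TwoHexagons

end Darts

/-! ### Numbering of rays, behaviour far away and rotation of cup diagrams. -/

theorem Int.eq_add_of_strictMono {g : ℤ → ℤ} (hg : StrictMono g) (hs : Function.Surjective g) (n : ℤ) :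
    g n = n + g 0 := by
  have h1 : ∀ n, g (n + 1) = g n + 1 := by
    intro n
    obtain ⟨a, ha⟩ := hs (g n + 1)
    have h2 : n < a := hg.lt_iff_lt.1 (by omega)
    have h3 : a ≤ n + 1 := by
      by_contra hc
      have := hg (show n + 1 < a by omega)
      have := hg (show n < n + 1 by omega)
      omega
    rw [show n + 1 = a by omega, ha]
  induction n with
  | zero => simp
  | succ n ih => rw [h1, ih]; ring
  | pred n ih =>
    have := h1 (-n - 1)
    rw [sub_add_cancel] at this
    omega

namespace CupDiagram

variable (σ : CupDiagram)

theorem mate_injective : Function.Injective σ.mate := fun x y h => by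
  rw [← σ.mate_mate x, h, σ.mate_mate]

/-- The rays of a cup diagram are numbered from left to right; those that are redrawn to the left
have the negative numbers. -/
noncomputable def idx (x : ℤ) : ℤ := x - σ.numCupEndsBefore x + σ.numCups + 1

theorem rayPos_eq (x : ℤ) :
    σ.rayPos x = if σ.idx x < 0 then σ.idx x - σ.numCups - 1 else σ.idx x + σ.numCups - 1 := by
  unfold rayPos idx
  split_ifs <;> omega

theorem bottomLeft_iff (x : ℤ) : σ.BottomLeft x ↔ σ.idx x < 0 := by
  unfold BottomLeft
  rw [rayPos_eq]
  split_ifs <;> omega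

theorem topLeft_iff (x : ℤ) : σ.TopLeft x ↔ σ.idx (x - 1) < 0 := by
  rw [← bottomLeft_iff]
  unfold TopLeft BottomLeft
  omega

theorem idx_lt {x y : ℤ} (hx : σ.mate x = x) (hy : σ.mate y = y) (h : x < y) : σ.idx x < σ.idx y := by
  have := σ.rayPos_spec.1 hx hy h
  rw [rayPos_eq, rayPos_eq] at this
  split_ifs at this <;> omega

theorem exists_idx (n : ℤ) : ∃ x, σ.mate x = x ∧ σ.idx x = n := by
  have h : (if n < 0 then n - σ.numCups - 1 else n + σ.numCups - 1) ∈
      σ.rayPos '' {x | σ.mate x = x} := by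
    rw [σ.rayPos_spec.2.1, Set.mem_ofPred_eq]
    split_ifs <;> omega
  obtain ⟨x, hx, hx'⟩ := h
  refine ⟨x, hx, ?_⟩
  rw [rayPos_eq] at hx'
  split_ifs at hx' <;> omega

/-- The position of the ray with number `n`. -/
noncomputable def ray (n : ℤ) : ℤ := (σ.exists_idx n).choose

theorem mate_ray (n : ℤ) : σ.mate (σ.ray n) = σ.ray n := (σ.exists_idx n).choose_spec.1

theorem idx_ray (n : ℤ) : σ.idx (σ.ray n) = n := (σ.exists_idx n).choose_spec.2

theorem idx_lt_iff {x y : ℤ} (hx : σ.mate x = x) (hy : σ.mate y = y) :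
    σ.idx x < σ.idx y ↔ x < y := by
  constructor
  · intro h
    by_contra hc
    rcases (not_lt.1 hc).lt_or_eq with h1 | h1
    · have := σ.idx_lt hy hx h1
      omega
    · rw [h1] at h
      omega
  · exact σ.idx_lt hx hy

theorem ray_idx {x : ℤ} (hx : σ.mate x = x) : σ.ray (σ.idx x) = x := by
  have h1 := σ.idx_lt_iff hx (σ.mate_ray (σ.idx x))
  have h2 := σ.idx_lt_iff (σ.mate_ray (σ.idx x)) hx
  rw [idx_ray] at h1 h2
  omega

theorem ray_strictMono : StrictMono σ.ray := fun a b h => by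
  rw [← σ.idx_lt_iff (σ.mate_ray a) (σ.mate_ray b), idx_ray, idx_ray]
  exact h

/-- The ray number `n` of the cap diagram sits at `σ.ray n + 1`, and the first free endpoint from
there on is the next ray of the cup diagram. This is where the shift by one in every section comes
from. -/
theorem isRay_iff (x y : ℤ) : σ.IsRay x y ↔ ∃ n, x = σ.ray n + 1 ∧ y = σ.ray (n + 1) := by
  have hs := σ.ray_strictMono
  constructor
  · rintro ⟨h1, h2, h3, h4⟩
    have h1' : σ.mate (x - 1) = x - 1 := by
      unfold capMate at h1
      omega
    refine ⟨σ.idx (x - 1), by rw [σ.ray_idx h1']; omega, ?_⟩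
    have h5 := σ.idx_lt h1' h2 (by omega)
    by_contra hc
    have h6 : σ.ray (σ.idx (x - 1) + 1) < y := by
      have : σ.ray (σ.idx (x - 1) + 1) ≤ σ.ray (σ.idx y) := hs.monotone (by omega)
      rw [σ.ray_idx h2] at this
      omega
    have h7 : x - 1 < σ.ray (σ.idx (x - 1) + 1) := by
      have := hs (show σ.idx (x - 1) < σ.idx (x - 1) + 1 by omega)
      rwa [σ.ray_idx h1'] at this
    exact h4 _ (by omega) h6 (σ.mate_ray _)
  · rintro ⟨n, rfl, rfl⟩
    have h1 : σ.ray n < σ.ray (n + 1) := hs (by omega)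
    refine ⟨by simp [capMate, mate_ray], σ.mate_ray _, by omega, fun z hz hz' hm => ?_⟩
    have h2 := σ.idx_lt (σ.mate_ray n) hm (by omega)
    have h3 := σ.idx_lt hm (σ.mate_ray _) hz'
    rw [idx_ray] at h2 h3
    omega

/-- Rays are not below cups. -/
theorem lt_iff_of_ray {r d : ℤ} (hr : σ.mate r = r) (hd : σ.mate d ≠ d) : r < d ↔ r < σ.mate d := by
  have h1 := σ.nested d r
  have h2 := σ.nested (σ.mate d) r
  rw [σ.mate_mate] at h2
  have h3 : r ≠ d := by
    rintro rfl
    exact hd hr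
  have h4 : r ≠ σ.mate d := by
    rintro rfl
    rw [σ.mate_mate] at hr
    exact hd hr.symm
  grind

/-- The cups do not cross. -/
theorem crossing_free {d e : ℤ} (h : e ≠ d) (h' : e ≠ σ.mate d) :
    ((e < d ↔ e < σ.mate d) ↔ (σ.mate e < d ↔ σ.mate e < σ.mate d)) := by
  have h1 := σ.nested d e
  have h2 := σ.nested (σ.mate d) e
  have h3 := σ.nested d (σ.mate e)
  have h4 := σ.nested (σ.mate d) (σ.mate e)
  have h5 : σ.mate e ≠ σ.mate d := fun h'' => h (σ.mate_injective h'')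
  have h6 : σ.mate e ≠ d := fun h'' => h' (by rw [← h'', σ.mate_mate])
  rw [σ.mate_mate] at h2 h3 h4
  rw [σ.mate_mate] at h4
  grind

/-- Outside of the interval from `1 - M` to `M - 1` there are only rays, and they are not redrawn. -/
def Far (M : ℤ) : Prop :=
  ∀ c, (M - 1 ≤ c → σ.mate c = c ∧ σ.idx c = c - σ.numCups + 1) ∧
    (c ≤ 1 - M → σ.mate c = c ∧ σ.idx c = c + σ.numCups + 1)

theorem exists_far : ∃ M₀, ∀ M, M₀ ≤ M → σ.Far M := by
  obtain ⟨B, hB⟩ := σ.finite_cups.bddAbove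
  obtain ⟨A, hA⟩ := σ.finite_cups.bddBelow
  obtain ⟨B', hB'⟩ := σ.rayPos_spec.2.2.bddAbove
  obtain ⟨A', hA'⟩ := σ.rayPos_spec.2.2.bddBelow
  refine ⟨max (max (max B B') (max (-A) (-A'))) 0 + σ.numCups + 5, fun M hM c => ⟨fun h => ?_, fun h => ?_⟩⟩
  · have h1 : σ.mate c = c := by
      by_contra hc
      have := hB hc
      omega
    have h2 : σ.rayPos c = c := by
      by_contra hc
      have := hB' ⟨h1, hc⟩
      have := hA' ⟨h1, hc⟩
      omega
    refine ⟨h1, ?_⟩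
    have h3 : 0 ≤ c := by
      by_contra hc
      omega
    rw [rayPos_eq] at h2
    split_ifs at h2 <;> omega
  · have h1 : σ.mate c = c := by
      by_contra hc
      have := hA hc
      omega
    have h2 : σ.rayPos c = c := by
      by_contra hc
      have := hA' ⟨h1, hc⟩
      have := hB' ⟨h1, hc⟩
      omega
    refine ⟨h1, ?_⟩
    rw [rayPos_eq] at h2
    split_ifs at h2 <;> omega

variable {σ}

theorem Far.ray_right {M n : ℤ} (h : σ.Far M) (hn : M - σ.numCups ≤ n) :
    σ.ray n = n + σ.numCups - 1 := by
  have h1 := (h (n + σ.numCups - 1)).1 (by omega)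
  have h2 := σ.ray_idx h1.1
  rw [h1.2] at h2
  rw [← h2]
  congr 1
  omega

theorem Far.ray_left {M n : ℤ} (h : σ.Far M) (hn : n ≤ 2 - M + σ.numCups) :
    σ.ray n = n - σ.numCups - 1 := by
  have h1 := (h (n - σ.numCups - 1)).2 (by omega)
  have h2 := σ.ray_idx h1.1
  rw [h1.2] at h2
  rw [← h2]
  congr 1
  omega

variable (σ)

/-- The cup diagram rotated by 180 degrees, as a cap diagram that is shifted back. -/
def rot : CupDiagram where
  mate x := -3 - σ.mate (-3 - x)
  mate_mate i := by
    have := σ.mate_mate (-3 - i)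
    rw [sub_sub_cancel, this, sub_sub_cancel]
  finite_cups := by
    refine (σ.finite_cups.image fun x => -3 - x).subset ?_
    intro i hi
    refine ⟨-3 - i, ?_, by ring⟩
    simp only [Set.mem_ofPred_eq] at hi ⊢
    omega
  nested i k hik hk := by
    have h1 := σ.nested (σ.mate (-3 - i)) (-3 - k)
    rw [σ.mate_mate] at h1
    have := h1 (by omega) (by omega)
    omega

theorem rot_mate (x : ℤ) : σ.rot.mate x = -3 - σ.mate (-3 - x) := rfl

theorem rot_rot : σ.rot.rot = σ := by
  ext x
  simp only [rot_mate]
  rw [sub_sub_cancel, sub_sub_cancel]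

/-- Reflection reverses the order of the rays, so numbers change by `n ↦ -1 - n` up to a constant.
The far right and the far left determine this constant as two opposite numbers, hence it is zero.
The constant `-3` in `rot` is chosen for this result. -/
theorem rot_idx {x : ℤ} (hx : σ.mate x = x) : σ.rot.idx (-3 - x) = -1 - σ.idx x := by
  have hm : ∀ n, σ.rot.mate (-3 - σ.ray n) = -3 - σ.ray n := fun n => by
    rw [rot_mate, sub_sub_cancel, mate_ray]
  obtain ⟨g, hg⟩ : ∃ g : ℤ → ℤ, g = fun n => -1 - σ.rot.idx (-3 - σ.ray n) := ⟨_, rfl⟩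
  have h1 : StrictMono g := by
    intro a b hab
    have := σ.rot.idx_lt (hm b) (hm a) (by have := σ.ray_strictMono hab; omega)
    rw [hg]
    dsimp only
    omega
  have h2 : Function.Surjective g := by
    intro n
    have h3 := σ.rot.mate_ray (-1 - n)
    rw [rot_mate] at h3
    refine ⟨σ.idx (-3 - σ.rot.ray (-1 - n)), ?_⟩
    rw [hg]
    dsimp only
    rw [σ.ray_idx (by omega), sub_sub_cancel, idx_ray]
    omega
  have h3 := Int.eq_add_of_strictMono h1 h2
  obtain ⟨A, hA⟩ := σ.exists_far
  obtain ⟨B, hB⟩ := σ.rot.exists_far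
  have a1 := hA _ (le_max_left A B)
  have b1 := hB _ (le_max_right A B)
  have h4 := h3 (max A B + σ.numCups + σ.rot.numCups + 10)
  have h5 := h3 (-max A B - σ.numCups - σ.rot.numCups - 10)
  rw [hg] at h4 h5
  dsimp only at h4 h5
  rw [a1.ray_right (by omega), ((b1 _).2 (by omega)).2] at h4
  rw [a1.ray_left (by omega), ((b1 _).1 (by omega)).2] at h5
  have h6 := h3 (σ.idx x)
  rw [hg] at h6
  dsimp only at h6
  rw [σ.ray_idx hx] at h6
  omega

theorem rot_ray (n : ℤ) : σ.rot.ray n = -3 - σ.ray (-1 - n) := by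
  have h1 := σ.rot_idx (σ.mate_ray (-1 - n))
  rw [idx_ray, sub_sub_cancel] at h1
  have h2 : σ.rot.mate (-3 - σ.ray (-1 - n)) = -3 - σ.ray (-1 - n) := by
    rw [rot_mate, sub_sub_cancel, mate_ray]
  rw [← σ.rot.ray_idx h2, h1]

theorem IsOutermost.rot {a : ℤ} (h : σ.IsOutermost a) : σ.rot.IsOutermost (-3 - σ.mate a) := by
  have h1 := h.1
  constructor
  · rw [rot_mate, sub_sub_cancel, σ.mate_mate]
    omega
  · intro i hi
    rw [rot_mate]
    have h2 := σ.mate_mate (-3 - i)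
    have h3 := h.2 (-3 - i)
    have h4 := h.2 (σ.mate (-3 - i))
    have h5 := σ.nested a (σ.mate (-3 - i))
    have h6 := σ.mate_mate a
    have h7 : σ.mate (-3 - i) ≠ a := fun hc => by
      rw [← hc, h2] at hi
      omega
    have h8 : σ.mate (-3 - i) ≠ σ.mate a := fun hc => by
      have := σ.mate_injective hc
      rw [← hc] at hi
      omega
    rw [h2] at h4 h5
    omega

theorem erase_mate {a : ℤ} (h : σ.IsOutermost a) (x : ℤ) :
    (σ.erase a).mate x = if x = a ∨ x = σ.mate a then x else σ.mate x := by
  classical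
  simp only [erase, h, dif_pos]

theorem rot_erase {a : ℤ} (h : σ.IsOutermost a) :
    (σ.erase a).rot = σ.rot.erase (-3 - σ.mate a) := by
  ext x
  rw [σ.rot.erase_mate (h.rot), rot_mate, σ.erase_mate h, rot_mate, rot_mate, sub_sub_cancel,
    σ.mate_mate]
  have e1 : (-3 - x = a ∨ -3 - x = σ.mate a) ↔ (x = -3 - σ.mate a ∨ x = -3 - a) := by omega
  simp only [e1]
  split_ifs <;> omega

end CupDiagram

/-! ### The darts of a stacked diagram and its planarity. -/

/-- Half a point of a stacked diagram: `(j, true, c)` is the upper half of the point `c + 1` on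
the `j`-th line, `(j, false, c)` the lower half of the point `c`. -/
abbrev Dart := ℕ × Bool × ℤ

namespace Dart

def flip (d : Dart) : Dart := (d.1, !d.2.1, if d.2.1 then d.2.2 + 1 else d.2.2 - 1)

def Lt (d e : Dart) : Prop := d.1 = e.1 ∧ d.2.1 = e.2.1 ∧ d.2.2 < e.2.2

/-- The position of the point on its line. -/
def pos (d : Dart) : ℤ := if d.2.1 then d.2.2 + 1 else d.2.2

/-- The number of the diagram the dart points to. -/
def zone (d : Dart) : ℕ := d.1 + d.2.1.toNat

theorem flip_flip (d : Dart) : d.flip.flip = d := by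
  rcases d with ⟨j, u, c⟩
  cases u <;> simp [flip]

theorem flip_pos (d : Dart) : d.flip.pos = d.pos := by
  rcases d with ⟨j, u, c⟩
  cases u <;> simp [flip, pos]

open Classical in
/-- The positions of the darts of a stacked diagram. -/
noncomputable def darts : Darts Dart where
  flip := flip
  flip_flip := flip_flip
  left d e := if d.Lt e then 1 else 0
  left_flip d e := by
    have : d.flip.Lt e.flip ↔ d.Lt e := by
      rcases d with ⟨j, u, c⟩
      rcases e with ⟨j', u', c'⟩
      unfold Lt flip
      cases u <;> cases u' <;> simp
    simp only [this]
  left_self d := by simp [Lt]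
  up d := if d.2.1 then 1 else 0
  up_flip d := by
    rcases d with ⟨j, u, c⟩
    cases u
    · simp [flip]
    · simp only [flip]
      decide

theorem darts_flip : darts.flip = flip := rfl

open Classical in
theorem darts_left (d e : Dart) : darts.left d e = if d.Lt e then 1 else 0 := rfl

theorem darts_up (d : Dart) : darts.up d = if d.2.1 then 1 else 0 := rfl

theorem left_add_left {a b c d : Dart} : darts.left a b + darts.left c d = 0 ↔ (a.Lt b ↔ c.Lt d) := by
  simp only [darts_left]
  by_cases h1 : a.Lt b <;> by_cases h2 : c.Lt d <;> simp [h1, h2]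
  decide

theorem sum_left {a b c d e f g h : Dart} : darts.left a b + darts.left c d + darts.left e f +
    darts.left g h = 0 ↔ ((a.Lt b ↔ c.Lt d) ↔ (e.Lt f ↔ g.Lt h)) := by
  simp only [darts_left]
  by_cases h1 : a.Lt b <;> by_cases h2 : c.Lt d <;> by_cases h3 : e.Lt f <;>
    by_cases h4 : g.Lt h <;> simp [h1, h2, h3, h4] <;> decide

end Dart

/-- A noncrossing matching of some integers, such that the other integers are not below arcs. -/
structure NonCrossing (κ : ℤ → ℤ) : Prop where
  invol : ∀ n, κ (κ n) = n
  nc : ∀ a b, b ≠ a → b ≠ κ a → ((b < a ↔ b < κ a) ↔ (κ b < a ↔ κ b < κ a))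
  fix : ∀ a b, κ a ≠ a → κ b = b → (b < a ↔ b < κ a)

theorem NonCrossing.id : NonCrossing fun n => n :=
  ⟨fun _ => rfl, fun _ _ _ _ => by simp, fun _ _ h => absurd rfl h⟩

/-- The arcs are concentric, and oddness of `s` excludes a fixed point in their centre, which would
be a ray below an arc. -/
theorem NonCrossing.const_sub (s : ℤ) (hs : Odd s) : NonCrossing fun n => s - n := by
  obtain ⟨r, rfl⟩ := hs
  exact ⟨fun _ => by ring, fun _ _ _ _ => by omega, fun _ _ _ _ => by omega⟩

/-- How the rays of the diagrams in a stack are joined; here the integers are the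
numbers of the rays. The rays at the bottom and at the top are joined by `κ` and `κ'`. -/
def joinRays (m : ℕ) (κ κ' : ℤ → ℤ) (d : Dart) : Dart :=
  if d.2.1 then
    if d.1 < m then (d.1 + 1, false, d.2.2 + 1)
    else if d.1 = m then (d.1, true, κ' d.2.2) else d
  else if d.1 = 0 then (d.1, false, κ d.2.2)
  else if d.1 ≤ m then (d.1 - 1, true, d.2.2 - 1) else d

section JoinRays

variable {m : ℕ} {κ κ' : ℤ → ℤ}

/-- Seen from one boundary of a section there are only two possibilities: a noncrossing matching of
this boundary with itself, or a translation onto the facing boundary. Planarity is checked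
separately for these two. -/
theorem joinRays_cases (hκ : NonCrossing κ) (hκ' : NonCrossing κ') (m j : ℕ) (u : Bool) :
    (∃ f, NonCrossing f ∧ ∀ n, joinRays m κ κ' (j, u, n) = (j, u, f n)) ∨
      ∃ j' s, ∀ n, joinRays m κ κ' (j, u, n) = (j', !u, n + s) ∧
        joinRays m κ κ' (j', !u, n) = (j, u, n - s) := by
  unfold joinRays
  cases u
  · by_cases h0 : j = 0
    · exact Or.inl ⟨κ, hκ, fun n => by simp [h0]⟩
    · by_cases h1 : j ≤ m
      · refine Or.inr ⟨j - 1, -1, fun n => ?_⟩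
        have : j - 1 < m := by omega
        have h2 : j - 1 + 1 = j := by omega
        simp [h0, h1, this, h2]
        ring
      · exact Or.inl ⟨_, .id, fun n => by simp [h0, h1]⟩
  · by_cases h0 : j < m
    · exact Or.inr ⟨j + 1, 1, fun n => by simp [h0]⟩
    · by_cases h1 : j = m
      · exact Or.inl ⟨κ', hκ', fun n => by simp [h1]⟩
      · exact Or.inl ⟨_, .id, fun n => by simp [h0, h1]⟩

theorem zone_joinRays (m : ℕ) (κ κ' : ℤ → ℤ) (d : Dart) : (joinRays m κ κ' d).zone = d.zone := by
  rcases d with ⟨j, u, n⟩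
  unfold joinRays Dart.zone
  cases u
  · by_cases h0 : j = 0
    · simp [h0]
    · by_cases h1 : j ≤ m
      · simp [h0, h1]
        omega
      · simp [h0, h1]
  · by_cases h0 : j < m
    · simp [h0]
    · by_cases h1 : j = m <;> simp [h0, h1]

theorem joinRays_le {d : Dart} : (joinRays m κ κ' d).1 ≤ m ↔ d.1 ≤ m := by
  rcases d with ⟨j, u, n⟩
  unfold joinRays
  dsimp only
  split_ifs <;> dsimp only <;> omega

/-- On one boundary planarity is that of the noncrossing matching. Between facing boundaries it
holds because translations preserve the order. -/
theorem joinRays_planar (hκ : NonCrossing κ) (hκ' : NonCrossing κ') (m : ℕ) :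
    Dart.darts.Planar (joinRays m κ κ') := by
  have invol : Function.Involutive (joinRays m κ κ') := by
    rintro ⟨j, u, n⟩
    rcases joinRays_cases hκ hκ' m j u with ⟨f, hf, h⟩ | ⟨j', s, h⟩
    · rw [h, h, hf.invol]
    · rw [(h n).1, (h _).2, add_sub_cancel_right]
  have fix : ∀ d e, joinRays m κ κ' d ≠ d → joinRays m κ κ' e = e →
      (e.Lt d ↔ e.Lt (joinRays m κ κ' d)) ∧ (d.Lt e ↔ (joinRays m κ κ' d).Lt e) := by
    rintro ⟨j, u, n⟩ ⟨i, v, l⟩ hd he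
    rcases joinRays_cases hκ hκ' m j u with ⟨f, hf, h⟩ | ⟨j', s, h⟩
    · by_cases hc : i = j ∧ v = u
      · obtain ⟨rfl, rfl⟩ := hc
        rw [h] at hd he ⊢
        simp only [ne_eq, Prod.mk.injEq, true_and] at hd he
        have := hf.fix n l hd he
        have h1 : l ≠ n := by
          rintro rfl
          exact hd he
        have h2 : l ≠ f n := by
          rintro rfl
          rw [hf.invol] at he
          exact hd he.symm
        simp only [Dart.Lt, true_and]
        omega
      · rw [h]
        simp only [Dart.Lt]
        tauto
    · have hc : ¬ (i = j ∧ v = u) := by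
        rintro ⟨rfl, rfl⟩
        rw [(h l).1] at he
        simp at he
      have hc' : ¬ (i = j' ∧ v = !u) := by
        rintro ⟨rfl, rfl⟩
        rw [(h l).2] at he
        simp at he
      rw [(h n).1]
      simp only [Dart.Lt]
      tauto
  refine ⟨invol, ?_, fun d e hd he => Dart.left_add_left.2 (fix d e hd he).1,
    fun d e hd he => Dart.left_add_left.2 (fix e d he hd).2, ?_⟩
  · rintro ⟨j, u, n⟩ ⟨i, v, l⟩ - - h1 h2
    rw [Dart.sum_left]
    rcases joinRays_cases hκ hκ' m j u with ⟨f, hf, h⟩ | ⟨j', s, h⟩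
    · by_cases hc : i = j ∧ v = u
      · obtain ⟨rfl, rfl⟩ := hc
        rw [h] at h2 ⊢
        simp only [ne_eq, Prod.mk.injEq, true_and] at h1 h2
        rw [h]
        simp only [Dart.Lt, true_and]
        exact hf.nc n l h1 h2
      · have hc' : ¬ ((joinRays m κ κ' (i, v, l)).1 = j ∧ (joinRays m κ κ' (i, v, l)).2.1 = u) := by
          rintro ⟨e1, e2⟩
          have := invol (i, v, l)
          rw [← Prod.mk.eta (p := joinRays m κ κ' (i, v, l)),
            ← Prod.mk.eta (p := (joinRays m κ κ' (i, v, l)).2), e1, e2, h] at this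
          simp only [Prod.mk.injEq] at this
          exact hc ⟨this.1.symm, this.2.1.symm⟩
        rw [h]
        simp only [Dart.Lt]
        tauto
    · by_cases hc : i = j ∧ v = u
      · obtain ⟨rfl, rfl⟩ := hc
        rw [(h n).1, (h l).1]
        simp [Dart.Lt]
      · by_cases hc2 : i = j' ∧ v = !u
        · obtain ⟨rfl, rfl⟩ := hc2
          rw [(h n).1, (h l).2]
          simp [Dart.Lt]
          omega
        · have hc' : ¬ ((joinRays m κ κ' (i, v, l)).1 = j ∧
              (joinRays m κ κ' (i, v, l)).2.1 = u) := by
            rintro ⟨e1, e2⟩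
            have := invol (i, v, l)
            rw [← Prod.mk.eta (p := joinRays m κ κ' (i, v, l)),
              ← Prod.mk.eta (p := (joinRays m κ κ' (i, v, l)).2), e1, e2, (h _).1] at this
            simp only [Prod.mk.injEq] at this
            exact hc2 ⟨this.1.symm, this.2.1.symm⟩
          have hc2' : ¬ ((joinRays m κ κ' (i, v, l)).1 = j' ∧
              (joinRays m κ κ' (i, v, l)).2.1 = !u) := by
            rintro ⟨e1, e2⟩
            have := invol (i, v, l)
            rw [← Prod.mk.eta (p := joinRays m κ κ' (i, v, l)),
              ← Prod.mk.eta (p := (joinRays m κ κ' (i, v, l)).2), e1, e2, (h _).2] at this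
            simp only [Prod.mk.injEq] at this
            exact hc ⟨this.1.symm, this.2.1.symm⟩
          rw [(h n).1]
          simp only [Dart.Lt]
          tauto
  · rintro ⟨j, u, n⟩ hd
    simp only [Dart.darts_left, Dart.darts_up]
    rcases joinRays_cases hκ hκ' m j u with ⟨f, hf, h⟩ | ⟨j', s, h⟩
    · rw [h] at hd ⊢
      simp only [ne_eq, Prod.mk.injEq, true_and] at hd
      simp only [Dart.Lt, true_and]
      rcases lt_or_gt_of_ne hd with h1 | h1 <;> cases u <;> simp [h1, h1.not_gt] <;> decide
    · rw [(h n).1]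
      cases u <;> simp [Dart.Lt] <;> decide

end JoinRays

namespace StackedDiagram

variable (E : StackedDiagram)

/-- The cup diagrams in the stack. -/
def sec (z : ℕ) : CupDiagram := (E.bottom :: (E.middle ++ [E.top])).getD z E.bottom

theorem sec_succ {j : ℕ} {σ : CupDiagram} (h : E.middle[j]? = some σ) : E.sec (j + 1) = σ := by
  have hj : j < E.middle.length := by
    by_contra hc
    rw [List.getElem?_eq_none (by omega)] at h
    simp at h
  simp only [sec, List.getD_eq_getElem?_getD, List.getElem?_cons_succ]
  rw [List.getElem?_append_left hj, h]
  rfl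

theorem sec_last : E.sec (E.middle.length + 1) = E.top := by
  simp [sec, List.getD_eq_getElem?_getD]

/-- The ray that has the number `d.2.2`. -/
noncomputable def rayDart (d : Dart) : Dart := (d.1, d.2.1, (E.sec d.zone).ray d.2.2)

/-- The other end of the arc at a dart, if rays at the bottom and the top are joined
by `κ` and `κ'`. -/
noncomputable def arcs (κ κ' : ℤ → ℤ) (d : Dart) : Dart :=
  if (E.sec d.zone).mate d.2.2 ≠ d.2.2 then (d.1, d.2.1, (E.sec d.zone).mate d.2.2)
  else E.rayDart (joinRays E.middle.length κ κ' (d.1, d.2.1, (E.sec d.zone).idx d.2.2))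

variable {E} {κ κ' : ℤ → ℤ}

theorem rayDart_zone (d : Dart) : (E.rayDart d).zone = d.zone := rfl

theorem arcs_cup {d : Dart} (h : (E.sec d.zone).mate d.2.2 ≠ d.2.2) :
    E.arcs κ κ' d = (d.1, d.2.1, (E.sec d.zone).mate d.2.2) := if_pos h

theorem mate_rayDart (d : Dart) :
    (E.sec (E.rayDart d).zone).mate (E.rayDart d).2.2 = (E.rayDart d).2.2 := by
  rw [rayDart_zone]
  exact CupDiagram.mate_ray _ _

theorem arcs_rayDart (d : Dart) :
    E.arcs κ κ' (E.rayDart d) = E.rayDart (joinRays E.middle.length κ κ' d) := by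
  rw [arcs, if_neg (by rw [mate_rayDart]; simp), rayDart_zone]
  simp only [rayDart, CupDiagram.idx_ray]

theorem exists_rayDart {d : Dart} (h : (E.sec d.zone).mate d.2.2 = d.2.2) :
    ∃ e, E.rayDart e = d :=
  ⟨(d.1, d.2.1, (E.sec d.zone).idx d.2.2), by
    change (d.1, d.2.1, (E.sec d.zone).ray ((E.sec d.zone).idx d.2.2)) = d
    rw [CupDiagram.ray_idx _ h]⟩

theorem rayDart_lt {d e : Dart} : (E.rayDart d).Lt (E.rayDart e) ↔ d.Lt e := by
  unfold Dart.Lt rayDart Dart.zone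
  dsimp only
  constructor
  · rintro ⟨h1, h2, h3⟩
    rw [h1, h2] at h3
    exact ⟨h1, h2, (CupDiagram.ray_strictMono _).lt_iff_lt.1 h3⟩
  · rintro ⟨h1, h2, h3⟩
    rw [h1, h2]
    exact ⟨rfl, rfl, (CupDiagram.ray_strictMono _).lt_iff_lt.2 h3⟩

theorem rayDart_left (d e : Dart) :
    Dart.darts.left (E.rayDart d) (E.rayDart e) = Dart.darts.left d e := by
  rw [Dart.darts_left, Dart.darts_left]
  by_cases h : d.Lt e
  · rw [if_pos h, if_pos (rayDart_lt.2 h)]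
  · rw [if_neg h, if_neg fun h' => h (rayDart_lt.1 h')]

theorem rayDart_injective : Function.Injective E.rayDart := by
  rintro ⟨j, u, n⟩ ⟨i, v, l⟩ h
  simp only [rayDart, Dart.zone, Prod.mk.injEq] at h
  obtain ⟨rfl, rfl, h⟩ := h
  rw [(CupDiagram.ray_strictMono _).injective h]

-- Pairs of cups do not cross by `crossing_free`; a ray never starts below a cup, so a ray and a cup
-- do not interact; and pairs of rays are compared through their numbers, where planarity is
-- `joinRays_planar`.
set_option maxHeartbeats 1000000 in
theorem arcs_planar (hκ : NonCrossing κ) (hκ' : NonCrossing κ') : Dart.darts.Planar (E.arcs κ κ') := by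
  have hK := joinRays_planar hκ hκ' E.middle.length
  -- cups
  have cupzone : ∀ d c, (Dart.zone (d.1, d.2.1, c)) = Dart.zone d := fun _ _ => rfl
  have cuparc : ∀ d : Dart, (E.sec d.zone).mate d.2.2 ≠ d.2.2 →
      (E.sec (E.arcs κ κ' d).zone).mate (E.arcs κ κ' d).2.2 ≠ (E.arcs κ κ' d).2.2 := by
    intro d hd
    rw [arcs_cup hd, cupzone]
    dsimp only
    rw [CupDiagram.mate_mate]
    exact hd.symm
  have rayarc : ∀ d : Dart, (E.sec d.zone).mate d.2.2 = d.2.2 →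
      (E.sec (E.arcs κ κ' d).zone).mate (E.arcs κ κ' d).2.2 = (E.arcs κ κ' d).2.2 := by
    intro d hd
    obtain ⟨d, rfl⟩ := exists_rayDart hd
    rw [arcs_rayDart]
    exact mate_rayDart _
  have cupray : ∀ d e : Dart, (E.sec d.zone).mate d.2.2 ≠ d.2.2 →
      (E.sec e.zone).mate e.2.2 = e.2.2 →
      (e.Lt d ↔ e.Lt (E.arcs κ κ' d)) ∧ (d.Lt e ↔ (E.arcs κ κ' d).Lt e) := by
    rintro ⟨j, u, c⟩ ⟨j', u', c'⟩ hd he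
    rw [arcs_cup hd]
    unfold Dart.Lt
    dsimp only at hd he ⊢
    by_cases hc : j = j' ∧ u = u'
    · obtain ⟨rfl, rfl⟩ := hc
      simp only [true_and, Dart.zone] at hd he ⊢
      have := CupDiagram.lt_iff_of_ray _ he hd
      have h3 : c' ≠ c := by
        rintro rfl
        exact hd he
      have h4 : c' ≠ (E.sec (j + u.toNat)).mate c := by
        rintro rfl
        rw [CupDiagram.mate_mate] at he
        exact hd he.symm
      omega
    · have hc' : ¬ (j' = j ∧ u' = u) := fun h => hc ⟨h.1.symm, h.2.symm⟩
      constructor <;> tauto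
  have invol : Function.Involutive (E.arcs κ κ') := by
    intro d
    by_cases hd : (E.sec d.zone).mate d.2.2 = d.2.2
    · obtain ⟨d, rfl⟩ := exists_rayDart hd
      rw [arcs_rayDart, arcs_rayDart, hK.invol]
    · rw [arcs_cup (cuparc d hd), arcs_cup hd]
      change (d.1, d.2.1, (E.sec d.zone).mate ((E.sec d.zone).mate d.2.2)) = d
      rw [CupDiagram.mate_mate]
  have raycup_nc : ∀ d e : Dart, (E.sec d.zone).mate d.2.2 ≠ d.2.2 →
      (E.sec e.zone).mate e.2.2 = e.2.2 →
      ((e.Lt d ↔ e.Lt (E.arcs κ κ' d)) ↔ ((E.arcs κ κ' e).Lt d ↔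
        (E.arcs κ κ' e).Lt (E.arcs κ κ' d))) ∧
      ((d.Lt e ↔ d.Lt (E.arcs κ κ' e)) ↔ ((E.arcs κ κ' d).Lt e ↔
        (E.arcs κ κ' d).Lt (E.arcs κ κ' e))) := by
    intro d e hd he
    have h1 := cupray d e hd he
    have h2 := cupray d _ hd (rayarc e he)
    tauto
  refine ⟨invol, ?_, ?_, ?_, ?_⟩
  · intro d e hd he hed hed'
    rw [Dart.sum_left]
    by_cases h1 : (E.sec d.zone).mate d.2.2 = d.2.2
    · by_cases h2 : (E.sec e.zone).mate e.2.2 = e.2.2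
      · obtain ⟨d, rfl⟩ := exists_rayDart h1
        obtain ⟨e, rfl⟩ := exists_rayDart h2
        rw [arcs_rayDart] at hd he hed' ⊢
        rw [arcs_rayDart, rayDart_lt, rayDart_lt, rayDart_lt, rayDart_lt, ← Dart.sum_left]
        exact hK.nc _ _ (fun h => hd (by rw [h])) (fun h => he (by rw [h]))
          (fun h => hed (by rw [h])) (fun h => hed' (by rw [h]))
      · exact (raycup_nc e d h2 h1).2
    · by_cases h2 : (E.sec e.zone).mate e.2.2 = e.2.2
      · exact (raycup_nc d e h1 h2).1
      · rw [arcs_cup h1] at hed' ⊢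
        rw [arcs_cup h2]
        rcases d with ⟨j, u, c⟩
        rcases e with ⟨j', u', c'⟩
        unfold Dart.Lt
        dsimp only at h1 h2 hed' ⊢
        by_cases hc : j = j' ∧ u = u'
        · obtain ⟨rfl, rfl⟩ := hc
          simp only [true_and, Dart.zone, ne_eq, Prod.mk.injEq] at hed hed' ⊢
          exact CupDiagram.crossing_free _ hed hed'
        · have hc' : ¬ (j' = j ∧ u' = u) := fun h => hc ⟨h.1.symm, h.2.symm⟩
          constructor <;> tauto
  · intro d e hd he
    rw [Dart.left_add_left]
    by_cases h2 : (E.sec e.zone).mate e.2.2 = e.2.2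
    · by_cases h1 : (E.sec d.zone).mate d.2.2 = d.2.2
      · obtain ⟨d, rfl⟩ := exists_rayDart h1
        obtain ⟨e, rfl⟩ := exists_rayDart h2
        rw [arcs_rayDart] at hd he ⊢
        rw [rayDart_lt, rayDart_lt, ← Dart.left_add_left]
        exact hK.nc_left _ _ (fun h => hd (by rw [h])) (rayDart_injective he)
      · exact (cupray d e h1 h2).1
    · exact absurd he (by
        rw [arcs_cup h2]
        intro h
        exact h2 (congrArg (fun x : Dart => x.2.2) h))
  · intro e d he hd
    rw [Dart.left_add_left]
    by_cases h2 : (E.sec e.zone).mate e.2.2 = e.2.2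
    · by_cases h1 : (E.sec d.zone).mate d.2.2 = d.2.2
      · obtain ⟨d, rfl⟩ := exists_rayDart h1
        obtain ⟨e, rfl⟩ := exists_rayDart h2
        rw [arcs_rayDart] at hd he ⊢
        rw [rayDart_lt, rayDart_lt, ← Dart.left_add_left]
        exact hK.nc_right _ _ (rayDart_injective he) (fun h => hd (by rw [h]))
      · exact (cupray d e h1 h2).2
    · exact absurd he (by
        rw [arcs_cup h2]
        intro h
        exact h2 (congrArg (fun x : Dart => x.2.2) h))
  · intro d hd
    by_cases h1 : (E.sec d.zone).mate d.2.2 = d.2.2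
    · obtain ⟨d, rfl⟩ := exists_rayDart h1
      rw [arcs_rayDart] at hd ⊢
      have := hK.turn d (fun h => hd (by rw [h]))
      rw [rayDart_left, rayDart_left]
      exact this
    · rw [arcs_cup h1]
      simp only [Dart.darts_left, Dart.darts_up, Dart.Lt, true_and]
      rcases lt_or_gt_of_ne h1 with h2 | h2 <;> cases d.2.1 <;> simp [h2, h2.not_gt] <;> decide

end StackedDiagram

/-! ### Ends of lines, and passage to finite subdiagrams. -/

namespace Darts

section Ends

variable {A : Type*} [Fintype A] [DecidableEq A] {S : Darts A}

/-- The number of points of the line from `x` to `y` to the left of a point is constant, modulo two,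
along a different line. At an end of that line, the interior points of the first line contribute in
pairs, and only `x` and `y` remain. -/
theorem Planar.ends_nc_of_fintype {μ : A → A} (hμ : S.Planar μ) {x y z w : A} (hx : μ x = x)
    (hy : μ y = y) (hz : μ z = z) (hw : μ w = w) (hxy : Link S.flip μ x y) (hne : y ≠ x)
    (hzw : Link S.flip μ z w) (hxz : ¬ Link S.flip μ x z) :
    S.left x z + S.left y z = S.left x w + S.left y w := by
  classical
  obtain ⟨X, hX⟩ : ∃ X : Finset A, X = Finset.univ.filter fun v => Link S.flip μ x v := ⟨_, rfl⟩
  have memX : ∀ v, v ∈ X ↔ Link S.flip μ x v := fun v => by simp [hX]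
  have X1 : ∀ v ∈ X, S.flip v ∈ X := fun v hv => by
    rw [memX] at hv ⊢
    exact hv.trans (.left v)
  have X2 : ∀ v ∈ X, μ v ∈ X := fun v hv => by
    rw [memX] at hv ⊢
    exact hv.trans (.right v)
  have count_end : ∀ v, μ v = v → S.count X v = S.left x v + S.left y v := by
    intro v hv
    unfold count
    rw [← Finset.sum_filter_add_sum_filter_not X (fun e => μ e ≠ e)]
    have e1 : ∑ e ∈ X with μ e ≠ e, S.left e v = 0 := by
      refine sum_eq_zero_of_involutive hμ.invol ?_ ?_ ?_
      · intro e he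
        rw [Finset.mem_filter] at he ⊢
        refine ⟨X2 _ he.1, fun h => he.2 ?_⟩
        rw [hμ.invol] at h
        exact h.symm
      · intro e he
        rw [Finset.mem_filter] at he
        exact hμ.nc_right v e hv he.2
      · intro e he h
        rw [Finset.mem_filter] at he
        exact absurd h he.2
    have e2 : X.filter (fun e => ¬ μ e ≠ e) = {x, y} := by
      ext e
      simp only [Finset.mem_filter, memX, not_not, Finset.mem_insert, Finset.mem_singleton]
      constructor
      · rintro ⟨h1, h2⟩
        by_contra hc
        push Not at hc
        exact hc.2 (Link.eq_of_fixed S.flip_flip hμ.invol hx h2 hy h1 hxy hc.1 hne)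
      · rintro (rfl | rfl)
        · exact ⟨.refl _, hx⟩
        · exact ⟨hxy, hy⟩
    rw [e1, zero_add, e2, Finset.sum_pair hne.symm]
  rw [← count_end z hz, ← count_end w hw]
  have h1 : z ∉ X := fun h => hxz ((memX z).1 h)
  have h2 : w ∉ X := fun h => hxz (((memX w).1 h).trans hzw.symm)
  have key := Link.eq_of_invariant (p := fun d => if d ∈ X then 0 else S.count X d)
    (fun d => ?_) (fun d => ?_) hzw
  · simpa only [if_neg h1, if_neg h2] using key
  · have : S.flip d ∈ X ↔ d ∈ X := ⟨fun h => by simpa only [S.flip_flip d] using X1 _ h, X1 d⟩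
    simp only [this, S.count_flip X1]
  · have : μ d ∈ X ↔ d ∈ X := ⟨fun h => by simpa only [hμ.invol d] using X2 _ h, X2 d⟩
    by_cases hd : d ∈ X
    · simp only [this, if_pos hd]
    · simp only [this, if_neg hd]
      by_cases hdd : μ d = d
      · rw [hdd]
      · exact hμ.count_arc X2 hd hdd

end Ends

section Restrict

variable {A : Type*} (S : Darts A)

/-- Restrict to a set of points. -/
def restrict (W : Set A) (hW : ∀ x ∈ W, S.flip x ∈ W) : Darts W where
  flip x := ⟨S.flip x, hW x x.2⟩
  flip_flip x := Subtype.ext (S.flip_flip x)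
  left x y := S.left x y
  left_flip x y := S.left_flip x y
  left_self x := S.left_self x
  up x := S.up x
  up_flip x := S.up_flip x

end Restrict

end Darts

/-- Restrict a map to an invariant set. -/
def restr {A : Type*} {W : Set A} (f : A → A) (hf : ∀ x ∈ W, f x ∈ W) (x : W) : W := ⟨f x, hf x x.2⟩

theorem Link.restr_iff {A : Type*} {W : Set A} {f g : A → A} (hf' : Function.Involutive f)
    (hg' : Function.Involutive g) (hf : ∀ x ∈ W, f x ∈ W)
    (hg : ∀ x ∈ W, g x ∈ W) (x y : W) : Link (restr f hf) (restr g hg) x y ↔ Link f g x.1 y.1 := by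
  constructor
  · intro h
    exact Link.of_rel (r := fun x y : W => Link f g x.1 y.1) ⟨fun _ => .refl _, .symm, .trans⟩
      (fun x => .left x.1) (fun x => .right x.1) h
  · intro h
    refine (Link.of_rel (r := fun a b => (a ∈ W ↔ b ∈ W) ∧ ∀ ha hb,
      Link (restr f hf) (restr g hg) ⟨a, ha⟩ ⟨b, hb⟩) ⟨fun _ => ⟨Iff.rfl, fun _ _ => .refl _⟩,
      fun h => ⟨h.1.symm, fun ha hb => (h.2 hb ha).symm⟩, fun h h' => ⟨h.1.trans h'.1,
      fun ha hb => (h.2 ha (h.1.1 ha)).trans (h'.2 (h.1.1 ha) hb)⟩⟩ (fun a => ⟨⟨hf a, fun h => ?_⟩,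
      fun ha _ => .left (f := restr f hf) ⟨a, ha⟩⟩) (fun a => ⟨⟨hg a, fun h => ?_⟩,
      fun ha _ => .right (g := restr g hg) ⟨a, ha⟩⟩) h).2 x.2 y.2
    · have := hf _ h
      rwa [hf'] at this
    · have := hg _ h
      rwa [hg'] at this

theorem Link.mem_iff {A : Type*} {W : Set A} {f g : A → A} (hf' : Function.Involutive f)
    (hg' : Function.Involutive g) (hf : ∀ x ∈ W, f x ∈ W)
    (hg : ∀ x ∈ W, g x ∈ W) {x y : A} (h : Link f g x y) : x ∈ W ↔ y ∈ W := by
  refine Link.iff_of_invariant (p := fun a => a ∈ W) (fun a => ⟨fun h => ?_, hf a⟩)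
    (fun a => ⟨fun h => ?_, hg a⟩) h
  · have := hf _ h
    rwa [hf'] at this
  · have := hg _ h
    rwa [hg'] at this

theorem Link.exists_fixed_of_finite {A : Type*} {W : Set A} (hW : W.Finite) {f g : A → A}
    (hf' : Function.Involutive f) (hg' : Function.Involutive g) (hf : ∀ x ∈ W, f x ∈ W)
    (hg : ∀ x ∈ W, g x ∈ W) {x : A} (hxW : x ∈ W) (hx : g x = x) (hne : ∀ y, f y ≠ y) :
    ∃ y, y ≠ x ∧ g y = y ∧ Link f g x y := by
  have := hW.to_subtype
  obtain ⟨y, h1, h2, h3⟩ := Link.exists_fixed (A := W) (f := restr f hf) (g := restr g hg)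
    (fun a => Subtype.ext (hf' a)) (fun a => Subtype.ext (hg' a)) (x := ⟨x, hxW⟩)
    (Subtype.ext hx) (fun y h => hne y (congrArg Subtype.val h))
  exact ⟨y, fun h => h1 (Subtype.ext h), congrArg Subtype.val h2, (restr_iff hf' hg' hf hg _ _).1 h3⟩

namespace Darts

variable {A : Type*} {S : Darts A} {W : Set A}

theorem Planar.restrict {μ : A → A} (hμ : S.Planar μ) (hW : ∀ x ∈ W, S.flip x ∈ W)
    (hμW : ∀ x ∈ W, μ x ∈ W) : (S.restrict W hW).Planar (restr μ hμW) where
  invol x := Subtype.ext (hμ.invol x)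
  nc d e hd he h h' := hμ.nc d e (fun h => hd (Subtype.ext h)) (fun h => he (Subtype.ext h))
    (fun h'' => h (Subtype.ext h'')) (fun h'' => h' (Subtype.ext h''))
  nc_left d e hd he := hμ.nc_left d e (fun h => hd (Subtype.ext h)) (congrArg Subtype.val he)
  nc_right d e hd he := hμ.nc_right d e (congrArg Subtype.val hd) (fun h => he (Subtype.ext h))
  turn d hd := hμ.turn d (fun h => hd (Subtype.ext h))

theorem Planar.ends_nc {μ : A → A} (hμ : S.Planar μ) (hfin : W.Finite)
    (hW : ∀ x ∈ W, S.flip x ∈ W) (hμW : ∀ x ∈ W, μ x ∈ W) {x y z w : A} (hxW : x ∈ W) (hzW : z ∈ W)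
    (hx : μ x = x) (hy : μ y = y) (hz : μ z = z) (hw : μ w = w) (hxy : Link S.flip μ x y)
    (hne : y ≠ x) (hzw : Link S.flip μ z w) (hxz : ¬ Link S.flip μ x z) :
    S.left x z + S.left y z = S.left x w + S.left y w := by
  classical
  have := hfin.fintype
  have hyW := (Link.mem_iff S.flip_flip hμ.invol hW hμW hxy).1 hxW
  have hwW := (Link.mem_iff S.flip_flip hμ.invol hW hμW hzw).1 hzW
  have l := Link.restr_iff (W := W) S.flip_flip hμ.invol hW hμW
  exact (hμ.restrict hW hμW).ends_nc_of_fintype (x := ⟨x, hxW⟩) (y := ⟨y, hyW⟩) (z := ⟨z, hzW⟩)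
    (w := ⟨w, hwW⟩) (Subtype.ext hx) (Subtype.ext hy) (Subtype.ext hz) (Subtype.ext hw)
    ((l _ _).2 hxy) (fun h => hne (congrArg Subtype.val h)) ((l _ _).2 hzw)
    (fun h => hxz ((l _ _).1 h))

theorem restr_rewire {μ : A → A} {h : Fin 6 → A} {m : Fin 6 → Fin 6} (hh : Function.Injective h)
    (hhW : ∀ i, h i ∈ W)
    (hμW : ∀ x ∈ W, μ x ∈ W) (hμW' : ∀ x ∈ W, rewire h m μ x ∈ W) :
    rewire (fun i => (⟨h i, hhW i⟩ : W)) m (restr μ hμW) = restr (rewire h m μ) hμW' := by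
  have hh' : Function.Injective fun i => (⟨h i, hhW i⟩ : W) :=
    fun i j hij => hh (congrArg Subtype.val hij)
  funext x
  by_cases hx : ∃ i, h i = x.1
  · obtain ⟨i, hi⟩ := hx
    obtain rfl : (⟨h i, hhW i⟩ : W) = x := Subtype.ext hi
    rw [rewire_apply m _ hh' i]
    exact Subtype.ext (rewire_apply m μ hh i).symm
  · rw [rewire_of_notMem]
    · refine Subtype.ext (rewire_of_notMem _ _ fun i hi => hx ⟨i, hi⟩).symm
    · intro i hi
      exact hx ⟨i, congrArg Subtype.val hi⟩

theorem rewire_mem {μ : A → A} {h : Fin 6 → A} {m : Fin 6 → Fin 6} (hh : Function.Injective h)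
    (hhW : ∀ i, h i ∈ W) (hμW : ∀ x ∈ W, μ x ∈ W) : ∀ x ∈ W, rewire h m μ x ∈ W := by
  intro x hx
  by_cases hxh : ∃ i, h i = x
  · obtain ⟨i, rfl⟩ := hxh
    rw [rewire_apply m _ hh]
    exact hhW _
  · rw [rewire_of_notMem _ _ fun i hi => hxh ⟨i, hi⟩]
    exact hμW x hx

/-- If a diagram stays connected under one surgery, and the result of it does so under another
surgery, then the diagram stays connected under that surgery. -/
theorem Planar.connected_of_surgeries {μ : A → A} (hμ : S.Planar μ) (hfin : W.Finite)
    (hW : ∀ x ∈ W, S.flip x ∈ W) (hμW : ∀ x ∈ W, μ x ∈ W) (hne : ∀ x ∈ W, μ x ≠ x)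
    {h k : Fin 6 → A} {t' : HexShape} (hh : S.IsHex .surgery h) (hk : S.IsHex t' k)
    (ht : t' = .surgery ∨ t' = .line)
    (hhk : ∀ i j, h i ≠ k j) (hhW : ∀ i, h i ∈ W) (hkW : ∀ i, k i ∈ W)
    (h0 : ∀ i, μ (h i) = h (hexBefore i)) (k0 : ∀ i, μ (k i) = k (hexBefore i))
    (hμh : S.Planar (rewire h hexAfter μ)) (hμk : S.Planar (rewire k hexAfter μ))
    (hμhk : S.Planar (rewire h hexAfter (rewire k hexAfter μ)))
    (c0 : ∀ x ∈ W, ∀ y ∈ W, Link S.flip μ x y)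
    (ck : ∀ x ∈ W, ∀ y ∈ W, Link S.flip (rewire k hexAfter μ) x y)
    (chk : ∀ x ∈ W, ∀ y ∈ W, Link S.flip (rewire h hexAfter (rewire k hexAfter μ)) x y) :
    ∀ x ∈ W, ∀ y ∈ W, Link S.flip (rewire h hexAfter μ) x y := by
  classical
  have := hfin.fintype
  have Wh := rewire_mem (m := hexAfter) hh.inj hhW hμW
  have Wk := rewire_mem (m := hexAfter) hk.inj hkW hμW
  have Whk := rewire_mem (m := hexAfter) hh.inj hhW Wk
  have eh := restr_rewire (m := hexAfter) hh.inj hhW hμW Wh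
  have ek := restr_rewire (m := hexAfter) hk.inj hkW hμW Wk
  have ehk := restr_rewire (m := hexAfter) hh.inj hhW Wk Whk
  have ht' : t'.GapOK hexBefore 0 ∧ t'.GapOK hexBefore 3 := by
    rcases ht with rfl | rfl
    · exact HexShape.surgery_gapOK
    · exact HexShape.line_gapOK
  have hh' : (S.restrict W hW).IsHex .surgery fun i => (⟨h i, hhW i⟩ : W) :=
    ⟨fun i j hij => hh.inj (congrArg Subtype.val hij), fun a b => hh.left a b, fun a => hh.up a⟩
  have hk' : (S.restrict W hW).IsHex t' fun i => (⟨k i, hkW i⟩ : W) :=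
    ⟨fun i j hij => hk.inj (congrArg Subtype.val hij), fun a b => hk.left a b, fun a => hk.up a⟩
  have key := (hμ.restrict hW hμW).connected_of_connected (t := .surgery) (t' := t')
    (fun x hx => hne x x.2 (congrArg Subtype.val hx))
    hh' hk'
    (fun i j hij => hhk i j (congrArg Subtype.val hij)) (fun i => Subtype.ext (h0 i))
    (fun i => Subtype.ext (k0 i)) (by rw [eh]; exact hμh.restrict hW Wh)
    (by rw [ek]; exact hμk.restrict hW Wk) (by rw [ek, ehk]; exact hμhk.restrict hW Whk)
    HexShape.surgery_shortOK_even HexShape.surgery_shortOK_odd HexShape.surgery_gapOK_even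
    HexShape.surgery_gapOK_odd ht'.1 ht'.2
    (fun x y => (Link.restr_iff S.flip_flip hμ.invol hW hμW x y).2 (c0 x x.2 y y.2))
    (fun x y => by
      rw [ek]
      exact (Link.restr_iff S.flip_flip hμk.invol hW Wk x y).2 (ck x x.2 y y.2))
    (fun x y => by
      rw [ek, ehk]
      exact (Link.restr_iff S.flip_flip hμhk.invol hW Whk x y).2 (chk x x.2 y y.2))
  intro x hx y hy
  have := key ⟨x, hx⟩ ⟨y, hy⟩
  rw [eh] at this
  exact (Link.restr_iff S.flip_flip hμh.invol hW Wh _ _).1 this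

end Darts

theorem Link.of_rel_on {A : Type*} {f g : A → A} {p : A → Prop} {r : A → A → Prop}
    (hpf : ∀ x, p (f x) ↔ p x) (hpg : ∀ x, p (g x) ↔ p x) (hr : Equivalence r)
    (hf : ∀ x, p x → r x (f x)) (hg : ∀ x, p x → r x (g x)) {x y : A} (h : Link f g x y)
    (hx : p x) : r x y :=
  (Link.of_rel (r := fun a b => (p a ↔ p b) ∧ (p a → r a b)) ⟨fun _ => ⟨Iff.rfl, fun _ => hr.refl _⟩,
    fun h => ⟨h.1.symm, fun hb => hr.symm (h.2 (h.1.2 hb))⟩, fun h h' => ⟨h.1.trans h'.1,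
    fun ha => hr.trans (h.2 ha) (h'.2 (h.1.1 ha))⟩⟩ (fun a => ⟨(hpf a).symm, hf a⟩)
    (fun a => ⟨(hpg a).symm, hg a⟩) h).2 hx

/-! ### Strands, surgeries and components in terms of darts. -/

namespace StackedDiagram

variable {E : StackedDiagram} {κ κ' : ℤ → ℤ}

theorem sec_of_lt {z : ℕ} (h : E.middle.length + 1 < z) : E.sec z = E.bottom := by
  rw [sec, List.getD_eq_getElem?_getD, List.getElem?_eq_none]
  · rfl
  · simp
    omega

theorem length_replace (E : StackedDiagram) (j : ℕ) (a : ℤ) :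
    (E.replace j a).middle.length = E.middle.length := by
  simp [replace]

theorem replace_middle_self {j : ℕ} {a : ℤ} {σ : CupDiagram} (h : E.middle[j]? = some σ) :
    (E.replace j a).middle[j]? = some (σ.erase a) := by
  simp [replace, h]

theorem replace_middle_of_ne {i j : ℕ} {a : ℤ} (h : j ≠ i) :
    (E.replace j a).middle[i]? = E.middle[i]? := by
  simp [replace, h]

theorem sec_replace_self {j : ℕ} {a : ℤ} {σ : CupDiagram} (h : E.middle[j]? = some σ) :
    (E.replace j a).sec (j + 1) = σ.erase a := sec_succ _ (replace_middle_self h)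

theorem sec_replace_of_ne {z j : ℕ} {a : ℤ} (h : z ≠ j + 1) :
    (E.replace j a).sec z = E.sec z := by
  rcases Nat.eq_zero_or_pos z with rfl | hz
  · rfl
  · obtain ⟨i, rfl⟩ : ∃ i, z = i + 1 := ⟨z - 1, by omega⟩
    rcases lt_trichotomy i E.middle.length with h1 | h1 | h1
    · have h2 : E.middle[i]? = some E.middle[i] := List.getElem?_eq_getElem h1
      rw [sec_succ _ h2, sec_succ]
      rw [replace_middle_of_ne (by omega), h2]
    · have := (E.replace j a).sec_last
      rw [length_replace] at this
      rw [h1, this, E.sec_last]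
      rfl
    · have := length_replace E j a
      rw [sec_of_lt (E := E) (by omega), sec_of_lt (by omega)]
      rfl

/-- The dart at a point on the boundary of the `j`-th middle section. -/
def sectionDart (j : ℕ) (s : Bool × ℤ) : Dart := if s.1 then (j + 1, false, s.2) else (j, true, s.2 - 1)

theorem sectionDart_injective (j : ℕ) : Function.Injective (sectionDart j) := by
  rintro ⟨u, x⟩ ⟨v, y⟩ h
  cases u <;> cases v <;> simp [sectionDart] at h ⊢ <;> omega

theorem arcs_strand {j : ℕ} {σ : CupDiagram} (h : E.middle[j]? = some σ) {s t : Bool × ℤ}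
    (hs : σ.Strand s t) : E.arcs κ κ' (sectionDart j s) = sectionDart j t ∧
      E.arcs κ κ' (sectionDart j t) = sectionDart j s := by
  have hsec := E.sec_succ h
  have hj : j < E.middle.length := by
    by_contra hc
    rw [List.getElem?_eq_none (by omega)] at h
    simp at h
  rcases hs with ⟨x, hx⟩ | ⟨x, hx⟩ | ⟨x, y, hxy⟩
  · have h1 : σ.mate (x - 1) ≠ x - 1 := by
      unfold CupDiagram.capMate at hx
      omega
    constructor
    · rw [arcs_cup]
      · simp [sectionDart, Dart.zone, hsec, CupDiagram.capMate]
      · simpa [sectionDart, Dart.zone, hsec] using h1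
    · rw [arcs_cup]
      · simp [sectionDart, Dart.zone, hsec, CupDiagram.capMate, CupDiagram.mate_mate]
      · simp [sectionDart, Dart.zone, hsec, CupDiagram.capMate, CupDiagram.mate_mate]
        exact h1.symm
  · constructor
    · rw [arcs_cup]
      · simp [sectionDart, Dart.zone, hsec]
      · simpa [sectionDart, Dart.zone, hsec] using hx
    · rw [arcs_cup]
      · simp [sectionDart, Dart.zone, hsec, CupDiagram.mate_mate]
      · simp [sectionDart, Dart.zone, hsec, CupDiagram.mate_mate]
        exact hx.symm
  · obtain ⟨n, rfl, rfl⟩ := (σ.isRay_iff x y).1 hxy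
    have e1 : sectionDart j (false, σ.ray n + 1) = E.rayDart (j, true, n) := by
      simp [sectionDart, rayDart, Dart.zone, hsec]
    have e2 : sectionDart j (true, σ.ray (n + 1)) = E.rayDart (j + 1, false, n + 1) := by
      simp [sectionDart, rayDart, Dart.zone, hsec]
    rw [e1, e2, arcs_rayDart, arcs_rayDart]
    have : j + 1 ≤ E.middle.length := hj
    constructor <;> simp [joinRays, hj, this]

theorem exists_strand (σ : CupDiagram) (s : Bool × ℤ) : ∃ t, σ.Strand s t ∨ σ.Strand t s := by
  rcases s with ⟨u, x⟩
  cases u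
  · by_cases h : σ.capMate x = x
    · have h1 : σ.mate (x - 1) = x - 1 := by
        unfold CupDiagram.capMate at h
        omega
      refine ⟨(true, σ.ray (σ.idx (x - 1) + 1)), Or.inl (.ray _ _ ((σ.isRay_iff _ _).2
        ⟨σ.idx (x - 1), ?_, rfl⟩))⟩
      rw [σ.ray_idx h1]
      ring
    · exact ⟨_, Or.inl (.cap x h)⟩
  · by_cases h : σ.mate x = x
    · refine ⟨(false, σ.ray (σ.idx x - 1) + 1), Or.inr (.ray _ _ ((σ.isRay_iff _ _).2
        ⟨σ.idx x - 1, rfl, ?_⟩))⟩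
      rw [sub_add_cancel, σ.ray_idx h]
    · exact ⟨_, Or.inl (.cup x h)⟩

theorem exists_sectionDart {j : ℕ} {d : Dart} (h : d.zone = j + 1) : ∃ s, sectionDart j s = d := by
  rcases d with ⟨i, u, c⟩
  cases u
  · refine ⟨(true, c), ?_⟩
    simp [Dart.zone] at h
    simp [sectionDart, h]
  · refine ⟨(false, c + 1), ?_⟩
    simp [Dart.zone] at h
    simp [sectionDart, h]

theorem arcs_of_sec_eq {F : StackedDiagram} (hm : F.middle.length = E.middle.length) {d : Dart}
    (hd : F.sec d.zone = E.sec d.zone) : F.arcs κ κ' d = E.arcs κ κ' d := by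
  have h2 : ∀ n, F.rayDart (joinRays E.middle.length κ κ' (d.1, d.2.1, n)) =
      E.rayDart (joinRays E.middle.length κ κ' (d.1, d.2.1, n)) := by
    intro n
    simp only [rayDart, zone_joinRays]
    have : Dart.zone (d.1, d.2.1, n) = d.zone := rfl
    rw [this, hd]
  simp only [arcs, hm, hd, h2]

/-- A surgery changes the strands at six points. -/
theorem exists_hexagon {j : ℕ} {a : ℤ} {σ : CupDiagram} (hσ : E.middle[j]? = some σ)
    (ha : σ.IsOutermost a) : ∃ h : Fin 6 → Dart, Dart.darts.IsHex .surgery h ∧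
      (∀ i, (h i).zone = j + 1) ∧
      ∀ κ κ', (∀ i, E.arcs κ κ' (h i) = h (hexBefore i)) ∧
        (E.replace j a).arcs κ κ' = rewire h hexAfter (E.arcs κ κ') := by
  obtain ⟨p, q, hpq, hpa, hbq, hs⟩ := σ.strand_erase a (σ.mate a) ha rfl
  obtain ⟨b, hb⟩ : ∃ b, b = σ.mate a := ⟨_, rfl⟩
  rw [← hb] at hs hbq
  have hab : a < b := hb ▸ ha.1
  -- The corners in cyclic order: from left to right on the lower line, then from right to left on
  -- the upper line. In this order the strands before and after are `hexBefore` and `hexAfter`.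
  obtain ⟨g, hg⟩ : ∃ g : Fin 6 → Bool × ℤ, g = ![(false, p), (false, a + 1), (false, b + 1),
    (true, q), (true, b), (true, a)] := ⟨_, rfl⟩
  have ginj : Function.Injective g := by
    rw [hg]
    intro i i' hi
    fin_cases i <;> fin_cases i' <;> simp at hi ⊢ <;> omega
  have hinj : Function.Injective fun i => sectionDart j (g i) :=
    (sectionDart_injective j).comp ginj
  have inv : ∀ F : StackedDiagram, Function.Involutive (F.arcs (fun n => n) fun n => n) := fun F =>
    (arcs_planar .id .id).invol
  have gstrand : ∀ i, σ.Strand (g i) (g (hexBefore i)) ∨ σ.Strand (g (hexBefore i)) (g i) := by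
    have h1 : σ.Strand (g 0) (g 3) := by
      rw [hg]
      exact .ray p q hpq
    have h2 : σ.Strand (g 1) (g 2) := by
      have := CupDiagram.Strand.cap (σ := σ) (a + 1) (by simp [CupDiagram.capMate, ← hb]; omega)
      simp only [CupDiagram.capMate, add_sub_cancel_right, ← hb] at this
      rw [hg]
      exact this
    have h3 : σ.Strand (g 5) (g 4) := by
      have := CupDiagram.Strand.cup (σ := σ) a (by omega)
      rw [← hb] at this
      rw [hg]
      exact this
    intro i
    fin_cases i
    exacts [Or.inl h1, Or.inl h2, Or.inr h2, Or.inr h1, Or.inr h3, Or.inl h3]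
  have gmem : ∀ s, s ∈ ({(false, p), (false, a + 1), (false, b + 1), (true, a), (true, b),
      (true, q)} : Set (Bool × ℤ)) ↔ ∃ i, g i = s := by
    intro s
    simp only [Set.mem_insert_iff, Set.mem_singleton_iff, hg]
    constructor
    · rintro (h | h | h | h | h | h)
      exacts [⟨0, h.symm⟩, ⟨1, h.symm⟩, ⟨2, h.symm⟩, ⟨5, h.symm⟩, ⟨4, h.symm⟩, ⟨3, h.symm⟩]
    · rintro ⟨i, rfl⟩
      fin_cases i <;> simp
  -- The six corners are closed under taking the other end of a strand, so a strand with one end off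
  -- the hexagon avoids it altogether and survives the surgery.
  have gpartner : ∀ s t, σ.Strand s t ∨ σ.Strand t s → (∃ i, g i = t) → ∃ i, g i = s := by
    rintro s t hst ⟨i, rfl⟩
    refine ⟨hexBefore i, sectionDart_injective j ?_⟩
    have h1 : E.arcs (fun n => n) (fun n => n) (sectionDart j (g i)) = sectionDart j s := by
      rcases hst with h | h
      · exact (arcs_strand hσ h).2
      · exact (arcs_strand hσ h).1
    rw [← h1]
    rcases gstrand i with h | h
    · exact (arcs_strand hσ h).1.symm
    · exact (arcs_strand hσ h).2.symm
  have gafter : ∀ i, (σ.erase a).Strand (g i) (g (hexAfter i)) ∨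
      (σ.erase a).Strand (g (hexAfter i)) (g i) := by
    have h1 : (σ.erase a).Strand (g 0) (g 5) := by
      rw [hs, hg]
      simp
    have h2 : (σ.erase a).Strand (g 1) (g 4) := by
      rw [hs, hg]
      simp
    have h3 : (σ.erase a).Strand (g 2) (g 3) := by
      rw [hs, hg]
      simp
    intro i
    fin_cases i
    exacts [Or.inl h1, Or.inl h2, Or.inl h3, Or.inr h3, Or.inr h2, Or.inr h1]
  refine ⟨fun i => sectionDart j (g i), ⟨hinj, fun i i' => ?_, fun i => ?_⟩, fun i => ?_,
    fun κ κ' => ⟨fun i => ?_, ?_⟩⟩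
  · rw [Dart.darts_left, hg]
    fin_cases i <;> fin_cases i' <;>
      simp [sectionDart, Dart.Lt, HexShape.surgery] <;> omega
  · rw [Dart.darts_up, hg]
    fin_cases i <;> simp [sectionDart, HexShape.surgery]
  · rw [hg]
    fin_cases i <;> simp [sectionDart, Dart.zone]
  · rcases gstrand i with h | h
    · exact (arcs_strand hσ h).1
    · exact (arcs_strand hσ h).2
  · funext d
    by_cases hd : ∃ i, sectionDart j (g i) = d
    · obtain ⟨i, rfl⟩ := hd
      rw [rewire_apply hexAfter _ hinj i]
      rcases gafter i with h | h
      · exact (arcs_strand (replace_middle_self hσ) h).1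
      · exact (arcs_strand (replace_middle_self hσ) h).2
    · rw [rewire_of_notMem _ _ fun i hi => hd ⟨i, hi⟩]
      by_cases hz : d.zone = j + 1
      · obtain ⟨s, rfl⟩ := exists_sectionDart hz
        have hsg : ¬ ∃ i, g i = s := fun ⟨i, hi⟩ => hd ⟨i, by rw [hi]⟩
        obtain ⟨t, ht⟩ := exists_strand σ s
        have htg : ¬ ∃ i, g i = t := fun h => hsg (gpartner s t ht h)
        rcases ht with ht | ht
        · rw [(arcs_strand hσ ht).1]
          refine (arcs_strand (replace_middle_self hσ) ((hs s t).2 (Or.inl ⟨ht, ?_⟩))).1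
          rwa [gmem]
        · rw [(arcs_strand hσ ht).2]
          refine (arcs_strand (replace_middle_self hσ) ((hs t s).2 (Or.inl ⟨ht, ?_⟩))).2
          rwa [gmem]
      · exact arcs_of_sec_eq (length_replace E j a) (sec_replace_of_ne hz)

theorem arcs_le (d : Dart) : (E.arcs κ κ' d).1 ≤ E.middle.length ↔ d.1 ≤ E.middle.length := by
  unfold arcs
  split_ifs
  · rfl
  · exact joinRays_le

/-- Connected components, in terms of darts. -/
theorem connected_iff {v w : ℕ × ℤ} (hv : v.1 ≤ E.middle.length) : E.Connected v w ↔
    Link Dart.flip (E.arcs (fun n => n) fun n => n) (v.1, false, v.2) (w.1, false, w.2) := by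
  have hflip : ∀ j c, Link Dart.flip (E.arcs (fun n => n) fun n => n) (j, false, c)
      (j, true, c - 1) := fun j c => .left (f := Dart.flip) (j, false, c)
  constructor
  · clear hv
    intro h
    induction h with
    | refl => exact .refl _
    | symm _ _ _ ih => exact ih.symm
    | trans _ _ _ _ _ ih ih' => exact ih.trans ih'
    | rel x y h =>
      rcases h with ⟨x, h⟩ | ⟨j, σ, hj, s, t, h⟩ | ⟨x, h⟩
      · have h1 := Link.right (f := Dart.flip) (g := E.arcs (fun n => n) fun n => n) (0, false, x)
        rwa [arcs_cup (d := (0, false, x)) h] at h1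
      · have h1 := Link.right (f := Dart.flip) (g := E.arcs (fun n => n) fun n => n)
          (sectionDart j s)
        rw [(arcs_strand hj h).1] at h1
        have h2 : ∀ s : Bool × ℤ, Link Dart.flip (E.arcs (fun n => n) fun n => n)
            (j + s.1.toNat, false, s.2) (sectionDart j s) := by
          rintro ⟨u, x⟩
          cases u
          · exact hflip j x
          · exact .refl _
        exact (h2 s).trans (h1.trans (h2 t).symm)
      · have h0 : (E.sec (Dart.zone (E.middle.length, true, x - 1))).mate (x - 1) ≠ x - 1 := by
          change (E.sec (E.middle.length + 1)).mate (x - 1) ≠ x - 1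
          rw [E.sec_last]
          unfold CupDiagram.capMate at h
          omega
        have h1 := Link.right (f := Dart.flip) (g := E.arcs (fun n => n) fun n => n)
          (E.middle.length, true, x - 1)
        rw [arcs_cup h0] at h1
        refine (hflip _ _).trans (h1.trans ?_)
        have h2 := hflip E.middle.length (E.top.capMate x)
        rw [CupDiagram.capMate, add_sub_cancel_right] at h2
        have h3 : (E.sec (Dart.zone (E.middle.length, true, x - 1))).mate (x - 1) =
            E.top.mate (x - 1) := by
          rw [← E.sec_last]
          rfl
        dsimp only at h3 ⊢
        rw [h3, CupDiagram.capMate]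
        exact h2.symm
  · intro h
    have key := Link.of_rel_on (f := Dart.flip) (p := fun d : Dart => d.1 ≤ E.middle.length)
      (r := fun d e : Dart => E.Connected (d.1, d.pos) (e.1, e.pos)) (fun _ => Iff.rfl) arcs_le
      ⟨fun _ => .refl _, .symm _ _, .trans _ _ _⟩ (fun d _ => ?_) (fun d hd => ?_) h hv
    · exact key
    · rw [Dart.flip_pos]
      exact .refl _
    · have hsd : ∀ j s, ((sectionDart j s).1, (sectionDart j s).pos) = (j + s.1.toNat, s.2) := by
        rintro j ⟨u, x⟩
        cases u <;> simp [sectionDart, Dart.pos]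
      by_cases h1 : ∃ j, d.zone = j + 1 ∧ j < E.middle.length
      · obtain ⟨j, h1, h2⟩ := h1
        obtain ⟨s, rfl⟩ := exists_sectionDart h1
        have hσ : E.middle[j]? = some E.middle[j] := List.getElem?_eq_getElem h2
        obtain ⟨t, ht⟩ := exists_strand E.middle[j] s
        rcases ht with ht | ht
        · rw [(arcs_strand hσ ht).1, hsd, hsd]
          exact .rel _ _ (.strand j _ hσ s t ht)
        · rw [(arcs_strand hσ ht).2, hsd, hsd]
          exact .symm _ _ (.rel _ _ (.strand j _ hσ t s ht))
      · rcases d with ⟨i, u, c⟩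
        -- Outside of the middle sections only the bottom and the top remain; there a ray is an end
        -- of a line, fixed by the open diagram, and a cup is an arc of the bottom or of the top.
        by_cases h2 : (E.sec (Dart.zone (i, u, c))).mate c = c
        · have : E.arcs (fun n => n) (fun n => n) (i, u, c) = (i, u, c) := by
            obtain ⟨e, he⟩ := exists_rayDart (d := (i, u, c)) h2
            have h3 : e.zone = Dart.zone (i, u, c) := by rw [← he, rayDart_zone]
            rw [← he, arcs_rayDart]
            congr 1
            rcases e with ⟨i', u', c'⟩
            rw [← h3] at h1
            unfold joinRays
            cases u'
            · by_cases h4 : i' = 0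
              · simp [h4]
              · by_cases h5 : i' ≤ E.middle.length
                · exact absurd ⟨i' - 1, by simp [Dart.zone]; omega, by omega⟩ h1
                · simp [h4, h5]
            · by_cases h4 : i' < E.middle.length
              · exact absurd ⟨i', by simp [Dart.zone], h4⟩ h1
              · simp [h4]
          rw [this]
          exact .refl _
        · rw [arcs_cup h2]
          dsimp only at hd h2 ⊢
          have hz : i + u.toNat = 0 ∨ (u = true ∧ i = E.middle.length) := by
            by_contra hc
            refine h1 ⟨i + u.toNat - 1, ?_⟩
            cases u <;> simp [Dart.zone] at hc ⊢ <;> omega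
          rcases hz with hz | ⟨rfl, rfl⟩
          · obtain rfl : u = false := by
              cases u <;> simp_all
            obtain rfl : i = 0 := by simpa using hz
            exact .rel _ _ (.bottomCup c h2)
          · have h3 : E.sec (Dart.zone (E.middle.length, true, c)) = E.top := E.sec_last
            rw [h3] at h2 ⊢
            have h4 := Arc.topCap (E := E) (c + 1) (by
              simp only [CupDiagram.capMate, add_sub_cancel_right]
              omega)
            simp only [CupDiagram.capMate, add_sub_cancel_right] at h4
            exact .rel _ _ h4

end StackedDiagram

/-! ### Finite windows. -/

namespace CupDiagram.Far

variable {σ : CupDiagram} {M : ℤ}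

theorem ray_le (h : σ.Far M) (n : ℤ) : σ.ray n ≤ M - 1 ↔ n ≤ M - σ.numCups := by
  have := h.ray_right (le_refl (M - σ.numCups))
  have h2 := σ.ray_strictMono.le_iff_le (a := n) (b := (M - σ.numCups))
  omega

theorem ray_le' (h : σ.Far M) (n : ℤ) : σ.ray n ≤ M ↔ n ≤ M - σ.numCups + 1 := by
  have := h.ray_right (show M - σ.numCups ≤ M - σ.numCups + 1 by omega)
  have h2 := σ.ray_strictMono.le_iff_le (a := n) (b := (M - σ.numCups + 1))
  omega

theorem le_ray (h : σ.Far M) (n : ℤ) : -2 - M ≤ σ.ray n ↔ -1 - M + σ.numCups ≤ n := by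
  have := h.ray_left (show -1 - M + σ.numCups ≤ 2 - M + σ.numCups by omega)
  have h2 := σ.ray_strictMono.le_iff_le (a := (-1 - M + σ.numCups)) (b := n)
  omega

theorem le_ray' (h : σ.Far M) (n : ℤ) : -1 - M ≤ σ.ray n ↔ -M + σ.numCups ≤ n := by
  have := h.ray_left (show -M + σ.numCups ≤ 2 - M + σ.numCups by omega)
  have h2 := σ.ray_strictMono.le_iff_le (a := (-M + σ.numCups)) (b := n)
  omega

end CupDiagram.Far

namespace StackedDiagram

variable {E : StackedDiagram} {κ κ' : ℤ → ℤ} {M : ℤ}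

variable (E) in
/-- All diagrams in the stack are trivial outside of a window. -/
def Far (M : ℤ) : Prop := ∀ z, (E.sec z).Far M

variable (E) in
theorem exists_far : ∃ M₀, ∀ M, M₀ ≤ M → E.Far M := by
  choose f hf using fun z => (E.sec z).exists_far
  obtain ⟨B, hB⟩ := ((Set.finite_Iic (E.middle.length + 1)).image f).bddAbove
  refine ⟨max B (f 0), fun M hM z => ?_⟩
  by_cases hz : z ≤ E.middle.length + 1
  · have := hB ⟨z, hz, rfl⟩
    exact hf z M (by omega)
  · rw [sec_of_lt (by omega)]
    exact hf 0 M (by omega)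

/-- The darts in a finite window. -/
def window (m : ℕ) (M : ℤ) : Set Dart := {d | d.1 ≤ m ∧ -1 - M ≤ d.pos ∧ d.pos ≤ M}

theorem window_finite (m : ℕ) (M : ℤ) : (window m M).Finite := by
  refine ((Set.finite_Iic m).prod (Set.finite_univ.prod (Set.finite_Icc (-2 - M) M))).subset ?_
  rintro ⟨j, u, c⟩ ⟨h1, h2, h3⟩
  refine ⟨h1, trivial, ?_⟩
  rw [Set.mem_Icc]
  cases u <;> simp [Dart.pos] at h2 h3 ⊢ <;> omega

theorem flip_mem_window {m : ℕ} : ∀ d ∈ window m M, Dart.darts.flip d ∈ window m M := by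
  intro d hd
  unfold window at hd ⊢
  rw [Set.mem_ofPred_eq] at hd ⊢
  rw [Dart.darts_flip, Dart.flip_pos]
  exact hd

/-- The window is centred so that, in terms of ray numbers, it is symmetric about `-1/2` at upward
darts and about `1/2` at downward darts. It is therefore compatible with the shift by one in each
section, and with the closing `v ↔ 1 - v` at the bottom. -/
theorem rayDart_mem_window (hF : E.Far M) (d : Dart) : E.rayDart d ∈ window E.middle.length M ↔
    d.1 ≤ E.middle.length ∧
      if d.2.1 then -(M + 1 - (E.sec d.zone).numCups) ≤ d.2.2 ∧ d.2.2 ≤ M - (E.sec d.zone).numCups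
      else -M + (E.sec d.zone).numCups ≤ d.2.2 ∧ d.2.2 ≤ M + 1 - (E.sec d.zone).numCups := by
  rcases d with ⟨j, u, n⟩
  have h1 := (hF (Dart.zone (j, u, n))).ray_le n
  have h2 := (hF (Dart.zone (j, u, n))).ray_le' n
  have h3 := (hF (Dart.zone (j, u, n))).le_ray n
  have h4 := (hF (Dart.zone (j, u, n))).le_ray' n
  unfold window
  rw [Set.mem_ofPred_eq]
  cases u <;> simp only [rayDart, Dart.pos] <;> simp <;> omega

theorem arcs_mem_window (hF : E.Far M)
    (hκ : ∀ n, -M + E.bottom.numCups ≤ n → n ≤ M + 1 - E.bottom.numCups →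
      -M + E.bottom.numCups ≤ κ n ∧ κ n ≤ M + 1 - E.bottom.numCups)
    (hκ' : ∀ n, -(M + 1 - E.top.numCups) ≤ n → n ≤ M - E.top.numCups →
      -(M + 1 - E.top.numCups) ≤ κ' n ∧ κ' n ≤ M - E.top.numCups) :
    ∀ d ∈ window E.middle.length M, E.arcs κ κ' d ∈ window E.middle.length M := by
  intro d hd
  by_cases h : (E.sec d.zone).mate d.2.2 = d.2.2
  · obtain ⟨⟨j, u, n⟩, rfl⟩ := exists_rayDart h
    rw [arcs_rayDart, rayDart_mem_window hF, joinRays_le, zone_joinRays]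
    rw [rayDart_mem_window hF] at hd
    refine ⟨hd.1, ?_⟩
    obtain ⟨hj, hd⟩ := hd
    unfold joinRays
    dsimp only at hj hd ⊢
    cases u
    · by_cases h0 : j = 0
      · have hz : E.sec (Dart.zone (j, false, n)) = E.bottom := by
          rw [h0]
          rfl
        rw [hz] at hd ⊢
        simp [h0] at hd ⊢
        have := hκ n (by omega) (by omega)
        omega
      · simp [h0, hj] at hd ⊢
        omega
    · by_cases h0 : j < E.middle.length
      · simp [h0] at hd ⊢
        omega
      · have h1 : j = E.middle.length := by omega
        have hz : E.sec (Dart.zone (j, true, n)) = E.top := by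
          rw [h1]
          exact E.sec_last
        rw [hz] at hd ⊢
        simp [h1] at hd ⊢
        have := hκ' n (by omega) (by omega)
        omega
  · rw [arcs_cup h]
    have hF1 := hF d.zone
    have h1 := hF1 ((E.sec d.zone).mate d.2.2)
    rw [CupDiagram.mate_mate] at h1
    rcases d with ⟨j, u, c⟩
    unfold window at hd ⊢
    rw [Set.mem_ofPred_eq] at hd ⊢
    refine ⟨hd.1, ?_⟩
    dsimp only [Dart.pos] at *
    cases u <;> simp only [if_true, Bool.false_eq_true, if_false] at * <;> omega

/-- Far to the left and to the right, all lines are vertical. -/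
theorem arcs_far (hF : E.Far M) {j : ℕ} (hj : j < E.middle.length) {x : ℤ}
    (hx : M ≤ x ∨ x ≤ -1 - M) : E.arcs κ κ' (j, true, x - 1) = (j + 1, false, x) := by
  have hF1 := hF (j + 1)
  have e1 : (j, true, x - 1) = E.rayDart (j, true, (E.sec (j + 1)).idx (x - 1)) := by
    have : (E.sec (j + 1)).mate (x - 1) = x - 1 := by
      rcases hx with h | h
      · exact ((hF1 _).1 (by omega)).1
      · exact ((hF1 _).2 (by omega)).1
    simp only [rayDart, Dart.zone]
    rw [Bool.toNat_true, (E.sec (j + 1)).ray_idx this]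
  have e2 : (j + 1, false, x) = E.rayDart (j + 1, false, (E.sec (j + 1)).idx x) := by
    have : (E.sec (j + 1)).mate x = x := by
      rcases hx with h | h
      · exact ((hF1 _).1 (by omega)).1
      · exact ((hF1 _).2 (by omega)).1
    simp only [rayDart, Dart.zone]
    rw [Bool.toNat_false, add_zero, (E.sec (j + 1)).ray_idx this]
  rw [e1, e2, arcs_rayDart]
  congr 1
  simp only [joinRays, hj, if_true]
  rcases hx with h | h
  · rw [((hF1 x).1 (by omega)).2, ((hF1 (x - 1)).1 (by omega)).2]
    simp
    ring
  · rw [((hF1 x).2 (by omega)).2, ((hF1 (x - 1)).2 (by omega)).2]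
    simp
    ring

theorem link_far (hF : E.Far M) {j : ℕ} (hj : j ≤ E.middle.length) {x : ℤ}
    (hx : M ≤ x ∨ x ≤ -1 - M) :
    Link Dart.flip (E.arcs κ κ') (0, false, x) (j, true, x - 1) := by
  induction j with
  | zero => exact .left (f := Dart.flip) (0, false, x)
  | succ j ih =>
    have h1 := Link.right (f := Dart.flip) (g := E.arcs κ κ') (j, true, x - 1)
    rw [arcs_far hF (by omega) hx] at h1
    exact (ih (by omega)).trans (h1.trans (.left (f := Dart.flip) (j + 1, false, x)))

variable (E) in
/-- The ray with number `v` at the bottom. -/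
noncomputable def bottomEnd (v : ℤ) : Dart := E.rayDart (0, false, v)

variable (E) in
/-- The ray with number `u` at the top. -/
noncomputable def topEnd (u : ℤ) : Dart := E.rayDart (E.middle.length, true, u)

theorem arcs_bottomEnd (v : ℤ) : E.arcs κ κ' (E.bottomEnd v) = E.bottomEnd (κ v) := by
  rw [bottomEnd, arcs_rayDart]
  rfl

theorem arcs_topEnd (u : ℤ) : E.arcs κ κ' (E.topEnd u) = E.topEnd (κ' u) := by
  rw [topEnd, arcs_rayDart]
  simp [joinRays, topEnd]

theorem bottomEnd_eq (v : ℤ) : E.bottomEnd v = (0, false, E.bottom.ray v) := rfl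

theorem topEnd_eq (u : ℤ) : E.topEnd u = (E.middle.length, true, E.top.ray u) := by
  rw [topEnd, rayDart]
  have : E.sec (Dart.zone (E.middle.length, true, u)) = E.top := E.sec_last
  rw [this]

theorem bottomEnd_le (v : ℤ) : (E.bottomEnd v).1 ≤ E.middle.length := Nat.zero_le _

theorem topEnd_le (v : ℤ) : (E.topEnd v).1 ≤ E.middle.length := le_refl _

theorem bottomEnd_injective : Function.Injective E.bottomEnd := fun v w h => by
  rw [bottomEnd_eq, bottomEnd_eq] at h
  simp only [Prod.mk.injEq, true_and] at h
  exact E.bottom.ray_strictMono.injective h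

theorem topEnd_injective : Function.Injective E.topEnd := fun v w h => by
  rw [topEnd_eq, topEnd_eq] at h
  simp only [Prod.mk.injEq, true_and] at h
  exact E.top.ray_strictMono.injective h

theorem bottomEnd_ne_topEnd (v u : ℤ) : E.bottomEnd v ≠ E.topEnd u := by
  rw [bottomEnd_eq, topEnd_eq]
  simp

theorem topEnd_mem_window (hF : E.Far M) (u : ℤ) : E.topEnd u ∈ window E.middle.length M ↔
    -(M + 1 - E.top.numCups) ≤ u ∧ u ≤ M - E.top.numCups := by
  rw [topEnd, rayDart_mem_window hF]
  have : E.sec (Dart.zone (E.middle.length, true, u)) = E.top := E.sec_last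
  simp [this]

/-- The arcs with fixed ends are the ends. -/
theorem exists_end {d : Dart} (hd : d.1 ≤ E.middle.length)
    (h : E.arcs κ κ' d = d) : (∃ v, κ v = v ∧ d = E.bottomEnd v) ∨ ∃ u, κ' u = u ∧ d = E.topEnd u := by
  by_cases hm : (E.sec d.zone).mate d.2.2 = d.2.2
  · obtain ⟨⟨j, u, n⟩, rfl⟩ := exists_rayDart hm
    rw [arcs_rayDart] at h
    have h := rayDart_injective h
    have hd' : j ≤ E.middle.length := hd
    unfold joinRays at h
    cases u
    · by_cases h0 : j = 0
      · subst h0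
        simp at h
        exact Or.inl ⟨n, h, rfl⟩
      · simp [h0, hd'] at h
    · by_cases h0 : j < E.middle.length
      · simp [h0] at h
      · obtain rfl : j = E.middle.length := by omega
        simp at h
        exact Or.inr ⟨n, h, rfl⟩
  · rw [arcs_cup hm] at h
    exact absurd (congrArg (fun d : Dart => d.2.2) h) hm

/-- Far away the lines are vertical, so positions agree, and the two numberings differ by one for
the shift of the caps and by the difference of the numbers of cups. On the left this difference
enters with the opposite sign. -/
theorem link_far_right (hF : E.Far M) {v : ℤ} (hv : M ≤ v + E.bottom.numCups - 1) :
    Link Dart.flip (E.arcs κ κ') (E.bottomEnd v)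
      (E.topEnd (v - 1 + (E.bottom.numCups - E.top.numCups))) := by
  have hF0 : E.bottom.Far M := hF 0
  have hF1 : E.top.Far M := by
    rw [← E.sec_last]
    exact hF _
  have h := link_far (κ := κ) (κ' := κ') hF (le_refl _) (Or.inl hv)
  rw [bottomEnd_eq, topEnd_eq, hF0.ray_right (by omega), hF1.ray_right (by omega)]
  convert h using 3
  ring

theorem link_far_left (hF : E.Far M) {v : ℤ} (hv : v - E.bottom.numCups - 1 ≤ -1 - M) :
    Link Dart.flip (E.arcs κ κ') (E.bottomEnd v)
      (E.topEnd (v - 1 - (E.bottom.numCups - E.top.numCups))) := by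
  have hF0 : E.bottom.Far M := hF 0
  have hF1 : E.top.Far M := by
    rw [← E.sec_last]
    exact hF _
  have h := link_far (κ := κ) (κ' := κ') hF (le_refl _) (Or.inr hv)
  rw [bottomEnd_eq, topEnd_eq, hF0.ray_left (by omega), hF1.ray_left (by omega)]
  convert h using 3
  ring

end StackedDiagram

/-! ### Rotation of stacked diagrams. -/

/-- Rotate a dart by 180 degrees. -/
def Dart.rot (m : ℕ) (d : Dart) : Dart := (m - d.1, !d.2.1, -3 - d.2.2)

theorem Dart.rot_rot {m : ℕ} {d : Dart} (h : d.1 ≤ m) : (d.rot m).rot m = d := by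
  rcases d with ⟨j, u, c⟩
  simp only [Dart.rot, Bool.not_not, sub_sub_cancel]
  dsimp only at h
  congr 1
  omega

theorem Dart.flip_rot (m : ℕ) (d : Dart) : (d.rot m).flip = d.flip.rot m := by
  rcases d with ⟨j, u, c⟩
  cases u <;> (simp [Dart.rot, Dart.flip]; ring)

theorem Dart.rot_zone {m : ℕ} {d : Dart} (h : d.1 ≤ m) : (d.rot m).zone = m + 1 - d.zone := by
  rcases d with ⟨j, u, c⟩
  dsimp only at h
  cases u <;> simp [Dart.rot, Dart.zone] <;> omega

def rotIndex (κ : ℤ → ℤ) (n : ℤ) : ℤ := -1 - κ (-1 - n)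

namespace StackedDiagram

variable (E : StackedDiagram) {κ κ' : ℤ → ℤ} {M : ℤ}

/-- The stacked diagram rotated by 180 degrees. -/
def rot : StackedDiagram := ⟨E.top.rot, (E.middle.map CupDiagram.rot).reverse, E.bottom.rot⟩

theorem rot_rot : E.rot.rot = E := by
  have : CupDiagram.rot ∘ CupDiagram.rot = id := funext CupDiagram.rot_rot
  ext1 <;> simp [rot, CupDiagram.rot_rot, this]

theorem length_rot : E.rot.middle.length = E.middle.length := by simp [rot]

theorem sec_rot {z : ℕ} (hz : z ≤ E.middle.length + 1) :
    E.rot.sec z = (E.sec (E.middle.length + 1 - z)).rot := by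
  rcases Nat.eq_zero_or_pos z with rfl | hz0
  · rw [Nat.sub_zero, sec_last]
    rfl
  · obtain ⟨i, rfl⟩ : ∃ i, z = i + 1 := ⟨z - 1, by omega⟩
    by_cases hi : i = E.middle.length
    · have := E.rot.sec_last
      rw [length_rot] at this
      rw [hi, this, Nat.sub_self]
      rfl
    · have hi' : i < E.middle.length := by omega
      have h1 : E.middle[E.middle.length - 1 - i]? = some E.middle[E.middle.length - 1 - i] :=
        List.getElem?_eq_getElem _
      have h2 : E.rot.middle[i]? = some E.middle[E.middle.length - 1 - i].rot := by
        rw [rot]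
        dsimp only
        rw [List.getElem?_reverse (by simpa using hi')]
        simp [h1]
      rw [sec_succ _ h2]
      have : E.middle.length + 1 - (i + 1) = (E.middle.length - 1 - i) + 1 := by omega
      rw [this, sec_succ _ h1]

variable {E}

theorem joinRays_rot {m : ℕ} {j : ℕ} (hj : j ≤ m) (u : Bool) (n : ℤ) :
    joinRays m (rotIndex κ') (rotIndex κ) (m - j, !u, -1 - n) =
      ((m - (joinRays m κ κ' (j, u, n)).1), (!(joinRays m κ κ' (j, u, n)).2.1),
        -1 - (joinRays m κ κ' (j, u, n)).2.2) := by
  unfold joinRays rotIndex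
  cases u
  · by_cases h0 : j = 0
    · simp [h0]
    · have h1 : m - j < m := by omega
      have h2 : m - j + 1 = m - (j - 1) := by omega
      simp [h0, hj, h1, h2]
      ring
  · by_cases h0 : j < m
    · have h1 : m - j ≠ 0 := by omega
      have h2 : m - j - 1 = m - (j + 1) := by omega
      have h4 : m - j ≤ m := by omega
      simp [h0, h1, h2]
      ring
    · obtain rfl : j = m := by omega
      simp

theorem rayDart_rot {j : ℕ} (hj : j ≤ E.middle.length) (u : Bool) (n : ℤ) :
    (E.rayDart (j, u, n)).rot E.middle.length =
      E.rot.rayDart (E.middle.length - j, !u, -1 - n) := by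
  have hz : Dart.zone (E.middle.length - j, !u, -1 - n) =
      E.middle.length + 1 - Dart.zone (j, u, n) := by
    cases u <;> simp [Dart.zone] <;> omega
  have hz' : Dart.zone (j, u, n) ≤ E.middle.length + 1 := by
    cases u <;> simp [Dart.zone] <;> omega
  simp only [rayDart]
  rw [hz, sec_rot _ (by omega), CupDiagram.rot_ray]
  have : E.middle.length + 1 - (E.middle.length + 1 - Dart.zone (j, u, n)) = Dart.zone (j, u, n) := by
    omega
  rw [this]
  simp [Dart.rot]

theorem arcs_rot {d : Dart} (hd : d.1 ≤ E.middle.length) :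
    E.rot.arcs (rotIndex κ') (rotIndex κ) (d.rot E.middle.length) =
      (E.arcs κ κ' d).rot E.middle.length := by
  by_cases h : (E.sec d.zone).mate d.2.2 = d.2.2
  · obtain ⟨⟨j, u, n⟩, rfl⟩ := exists_rayDart h
    have hd : j ≤ E.middle.length := hd
    rw [rayDart_rot hd, arcs_rayDart, arcs_rayDart, length_rot, joinRays_rot hd]
    exact (rayDart_rot (joinRays_le.2 hd) _ _).symm
  · have hz' : d.zone ≤ E.middle.length + 1 := by
      rcases d with ⟨j, u, n⟩
      dsimp only at hd
      cases u <;> simp [Dart.zone] <;> omega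
    have h1 : E.rot.sec (d.rot E.middle.length).zone = (E.sec d.zone).rot := by
      rw [Dart.rot_zone hd, sec_rot _ (by omega)]
      congr 2
      omega
    have h2 : (E.rot.sec (d.rot E.middle.length).zone).mate (d.rot E.middle.length).2.2 =
        -3 - (E.sec d.zone).mate d.2.2 := by
      rw [h1, CupDiagram.rot_mate]
      simp [Dart.rot]
    rw [arcs_cup h, arcs_cup (by rw [h2]; simp [Dart.rot]; exact h), h2]
    simp [Dart.rot]

theorem link_rot {d e : Dart} (hd : d.1 ≤ E.middle.length)
    (h : Link Dart.flip (E.arcs κ κ') d e) :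
    Link Dart.flip (E.rot.arcs (rotIndex κ') (rotIndex κ)) (d.rot E.middle.length)
      (e.rot E.middle.length) :=
  Link.of_rel_on (f := Dart.flip) (p := fun d : Dart => d.1 ≤ E.middle.length)
    (r := fun d e => Link Dart.flip (E.rot.arcs (rotIndex κ') (rotIndex κ))
      (d.rot E.middle.length) (e.rot E.middle.length)) (fun _ => Iff.rfl) arcs_le
    ⟨fun _ => .refl _, .symm, .trans⟩ (fun d _ => by
      rw [← Dart.flip_rot]
      exact .left _) (fun d hd => by
      rw [← arcs_rot hd]
      exact .right _) h hd

theorem rot_bottomEnd (v : ℤ) : (E.bottomEnd v).rot E.middle.length = E.rot.topEnd (-1 - v) := by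
  rw [bottomEnd, rayDart_rot (Nat.zero_le _), topEnd, length_rot]
  rfl

theorem rot_topEnd (u : ℤ) : (E.topEnd u).rot E.middle.length = E.rot.bottomEnd (-1 - u) := by
  rw [topEnd, rayDart_rot (le_refl _), Nat.sub_self]
  rfl

theorem rotIndex_id : (rotIndex fun n => n) = fun n => n := by
  funext n
  simp [rotIndex]

/-- In particular the closing `1 - n` at the bottom turns into `-3 - n` at the top; this is why the
latter is used to define `ConnInf`. -/
theorem rotIndex_const_sub (s : ℤ) : (rotIndex fun n => s - n) = fun n => -2 - s - n := by
  funext n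
  simp [rotIndex]
  ring

theorem rot_replace {j : ℕ} {a : ℤ} {σ : CupDiagram} (hσ : E.middle[j]? = some σ)
    (ha : σ.IsOutermost a) :
    (E.replace j a).rot = E.rot.replace (E.middle.length - 1 - j) (-3 - σ.mate a) ∧
      E.rot.middle[E.middle.length - 1 - j]? = some σ.rot := by
  have hj : j < E.middle.length := by
    by_contra hc
    rw [List.getElem?_eq_none (by omega)] at hσ
    simp at hσ
  have key : E.rot.middle[E.middle.length - 1 - j]? = some σ.rot := by
    rw [rot]
    dsimp only
    rw [List.getElem?_reverse (by simp; omega)]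
    have : E.middle.length - 1 - (E.middle.length - 1 - j) = j := by omega
    simp [this, hσ]
  refine ⟨?_, key⟩
  have hl : (E.replace j a).rot.middle = (E.rot.replace (E.middle.length - 1 - j)
      (-3 - σ.mate a)).middle := by
    refine List.ext_getElem? fun i => ?_
    by_cases hi : i < E.middle.length
    · have h0 : (E.replace j a).rot.middle[i]? =
          (E.replace j a).middle[E.middle.length - 1 - i]?.map CupDiagram.rot := by
        rw [rot]
        dsimp only
        rw [List.getElem?_reverse (by simpa [length_replace] using hi), List.getElem?_map,
          List.length_map, length_replace]
      by_cases hij : i = E.middle.length - 1 - j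
      · have h1 : E.middle.length - 1 - i = j := by omega
        rw [h0, h1, replace_middle_self hσ, hij, replace_middle_self key, Option.map_some,
          σ.rot_erase ha]
      · rw [h0, replace_middle_of_ne (by omega), replace_middle_of_ne (by omega), rot]
        dsimp only
        rw [List.getElem?_reverse (by simpa using hi), List.getElem?_map, List.length_map]
    · rw [List.getElem?_eq_none, List.getElem?_eq_none]
      · rw [length_replace, length_rot]
        omega
      · rw [length_rot, length_replace]
        omega
  exact StackedDiagram.ext rfl hl rfl

end StackedDiagram

/-! ### Noncrossing matchings of the ends of lines. -/

/-- Ends of lines: `(false, v)` is the ray `v` at the bottom, `(true, u)` the ray `u` at the top. -/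
def EndLt (e f : Bool × ℤ) : Prop := e.1 = f.1 ∧ e.2 < f.2

/-- A noncrossing matching of the ends of lines. -/
structure EndMatching (ι : Bool × ℤ → Bool × ℤ) : Prop where
  invol : ∀ e, ι (ι e) = e
  ne : ∀ e, ι e ≠ e
  nc : ∀ e f, f ≠ e → f ≠ ι e →
    ((EndLt e f ↔ EndLt (ι e) f) ↔ (EndLt e (ι f) ↔ EndLt (ι e) (ι f)))

namespace EndMatching

variable {ι : Bool × ℤ → Bool × ℤ}

/-- An end enclosed by a returning line cannot get out, so it returns as well, inside of that line.
-/
theorem inside (h : EndMatching ι) {s : Bool} {l r x : ℤ} (hl : ι (s, l) = (s, r)) (h1 : l < x)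
    (h2 : x < r) : ∃ y, ι (s, x) = (s, y) ∧ l < y ∧ y < r := by
  have h3 := h.nc (s, l) (s, x) (by simp; omega) (by rw [hl]; simp; omega)
  have h4 : ι (s, x) ≠ (s, r) := by
    intro hc
    have := (h.invol (s, x)).symm.trans ((congrArg ι hc).trans ((congrArg ι hl).symm.trans (h.invol _)))
    simp at this
    omega
  rw [hl] at h3
  rcases hy : ι (s, x) with ⟨s', y⟩
  rw [hy] at h3 h4
  simp only [EndLt, true_and] at h3
  have h5 : s = s' := by
    by_contra hc
    simp [hc, h1, h2.not_gt] at h3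
  subst h5
  refine ⟨y, rfl, ?_⟩
  simp only [true_and] at h3
  simp only [ne_eq, Prod.mk.injEq, true_and] at h4
  omega

/-- All ends enclosed by a returning line are matched among themselves, each negative one with a
nonnegative one. So there are equally many of both kinds, which makes the outer ends symmetric. -/
theorem eq_neg (h : EndMatching ι)
    (hs : ∀ s n n', ι (s, n) = (s, n') → ¬ (n < 0 ↔ n' < 0)) {s : Bool} {n n' : ℤ}
    (hn : ι (s, n) = (s, n')) : n' = -1 - n := by
  have main : ∀ l r, l < r → ι (s, l) = (s, r) → r = -1 - l := by
    intro l r hlr hl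
    have hr : ι (s, r) = (s, l) := by rw [← hl, h.invol]
    have hsign := hs s l r hl
    have hin : ∀ x, l ≤ x → x ≤ r → ∃ y, ι (s, x) = (s, y) ∧ l ≤ y ∧ y ≤ r := by
      intro x h1 h2
      rcases h1.lt_or_eq with h3 | rfl
      · rcases h2.lt_or_eq with h4 | rfl
        · obtain ⟨y, hy, hy1, hy2⟩ := h.inside hl h3 h4
          exact ⟨y, hy, hy1.le, hy2.le⟩
        · exact ⟨l, hr, le_refl _, hlr.le⟩
      · exact ⟨r, hl, hlr.le, le_refl _⟩
    have hinj : ∀ x, l ≤ x → x ≤ r → ∀ x', l ≤ x' → x' ≤ r →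
        (ι (s, x)).2 = (ι (s, x')).2 → x = x' := by
      intro x h1 h2 x' h1' h2' hxx
      obtain ⟨y, hy, -⟩ := hin x h1 h2
      obtain ⟨y', hy', -⟩ := hin x' h1' h2'
      rw [hy, hy'] at hxx
      dsimp only at hxx
      have := (h.invol (s, x)).symm.trans ((congrArg ι (hy.trans (by rw [hxx, hy']))).trans (h.invol _))
      simpa using this
    have c1 : (Finset.Icc l (-1)).card ≤ (Finset.Icc 0 r).card := by
      refine Finset.card_le_card_of_injOn (fun x => (ι (s, x)).2) ?_ ?_
      · intro x hx
        simp only [Finset.coe_Icc, Set.mem_Icc] at hx ⊢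
        obtain ⟨y, hy, hy1, hy2⟩ := hin x (by omega) (by omega)
        have := hs s x y hy
        rw [hy]
        omega
      · intro x hx x' hx'
        simp only [Finset.coe_Icc, Set.mem_Icc] at hx hx'
        exact hinj x (by omega) (by omega) x' (by omega) (by omega)
    have c2 : (Finset.Icc 0 r).card ≤ (Finset.Icc l (-1)).card := by
      refine Finset.card_le_card_of_injOn (fun x => (ι (s, x)).2) ?_ ?_
      · intro x hx
        simp only [Finset.coe_Icc, Set.mem_Icc] at hx ⊢
        obtain ⟨y, hy, hy1, hy2⟩ := hin x (by omega) (by omega)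
        have := hs s x y hy
        rw [hy]
        omega
      · intro x hx x' hx'
        simp only [Finset.coe_Icc, Set.mem_Icc] at hx hx'
        exact hinj x (by omega) (by omega) x' (by omega) (by omega)
    rw [Int.card_Icc, Int.card_Icc] at c1 c2
    omega
  rcases lt_trichotomy n n' with h1 | h1 | h1
  · exact main n n' h1 hn
  · rw [← h1] at hn
    exact absurd hn (h.ne _)
  · have := main n' n h1 (by rw [← hn, h.invol])
    omega

/-- Returning lines join `n` and `-1 - n`, and everything enclosed by a returning line returns. The
first nonnegative end that does not return is therefore `p`. -/
theorem exists_range (h : EndMatching ι)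
    (hs : ∀ s n n', ι (s, n) = (s, n') → ¬ (n < 0 ↔ n' < 0)) (s : Bool)
    (hf : ∃ p : ℕ, (ι (s, p)).1 ≠ s) :
    ∃ p : ℤ, 0 ≤ p ∧ ∀ n, (ι (s, n)).1 = s ↔ -p ≤ n ∧ n < p := by
  classical
  have eq : ∀ n, (ι (s, n)).1 = s → ι (s, n) = (s, -1 - n) := by
    intro n hn
    have : ι (s, n) = (s, (ι (s, n)).2) := Prod.ext hn rfl
    rw [this, h.eq_neg hs this]
  have down : ∀ n, 0 ≤ n → (ι (s, n)).1 = s → ∀ i, 0 ≤ i → i ≤ n → (ι (s, i)).1 = s := by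
    intro n h0 hn i hi hin
    rcases hin.lt_or_eq with h1 | rfl
    · have h2 := eq n hn
      have h3 : ι (s, -1 - n) = (s, n) := by rw [← h2, h.invol]
      obtain ⟨y, hy, -⟩ := h.inside h3 (show -1 - n < i by omega) h1
      rw [hy]
    · exact hn
  have neg : ∀ n, (ι (s, n)).1 = s ↔ (ι (s, -1 - n)).1 = s := by
    have : ∀ n, (ι (s, n)).1 = s → (ι (s, -1 - n)).1 = s := by
      intro n hn
      rw [← eq n hn, h.invol]
    intro n
    exact ⟨this n, fun h => by simpa using this _ h⟩
  have pos : ∀ n : ℤ, 0 ≤ n → ((ι (s, n)).1 = s ↔ n < Nat.find hf) := by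
    intro n hn
    constructor
    · intro h1
      by_contra hc
      exact Nat.find_spec hf (down n hn h1 _ (by omega) (by omega))
    · intro h1
      by_contra hc
      refine Nat.find_min hf (m := n.toNat) (by omega) ?_
      rwa [Int.toNat_of_nonneg hn]
  refine ⟨Nat.find hf, by omega, fun n => ?_⟩
  rcases le_or_gt 0 n with h0 | h0
  · rw [pos n h0]
    omega
  · rw [neg n, pos _ (by omega)]
    omega

/-- Close the ends at the bottom. -/
def close (e : Bool × ℤ) : Bool × ℤ := if e.1 then e else (e.1, 1 - e.2)

/-- The returning lines at the bottom together with the closing form a spiral joining `-p` to `p`.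
The propagating lines preserve the order, which together with their behaviour far away fixes them
completely. So the closing at the bottom appears at the top as the standard matching. -/
theorem link_close (h : EndMatching ι)
    (hs : ∀ s n n', ι (s, n) = (s, n') → ¬ (n < 0 ↔ n' < 0)) {N d : ℤ}
    (hr : ∀ n, N ≤ n → ι (false, n) = (true, n - 1 + d))
    (hl : ∀ n, n ≤ -N → ι (false, n) = (true, n - 1 - d)) :
    (∀ u, Link ι close (true, u) (true, -1 - u)) ∧ ∀ e, ∃ u, Link ι close e (true, u) := by
  obtain ⟨p, hp, hpS⟩ := h.exists_range hs false ⟨N.toNat, by rw [hr _ (by omega)]; simp⟩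
  obtain ⟨q, hq, hqS⟩ := h.exists_range hs true ⟨(N + |d|).toNat, by
    have h1 := hr ((N + |d|).toNat + 1 - d) (by
      have := le_abs_self d
      omega)
    have : ι (true, ((N + |d|).toNat : ℤ)) = (false, (N + |d|).toNat + 1 - d) := by
      rw [← h.invol (false, _), h1]
      congr 2
      ring
    rw [this]
    simp⟩
  have eq : ∀ s n, (ι (s, n)).1 = s → ι (s, n) = (s, -1 - n) := by
    intro s n hn
    have : ι (s, n) = (s, (ι (s, n)).2) := Prod.ext hn rfl
    rw [this, h.eq_neg hs this]
  -- `J p` numbers the ends outside of the central block `-p ≤ n < p`, and `U p` is its inverse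
  -- there; in this numbering the propagating lines form an order-preserving bijection `g` of the
  -- integers.
  obtain ⟨J, hJ⟩ : ∃ J : ℤ → ℤ → ℤ, J = fun p w => if 0 ≤ w then w + p else w - p := ⟨_, rfl⟩
  obtain ⟨U, hU⟩ : ∃ U : ℤ → ℤ → ℤ, U = fun p w => if 0 ≤ w then w - p else w + p := ⟨_, rfl⟩
  have JU : ∀ p n, 0 ≤ p → ¬ (-p ≤ n ∧ n < p) → J p (U p n) = n := by
    intro p n hp hn
    simp only [hJ, hU]
    split_ifs <;> omega
  have UJ : ∀ p n, 0 ≤ p → U p (J p n) = n := by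
    intro p n hp
    simp only [hJ, hU]
    split_ifs <;> omega
  have Jout : ∀ p w, 0 ≤ p → ¬ (-p ≤ J p w ∧ J p w < p) := by
    intro p w hp
    simp only [hJ]
    split_ifs <;> omega
  have Jmono : ∀ p w w', 0 ≤ p → (J p w < J p w' ↔ w < w') := by
    intro p w w' hp
    simp only [hJ]
    split_ifs <;> omega
  obtain ⟨g, hg⟩ : ∃ g : ℤ → ℤ, g = fun w => U q (ι (false, J p w)).2 := ⟨_, rfl⟩
  have hJg : ∀ w, ι (false, J p w) = (true, J q (g w)) := by
    intro w
    have h1 : (ι (false, J p w)).1 ≠ false := by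
      rw [Ne, hpS]
      exact Jout p w hp
    have h2 : ι (false, J p w) = (true, (ι (false, J p w)).2) := Prod.ext (by simpa using h1) rfl
    have h3 : (ι (true, (ι (false, J p w)).2)).1 ≠ true := by
      rw [← h2, h.invol]
      simp
    rw [Ne, hqS] at h3
    rw [h2, hg]
    dsimp only
    rw [JU q _ hq h3]
  have gmono : StrictMono g := by
    intro w w' hw
    have h1 := (Jmono p w w' hp).2 hw
    have h2 := h.nc (false, J p w) (false, J p w') (by simp; omega) (by rw [hJg]; simp)
    rw [hJg, hJg] at h2
    simp [EndLt, h1] at h2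
    exact (Jmono q _ _ hq).1 h2
  have gsurj : Function.Surjective g := by
    intro z
    have h1 : (ι (true, J q z)).1 ≠ true := by
      rw [Ne, hqS]
      exact Jout q z hq
    have h2 : ι (true, J q z) = (false, (ι (true, J q z)).2) := Prod.ext (by simpa using h1) rfl
    have h3 : (ι (false, (ι (true, J q z)).2)).1 ≠ false := by
      rw [← h2, h.invol]
      simp
    rw [Ne, hpS] at h3
    refine ⟨U p (ι (true, J q z)).2, ?_⟩
    rw [hg]
    dsimp only
    rw [JU p _ hp h3, ← h2, h.invol]
    exact UJ q z hq
  have hg0 := Int.eq_add_of_strictMono gmono gsurj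
  -- Let `c = p + d - q`. The right end gives `g 0 = c - 1` and the left end gives `g 0 = -c - 1`;
  -- hence `c = 0`.
  have g0 : g 0 = -1 := by
    have a1 : g (|N| + |d| + q + 2) = |N| + |d| + q + 2 + p - 1 + d - q := by
      have e1 : J p (|N| + |d| + q + 2) = |N| + |d| + q + 2 + p := by
        simp only [hJ]
        rw [if_pos (by positivity)]
      rw [hg]
      dsimp only
      rw [e1, hr _ (by have := le_abs_self N; have := abs_nonneg d; omega), hU]
      dsimp only
      rw [if_pos (by have := abs_nonneg N; have := neg_abs_le d; omega)]
    have a2 : g (-(|N| + |d| + q + 2)) = -(|N| + |d| + q + 2) - p - 1 - d + q := by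
      have e1 : J p (-(|N| + |d| + q + 2)) = -(|N| + |d| + q + 2) - p := by
        simp only [hJ]
        rw [if_neg (by have := abs_nonneg N; have := abs_nonneg d; omega)]
      rw [hg]
      dsimp only
      rw [e1, hl _ (by have := le_abs_self N; have := abs_nonneg d; omega), hU]
      dsimp only
      rw [if_neg (by have := abs_nonneg N; have := neg_abs_le d; omega)]
    have b1 := hg0 (|N| + |d| + q + 2)
    have b2 := hg0 (-(|N| + |d| + q + 2))
    omega
  have prop : ∀ w, Link ι close (false, J p w) (true, J q (w - 1)) := by
    intro w
    have := Link.left (f := ι) (g := close) (false, J p w)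
    rw [hJg, hg0 w, g0] at this
    exact this
  have cl : ∀ v, Link ι close (false, v) (false, 1 - v) := fun v =>
    .right (f := ι) (g := close) (false, v)
  have step : ∀ v, -p ≤ v → v < p → Link ι close (false, v) (false, v + 2) := by
    intro v h1 h2
    have h3 := Link.left (f := ι) (g := close) (false, v)
    rw [eq false v ((hpS v).2 ⟨h1, h2⟩)] at h3
    have h4 := cl (-1 - v)
    rw [show 1 - (-1 - v) = v + 2 by ring] at h4
    exact h3.trans h4
  -- A returning line followed by the closing moves two steps to the right: `v`, then `-1 - v`, then
  -- `v + 2`. Starting at `-p` this leaves the central block exactly at `p`.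
  have climb : ∀ t : ℕ, t ≤ p → Link ι close (false, -p) (false, -p + 2 * t) := by
    intro t
    induction t with
    | zero => 
      intro _
      simpa using Link.refl _
    | succ t ih =>
      intro ht
      push_cast at ht
      have h1 := step (-p + 2 * t) (by omega) (by omega)
      rw [show -p + 2 * (t : ℤ) + 2 = -p + 2 * ((t + 1 : ℕ) : ℤ) by push_cast; ring] at h1
      exact (ih (by omega)).trans h1
  have J0 : J p 0 = p := by simp [hJ]
  -- The closing joins the propagating end numbered `z + 1` to the one numbered `-z`. Only for `z =
  -- 0` does it land in the block or on its border `-p`, from where the spiral leads on to `p`.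
  have pos : ∀ z, 0 ≤ z → Link ι close (true, J q z) (true, J q (-1 - z)) := by
    intro z hz
    have h1 := prop (z + 1)
    rw [add_sub_cancel_right] at h1
    have e1 : J p (z + 1) = z + 1 + p := by
      simp only [hJ]
      rw [if_pos (by omega)]
    have h2 := cl (J p (z + 1))
    rw [e1, show 1 - (z + 1 + p) = -z - p by ring] at h2
    rw [e1] at h1
    refine h1.symm.trans (h2.trans ?_)
    by_cases h0 : z = 0
    · subst h0
      have h3 := climb p.toNat (by omega)
      rw [Int.toNat_of_nonneg hp, show -p + 2 * p = J p 0 by rw [J0]; ring] at h3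
      have h4 := prop 0
      rw [show (0 : ℤ) - 1 = -1 - 0 by ring] at h4
      simpa using h3.trans h4
    · have e2 : J p (-z) = -z - p := by
        simp only [hJ]
        rw [if_neg (by omega)]
      have h3 := prop (-z)
      rw [e2, show -z - 1 = -1 - z by ring] at h3
      exact h3
  constructor
  · intro u
    by_cases hu : (ι (true, u)).1 = true
    · rw [← eq true u hu]
      exact .left _
    · rw [hqS] at hu
      have e1 := JU q u hq hu
      have e2 : J q (-1 - U q u) = -1 - u := by
        rw [← e1, UJ q _ hq]
        simp only [hJ]
        split_ifs <;> omega
      rcases le_or_gt 0 (U q u) with h0 | h0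
      · have := pos _ h0
        rwa [e1, e2] at this
      · have := pos (-1 - U q u) (by omega)
        rw [sub_sub_cancel, e1, e2] at this
        exact this.symm
  · rintro ⟨s, v⟩
    cases s
    · have out : ∀ v, ¬ (-p ≤ v ∧ v < p) → ∃ u, Link ι close (false, v) (true, u) := by
        intro v hv
        have := prop (U p v)
        rw [JU p v hp hv] at this
        exact ⟨_, this⟩
      -- From inside of the block the spiral climbs to the right until it meets a propagating line.
      have : ∀ t : ℕ, ∀ v, p - v ≤ t → ∃ u, Link ι close (false, v) (true, u) := by
        intro t
        induction t with
        | zero => exact fun v hv => out v (by push_cast at hv; omega)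
        | succ t ih =>
          intro v hv
          by_cases hin : -p ≤ v ∧ v < p
          · obtain ⟨u, hu⟩ := ih (v + 2) (by push_cast at hv; omega)
            exact ⟨u, (step v hin.1 hin.2).trans hu⟩
          · exact out v hin
      exact this (p - v).toNat v (by omega)
    · exact ⟨v, .refl _⟩

/-- A matching of the ends at the top that is standard far away is standard, unless it
contains a small arc on the left. -/
theorem eq_of_no_small_arc {ι : ℤ → ℤ} (invol : ∀ u, ι (ι u) = u) (hne : ∀ u, ι u ≠ u)
    (nc : ∀ e f, f ≠ e → f ≠ ι e → ((e < f ↔ ι e < f) ↔ (e < ι f ↔ ι e < ι f))) {N : ℤ}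
    (far : ∀ u, N ≤ u → ι u = -1 - u) (small : ∀ i, i + 1 < 0 → ι i ≠ i + 1) (u : ℤ) :
    ι u = -1 - u := by
  have inj : ∀ a b, ι a = ι b → a = b := fun a b h => by rw [← invol a, h, invol]
  have inside : ∀ l x, l < x → x < ι l → l < ι x ∧ ι x < ι l := by
    intro l x h1 h2
    have h3 := nc l x (by omega) (by omega)
    have h4 : ι x ≠ ι l := fun h => by
      have := inj _ _ h
      omega
    omega
  -- An arc entirely on the left encloses a shorter one starting at the next point, and finally one
  -- joining neighbours, which is excluded.
  have nonneg : ∀ n : ℕ, ∀ l, l < ι l → ι l - l ≤ n → 0 ≤ ι l := by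
    intro n
    induction n with
    | zero =>
      intro l h1 h2
      push_cast at h2
      omega
    | succ n ih =>
      intro l h1 h2
      by_contra hc
      have h3 := small l (by omega)
      obtain ⟨h4, h5⟩ := inside l (l + 1) (by omega) (by omega)
      have h6 := hne (l + 1)
      have := ih (l + 1) (by omega) (by push_cast at h2; omega)
      omega
  have nonneg' : ∀ l, l < 0 → 0 ≤ ι l := by
    intro l hl
    rcases lt_or_gt_of_ne (hne l) with h1 | h1
    · have := nonneg (l - ι l).toNat (ι l) (by rwa [invol]) (by rw [invol]; omega)
      rw [invol] at this
      omega
    · exact nonneg (ι l - l).toNat l h1 (by omega)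
  -- Induction from the far right towards the middle. Once all larger values are taken, the points
  -- from `-1 - i` to `-1` are matched bijectively with those from `0` to `i`, and noncrossing
  -- forces the partner of `i` to be the outermost one.
  have main : ∀ k : ℕ, ∀ i, 0 ≤ i → N - k ≤ i → ι (-1 - i) = i := by
    intro k
    induction k with
    | zero =>
      intro i _ hi
      rw [← far i (by push_cast at hi; omega), invol]
    | succ k ih =>
      intro i h0 hi
      have big : ∀ x, -1 - i ≤ x → x < 0 → ι x ≤ i := by
        intro x h1 h2
        by_contra hc
        have h3 := ih (ι x) (by omega) (by push_cast at hi; omega)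
        have := inj _ x h3
        omega
      have hmaps : ∀ x ∈ Finset.Icc (-1 - i) (-1), ι x ∈ Finset.Icc 0 i := by
        intro x hx
        rw [Finset.mem_Icc] at hx ⊢
        exact ⟨nonneg' x (by omega), big x hx.1 (by omega)⟩
      obtain ⟨z, hz, hzi⟩ := Finset.surj_on_of_inj_on_of_card_le
        (s := Finset.Icc (-1 - i) (-1)) (t := Finset.Icc 0 i) (fun x _ => ι x)
        hmaps (fun a b _ _ h => inj _ _ h) (by rw [Int.card_Icc, Int.card_Icc]; omega) i
        (by rw [Finset.mem_Icc]; omega)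
      rw [Finset.mem_Icc] at hz
      by_cases h1 : z = -1 - i
      · rw [← h1, ← hzi]
      · have h2 := hmaps (-1 - i) (by rw [Finset.mem_Icc]; omega)
        rw [Finset.mem_Icc] at h2
        have h3 := inside (-1 - i) z (by omega) (by omega)
        omega
  rcases le_or_gt 0 u with h | h
  · have := main (N - u).toNat u h (by omega)
    rw [← this, invol, this]
  · have := main (N - (-1 - u)).toNat (-1 - u) (by omega) (by omega)
    rwa [sub_sub_cancel] at this

end EndMatching

/-! ### Closings of a window at the top. -/

/-- A family of closings at the top. -/
def closing (p n u : ℤ) : ℤ :=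
  if 1 - p ≤ u ∧ u ≤ p then 1 - u
  else if -p - 3 ≤ u ∧ u ≤ -p then -2 * p - 3 - u
  else if -n ≤ u ∧ u ≤ n - 3 then -3 - u
  else if u = n - 2 then n - 1
  else if u = n - 1 then n - 2 else u

section Closing

variable {p n : ℤ}

/-- The closing consists of a block of concentric arcs around `1/2`, to its left two nested arcs
whose inner one joins `-p - 2` to `-p - 1`, around both of them concentric arcs with centre `-3/2`,
and one small arc at the right border. Varying `p` moves the inner small arc through all places on
the left. -/
theorem closing_cases (hp : 0 ≤ p) (hn : p + 3 ≤ n) (u : ℤ) :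
    (1 - p ≤ u ∧ u ≤ p ∧ closing p n u = 1 - u) ∨
    (-p - 3 ≤ u ∧ u ≤ -p ∧ closing p n u = -2 * p - 3 - u) ∨
    (p < u ∧ u ≤ n - 3 ∧ closing p n u = -3 - u) ∨
    (-n ≤ u ∧ u < -p - 3 ∧ closing p n u = -3 - u) ∨
    (u = n - 2 ∧ closing p n u = n - 1) ∨ (u = n - 1 ∧ closing p n u = n - 2) ∨
    (u < -n ∧ closing p n u = u) ∨ (n ≤ u ∧ closing p n u = u) := by
  unfold closing
  split_ifs <;> omega

theorem closing_nonCrossing (hp : 0 ≤ p) (hn : p + 3 ≤ n) : NonCrossing (closing p n) where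
  invol u := by
    have h1 := closing_cases hp hn u
    have h2 := closing_cases hp hn (closing p n u)
    omega
  nc a b h1 h2 := by
    have h3 := closing_cases hp hn a
    have h4 := closing_cases hp hn b
    generalize closing p n a = a' at *
    generalize closing p n b = b' at *
    rcases h3 with h3 | h3 | h3 | h3 | h3 | h3 | h3 | h3 <;>
      rcases h4 with h4 | h4 | h4 | h4 | h4 | h4 | h4 | h4 <;> omega
  fix a b h1 h2 := by
    have h3 := closing_cases hp hn a
    have h4 := closing_cases hp hn b
    omega

theorem closing_ne (hp : 0 ≤ p) (hn : p + 3 ≤ n) {u : ℤ} (h1 : -n ≤ u) (h2 : u < n) :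
    closing p n u ≠ u := by
  have h3 := closing_cases hp hn u
  omega

theorem closing_bounds (hp : 0 ≤ p) (hn : p + 3 ≤ n) {u : ℤ} (h1 : -n ≤ u) (h2 : u < n) :
    -n ≤ closing p n u ∧ closing p n u < n := by
  have h3 := closing_cases hp hn u
  omega

/-- The points at which two consecutive closings differ. -/
def closingPoints (p : ℤ) : Fin 6 → ℤ := ![-p - 4, -p - 3, -p - 2, -p - 1, -p, p + 1]

theorem closingPoints_strictMono (hp : 0 ≤ p) : StrictMono (closingPoints p) := by
  rw [Fin.strictMono_iff_lt_succ]
  intro i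
  fin_cases i <;> (simp [closingPoints]; try omega)

/-- Together with `closing_after` and `closing_off` this shows that lowering the parameter by one is
a move on a hexagon, to which the theorem on two surgeries applies. -/
theorem closing_before (hp : 0 ≤ p) (hn : p + 4 ≤ n) (i : Fin 6) :
    closing (p + 1) n (closingPoints p i) = closingPoints p (hexBefore i) := by
  have h3 := closing_cases (p := p + 1) (n := n) (by omega) (by omega) (closingPoints p i)
  fin_cases i <;> simp [closingPoints, hexBefore] at h3 ⊢ <;> omega

theorem closing_after (hp : 0 ≤ p) (hn : p + 4 ≤ n) (i : Fin 6) :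
    closing p n (closingPoints p i) = closingPoints p (hexAfter i) := by
  have h3 := closing_cases hp (show p + 3 ≤ n by omega) (closingPoints p i)
  fin_cases i <;> simp [closingPoints, hexAfter] at h3 ⊢ <;> omega

theorem closing_off (hp : 0 ≤ p) (hn : p + 4 ≤ n) {u : ℤ} (hu : ∀ i, closingPoints p i ≠ u) :
    closing p n u = closing (p + 1) n u := by
  have h1 := closing_cases hp (show p + 3 ≤ n by omega) u
  have h2 := closing_cases (p := p + 1) (n := n) (by omega) (by omega) u
  have a0 : -p - 4 ≠ u := hu 0
  have a1 : -p - 3 ≠ u := hu 1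
  have a2 : -p - 2 ≠ u := hu 2
  have a3 : -p - 1 ≠ u := hu 3
  have a4 : -p ≠ u := hu 4
  have a5 : p + 1 ≠ u := hu 5
  omega

/-- Alternating between `u ↔ -1 - u` and the closing leads from every positive number to a smaller
nonnegative one, mostly in steps of two; at `p + 1` and `p + 2` the two nested arcs bring the path
back into the inner block. -/
theorem closing_connected (hp : 0 ≤ p) (hn : p + 3 ≤ n) {r : ℤ → ℤ → Prop} (hr : Equivalence r)
    (h1 : ∀ u, r u (-1 - u)) (h2 : ∀ u, r u (closing p n u)) {u : ℤ} (hu : -n ≤ u) (hu' : u < n) :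
    r u 0 := by
  have pos : ∀ k : ℕ, (k : ℤ) < n → r k 0 := by
    intro k
    induction k using Nat.strong_induction_on with
    | _ k ih =>
      intro hk
      have via : ∀ v : ℤ, 0 ≤ v → v < k → r k v → r k 0 := by
        intro v hv0 hv hkv
        have := ih v.toNat (by omega) (by omega)
        rw [Int.toNat_of_nonneg hv0] at this
        exact hr.trans hkv this
      have c := closing_cases hp hn k
      have c' := closing_cases hp hn (-1 - k)
      have d := h2 k
      have d' := h2 (-1 - k)
      rcases Nat.eq_zero_or_pos k with rfl | h0
      · exact hr.refl _
      · by_cases a : (k : ℤ) ≤ p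
        · have e : closing p n k = 1 - k := by omega
          rw [e] at d
          by_cases b : k = 1
          · refine via 0 le_rfl (by omega) ?_
            rw [b] at d ⊢
            exact d
          · refine via (k - 2) (by omega) (by omega) (hr.trans d ?_)
            have := h1 (1 - k)
            rwa [show -1 - (1 - (k : ℤ)) = k - 2 by ring] at this
        · by_cases b : (k : ℤ) ≤ p + 2
          · have e : closing p n (-1 - k) = -2 * p - 2 + k := by omega
            rw [e] at d'
            have f := hr.trans (h1 k) d'
            by_cases b0 : -2 * p - 2 + (k : ℤ) = 0
            · rw [b0] at f
              exact f
            · refine via (2 * p + 1 - k) (by omega) (by omega) (hr.trans f ?_)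
              have := h1 (-2 * p - 2 + k)
              rwa [show -1 - (-2 * p - 2 + (k : ℤ)) = 2 * p + 1 - k by ring] at this
          · have e : closing p n (-1 - k) = -2 + k := by omega
            rw [e] at d'
            exact via (-2 + k) (by omega) (by omega) (hr.trans (h1 k) d')
  rcases le_or_gt 0 u with h | h
  · have := pos u.toNat (by omega)
    rwa [Int.toNat_of_nonneg h] at this
  · have := pos (-1 - u).toNat (by omega)
    rw [Int.toNat_of_nonneg (by omega)] at this
    exact hr.trans (h1 u) this

end Closing

/-! ### The criterion for orientability. -/

theorem Dart.flip_ne (d : Dart) : d.flip ≠ d := by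
  rcases d with ⟨j, u, c⟩
  cases u <;> simp [Dart.flip]

namespace StackedDiagram

variable {E : StackedDiagram} {κ κ' : ℤ → ℤ} {M : ℤ}

theorem eventually_mem_window {m : ℕ} {d : Dart} (hd : d.1 ≤ m) : ∃ M₀, ∀ M, M₀ ≤ M → d ∈ window m M := by
  refine ⟨|d.pos| + 1, fun M hM => ⟨hd, ?_⟩⟩
  have h1 := neg_abs_le d.pos
  have h2 := le_abs_self d.pos
  omega

theorem arcs_involutive (hκ : NonCrossing κ) (hκ' : NonCrossing κ') :
    Function.Involutive (E.arcs κ κ') := (arcs_planar hκ hκ').invol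

variable (E κ κ') in
/-- The diagram preserves large windows. -/
def Bounded : Prop := ∃ M₀, ∀ M, M₀ ≤ M → ∀ d ∈ window E.middle.length M,
  E.arcs κ κ' d ∈ window E.middle.length M

/-- The fixed points of the diagram are matched. -/
theorem exists_matching (hκ : NonCrossing κ) (hκ' : NonCrossing κ') (hb : E.Bounded κ κ')
    {I : Type*} {ed : I → Dart} (hinj : Function.Injective ed)
    (hfix : ∀ d, d.1 ≤ E.middle.length → E.arcs κ κ' d = d → ∃ i, ed i = d)
    (hed : ∀ i, (ed i).1 ≤ E.middle.length ∧ E.arcs κ κ' (ed i) = ed i) :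
    ∃ ι : I → I, (∀ e, ι (ι e) = e) ∧ (∀ e, ι e ≠ e) ∧
      (∀ e f, Link Dart.flip (E.arcs κ κ') (ed e) (ed f) ↔ f = e ∨ f = ι e) ∧
      ∀ e f, f ≠ e → f ≠ ι e → (((ed e).Lt (ed f) ↔ (ed (ι e)).Lt (ed f)) ↔
        ((ed e).Lt (ed (ι f)) ↔ (ed (ι e)).Lt (ed (ι f)))) := by
  obtain ⟨M₀, hM₀⟩ := hb
  have hp := arcs_planar (E := E) hκ hκ'
  -- Inside of a large invariant window the diagram is finite, so the line starting at an end has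
  -- another end.
  have ex : ∀ e, ∃ f, f ≠ e ∧ Link Dart.flip (E.arcs κ κ') (ed e) (ed f) := by
    intro e
    obtain ⟨M₁, hM₁⟩ := eventually_mem_window (hed e).1
    have hW := hM₀ _ (le_max_left M₀ M₁)
    obtain ⟨y, h1, h2, h3⟩ := Link.exists_fixed_of_finite (window_finite _ _) Dart.flip_flip hp.invol
      flip_mem_window hW (hM₁ _ (le_max_right M₀ M₁)) (hed e).2
        Dart.flip_ne
    obtain ⟨f, rfl⟩ := hfix y ((Link.mem_iff Dart.flip_flip hp.invol flip_mem_window hW h3).1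
      (hM₁ _ (le_max_right M₀ M₁))).1 h2
    exact ⟨f, fun h => h1 (by rw [h]), h3⟩
  choose ι hι1 hι2 using ex
  have link : ∀ e f, Link Dart.flip (E.arcs κ κ') (ed e) (ed f) ↔ f = e ∨ f = ι e := by
    intro e f
    constructor
    · intro h
      by_cases hfe : f = e
      · exact Or.inl hfe
      · exact Or.inr (hinj (Link.eq_of_fixed Dart.flip_flip hp.invol (hed e).2 (hed f).2
          (hed (ι e)).2 h (hι2 e) (fun h => hfe (hinj h)) (fun h => hι1 e (hinj h))))
    · rintro (rfl | rfl)
      · exact .refl _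
      · exact hι2 e
  refine ⟨ι, fun e => ?_, hι1, link, fun e f h1 h2 => ?_⟩
  · rcases (link (ι e) e).1 (hι2 e).symm with h | h
    · exact absurd h.symm (hι1 e)
    · exact h.symm
  · obtain ⟨M₁, hM₁⟩ := eventually_mem_window (hed e).1
    obtain ⟨M₂, hM₂⟩ := eventually_mem_window (hed f).1
    have hW := hM₀ (max M₀ (max M₁ M₂)) (by omega)
    have := hp.ends_nc (window_finite _ _) flip_mem_window hW (hM₁ _ (by omega))
      (hM₂ _ (by omega)) (hed e).2 (hed (ι e)).2 (hed f).2 (hed (ι f)).2 (hι2 e)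
      (fun h => hι1 e (hinj h)) (hι2 f) (fun h => by
        rcases (link e f).1 h with h | h
        · exact h1 h
        · exact h2 h)
    rw [← Dart.sum_left]
    generalize Dart.darts.left (ed e) (ed f) = a at *
    generalize Dart.darts.left (ed (ι e)) (ed f) = b at *
    generalize Dart.darts.left (ed e) (ed (ι f)) = c at *
    generalize Dart.darts.left (ed (ι e)) (ed (ι f)) = d at *
    revert a b c d
    decide

theorem arcs_mono {κ₁ κ₁' : ℤ → ℤ} (h : ∀ n, κ₁ n = n ∨ κ₁ n = κ n) (h' : ∀ n, κ₁' n = n ∨ κ₁' n = κ' n)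
    (d : Dart) : E.arcs κ₁ κ₁' d = d ∨ E.arcs κ₁ κ₁' d = E.arcs κ κ' d := by
  by_cases hd : (E.sec d.zone).mate d.2.2 = d.2.2
  · obtain ⟨⟨j, u, n⟩, rfl⟩ := exists_rayDart hd
    rw [arcs_rayDart, arcs_rayDart]
    have : joinRays E.middle.length κ₁ κ₁' (j, u, n) = (j, u, n) ∨
        joinRays E.middle.length κ₁ κ₁' (j, u, n) = joinRays E.middle.length κ κ' (j, u, n) := by
      unfold joinRays
      cases u
      · by_cases h0 : j = 0
        · simp [h0, h]
        · simp [h0]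
      · by_cases h0 : j < E.middle.length
        · simp [h0]
        · by_cases h1 : j = E.middle.length
          · simp [h1, h']
          · simp [h0, h1]
    rcases this with h | h
    · exact Or.inl (by rw [h])
    · exact Or.inr (by rw [h])
  · right
    rw [arcs_cup hd, arcs_cup hd]

theorem link_mono {κ₁ κ₁' : ℤ → ℤ} (h : ∀ n, κ₁ n = n ∨ κ₁ n = κ n) (h' : ∀ n, κ₁' n = n ∨ κ₁' n = κ' n)
    {d e : Dart} (hl : Link Dart.flip (E.arcs κ₁ κ₁') d e) : Link Dart.flip (E.arcs κ κ') d e :=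
  Link.of_rel (r := Link Dart.flip (E.arcs κ κ')) ⟨.refl, .symm, .trans⟩ (fun d => .left d) (fun d => by
    rcases arcs_mono h h' d with h1 | h1
    · rw [h1]
      exact .refl d
    · rw [h1]
      exact .right d) hl

/-- Closing the rays at the top changes nothing for the other points. -/
theorem arcs_eq_or {κ₁ κ₁' : ℤ → ℤ} {d : Dart} (hd : d.1 ≤ E.middle.length) :
    E.arcs κ κ' d = E.arcs κ₁ κ₁' d ∨ (∃ v, d = E.bottomEnd v) ∨ ∃ u, d = E.topEnd u := by
  by_cases hm : (E.sec d.zone).mate d.2.2 = d.2.2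
  · obtain ⟨⟨j, u, n⟩, rfl⟩ := exists_rayDart hm
    have hd' : j ≤ E.middle.length := hd
    rw [arcs_rayDart, arcs_rayDart]
    unfold joinRays
    cases u
    · by_cases h0 : j = 0
      · subst h0
        exact Or.inr (Or.inl ⟨n, rfl⟩)
      · simp [h0]
    · by_cases h0 : j < E.middle.length
      · simp [h0]
      · obtain rfl : j = E.middle.length := by omega
        exact Or.inr (Or.inr ⟨n, rfl⟩)
  · exact Or.inl (by rw [arcs_cup hm, arcs_cup hm])

theorem arcs_eq_or' {κ₁' : ℤ → ℤ} {d : Dart} (hd : d.1 ≤ E.middle.length) :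
    E.arcs κ κ' d = E.arcs κ κ₁' d ∨ ∃ u, d = E.topEnd u := by
  rcases arcs_eq_or (κ := κ) (κ₁ := κ) (κ' := κ') (κ₁' := κ₁') hd with h | ⟨v, rfl⟩ | h
  · exact Or.inl h
  · exact Or.inl (by rw [arcs_bottomEnd, arcs_bottomEnd])
  · exact Or.inr h

variable (E) in
/-- The dart at an end of a line. -/
noncomputable def endDart (e : Bool × ℤ) : Dart := if e.1 then E.topEnd e.2 else E.bottomEnd e.2

theorem endDart_injective : Function.Injective E.endDart := by
  rintro ⟨s, n⟩ ⟨s', n'⟩ h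
  cases s <;> cases s' <;> simp only [endDart, if_true, Bool.false_eq_true, if_false] at h
  · rw [bottomEnd_injective h]
  · exact absurd h (bottomEnd_ne_topEnd _ _)
  · exact absurd h.symm (bottomEnd_ne_topEnd _ _)
  · rw [topEnd_injective h]

theorem endDart_le (e : Bool × ℤ) : (E.endDart e).1 ≤ E.middle.length := by
  rcases e with ⟨s, n⟩
  cases s
  exacts [bottomEnd_le n, topEnd_le n]

theorem endDart_lt {e f : Bool × ℤ} : (E.endDart e).Lt (E.endDart f) ↔ EndLt e f := by
  rcases e with ⟨s, n⟩
  rcases f with ⟨s', n'⟩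
  have h0 := E.bottom.ray_strictMono.lt_iff_lt (a := n) (b := n')
  have h1 := E.top.ray_strictMono.lt_iff_lt (a := n) (b := n')
  cases s <;> cases s' <;>
    simp [endDart, bottomEnd_eq, topEnd_eq, Dart.Lt, EndLt, h0, h1]

variable (E) in
/-- The links of the diagram without any closing. -/
def OpenLink : Dart → Dart → Prop := Link Dart.flip (E.arcs (fun n => n) fun n => n)

/-- In terms of ray numbers the condition at the bottom, relative to `-1`, and that at the top,
relative to `0`, become the same condition on signs. -/
theorem orientable_iff : E.Orientable ↔
    (∀ d : Dart, d.1 ≤ E.middle.length → ∃ e, E.OpenLink d (E.endDart e)) ∧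
    ∀ s n n', n ≠ n' → E.OpenLink (E.endDart (s, n)) (E.endDart (s, n')) → ¬ (n < 0 ↔ n' < 0) := by
  have hb : ∀ x, E.IsBottomEnd x ↔ ∃ n, x = E.bottom.ray n := fun x =>
    ⟨fun h => ⟨_, (E.bottom.ray_idx h).symm⟩, by
      rintro ⟨n, rfl⟩
      exact E.bottom.mate_ray n⟩
  have ht : ∀ x, E.IsTopEnd x ↔ ∃ n, x = E.top.ray n + 1 := fun x => by
    unfold IsTopEnd CupDiagram.capMate
    constructor
    · intro h
      refine ⟨E.top.idx (x - 1), ?_⟩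
      rw [E.top.ray_idx (by omega)]
      ring
    · rintro ⟨n, rfl⟩
      rw [add_sub_cancel_right, CupDiagram.mate_ray]
  have hbl : ∀ n, E.bottom.BottomLeft (E.bottom.ray n) ↔ n < 0 := fun n => by
    rw [CupDiagram.bottomLeft_iff, CupDiagram.idx_ray]
  have htl : ∀ n, E.top.TopLeft (E.top.ray n + 1) ↔ n < 0 := fun n => by
    rw [CupDiagram.topLeft_iff, add_sub_cancel_right, CupDiagram.idx_ray]
  have tl : ∀ n, E.OpenLink (E.middle.length, false, E.top.ray n + 1) (E.topEnd n) := fun n => by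
    have h := Link.left (f := Dart.flip) (g := E.arcs (fun n => n) fun n => n)
      (E.middle.length, false, E.top.ray n + 1)
    have e : E.topEnd n = Dart.flip (E.middle.length, false, E.top.ray n + 1) := by
      simp [topEnd_eq, Dart.flip]
    rw [e]
    exact h
  have tr : ∀ {a b c}, E.OpenLink a b → E.OpenLink b c → E.OpenLink a c := fun h h' => Link.trans h h'
  have sy : ∀ {a b}, E.OpenLink a b → E.OpenLink b a := fun h => Link.symm h
  have cb : ∀ (v : ℕ × ℤ) (n : ℤ), v.1 ≤ E.middle.length →
      (E.Connected v (0, E.bottom.ray n) ↔ E.OpenLink (v.1, false, v.2) (E.bottomEnd n)) :=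
    fun v n hv => connected_iff hv
  have ct : ∀ (v : ℕ × ℤ) (n : ℤ), v.1 ≤ E.middle.length →
      (E.Connected v (E.middle.length, E.top.ray n + 1) ↔
        E.OpenLink (v.1, false, v.2) (E.topEnd n)) := fun v n hv => by
    rw [connected_iff hv]
    exact ⟨fun h => tr h (tl n), fun h => tr h (sy (tl n))⟩
  unfold Orientable
  constructor
  · rintro ⟨h1, h2, h3⟩
    constructor
    · intro d hd
      have hdv : E.OpenLink d (d.1, false, d.pos) := by
        rcases d with ⟨j, u, c⟩
        cases u
        · exact .refl _
        · exact .left (f := Dart.flip) (j, true, c)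
      rcases h1 (d.1, d.pos) hd with ⟨x, hx, h⟩ | ⟨x, hx, h⟩
      · obtain ⟨n, rfl⟩ := (hb x).1 hx
        exact ⟨(false, n), tr hdv ((cb (d.1, d.pos) n hd).1 h)⟩
      · obtain ⟨n, rfl⟩ := (ht x).1 hx
        exact ⟨(true, n), tr hdv ((ct (d.1, d.pos) n hd).1 h)⟩
    · intro s n n' hn h
      cases s
      · rw [← hbl n, ← hbl n']
        exact h2 _ _ (fun hc => hn (E.bottom.ray_strictMono.injective hc))
          ((hb _).2 ⟨n, rfl⟩) ((hb _).2 ⟨n', rfl⟩) ((cb (0, _) n' (Nat.zero_le _)).2 h)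
      · rw [← htl n, ← htl n']
        exact h3 _ _ (fun hc => hn (E.top.ray_strictMono.injective (by omega)))
          ((ht _).2 ⟨n, rfl⟩) ((ht _).2 ⟨n', rfl⟩)
          ((ct (E.middle.length, _) n' le_rfl).2 (tr (tl n) h))
  · rintro ⟨h1, h2⟩
    refine ⟨?_, ?_, ?_⟩
    · intro v hv
      obtain ⟨⟨s, n⟩, h⟩ := h1 (v.1, false, v.2) hv
      cases s
      · exact Or.inl ⟨_, (hb _).2 ⟨n, rfl⟩, (cb v n hv).2 h⟩
      · exact Or.inr ⟨_, (ht _).2 ⟨n, rfl⟩, (ct v n hv).2 h⟩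
    · intro x y hxy hx hy h
      obtain ⟨n, rfl⟩ := (hb x).1 hx
      obtain ⟨n', rfl⟩ := (hb y).1 hy
      rw [hbl, hbl]
      exact h2 false n n' (fun hc => hxy (by rw [hc])) ((cb (0, _) n' (Nat.zero_le _)).1 h)
    · intro x y hxy hx hy h
      obtain ⟨n, rfl⟩ := (ht x).1 hx
      obtain ⟨n', rfl⟩ := (ht y).1 hy
      rw [htl, htl]
      exact h2 true n n' (fun hc => hxy (by rw [hc]))
        (tr (sy (tl n)) ((ct (E.middle.length, _) n' le_rfl).1 h))

theorem Orientable.rot (h : E.Orientable) : E.rot.Orientable := by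
  rw [orientable_iff] at h ⊢
  have ee : ∀ s n, (E.endDart (s, n)).rot E.middle.length = E.rot.endDart (!s, -1 - n) := by
    intro s n
    cases s
    exacts [rot_bottomEnd n, rot_topEnd n]
  have ee' : ∀ s n, (E.rot.endDart (s, n)).rot E.middle.length = E.endDart (!s, -1 - n) := by
    intro s n
    have h1 := ee (!s) (-1 - n)
    rw [Bool.not_not, sub_sub_cancel] at h1
    rw [← h1, Dart.rot_rot (endDart_le _)]
  have hl : ∀ {d e : Dart}, d.1 ≤ E.middle.length → E.OpenLink d e →
      E.rot.OpenLink (d.rot E.middle.length) (e.rot E.middle.length) := by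
    intro d e hd h
    have := link_rot hd h
    rwa [rotIndex_id] at this
  have hl' : ∀ {d e : Dart}, d.1 ≤ E.middle.length → E.rot.OpenLink d e →
      E.OpenLink (d.rot E.middle.length) (e.rot E.middle.length) := by
    intro d e hd h
    have := link_rot (E := E.rot) (by rw [length_rot]; exact hd) h
    rwa [rotIndex_id, E.rot_rot, length_rot] at this
  constructor
  · intro d hd
    rw [length_rot] at hd
    obtain ⟨⟨s, n⟩, he⟩ := h.1 (d.rot E.middle.length) (Nat.sub_le _ _)
    have := hl (Nat.sub_le _ _) he
    rw [Dart.rot_rot hd, ee] at this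
    exact ⟨_, this⟩
  · intro s n n' hn hc
    have h1 := hl' (by rw [← length_rot]; exact endDart_le _) hc
    rw [ee', ee'] at h1
    have := h.2 (!s) (-1 - n) (-1 - n') (by omega) h1
    omega

theorem nonCrossing_one : NonCrossing fun n => 1 - n := .const_sub 1 odd_one

variable (E) in
/-- If the rays `v` and `1 - v` at the bottom are joined, then all lines have their ends at
the top, and these are `u` and `-1 - u`. -/
def TopCrit : Prop :=
  (∀ d : Dart, d.1 ≤ E.middle.length →
    ∃ u, Link Dart.flip (E.arcs (fun n => 1 - n) fun n => n) d (E.topEnd u)) ∧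
  ∀ u, Link Dart.flip (E.arcs (fun n => 1 - n) fun n => n) (E.topEnd u) (E.topEnd (-1 - u))

theorem TopCrit.eq (h : E.TopCrit) {u w : ℤ}
    (hl : Link Dart.flip (E.arcs (fun n => 1 - n) fun n => n) (E.topEnd u) (E.topEnd w)) :
    w = u ∨ w = -1 - u := by
  by_cases hw : w = u
  · exact Or.inl hw
  · refine Or.inr (topEnd_injective (Link.eq_of_fixed Dart.flip_flip (arcs_involutive nonCrossing_one .id)
      (arcs_topEnd u) (arcs_topEnd w) (arcs_topEnd _) hl (h.2 u) (fun h => hw (topEnd_injective h))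
      (fun h => ?_)))
    have := topEnd_injective h
    omega

/-- Closing the bottom only merges lines. So a circle would remain a component not reaching the top,
and a line with two ends at the top is still one after closing, hence joins `n` to `-1 - n`. The
lines at the bottom are treated by rotation. -/
theorem orientable_of_topCrit (h : E.TopCrit) (h' : E.rot.TopCrit) : E.Orientable := by
  rw [orientable_iff]
  constructor
  · intro d hd
    obtain ⟨u, hu⟩ := h.1 d hd
    by_contra hc
    push Not at hc
    have hle := Link.iff_of_invariant (f := Dart.flip) (g := E.arcs (fun n => 1 - n) fun n => n)
      (p := fun x => x.1 ≤ E.middle.length ∧ ∃ e, E.OpenLink x (E.endDart e)) ?_ ?_ hu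
    · exact (hle.2 ⟨topEnd_le u, (true, u), .refl _⟩).2.elim hc
    · intro x
      refine and_congr_right fun _ => ⟨?_, ?_⟩
      · rintro ⟨e, he⟩
        exact ⟨e, (Link.left (f := Dart.flip) x).trans he⟩
      · rintro ⟨e, he⟩
        exact ⟨e, (Link.left (f := Dart.flip) x).symm.trans he⟩
    · intro x
      rw [arcs_le]
      refine and_congr_right fun hx => ?_
      rcases arcs_eq_or (κ := fun n => 1 - n) (κ₁ := fun n => n) (κ' := fun n => n)
        (κ₁' := fun n => n) hx with h1 | ⟨v, rfl⟩ | ⟨u, rfl⟩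
      · rw [h1]
        constructor
        · rintro ⟨e, he⟩
          exact ⟨e, (Link.right (f := Dart.flip) x).trans he⟩
        · rintro ⟨e, he⟩
          exact ⟨e, (Link.right (f := Dart.flip) x).symm.trans he⟩
      · rw [arcs_bottomEnd]
        exact ⟨fun _ => ⟨(false, v), .refl _⟩, fun _ => ⟨(false, 1 - v), .refl _⟩⟩
      · rw [arcs_topEnd]
  · have top : ∀ {F : StackedDiagram}, F.TopCrit → ∀ n n', n ≠ n' →
        F.OpenLink (F.topEnd n) (F.topEnd n') → n' = -1 - n := by
      intro F hF n n' hn hl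
      rcases hF.eq (link_mono (fun _ => Or.inl rfl) (fun _ => Or.inl rfl) hl) with h | h
      · exact absurd h.symm hn
      · exact h
    intro s n n' hn hl
    cases s
    · have hl' : E.rot.OpenLink (E.rot.topEnd (-1 - n)) (E.rot.topEnd (-1 - n')) := by
        have := link_rot (bottomEnd_le n) hl
        rw [rotIndex_id, rot_bottomEnd] at this
        have e2 : (E.endDart (false, n')).rot E.middle.length = E.rot.topEnd (-1 - n') :=
          rot_bottomEnd n'
        rw [e2] at this
        exact this
      have := top h' _ _ (by omega) hl'
      omega
    · have := top h _ _ hn hl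
      omega

theorem bounded_id_id : E.Bounded (fun n => n) fun n => n := by
  obtain ⟨M₀, hM₀⟩ := E.exists_far
  exact ⟨M₀, fun M hM => arcs_mem_window (hM₀ M hM) (fun n h1 h2 => ⟨h1, h2⟩)
    fun n h1 h2 => ⟨h1, h2⟩⟩

theorem arcs_mem_window_closed (hF : E.Far M)
    (hκ' : ∀ n, -(M + 1 - E.top.numCups) ≤ n → n ≤ M - E.top.numCups →
      -(M + 1 - E.top.numCups) ≤ κ' n ∧ κ' n ≤ M - E.top.numCups) :
    ∀ d ∈ window E.middle.length M, E.arcs (fun n => 1 - n) κ' d ∈ window E.middle.length M :=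
  arcs_mem_window hF (fun n h1 h2 => by omega) hκ'

theorem bounded_one : E.Bounded (fun n => 1 - n) fun n => n := by
  obtain ⟨M₀, hM₀⟩ := E.exists_far
  exact ⟨M₀, fun M hM => arcs_mem_window_closed (hM₀ M hM) fun n h1 h2 => ⟨h1, h2⟩⟩

/-- The ends of an orientable diagram carry a noncrossing matching with the sign condition, standard
far away, and for such a matching the effect of the closing is computed in `EndMatching.link_close`.
-/
theorem Orientable.topCrit (h : E.Orientable) : E.TopCrit := by
  rw [orientable_iff] at h
  have hed : ∀ e, (E.endDart e).1 ≤ E.middle.length ∧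
      E.arcs (fun n => n) (fun n => n) (E.endDart e) = E.endDart e := by
    rintro ⟨s, n⟩
    refine ⟨endDart_le _, ?_⟩
    cases s
    exacts [arcs_bottomEnd n, arcs_topEnd n]
  obtain ⟨ι, invol, hne, hlink, hnc⟩ := exists_matching (E := E) .id .id bounded_id_id
    endDart_injective (fun d hd hf => by
      rcases exists_end hd hf with ⟨v, -, rfl⟩ | ⟨u, -, rfl⟩
      exacts [⟨(false, v), rfl⟩, ⟨(true, u), rfl⟩]) hed
  have hι : EndMatching ι := ⟨invol, hne, fun e f h1 h2 => by
    have := hnc e f h1 h2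
    simpa only [endDart_lt] using this⟩
  obtain ⟨M, hM⟩ := E.exists_far
  have hM := hM M le_rfl
  have far : ∀ e f, e ≠ f → E.OpenLink (E.endDart e) (E.endDart f) → ι e = f := by
    intro e f hef hl
    rcases (hlink e f).1 hl with h | h
    · exact absurd h.symm hef
    · exact h.symm
  obtain ⟨h1, h2⟩ := hι.link_close
    (fun s n n' hn => h.2 s n n' (fun hc => by
      rw [hc] at hn
      exact hne _ hn) (by
        refine (hlink _ _).2 (Or.inr hn.symm)))
    (N := |M| + E.bottom.numCups + 2) (d := E.bottom.numCups - E.top.numCups)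
    (fun n hn => far (false, n) (true, _) (by simp) (link_far_right hM (by
      have := le_abs_self M
      omega)))
    (fun n hn => far (false, n) (true, _) (by simp) (link_far_left hM (by
      have := le_abs_self M
      have := neg_abs_le M
      omega)))
  have lift : ∀ {e f}, Link ι EndMatching.close e f →
      Link Dart.flip (E.arcs (fun n => 1 - n) fun n => n) (E.endDart e) (E.endDart f) := by
    intro e f hl
    refine Link.of_rel (r := fun e f => Link Dart.flip (E.arcs (fun n => 1 - n) fun n => n)
      (E.endDart e) (E.endDart f)) ⟨fun _ => .refl _, .symm, .trans⟩ (fun e => ?_) (fun e => ?_) hl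
    · exact link_mono (κ₁ := fun n => n) (κ₁' := fun n => n) (fun _ => Or.inl rfl)
        (fun _ => Or.inl rfl) ((hlink e (ι e)).2 (Or.inr rfl))
    · rcases e with ⟨s, n⟩
      cases s
      · have := Link.right (f := Dart.flip) (g := E.arcs (fun n => 1 - n) fun n => n) (E.bottomEnd n)
        rwa [arcs_bottomEnd] at this
      · exact .refl _
  refine ⟨fun d hd => ?_, fun u => lift (h1 u)⟩
  obtain ⟨e, he⟩ := h.1 d hd
  obtain ⟨u, hu⟩ := h2 e
  exact ⟨u, (link_mono (κ₁ := fun n => n) (κ₁' := fun n => n) (fun _ => Or.inl rfl)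
        (fun _ => Or.inl rfl) he).trans (lift hu)⟩

theorem orientable_iff_topCrit : E.Orientable ↔ E.TopCrit ∧ E.rot.TopCrit :=
  ⟨fun h => ⟨h.topCrit, h.rot.topCrit⟩, fun h => orientable_of_topCrit h.1 h.2⟩

end StackedDiagram

/-! ### Connected closures and a single surgery. -/

namespace StackedDiagram

variable {E F : StackedDiagram} {κ κ' : ℤ → ℤ} {M p : ℤ}

variable (E) in
/-- The number of rays at the top of the window to the right of the middle. -/
noncomputable def topRays (M : ℤ) : ℤ := M + 1 - E.top.numCups

variable (E) in
/-- The diagram is connected inside of a window when it is closed at both ends. -/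
def ConnTop (p M : ℤ) : Prop := ∀ d ∈ window E.middle.length M, ∀ e ∈ window E.middle.length M,
  Link Dart.flip (E.arcs (fun n => 1 - n) (closing p (E.topRays M))) d e

variable (E) in
/-- The diagram is connected when it is closed at both ends. -/
def ConnInf : Prop := ∀ d : Dart, d.1 ≤ E.middle.length → ∀ e : Dart, e.1 ≤ E.middle.length →
  Link Dart.flip (E.arcs (fun n => 1 - n) (fun n => -3 - n)) d e

theorem topEnd_mem_window' (hF : E.Far M) (u : ℤ) : E.topEnd u ∈ window E.middle.length M ↔
    -E.topRays M ≤ u ∧ u < E.topRays M := by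
  rw [topEnd_mem_window hF, topRays]
  omega

theorem closed_mem_window (hF : E.Far M) (hp : 0 ≤ p) (hn : p + 3 ≤ E.topRays M) :
    ∀ d ∈ window E.middle.length M, E.arcs (fun n => 1 - n) (closing p (E.topRays M)) d ∈
      window E.middle.length M :=
  arcs_mem_window_closed hF fun n h1 h2 => by
    have := closing_bounds hp hn (u := n) (by unfold topRays; omega) (by unfold topRays; omega)
    unfold topRays at this ⊢
    omega

theorem TopCrit.connTop (h : E.TopCrit) (hF : E.Far M) (hp : 0 ≤ p) (hn : p + 3 ≤ E.topRays M) :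
    E.ConnTop p M := by
  have key : ∀ d ∈ window E.middle.length M,
      Link Dart.flip (E.arcs (fun n => 1 - n) (closing p (E.topRays M))) d (E.topEnd 0) := by
    intro d hd
    obtain ⟨u, hu⟩ := h.1 d hd.1
    have hW := arcs_mem_window_closed (κ' := fun n => n) hF fun n h1 h2 => ⟨h1, h2⟩
    have hm := (topEnd_mem_window' hF u).1 ((Link.mem_iff Dart.flip_flip
      (arcs_involutive nonCrossing_one .id) flip_mem_window hW hu).1 hd)
    refine (link_mono (fun _ => Or.inr rfl) (fun _ => Or.inl rfl) hu).trans ?_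
    refine closing_connected (r := fun u w => Link Dart.flip
      (E.arcs (fun n => 1 - n) (closing p (E.topRays M))) (E.topEnd u) (E.topEnd w)) hp hn
      ⟨fun _ => .refl _, .symm, .trans⟩ (fun u => ?_) (fun u => ?_) hm.1 hm.2
    · exact link_mono (fun _ => Or.inr rfl) (fun _ => Or.inl rfl) (h.2 u)
    · rw [← arcs_topEnd (κ := fun n => 1 - n)]
      exact .right _
  exact fun d hd e he => (key d hd).trans (key e he).symm

/-- The standard matching followed by the closing is the translation by `-2`, and the standard
matching joins `0` to `-1`, so both parities are reached. -/
theorem TopCrit.connInf (h : E.TopCrit) : E.ConnInf := by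
  have lift : ∀ {d e}, Link Dart.flip (E.arcs (fun n => 1 - n) fun n => n) d e →
      Link Dart.flip (E.arcs (fun n => 1 - n) (fun n => -3 - n)) d e :=
    fun h => link_mono (fun _ => Or.inr rfl) (fun _ => Or.inl rfl) h
  have step : ∀ u, Link Dart.flip (E.arcs (fun n => 1 - n) (fun n => -3 - n)) (E.topEnd u)
      (E.topEnd (u - 2)) := fun u => by
    have := Link.right (f := Dart.flip) (g := E.arcs (fun n => 1 - n) (fun n => -3 - n))
      (E.topEnd (-1 - u))
    rw [arcs_topEnd, show -3 - (-1 - u) = u - 2 by ring] at this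
    exact (lift (h.2 u)).trans this
  have even : ∀ n : ℕ, ∀ u : ℤ, Link Dart.flip (E.arcs (fun n => 1 - n) (fun n => -3 - n))
      (E.topEnd u) (E.topEnd (u - 2 * n)) := by
    intro n
    induction n with
    | zero => intro u; simpa using Link.refl _
    | succ n ih =>
      intro u
      have := (ih u).trans (step _)
      rwa [show u - 2 * (n : ℤ) - 2 = u - 2 * ((n + 1 : ℕ) : ℤ) by push_cast; ring] at this
  have key : ∀ u, Link Dart.flip (E.arcs (fun n => 1 - n) (fun n => -3 - n)) (E.topEnd u)
      (E.topEnd 0) := by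
    intro u
    rcases Int.even_or_odd' u with ⟨c, rfl | rfl⟩
    · rcases le_total 0 c with hc | hc
      · have := even c.toNat (2 * c)
        rwa [Int.toNat_of_nonneg hc, sub_self] at this
      · have := even (-c).toNat 0
        rw [Int.toNat_of_nonneg (by omega), show 0 - 2 * -c = 2 * c by ring] at this
        exact this.symm
    · have h0 := lift (h.2 0)
      rw [show -1 - (0 : ℤ) = -1 by ring] at h0
      refine Link.trans ?_ h0.symm
      rcases le_total 0 (c + 1) with hc | hc
      · have := even (c + 1).toNat (2 * c + 1)
        rwa [Int.toNat_of_nonneg hc, show 2 * c + 1 - 2 * (c + 1) = -1 by ring] at this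
      · have := even (-c - 1).toNat (-1)
        rw [Int.toNat_of_nonneg (by omega), show -1 - 2 * (-c - 1) = 2 * c + 1 by ring] at this
        exact this.symm
  intro d hd e he
  obtain ⟨u, hu⟩ := h.1 d hd
  obtain ⟨w, hw⟩ := h.1 e he
  exact ((lift hu).trans (key u)).trans ((lift hw).trans (key w)).symm

theorem ConnInf.rot (h : E.ConnInf) : E.rot.ConnInf := by
  intro d hd e he
  rw [length_rot] at hd he
  have := link_rot (Nat.sub_le _ _) (h (d.rot E.middle.length) (Nat.sub_le _ _)
    (e.rot E.middle.length) (Nat.sub_le _ _))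
  rw [Dart.rot_rot hd, Dart.rot_rot he, rotIndex_const_sub, rotIndex_const_sub] at this
  convert this using 4 <;> ring

/-- In a connected diagram, the window is connected if what leaves it is closed. -/
theorem ConnInf.connTop (h : E.ConnInf) (hF : E.Far M) (hn : 3 ≤ E.topRays M) :
    E.ConnTop 0 M := by
  classical
  obtain ⟨N, hN⟩ : ∃ N, N = E.topRays M := ⟨_, rfl⟩
  have hW := closed_mem_window hF le_rfl (p := 0) (by omega)
  have hinv : Function.Involutive (E.arcs (fun n => 1 - n) (closing 0 (E.topRays M))) :=
    arcs_involutive nonCrossing_one (closing_nonCrossing le_rfl (by omega))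
  have htop := topEnd_mem_window' hF
  rw [← hN] at hW hinv htop
  intro d hd e he
  rw [← hN]
  -- Everything outside of the window is contracted to the top end `N - 1`.
  have key := Link.of_rel_on (f := Dart.flip) (g := E.arcs (fun n => 1 - n) (fun n => -3 - n))
    (p := fun d : Dart => d.1 ≤ E.middle.length)
    (r := fun d e => Link Dart.flip (E.arcs (fun n => 1 - n) (closing 0 N))
      (if d ∈ window E.middle.length M then d else E.topEnd (N - 1))
      (if e ∈ window E.middle.length M then e else E.topEnd (N - 1))) (fun _ => Iff.rfl) arcs_le
    ⟨fun _ => .refl _, .symm, .trans⟩ (fun d hd => ?_) (fun d hd => ?_) (h d hd.1 e he.1) hd.1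
  · rwa [if_pos hd, if_pos he] at key
  · by_cases hc : d ∈ window E.middle.length M
    · have : d.flip ∈ window E.middle.length M := flip_mem_window d hc
      rw [if_pos hc, if_pos this]
      exact .left d
    · have : d.flip ∉ window E.middle.length M := fun h => hc (by
        have := flip_mem_window _ h
        rwa [Dart.darts_flip, Dart.flip_flip] at this)
      rw [if_neg hc, if_neg this]
      exact .refl _
  · rcases arcs_eq_or' (κ := fun n => 1 - n) (κ' := fun n => -3 - n) (κ₁' := closing 0 N) hd with
      h1 | ⟨u, rfl⟩
    · rw [h1]
      by_cases hc : d ∈ window E.middle.length M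
      · rw [if_pos hc, if_pos (hW d hc)]
        exact .right d
      · rw [if_neg hc, if_neg fun h => hc (by
          have := hW _ h
          rwa [hinv] at this)]
        exact .refl _
    · have c : ∀ u w, closing 0 N u = w → Link Dart.flip (E.arcs (fun n => 1 - n) (closing 0 N))
          (E.topEnd u) (E.topEnd w) := by
        rintro u _ rfl
        rw [← arcs_topEnd (κ := fun n => 1 - n)]
        exact .right _
      rw [arcs_topEnd]
      -- Under `-3 - u` only the ends `N - 2` and `N - 1` leave the window, and they are precisely
      -- the ones which the finite closing joins to each other.
      have h3 := closing_cases (p := 0) (n := N) le_rfl (by omega) u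
      have h4 := closing_cases (p := 0) (n := N) le_rfl (by omega) (-3 - u)
      by_cases h1 : E.topEnd u ∈ window E.middle.length M <;>
        by_cases h2 : E.topEnd (-3 - u) ∈ window E.middle.length M
      · rw [if_pos h1, if_pos h2]
        rw [htop] at h1 h2
        exact c _ _ (by omega)
      · rw [if_pos h1, if_neg h2]
        rw [htop] at h1 h2
        by_cases h5 : u = N - 1
        · rw [h5]
          exact .refl _
        · exact c _ _ (by omega)
      · rw [if_neg h1, if_pos h2]
        rw [htop] at h1 h2
        by_cases h5 : -3 - u = N - 1
        · rw [h5]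
          exact .refl _
        · exact (c _ _ (by omega)).symm
      · rw [if_neg h1, if_neg h2]
        exact .refl _

theorem closed_ne (hF : E.Far M) (hp : 0 ≤ p) (hn : p + 3 ≤ E.topRays M) :
    ∀ d ∈ window E.middle.length M,
      E.arcs (fun n => 1 - n) (closing p (E.topRays M)) d ≠ d := by
  intro d hd h
  rcases exists_end hd.1 h with ⟨v, hv, -⟩ | ⟨u, hu, rfl⟩
  · omega
  · rw [topEnd_mem_window' hF] at hd
    exact closing_ne hp hn hd.1 hd.2 hu

theorem topEnd_lt {u w : ℤ} : (E.topEnd u).Lt (E.topEnd w) ↔ u < w := by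
  have := endDart_lt (E := E) (e := (true, u)) (f := (true, w))
  simpa [endDart, EndLt] using this

theorem isHex_topEnd (hp : 0 ≤ p) :
    Dart.darts.IsHex .line fun i => E.topEnd (closingPoints p i) where
  inj := topEnd_injective.comp (closingPoints_strictMono hp).injective
  left a b := by
    rw [Dart.darts_left, topEnd_lt, (closingPoints_strictMono hp).lt_iff_lt, HexShape.line]
    dsimp only
    congr
  up a := by
    rw [Dart.darts_up, topEnd_eq]
    rfl

theorem arcs_rewire_top (hp : 0 ≤ p) {n : ℤ} (hn : p + 4 ≤ n) :
    rewire (fun i => E.topEnd (closingPoints p i)) hexAfter (E.arcs κ (closing (p + 1) n)) =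
      E.arcs κ (closing p n) := by
  have hinj : Function.Injective fun i => E.topEnd (closingPoints p i) :=
    topEnd_injective.comp (closingPoints_strictMono hp).injective
  funext d
  by_cases h : ∃ i, E.topEnd (closingPoints p i) = d
  · obtain ⟨i, rfl⟩ := h
    rw [rewire_apply _ _ hinj i, arcs_topEnd, closing_after hp hn]
  · push Not at h
    rw [rewire_of_notMem _ _ h]
    by_cases hd : d.1 ≤ E.middle.length
    · rcases arcs_eq_or' (κ := κ) (κ' := closing (p + 1) n) (κ₁' := closing p n) hd with
        h1 | ⟨u, rfl⟩
      · exact h1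
      · rw [arcs_topEnd, arcs_topEnd, closing_off hp hn fun i hi => h i (by rw [hi])]
    · by_cases hm : (E.sec d.zone).mate d.2.2 = d.2.2
      · obtain ⟨⟨j, u, n⟩, rfl⟩ := exists_rayDart hm
        have hd' : ¬ j ≤ E.middle.length := hd
        rw [arcs_rayDart, arcs_rayDart]
        unfold joinRays
        have h1 : j ≠ 0 := by omega
        have h2 : ¬ j < E.middle.length := by omega
        have h3 : j ≠ E.middle.length := by omega
        cases u <;> simp [h1, h2, h3]
      · rw [arcs_cup hm, arcs_cup hm]

theorem eventually_forall_mem_window {m : ℕ} {h : Fin 6 → Dart} (hd : ∀ i, (h i).1 ≤ m) :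
    ∃ M₀, ∀ M, M₀ ≤ M → ∀ i, h i ∈ window m M := by
  choose f hf using fun i => eventually_mem_window (hd i)
  refine ⟨Finset.univ.sup' Finset.univ_nonempty f, fun M hM i => hf i M (le_trans ?_ hM)⟩
  exact Finset.le_sup' f (Finset.mem_univ i)

theorem lt_length {j : ℕ} {σ : CupDiagram} (hσ : E.middle[j]? = some σ) : j < E.middle.length :=
  (List.getElem?_eq_some_iff.1 hσ).1

theorem le_of_zone {d : Dart} {j : ℕ} {σ : CupDiagram} (hσ : E.middle[j]? = some σ)
    (hd : d.zone = j + 1) : d.1 ≤ E.middle.length := by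
  have := lt_length hσ
  unfold Dart.zone at hd
  omega

theorem topEnd_zone (u : ℤ) : (E.topEnd u).zone = E.middle.length + 1 := by
  rw [topEnd_eq]
  rfl

theorem topRays_replace (j : ℕ) (a : ℤ) : (E.replace j a).topRays M = E.topRays M := rfl

/-- Induction on the parameter of the closing. The change from `p + 1` to `p` and the surgery are
moves at disjoint hexagons. The original diagram is connected for both closings, the new one for
`p`; the theorem on two surgeries gives connectedness of the new one for `p + 1`. -/
theorem ConnTop.of_replace {j : ℕ} {a : ℤ} {σ : CupDiagram} (hE : E.TopCrit)
    (hσ : E.middle[j]? = some σ) (ha : σ.IsOutermost a) (P : ℕ) : ∃ M₀, ∀ M, M₀ ≤ M →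
      (E.replace j a).ConnTop 0 M → (E.replace j a).ConnTop P M := by
  obtain ⟨h, hh, hz, hr⟩ := exists_hexagon hσ ha
  obtain ⟨M₁, hM₁⟩ := E.exists_far
  obtain ⟨M₂, hM₂⟩ := eventually_forall_mem_window fun i => le_of_zone hσ (hz i)
  -- The window must have room for the closings with all parameters up to `P`.
  refine ⟨max (max M₁ M₂) (P + 4 + E.top.numCups), fun M hM h0 => ?_⟩
  have hF := hM₁ M (by omega)
  have hhW := hM₂ M (by omega)
  have hT : (P : ℤ) + 4 ≤ E.topRays M := by
    unfold topRays
    omega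
  have step : ∀ p : ℕ, p ≤ P → (E.replace j a).ConnTop p M := by
    intro p
    induction p with
    | zero => exact fun _ => h0
    | succ p ih =>
      intro hp
      have ih := ih (by omega)
      unfold ConnTop at ih ⊢
      rw [length_replace, topRays_replace, (hr _ _).2] at ih ⊢
      have e : ((p + 1 : ℕ) : ℤ) = p + 1 := by push_cast; rfl
      rw [e]
      have hp0 : (0 : ℤ) ≤ p := by omega
      have hn : (p : ℤ) + 4 ≤ E.topRays M := by omega
      have k0 := arcs_rewire_top (E := E) (κ := fun n => 1 - n) hp0 hn
      have nc : NonCrossing (closing p (E.topRays M)) := closing_nonCrossing hp0 (by omega)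
      have nc' : NonCrossing (closing (p + 1) (E.topRays M)) :=
        closing_nonCrossing (by omega) (by omega)
      refine Darts.Planar.connected_of_surgeries (arcs_planar nonCrossing_one nc') (window_finite _ _)
        flip_mem_window (closed_mem_window hF (by omega) (by omega))
        (closed_ne hF (by omega) (by omega)) hh (isHex_topEnd (E := E) hp0) (Or.inr rfl)
        (fun i i' hc => ?_) hhW (fun i => ?_) (hr _ _).1 (fun i => ?_) ?_ ?_ ?_
        (hE.connTop hF (by omega) (by omega)) ?_ ?_
      · have h1 := hz i
        rw [hc, topEnd_zone] at h1
        have := lt_length hσ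
        omega
      · rw [topEnd_mem_window' hF]
        fin_cases i <;> simp [closingPoints] <;> omega
      · rw [arcs_topEnd, closing_before hp0 hn]
      · rw [← (hr _ _).2]
        exact arcs_planar nonCrossing_one nc'
      · rw [k0]
        exact arcs_planar nonCrossing_one nc
      · rw [k0, ← (hr _ _).2]
        exact arcs_planar nonCrossing_one nc
      · rw [k0]
        exact hE.connTop hF hp0 (by omega)
      · rw [k0]
        exact ih
  exact step P le_rfl

variable (F) in
/-- If closing both ends connects the diagram then all its lines have ends at the top. -/
theorem exists_topEnd_of_connTop (hF : ∃ M₀, ∀ M, M₀ ≤ M → F.ConnTop 0 M) {d : Dart}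
    (hd : d.1 ≤ F.middle.length) :
    ∃ u, Link Dart.flip (F.arcs (fun n => 1 - n) fun n => n) d (F.topEnd u) := by
  obtain ⟨M₀, hM₀⟩ := hF
  obtain ⟨M₁, hM₁⟩ := eventually_mem_window hd
  obtain ⟨M₂, hM₂⟩ := eventually_mem_window (topEnd_le (E := F) 0)
  have hl := hM₀ (max M₀ (max M₁ M₂)) (by omega) d (hM₁ _ (by omega)) _ (hM₂ _ (by omega))
  have hle := Link.iff_of_invariant (p := fun x : Dart => x.1 ≤ F.middle.length ∧
    ∃ u, Link Dart.flip (F.arcs (fun n => 1 - n) fun n => n) x (F.topEnd u)) ?_ ?_ hl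
  · exact (hle.2 ⟨topEnd_le 0, 0, .refl _⟩).2
  · intro x
    refine and_congr_right fun _ => exists_congr fun u => ?_
    exact ⟨fun he => (Link.left (f := Dart.flip) x).trans he,
      fun he => (Link.left (f := Dart.flip) x).symm.trans he⟩
  · intro x
    rw [arcs_le]
    refine and_congr_right fun hx => ?_
    rcases arcs_eq_or' (κ := fun n => 1 - n) (κ₁' := fun n => n) hx with h1 | ⟨u, rfl⟩
    · rw [h1]
      refine exists_congr fun u => ?_
      exact ⟨fun he => (Link.right (f := Dart.flip) x).trans he,
        fun he => (Link.right (f := Dart.flip) x).symm.trans he⟩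
    · rw [arcs_topEnd]
      exact ⟨fun _ => ⟨u, .refl _⟩, fun _ => ⟨_, .refl _⟩⟩

/-- Connectedness spreads from the closing with parameter `0` to all others. They exclude circles
and all small arcs on the left of the induced matching at the top, which is therefore standard. -/
theorem TopCrit.of_replace_of_connTop {j : ℕ} {a : ℤ} {σ : CupDiagram} (hE : E.TopCrit)
    (hσ : E.middle[j]? = some σ) (ha : σ.IsOutermost a)
    (hF : ∃ M₀, ∀ M, M₀ ≤ M → (E.replace j a).ConnTop 0 M) : (E.replace j a).TopCrit := by
  have nocirc := fun d hd => exists_topEnd_of_connTop (E.replace j a) hF (d := d) hd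
  have conn : ∀ P : ℕ, ∃ M₀, ∀ M, M₀ ≤ M → (E.replace j a).ConnTop P M := fun P => by
    obtain ⟨M₀, hM₀⟩ := hF
    obtain ⟨M₁, hM₁⟩ := ConnTop.of_replace hE hσ ha P
    exact ⟨max M₀ M₁, fun M hM => hM₁ M (by omega) (hM₀ M (by omega))⟩
  generalize E.replace j a = F at *
  refine ⟨nocirc, ?_⟩
  obtain ⟨ι, invol, hne, hlink, hnc⟩ := exists_matching (E := F) nonCrossing_one .id bounded_one
    topEnd_injective (fun d hd hf => by
      rcases exists_end hd hf with ⟨v, hv, -⟩ | ⟨u, -, rfl⟩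
      · omega
      · exact ⟨u, rfl⟩) (fun i => ⟨topEnd_le i, arcs_topEnd i⟩)
  obtain ⟨M, hM⟩ := F.exists_far
  have hM := hM M le_rfl
  have := EndMatching.eq_of_no_small_arc invol hne (fun e f h1 h2 => by
    have := hnc e f h1 h2
    simpa only [topEnd_lt] using this) (N := |M| + F.bottom.numCups + F.top.numCups + 2)
    (fun u hu => ?_) (fun i hi hc => ?_)
  · intro u
    exact (hlink _ _).2 (Or.inr (this u).symm)
  -- Far on the right the line runs straight down, through the closing to the far left, and straight
  -- up again.
  · have h1 := le_abs_self M
    have h2 := neg_abs_le M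
    obtain ⟨v, rfl⟩ : ∃ v, u = v - 1 + (F.bottom.numCups - F.top.numCups) :=
      ⟨u + 1 - (F.bottom.numCups - F.top.numCups), by ring⟩
    have l1 := link_far_right (κ := fun n => 1 - n) (κ' := fun n => n) hM (v := v) (by omega)
    have l2 := link_far_left (κ := fun n => 1 - n) (κ' := fun n => n) hM (v := 1 - v) (by omega)
    have l3 := Link.right (f := Dart.flip) (g := F.arcs (fun n => 1 - n) fun n => n) (F.bottomEnd v)
    rw [arcs_bottomEnd] at l3
    rcases (hlink _ _).1 ((l1.symm.trans l3).trans l2) with h | h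
    · omega
    · rw [← h]
      ring
  -- For `p = -i - 2` the inner small arc of the closing joins `i` to `i + 1`. If the diagram joins
  -- them as well, they form a circle that does not contain the end `0`, against connectedness.
  · obtain ⟨M₀, hM₀⟩ := conn (-i - 2).toNat
    obtain ⟨M₁, hM₁⟩ := eventually_mem_window (topEnd_le (E := F) 0)
    obtain ⟨M₂, hM₂⟩ := eventually_mem_window (topEnd_le (E := F) i)
    obtain ⟨M', hM'⟩ : ∃ M', M' = max (max M₀ (-i + F.top.numCups + 3)) (max M₁ M₂) := ⟨_, rfl⟩
    have hl := hM₀ M' (by omega) _ (hM₂ M' (by omega)) _ (hM₁ M' (by omega))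
    rw [Int.toNat_of_nonneg (by omega)] at hl
    have hN : -i - 2 + 3 ≤ F.topRays M' := by
      unfold topRays
      omega
    have hinv : Function.Involutive (F.arcs (fun n => 1 - n) (closing (-i - 2) (F.topRays M'))) :=
      arcs_involutive nonCrossing_one (closing_nonCrossing (by omega) hN)
    have c1 := closing_cases (p := -i - 2) (by omega) hN i
    have c2 := closing_cases (p := -i - 2) (by omega) hN (i + 1)
    have inv : ∀ x, Link Dart.flip (F.arcs (fun n => 1 - n) fun n => n) (F.topEnd i) x →
        Link Dart.flip (F.arcs (fun n => 1 - n) fun n => n) (F.topEnd i)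
          (F.arcs (fun n => 1 - n) (closing (-i - 2) (F.topRays M')) x) := by
      intro x hx
      have hle : x.1 ≤ F.middle.length := (Link.iff_of_invariant (f := Dart.flip)
        (p := fun x : Dart => x.1 ≤ F.middle.length) (fun _ => Iff.rfl) arcs_le hx).1 (topEnd_le i)
      rcases arcs_eq_or' (κ := fun n => 1 - n) (κ' := closing (-i - 2) (F.topRays M'))
        (κ₁' := fun n => n) hle with h1 | ⟨u, rfl⟩
      · rw [h1]
        exact hx.trans (.right _)
      · rw [arcs_topEnd]
        rcases (hlink _ _).1 hx with h | h
        · subst h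
          exact (hlink _ _).2 (Or.inr (by omega))
        · rw [hc] at h
          subst h
          exact (hlink _ _).2 (Or.inl (by omega))
    have := (Link.iff_of_invariant (p := fun x =>
      Link Dart.flip (F.arcs (fun n => 1 - n) fun n => n) (F.topEnd i) x) (fun x =>
        ⟨fun h => h.trans (Link.left (f := Dart.flip) x).symm, fun h => h.trans (.left (f := Dart.flip) x)⟩)
        (fun x => ⟨fun h => by
          have := inv _ h
          rwa [hinv] at this, inv x⟩) hl).1 (.refl _)
    rcases (hlink _ _).1 this with h | h <;> omega

/-- A surgery on an orientable diagram gives an orientable diagram if it gives a connected one. -/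
theorem TopCrit.of_replace {j : ℕ} {a : ℤ} {σ : CupDiagram} (hE : E.TopCrit)
    (hσ : E.middle[j]? = some σ) (ha : σ.IsOutermost a) (hF : (E.replace j a).ConnInf) :
    (E.replace j a).TopCrit := by
  refine hE.of_replace_of_connTop hσ ha ?_
  obtain ⟨M₀, hM₀⟩ := (E.replace j a).exists_far
  refine ⟨max M₀ (2 + E.top.numCups), fun M hM => hF.connTop (hM₀ M (by omega)) ?_⟩
  rw [topRays_replace, topRays]
  omega

/-- The connectedness hypothesis is invariant under rotation, so the one-sided statement can be
applied to the diagram and to its rotation. One connected curve thus controls both ends. -/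
theorem Orientable.of_replace {j : ℕ} {a : ℤ} {σ : CupDiagram} (hE : E.Orientable)
    (hσ : E.middle[j]? = some σ) (ha : σ.IsOutermost a) (hF : (E.replace j a).ConnInf) :
    (E.replace j a).Orientable := by
  rw [orientable_iff_topCrit] at hE ⊢
  obtain ⟨h1, h2⟩ := rot_replace hσ ha
  refine ⟨hE.1.of_replace hσ ha hF, ?_⟩
  rw [h1]
  refine hE.2.of_replace h2 ha.rot ?_
  rw [← h1]
  exact hF.rot

end StackedDiagram

/-! ### Two surgeries in different sections. -/

namespace StackedDiagram

variable {E F : StackedDiagram} {M : ℤ}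

/-- Different sections give disjoint hexagons. The closed diagram is connected before, after the
second surgery and after both, so the theorem on two surgeries makes it connected after the first;
together with `TopCrit` of the original diagram this suffices. -/
theorem TopCrit.of_replace_replace {j j' : ℕ} {a a' : ℤ} {σ σ' : CupDiagram} (hj : j ≠ j')
    (hE : E.TopCrit) (hσ : E.middle[j]? = some σ) (ha : σ.IsOutermost a)
    (hσ' : E.middle[j']? = some σ') (ha' : σ'.IsOutermost a') (h' : (E.replace j' a').TopCrit)
    (h'' : ((E.replace j' a').replace j a).TopCrit) : (E.replace j a).TopCrit := by
  obtain ⟨h, hh, hz, hr⟩ := exists_hexagon hσ ha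
  obtain ⟨k, hk, kz, kr⟩ := exists_hexagon hσ' ha'
  -- The two rewirings act in different zones, so performing both surgeries is the same as composing
  -- them.
  have hkr : ∀ κ κ', ((E.replace j' a').replace j a).arcs κ κ' =
      rewire h hexAfter (rewire k hexAfter (E.arcs κ κ')) := by
    intro κ κ'
    rw [← (kr κ κ').2]
    funext d
    by_cases hd : d.zone = j + 1
    · have e1 : ((E.replace j' a').replace j a).arcs κ κ' d = (E.replace j a).arcs κ κ' d := by
        refine arcs_of_sec_eq (by simp [length_replace]) ?_
        have hσ2 : (E.replace j' a').middle[j]? = some σ := by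
          rw [replace_middle_of_ne hj.symm, hσ]
        rw [hd, sec_replace_self hσ, sec_replace_self hσ2]
      rw [e1, (hr κ κ').2]
      by_cases hi : ∃ i, h i = d
      · obtain ⟨i, rfl⟩ := hi
        rw [rewire_apply _ _ hh.inj, rewire_apply _ _ hh.inj]
      · push Not at hi
        rw [rewire_of_notMem _ _ hi, rewire_of_notMem _ _ hi]
        exact (arcs_of_sec_eq (length_replace _ _ _) (sec_replace_of_ne (by omega))).symm
    · rw [rewire_of_notMem _ _ fun i hi => hd (by rw [← hi, hz])]
      exact arcs_of_sec_eq (length_replace _ _ _) (sec_replace_of_ne hd)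
  obtain ⟨M₁, hM₁⟩ := E.exists_far
  obtain ⟨M₂, hM₂⟩ := eventually_forall_mem_window fun i => le_of_zone hσ (hz i)
  obtain ⟨M₃, hM₃⟩ := eventually_forall_mem_window fun i => le_of_zone hσ' (kz i)
  obtain ⟨M₄, hM₄⟩ := (E.replace j' a').exists_far
  obtain ⟨M₅, hM₅⟩ := ((E.replace j' a').replace j a).exists_far
  refine hE.of_replace_of_connTop hσ ha
    ⟨max (max (max M₁ M₂) (max M₃ M₄)) (max M₅ (2 + E.top.numCups)), fun M hM => ?_⟩
  have hF := hM₁ M (by omega)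
  have hT : (0 : ℤ) + 3 ≤ E.topRays M := by
    unfold topRays
    omega
  have nc := closing_nonCrossing le_rfl hT
  have c' := h'.connTop (hM₄ M (by omega)) le_rfl (by rwa [topRays_replace])
  have c'' := h''.connTop (hM₅ M (by omega)) le_rfl (by rwa [topRays_replace, topRays_replace])
  unfold ConnTop at c' c'' ⊢
  rw [length_replace, topRays_replace] at c' ⊢
  rw [length_replace, length_replace, topRays_replace, topRays_replace, hkr] at c''
  rw [(kr _ _).2] at c'
  rw [(hr _ _).2]
  refine Darts.Planar.connected_of_surgeries (arcs_planar nonCrossing_one nc) (window_finite _ _)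
    flip_mem_window (closed_mem_window hF le_rfl hT) (closed_ne hF le_rfl hT) hh hk (Or.inl rfl)
    (fun i i' hc => ?_) (hM₂ M (by omega)) (hM₃ M (by omega)) (hr _ _).1 (kr _ _).1 ?_ ?_ ?_
    (hE.connTop hF le_rfl hT) c' c''
  · have h1 := hz i
    rw [hc, kz] at h1
    omega
  · rw [← (hr _ _).2]
    exact arcs_planar nonCrossing_one nc
  · rw [← (kr _ _).2]
    exact arcs_planar nonCrossing_one nc
  · rw [← hkr]
    exact arcs_planar nonCrossing_one nc

theorem Orientable.of_replace_of_ne {j j' : ℕ} {a a' : ℤ} {σ σ' : CupDiagram} (hj : j ≠ j')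
    (hE : E.Orientable) (hσ : E.middle[j]? = some σ) (ha : σ.IsOutermost a)
    (hσ' : E.middle[j']? = some σ') (ha' : σ'.IsOutermost a') (h' : (E.replace j' a').Orientable)
    (h'' : ((E.replace j' a').replace j a).Orientable) : (E.replace j a).Orientable := by
  rw [orientable_iff_topCrit] at *
  have hσ2 : (E.replace j' a').middle[j]? = some σ := by
    rw [replace_middle_of_ne hj.symm, hσ]
  obtain ⟨e1, f1⟩ := rot_replace hσ ha
  obtain ⟨e2, f2⟩ := rot_replace hσ' ha'
  obtain ⟨e3, -⟩ := rot_replace hσ2 ha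
  refine ⟨hE.1.of_replace_replace hj hσ ha hσ' ha' h'.1 h''.1, ?_⟩
  have := lt_length hσ
  have := lt_length hσ'
  rw [e1]
  refine hE.2.of_replace_replace (by omega) f1 ha.rot f2 ha'.rot (e2 ▸ h'.2) ?_
  have := h''.2
  rwa [e3, e2, length_replace] at this

/-- Orientability depends only on the components and on the ends, so it transfers along maps of
points that respect connectedness and are inverse to each other up to connectedness. -/
theorem orientable_congr (hb : E.bottom = F.bottom) (ht : E.top = F.top)
    (φ ψ : ℕ × ℤ → ℕ × ℤ) (hφ : ∀ v w, E.Arc v w → F.Connected (φ v) (φ w))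
    (hψ : ∀ v w, F.Arc v w → E.Connected (ψ v) (ψ w)) (hψφ : ∀ v, ψ (φ v) = v)
    (hφψ : ∀ w, F.Connected (φ (ψ w)) w) (φ_zero : ∀ x, F.Connected (φ (0, x)) (0, x))
    (φ_last : ∀ x, F.Connected (φ (E.middle.length, x)) (F.middle.length, x))
    (φ_le : ∀ v, v.1 ≤ E.middle.length → (φ v).1 ≤ F.middle.length)
    (ψ_le : ∀ w, w.1 ≤ F.middle.length → (ψ w).1 ≤ E.middle.length) :
    E.Orientable ↔ F.Orientable := by
  have lift : ∀ {A B : StackedDiagram} {f : ℕ × ℤ → ℕ × ℤ},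
      (∀ v w, A.Arc v w → B.Connected (f v) (f w)) →
      ∀ v w, A.Connected v w → B.Connected (f v) (f w) := by
    intro A B f h v w hvw
    induction hvw with
    | rel v w h0 => exact h v w h0
    | refl v => exact .refl _
    | symm v w _ ih => exact .symm _ _ ih
    | trans u v w _ _ ih1 ih2 => exact .trans _ _ _ ih1 ih2
  have key : ∀ v w, E.Connected v w ↔ F.Connected (φ v) (φ w) := fun v w =>
    ⟨lift hφ v w, fun h => by
      have := lift hψ _ _ h
      rwa [hψφ, hψφ] at this⟩
  have cr : ∀ {v w w'}, F.Connected w w' → (F.Connected v w ↔ F.Connected v w') := fun h =>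
    ⟨fun h' => .trans _ _ _ h' h, fun h' => .trans _ _ _ h' (.symm _ _ h)⟩
  have cl : ∀ {v w w'}, F.Connected w w' → (F.Connected w v ↔ F.Connected w' v) := fun h =>
    ⟨fun h' => .trans _ _ _ (.symm _ _ h) h', fun h' => .trans _ _ _ h h'⟩
  unfold Orientable NoCircle IsBottomEnd IsTopEnd
  simp only [key, cr (φ_zero _), cr (φ_last _), cl (φ_zero _), cl (φ_last _), hb, ht]
  refine and_congr_left fun _ => ⟨fun h w hw => ?_, fun h v hv => h _ (φ_le v hv)⟩
  rcases h (ψ w) (ψ_le w hw) with ⟨x, hx, hc⟩ | ⟨x, hx, hc⟩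
  · exact Or.inl ⟨x, hx, .trans _ _ _ (.symm _ _ (hφψ w)) hc⟩
  · exact Or.inr ⟨x, hx, .trans _ _ _ (.symm _ _ (hφψ w)) hc⟩

end StackedDiagram

/-! ### Cutting a section into two. -/

namespace CupDiagram

variable (σ : CupDiagram) (c : ℤ)

/-- The cups to the left of `c`. -/
def below : CupDiagram where
  mate x := if x < c ∧ σ.mate x < c then σ.mate x else x
  mate_mate i := by
    have := σ.mate_mate i
    grind
  finite_cups := σ.finite_cups.subset fun i hi => by
    simp only [Set.mem_ofPred_eq] at hi ⊢
    grind
  nested i k h1 h2 := by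
    have := σ.nested i k h1
    grind

/-- The cups that are not to the left of `c`. -/
def above : CupDiagram where
  mate x := if c ≤ x ∧ c ≤ σ.mate x then σ.mate x else x
  mate_mate i := by
    have := σ.mate_mate i
    grind
  finite_cups := σ.finite_cups.subset fun i hi => by
    simp only [Set.mem_ofPred_eq] at hi ⊢
    grind
  nested i k h1 h2 := by
    have := σ.nested i k h1
    grind

/-- No cup passes `c`. -/
def IsCut : Prop := ∀ x, σ.mate x < c ↔ x < c

variable {σ c}

theorem IsOutermost.isCut {a : ℤ} (h : σ.IsOutermost a) : σ.IsCut a := fun x =>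
  ⟨fun hx => by
    have := h.2 _ hx
    rwa [σ.mate_mate] at this, h.2 x⟩

theorem IsCut.below_mate (h : σ.IsCut c) (x : ℤ) :
    (σ.below c).mate x = if x < c then σ.mate x else x := by
  have := h x
  simp only [below]
  grind

theorem IsCut.above_mate (h : σ.IsCut c) (x : ℤ) :
    (σ.above c).mate x = if x < c then x else σ.mate x := by
  have := h x
  simp only [above]
  grind

theorem IsCut.erase {a : ℤ} (h : σ.IsCut c) (ha : σ.IsOutermost a) : (σ.erase a).IsCut c := by
  intro x
  have := h x
  rw [erase_mate _ ha]
  grind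

theorem below_erase_of_lt {a : ℤ} (h : σ.IsCut c) (ha : σ.IsOutermost a) (hac : a < c) :
    (σ.below c).IsOutermost a ∧ (σ.erase a).below c = (σ.below c).erase a ∧
      (σ.erase a).above c = σ.above c := by
  have h0 := (h a).2 hac
  have h1 : (σ.below c).IsOutermost a := by
    have := ha.1
    have := ha.2
    unfold IsOutermost
    simp only [h.below_mate]
    grind
  have h3 := ha.1
  refine ⟨h1, CupDiagram.ext (funext fun x => ?_), CupDiagram.ext (funext fun x => ?_)⟩
  · rw [(h.erase ha).below_mate, erase_mate _ h1, erase_mate _ ha, h.below_mate, h.below_mate]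
    grind
  · rw [(h.erase ha).above_mate, erase_mate _ ha, h.above_mate]
    grind

theorem above_erase_of_ge {a : ℤ} (h : σ.IsCut c) (ha : σ.IsOutermost a) (hac : c ≤ a) :
    (σ.above c).IsOutermost a ∧ (σ.erase a).above c = (σ.above c).erase a ∧
      (σ.erase a).below c = σ.below c := by
  have h0 := h a
  have h1 : (σ.above c).IsOutermost a := by
    have := ha.1
    have := ha.2
    unfold IsOutermost
    simp only [h.above_mate]
    grind
  have h3 := ha.1
  refine ⟨h1, CupDiagram.ext (funext fun x => ?_), CupDiagram.ext (funext fun x => ?_)⟩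
  · rw [(h.erase ha).above_mate, erase_mate _ h1, erase_mate _ ha, h.above_mate, h.above_mate]
    grind
  · rw [(h.erase ha).below_mate, erase_mate _ ha, h.below_mate]
    grind

/-- Every point is followed by a ray. -/
theorem exists_next_ray (σ : CupDiagram) (c : ℤ) :
    ∃ q, c ≤ q ∧ σ.mate q = q ∧ ∀ z, c ≤ z → z < q → σ.mate z ≠ z := by
  obtain ⟨B, hB⟩ := σ.finite_cups.bddAbove
  obtain ⟨q, ⟨hq1, hq2⟩, hq3⟩ := Int.exists_least_of_bdd (P := fun y => c ≤ y ∧ σ.mate y = y)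
    ⟨c, fun z hz => hz.1⟩ ⟨max c (B + 1), by omega, by
      by_contra hc
      have := hB hc
      omega⟩
  exact ⟨q, hq1, hq2, fun z h1 h2 h3 => absurd (hq3 z ⟨h1, h3⟩) (by omega)⟩

end CupDiagram

namespace StackedDiagram

theorem getElem?_insert {pre post : List CupDiagram} {σ : CupDiagram} {i : ℕ} :
    (pre ++ σ :: post)[i]? = if i < pre.length then pre[i]? else if i = pre.length then some σ
      else post[i - pre.length - 1]? := by
  rw [List.getElem?_append]
  split_ifs with h1 h2
  · rfl
  · simp [h2]
  · obtain ⟨k, hk⟩ : ∃ k, i - pre.length = k + 1 := ⟨i - pre.length - 1, by omega⟩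
    simp [hk]

/-- A section can be divided into two sections. -/
theorem orientable_split {b t σ : CupDiagram} {pre post : List CupDiagram} {c : ℤ}
    (hc : σ.IsCut c) : (⟨b, pre ++ σ :: post, t⟩ : StackedDiagram).Orientable ↔
      (⟨b, pre ++ σ.below c :: σ.above c :: post, t⟩ : StackedDiagram).Orientable := by
  obtain ⟨j, hj⟩ : ∃ j, j = pre.length := ⟨_, rfl⟩
  obtain ⟨q, hq1, hq2, hq3⟩ := σ.exists_next_ray c
  have capL : ∀ x, (σ.below c).capMate x = if x - 1 < c then σ.capMate x else x := by
    intro x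
    unfold CupDiagram.capMate
    rw [hc.below_mate]
    grind
  have capR : ∀ x, (σ.above c).capMate x = if x - 1 < c then x else σ.capMate x := by
    intro x
    unfold CupDiagram.capMate
    rw [hc.above_mate]
    grind
  have capc : ∀ x, σ.capMate x - 1 < c ↔ x - 1 < c := by
    intro x
    unfold CupDiagram.capMate
    rw [add_sub_cancel_right]
    exact hc _
  have eL : ∀ i, (pre ++ σ.below c :: σ.above c :: post)[i]? = if i < j then pre[i]? else
      if i = j then some (σ.below c) else if i = j + 1 then some (σ.above c)
      else post[i - j - 2]? := by
    intro i
    rw [getElem?_insert, ← hj]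
    split_ifs with h1 h2 h3
    · rfl
    · rfl
    · simp [h3]
    · obtain ⟨k, hk⟩ : ∃ k, i - j - 1 = k + 1 := ⟨i - j - 2, by omega⟩
      have : i - j - 2 = k := by omega
      simp [hk, this]
  have eE : ∀ i, (pre ++ σ :: post)[i]? = if i < j then pre[i]? else if i = j then some σ
      else post[i - j - 1]? := by
    intro i
    rw [getElem?_insert, ← hj]
  -- vertical lines in the divided section
  have s1 : ∀ x, c < x → (⟨b, pre ++ σ.below c :: σ.above c :: post, t⟩ : StackedDiagram).Arc
      (j, x) (j + 1, x) := fun x hx => by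
    refine .strand j (σ.below c) (by simp [eL]) (false, x) (true, x) (.ray x x ⟨?_, ?_, le_rfl, ?_⟩)
    · rw [capL, if_neg (by omega)]
    · rw [hc.below_mate, if_neg (by omega)]
    · intro z _ _
      omega
  have s2 : ∀ x, x < c → (⟨b, pre ++ σ.below c :: σ.above c :: post, t⟩ : StackedDiagram).Arc
      (j + 1, x) (j + 2, x) := fun x hx => by
    refine .strand (j + 1) (σ.above c) (by simp [eL]) (false, x) (true, x)
      (.ray x x ⟨?_, ?_, le_rfl, ?_⟩)
    · rw [capR, if_pos (by omega)]
    · rw [hc.above_mate, if_pos (by omega)]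
    · intro z _ _
      omega
  have s3 : (⟨b, pre ++ σ.below c :: σ.above c :: post, t⟩ : StackedDiagram).Arc
      (j + 1, c) (j + 2, q) := by
    refine .strand (j + 1) (σ.above c) (by simp [eL]) (false, c) (true, q)
      (.ray c q ⟨?_, ?_, hq1, ?_⟩)
    · rw [capR, if_pos (by omega)]
    · rw [hc.above_mate, if_neg (by omega), hq2]
    · intro z h1 h2
      rw [hc.above_mate, if_neg (by omega)]
      exact hq3 z h1 h2
  have mE : (⟨b, pre ++ σ :: post, t⟩ : StackedDiagram).middle.length = j + post.length + 1 := by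
    simp only [List.length_append, List.length_cons, ← hj]
    omega
  have mF : (⟨b, pre ++ σ.below c :: σ.above c :: post, t⟩ : StackedDiagram).middle.length =
      j + post.length + 2 := by
    simp only [List.length_append, List.length_cons, ← hj]
    omega
  obtain ⟨φ, φ1, φ2⟩ : ∃ φ : ℕ × ℤ → ℕ × ℤ, (∀ i x, i ≤ j → φ (i, x) = (i, x)) ∧
      ∀ i x, j < i → φ (i, x) = (i + 1, x) :=
    ⟨fun v => if v.1 ≤ j then v else (v.1 + 1, v.2), fun i x h => if_pos h,
      fun i x h => if_neg (by dsimp only; omega)⟩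
  -- The new line is absorbed by the vertical strands next to it: to the left of `c` upwards, to the
  -- right of `c` downwards. The point `c` itself is exceptional and follows its ray up to the next
  -- free endpoint `q`.
  obtain ⟨ψ, ψ1, ψ2, ψ3, ψ4, ψ5⟩ : ∃ ψ : ℕ × ℤ → ℕ × ℤ, (∀ i x, i ≤ j → ψ (i, x) = (i, x)) ∧
      (∀ x, x < c → ψ (j + 1, x) = (j + 1, x)) ∧ ψ (j + 1, c) = (j + 1, q) ∧
      (∀ x, c < x → ψ (j + 1, x) = (j, x)) ∧ ∀ i x, j + 1 < i → ψ (i, x) = (i - 1, x) := by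
    refine ⟨fun w => if w.1 ≤ j then w else if w.1 = j + 1 then
      (if w.2 < c then w else if w.2 = c then (w.1, q) else (j, w.2)) else (w.1 - 1, w.2),
      ?_, ?_, ?_, ?_, ?_⟩
    · intro i x h
      exact if_pos h
    · intro x h
      simp [h]
    · simp
    · intro x h
      have h1 : ¬ x < c := by omega
      have h2 : ¬ x = c := by omega
      simp [h1, h2]
    · intro i x h
      have h1 : ¬ i ≤ j := by omega
      have h2 : ¬ i = j + 1 := by omega
      simp [h1, h2]
  refine orientable_congr rfl rfl φ ψ ?_ ?_ ?_ ?_ (fun x => ?_) (fun x => ?_) ?_ ?_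
  · rintro v w (⟨x, hx⟩ | ⟨i, τ, hi, u, v, h⟩ | ⟨x, hx⟩)
    · rw [φ1 _ _ (by omega), φ1 _ _ (by omega)]
      exact .rel _ _ (.bottomCup x hx)
    · have hi : (pre ++ σ :: post)[i]? = some τ := hi
      rw [eE] at hi
      rcases lt_trichotomy i j with h1 | rfl | h1
      · rw [if_pos h1] at hi
        have : ∀ s : Bool, i + s.toNat ≤ j := fun s => by have := s.toNat_le; omega
        rw [φ1 _ _ (this _), φ1 _ _ (this _)]
        refine .rel _ _ (.strand i τ ?_ u v h)
        rw [eL, if_pos h1, hi]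
      · rw [if_neg (lt_irrefl _), if_pos rfl, Option.some.injEq] at hi
        subst hi
        have al : (⟨b, pre ++ σ.below c :: σ.above c :: post, t⟩ : StackedDiagram).middle[i]? =
            some (σ.below c) := by simp [eL]
        have au : (⟨b, pre ++ σ.below c :: σ.above c :: post, t⟩ : StackedDiagram).middle[i + 1]? =
            some (σ.above c) := by simp [eL]
        rcases h with ⟨x, hx⟩ | ⟨x, hx⟩ | ⟨x, y, hx⟩
        · change Connected _ (φ (i, x)) (φ (i, σ.capMate x))
          rw [φ1 _ _ le_rfl, φ1 _ _ le_rfl]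
          by_cases hxc : x - 1 < c
          · have e : (σ.below c).capMate x = σ.capMate x := by rw [capL, if_pos hxc]
            rw [← e] at hx ⊢
            exact .rel _ _ (.strand i _ al _ _ (.cap x hx))
          · have e : (σ.above c).capMate x = σ.capMate x := by rw [capR, if_neg hxc]
            have h3 := capc x
            rw [← e] at hx h3 ⊢
            exact .trans _ _ _ (.rel _ _ (s1 x (by omega))) (.trans _ _ _
              (.rel _ _ (.strand (i + 1) _ au _ _ (.cap x hx))) (.symm _ _ (.rel _ _ (s1 _ (by
                omega)))))
        · change Connected _ (φ (i + 1, x)) (φ (i + 1, σ.mate x))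
          rw [φ2 _ _ (by omega), φ2 _ _ (by omega)]
          have h3 := hc x
          by_cases hxc : x < c
          · have e : (σ.below c).mate x = σ.mate x := by rw [hc.below_mate, if_pos hxc]
            rw [← e] at hx h3 ⊢
            exact .trans _ _ _ (.symm _ _ (.rel _ _ (s2 x (by omega)))) (.trans _ _ _
              (.rel _ _ (.strand i _ al _ _ (.cup x hx))) (.rel _ _ (s2 _ (by
                dsimp only
                omega))))
          · have e : (σ.above c).mate x = σ.mate x := by rw [hc.above_mate, if_neg hxc]
            rw [← e] at hx h3 ⊢
            exact .rel _ _ (.strand (i + 1) _ au _ _ (.cup x hx))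
        · change Connected _ (φ (i, x)) (φ (i + 1, y))
          rw [φ1 _ _ le_rfl, φ2 _ _ (by omega)]
          obtain ⟨r1, r2, r3, r4⟩ := hx
          -- The point where the ray from `x` to `y` crosses the new line: it is vertical above the
          -- cut if it stays to the left of `c`, vertical below the cut if it stays to the right,
          -- and otherwise passes through `c`.
          have hl := fun h => Arc.strand (E := ⟨b, pre ++ σ.below c :: σ.above c :: post, t⟩)
            i _ al _ _ (.ray x (if y < c then y else if c < x then x else c) h)
          have hu := fun h => Arc.strand (E := ⟨b, pre ++ σ.below c :: σ.above c :: post, t⟩)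
            (i + 1) _ au _ _ (.ray (if y < c then y else if c < x then x else c) y h)
          refine .trans _ _ _ (.rel _ _ (hl ⟨?_, ?_, ?_, ?_⟩)) (.rel _ _ (hu ⟨?_, ?_, ?_, ?_⟩))
          · rw [capL]
            split_ifs <;> trivial
          · rw [hc.below_mate]
            split_ifs <;> first | trivial | omega
          · split_ifs <;> omega
          · intro z h1 h2
            have := r4 z
            rw [hc.below_mate]
            split_ifs at h2 ⊢ <;> omega
          · rw [capR]
            split_ifs <;> first | trivial | omega
          · rw [hc.above_mate]
            split_ifs <;> trivial
          · split_ifs <;> omega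
          · intro z h1 h2
            have := r4 z
            rw [hc.above_mate]
            split_ifs at h1 ⊢ <;> omega
      · rw [if_neg (by omega), if_neg (by omega)] at hi
        rw [φ2 _ _ (by omega), φ2 _ _ (by omega), add_right_comm, add_right_comm i v.1.toNat]
        refine .rel _ _ (.strand (i + 1) τ ?_ u v h)
        rw [eL, if_neg (by omega), if_neg (by omega), if_neg (by omega), ← hi]
        congr 1
        omega
    · rw [mE, φ2 _ _ (by omega), φ2 _ _ (by omega)]
      have := Arc.topCap (E := ⟨b, pre ++ σ.below c :: σ.above c :: post, t⟩) x hx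
      rw [mF] at this
      exact .rel _ _ this
  · rintro v w (⟨x, hx⟩ | ⟨i, τ, hi, u, v, h⟩ | ⟨x, hx⟩)
    · rw [ψ1 _ _ (by omega), ψ1 _ _ (by omega)]
      exact .rel _ _ (.bottomCup x hx)
    · have hi : (pre ++ σ.below c :: σ.above c :: post)[i]? = some τ := hi
      rw [eL] at hi
      have ae : (⟨b, pre ++ σ :: post, t⟩ : StackedDiagram).middle[j]? = some σ := by simp [eE]
      by_cases h1 : i < j
      · rw [if_pos h1] at hi
        have : ∀ s : Bool, i + s.toNat ≤ j := fun s => by have := s.toNat_le; omega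
        rw [ψ1 _ _ (this _), ψ1 _ _ (this _)]
        refine .rel _ _ (.strand i τ ?_ u v h)
        rw [eE, if_pos h1, hi]
      rw [if_neg h1] at hi
      by_cases h2 : i = j
      · rw [if_pos h2, Option.some.injEq] at hi
        subst hi h2
        rcases h with ⟨x, hx⟩ | ⟨x, hx⟩ | ⟨x, y, hx⟩
        · change Connected _ (ψ (i, x)) (ψ (i, (σ.below c).capMate x))
          rw [ψ1 _ _ le_rfl, ψ1 _ _ le_rfl]
          rw [capL] at hx ⊢
          split_ifs at hx ⊢ with h3
          · exact .rel _ _ (.strand i σ ae _ _ (.cap x hx))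
          · exact .refl _
        · change Connected _ (ψ (i + 1, x)) (ψ (i + 1, (σ.below c).mate x))
          rw [hc.below_mate] at hx ⊢
          split_ifs at hx ⊢ with h3
          · rw [ψ2 _ h3, ψ2 _ ((hc x).2 h3)]
            exact .rel _ _ (.strand i σ ae _ _ (.cup x hx))
          · exact .refl _
        · change Connected _ (ψ (i, x)) (ψ (i + 1, y))
          obtain ⟨r1, r2, r3, r4⟩ := hx
          rw [ψ1 _ _ le_rfl]
          rw [capL] at r1
          rw [hc.below_mate] at r2
          have r4' : ∀ z, x ≤ z → z < y → z < c ∧ σ.mate z ≠ z := by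
            intro z z1 z2
            have := r4 z z1 z2
            rw [hc.below_mate] at this
            grind
          rcases lt_trichotomy y c with hy | rfl | hy
          · rw [ψ2 _ hy]
            refine .rel _ _ (.strand i σ ae (false, x) (true, y) (.ray x y ⟨?_, ?_, r3, ?_⟩))
            · rwa [if_pos (by omega)] at r1
            · rwa [if_pos (by omega)] at r2
            · exact fun z z1 z2 => (r4' z z1 z2).2
          · rw [ψ3]
            refine .rel _ _ (.strand i σ ae (false, x) (true, q) (.ray x q ⟨?_, hq2, by omega, ?_⟩))
            · rwa [if_pos (by omega)] at r1
            · intro z z1 z2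
              by_cases hz : z < y
              · exact (r4' z z1 hz).2
              · exact hq3 z (by omega) z2
          · have hxy : x = y := by
              by_contra hxy
              have := r4' (y - 1) (by omega) (by omega)
              omega
            rw [ψ4 _ hy, hxy]
            exact .refl _
      rw [if_neg h2] at hi
      by_cases h2 : i = j + 1
      · rw [if_pos h2, Option.some.injEq] at hi
        subst hi h2
        rcases h with ⟨x, hx⟩ | ⟨x, hx⟩ | ⟨x, y, hx⟩
        · change Connected _ (ψ (j + 1, x)) (ψ (j + 1, (σ.above c).capMate x))
          rw [capR] at hx ⊢
          split_ifs at hx ⊢ with h3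
          · exact .refl _
          · have := capc x
            rw [ψ4 _ (by omega), ψ4 _ (by omega)]
            exact .rel _ _ (.strand j σ ae _ _ (.cap x hx))
        · change Connected _ (ψ (j + 1 + 1, x)) (ψ (j + 1 + 1, (σ.above c).mate x))
          rw [ψ5 _ _ (by omega), ψ5 _ _ (by omega)]
          rw [hc.above_mate] at hx ⊢
          split_ifs at hx ⊢ with h3
          · exact .refl _
          · exact .rel _ _ (.strand j σ ae _ _ (.cup x hx))
        · change Connected _ (ψ (j + 1, x)) (ψ (j + 1 + 1, y))
          obtain ⟨r1, r2, r3, r4⟩ := hx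
          rw [ψ5 (j + 1 + 1) y (by omega)]
          rw [capR] at r1
          rw [hc.above_mate] at r2
          have r4' : ∀ z, x ≤ z → z < y → c ≤ z ∧ σ.mate z ≠ z := by
            intro z z1 z2
            have := r4 z z1 z2
            rw [hc.above_mate] at this
            grind
          rcases lt_trichotomy x c with hx | rfl | hx
          · have hxy : x = y := by
              by_contra hxy
              have := r4' x (by omega) (by omega)
              omega
            rw [ψ2 _ hx, hxy]
            exact .refl _
          · have hqy : q = y := by
              rw [if_neg (by omega)] at r2
              rcases lt_trichotomy q y with h | h | h
              · exact absurd hq2 (r4' q (by omega) h).2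
              · exact h
              · exact absurd r2 (hq3 y r3 h)
            rw [ψ3, hqy]
            exact .refl _
          · rw [ψ4 _ hx]
            refine .rel _ _ (.strand j σ ae (false, x) (true, y) (.ray x y ⟨?_, ?_, r3, ?_⟩))
            · rwa [if_neg (by omega)] at r1
            · rwa [if_neg (by omega)] at r2
            · exact fun z z1 z2 => (r4' z z1 z2).2
      rw [if_neg h2] at hi
      rw [ψ5 _ _ (by omega), ψ5 _ _ (by omega)]
      have e : ∀ k, i + k - 1 = i - 1 + k := fun k => by omega
      rw [e, e]
      refine .rel _ _ (.strand (i - 1) τ ?_ u v h)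
      rw [eE, if_neg (by omega), if_neg (by omega), ← hi]
      congr 1
      omega
    · rw [mF, ψ5 _ _ (by omega), ψ5 _ _ (by omega)]
      have := Arc.topCap (E := ⟨b, pre ++ σ :: post, t⟩) x hx
      rw [mE] at this
      exact .rel _ _ this
  · rintro ⟨i, x⟩
    by_cases h : i ≤ j
    · rw [φ1 _ _ h, ψ1 _ _ h]
    · rw [φ2 _ _ (by omega), ψ5 _ _ (by omega)]
      rfl
  · rintro ⟨i, x⟩
    by_cases h : i ≤ j
    · rw [ψ1 _ _ h, φ1 _ _ h]
      exact .refl _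
    · by_cases h1 : i = j + 1
      · subst h1
        rcases lt_trichotomy x c with hx | rfl | hx
        · rw [ψ2 _ hx, φ2 _ _ (by omega)]
          exact .symm _ _ (.rel _ _ (s2 x hx))
        · rw [ψ3, φ2 _ _ (by omega)]
          exact .symm _ _ (.rel _ _ s3)
        · rw [ψ4 _ hx, φ1 _ _ (by omega)]
          exact .rel _ _ (s1 x hx)
      · rw [ψ5 _ _ (by omega), φ2 _ _ (by omega), Nat.sub_add_cancel (by omega)]
        exact .refl _
  · rw [φ1 _ _ (by omega)]
    exact .refl _
  · rw [mE, mF, φ2 _ _ (by omega)]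
    exact .refl _
  · rintro ⟨i, x⟩ hi
    rw [mE] at hi
    rw [mF]
    dsimp only at hi
    by_cases h : i ≤ j
    · rw [φ1 _ _ h]
      dsimp only
      omega
    · rw [φ2 _ _ (by omega)]
      dsimp only
      omega
  · rintro ⟨i, x⟩ hi
    rw [mF] at hi
    rw [mE]
    dsimp only at hi
    by_cases h : i ≤ j
    · rw [ψ1 _ _ h]
      dsimp only
      omega
    · by_cases h1 : i = j + 1
      · subst h1
        rcases lt_trichotomy x c with hx | rfl | hx
        · rw [ψ2 _ hx]
          dsimp only
          omega
        · rw [ψ3]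
          dsimp only
          omega
        · rw [ψ4 _ hx]
          dsimp only
          omega
      · rw [ψ5 _ _ (by omega)]
        dsimp only
        omega

end StackedDiagram

/-! ### Surgeries in one section, and commutation. -/

namespace CupDiagram

variable {σ : CupDiagram} {a a' : ℤ}

theorem IsOutermost.ne_mate (ha : σ.IsOutermost a) (ha' : σ.IsOutermost a') : a ≠ σ.mate a' := by
  intro h
  have h1 := ha.1
  have h2 := ha'.1
  have h3 := σ.mate_mate a'
  rw [← h] at h3
  omega

theorem IsOutermost.erase (ha : σ.IsOutermost a) (ha' : σ.IsOutermost a') (h : a ≠ a') :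
    (σ.erase a').IsOutermost a := by
  have h1 := ha.ne_mate ha'
  refine ⟨?_, fun i hi => ?_⟩
  · rw [erase_mate _ ha', if_neg (by tauto)]
    exact ha.1
  · rw [erase_mate _ ha']
    split_ifs
    exacts [hi, ha.2 i hi]

theorem erase_comm (ha : σ.IsOutermost a) (ha' : σ.IsOutermost a') (h : a ≠ a') :
    (σ.erase a').erase a = (σ.erase a).erase a' := by
  have h1 := ha.ne_mate ha'
  have h2 := ha'.ne_mate ha
  refine CupDiagram.ext (funext fun x => ?_)
  rw [erase_mate _ (ha.erase ha' h), erase_mate _ ha', erase_mate _ (ha'.erase ha h.symm),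
    erase_mate _ ha, erase_mate _ ha', erase_mate _ ha]
  grind

/-- The cup diagram without cups. -/
def trivial : CupDiagram where
  mate x := x
  mate_mate _ := rfl
  finite_cups := by simp
  nested i k h1 h2 := by omega

theorem eq_trivial (h : ∀ a, ¬ σ.IsOutermost a) : σ = trivial := by
  refine CupDiagram.ext (funext fun x => ?_)
  change σ.mate x = x
  by_contra hx
  obtain ⟨A, hA⟩ := σ.finite_cups.bddBelow
  obtain ⟨a, ha, hmin⟩ := Int.exists_least_of_bdd (P := fun y => σ.mate y ≠ y)
    ⟨A, fun z hz => hA hz⟩ ⟨x, hx⟩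
  refine h a ⟨?_, fun i hi => ?_⟩
  · have := hmin (σ.mate a) (by rw [σ.mate_mate]; exact fun h => ha h.symm)
    omega
  · by_contra hc
    have := hmin i (by omega)
    omega

theorem not_isOutermost_trivial : ¬ trivial.IsOutermost a := fun h => lt_irrefl _ h.1

end CupDiagram

namespace StackedDiagram

variable {E : StackedDiagram}

theorem exists_split {j : ℕ} {σ : CupDiagram} (hσ : E.middle[j]? = some σ) :
    ∃ pre post, pre.length = j ∧ E = ⟨E.bottom, pre ++ σ :: post, E.top⟩ := by
  obtain ⟨h, rfl⟩ := List.getElem?_eq_some_iff.1 hσ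
  refine ⟨E.middle.take j, E.middle.drop (j + 1), by simp; omega, ?_⟩
  ext1
  · rfl
  · simp
  · rfl

theorem replace_mk {b t σ : CupDiagram} {pre post : List CupDiagram} {a : ℤ} :
    (⟨b, pre ++ σ :: post, t⟩ : StackedDiagram).replace pre.length a =
      ⟨b, pre ++ σ.erase a :: post, t⟩ := by
  unfold replace
  congr 1
  induction pre with
  | nil => rfl
  | cons x l ih => simpa using ih

theorem replace_mk_succ {b t σ τ : CupDiagram} {pre post : List CupDiagram} {a : ℤ} :
    (⟨b, pre ++ τ :: σ :: post, t⟩ : StackedDiagram).replace (pre.length + 1) a =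
      ⟨b, pre ++ τ :: σ.erase a :: post, t⟩ := by
  have := replace_mk (b := b) (t := t) (σ := σ) (pre := pre ++ [τ]) (post := post) (a := a)
  simpa using this

/-- The left endpoint of the right one of the two cups is a cut, so after splitting the section
there the two cups lie in different sections. -/
theorem Orientable.of_replace_same {j : ℕ} {a a' : ℤ} {σ : CupDiagram} (haa : a ≠ a')
    (hE : E.Orientable) (hσ : E.middle[j]? = some σ) (ha : σ.IsOutermost a)
    (ha' : σ.IsOutermost a') (h' : (E.replace j a').Orientable)
    (h'' : ((E.replace j a').replace j a).Orientable) : (E.replace j a).Orientable := by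
  obtain ⟨pre, post, rfl, he⟩ := exists_split hσ
  rw [he] at hE h' h'' ⊢
  generalize E.bottom = b at *
  generalize E.top = t at *
  have ha2 := ha.erase ha' haa
  rw [replace_mk] at h' h'' ⊢
  rw [replace_mk] at h''
  rcases lt_or_gt_of_ne haa with h | h
  · have hc := ha'.isCut
    rw [orientable_split hc] at hE
    obtain ⟨r1, r2, r3⟩ := CupDiagram.above_erase_of_ge hc ha' le_rfl
    obtain ⟨l1, l2, l3⟩ := CupDiagram.below_erase_of_lt hc ha h
    obtain ⟨m1, m2, m3⟩ := CupDiagram.below_erase_of_lt (hc.erase ha') ha2 h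
    rw [orientable_split (hc.erase ha'), r2, r3, ← replace_mk_succ] at h'
    rw [orientable_split ((hc.erase ha').erase ha2), m2, m3, r2, r3, ← replace_mk,
      ← replace_mk_succ] at h''
    rw [orientable_split (hc.erase ha), l2, l3, ← replace_mk]
    exact hE.of_replace_of_ne (by omega) (by simp) l1 (by simp) r1 h' h''
  · have hc := ha.isCut
    rw [orientable_split hc] at hE
    obtain ⟨r1, r2, r3⟩ := CupDiagram.below_erase_of_lt hc ha' h
    obtain ⟨l1, l2, l3⟩ := CupDiagram.above_erase_of_ge hc ha le_rfl
    obtain ⟨m1, m2, m3⟩ := CupDiagram.above_erase_of_ge (hc.erase ha') ha2 le_rfl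
    rw [orientable_split (hc.erase ha'), r2, r3, ← replace_mk] at h'
    rw [orientable_split ((hc.erase ha').erase ha2), m2, m3, r2, r3, ← replace_mk_succ,
      ← replace_mk] at h''
    rw [orientable_split (hc.erase ha), l2, l3, ← replace_mk_succ]
    exact hE.of_replace_of_ne (by omega) (by simp) l1 (by simp) r1 h' h''

theorem IsPotentialSurgery.replace {j j' : ℕ} {a a' : ℤ} (h : E.IsPotentialSurgery j a)
    (h' : E.IsPotentialSurgery j' a') (hne : ¬ (j = j' ∧ a = a')) :
    (E.replace j' a').IsPotentialSurgery j a := by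
  obtain ⟨σ, hσ, ha⟩ := h
  obtain ⟨σ', hσ', ha'⟩ := h'
  by_cases hj : j = j'
  · subst hj
    obtain rfl : σ = σ' := by
      rw [hσ] at hσ'
      exact Option.some.inj hσ'
    exact ⟨_, replace_middle_self hσ, ha.erase ha' fun h => hne ⟨rfl, h⟩⟩
  · exact ⟨σ, by rw [replace_middle_of_ne (fun h => hj h.symm), hσ], ha⟩

theorem replace_comm {j j' : ℕ} {a a' : ℤ} (h : E.IsPotentialSurgery j a)
    (h' : E.IsPotentialSurgery j' a') :
    (E.replace j' a').replace j a = (E.replace j a).replace j' a' := by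
  obtain ⟨σ, hσ, ha⟩ := h
  obtain ⟨σ', hσ', ha'⟩ := h'
  refine StackedDiagram.ext rfl (List.ext_getElem? fun i => ?_) rfl
  by_cases hj : j = j'
  · subst hj
    obtain rfl : σ = σ' := by
      rw [hσ] at hσ'
      exact Option.some.inj hσ'
    by_cases hi : j = i
    · subst hi
      rw [replace_middle_self (replace_middle_self hσ), replace_middle_self (replace_middle_self hσ)]
      by_cases haa : a = a'
      · rw [haa]
      · rw [CupDiagram.erase_comm ha ha' haa]
    · simp only [replace_middle_of_ne hi]
  · by_cases hi : j = i
    · subst hi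
      have hj' : j' ≠ j := fun h => hj h.symm
      rw [replace_middle_self (by rw [replace_middle_of_ne hj', hσ]), replace_middle_of_ne hj',
        replace_middle_self hσ]
    · by_cases hi' : j' = i
      · subst hi'
        rw [replace_middle_of_ne hi, replace_middle_self hσ',
          replace_middle_self (by rw [replace_middle_of_ne hi, hσ'])]
      · simp only [replace_middle_of_ne hi, replace_middle_of_ne hi']

theorem Orientable.of_replace_of_potential {j j' : ℕ} {a a' : ℤ} (hE : E.Orientable)
    (h : E.IsPotentialSurgery j a) (h' : E.IsPotentialSurgery j' a') (hne : ¬ (j = j' ∧ a = a'))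
    (h1 : (E.replace j' a').Orientable)
    (h2 : ((E.replace j' a').replace j a).Orientable) : (E.replace j a).Orientable := by
  obtain ⟨σ, hσ, ha⟩ := h
  obtain ⟨σ', hσ', ha'⟩ := h'
  by_cases hj : j = j'
  · subst hj
    obtain rfl : σ = σ' := by
      rw [hσ] at hσ'
      exact Option.some.inj hσ'
    exact hE.of_replace_same (fun h => hne ⟨rfl, h⟩) hσ ha ha' h1 h2
  · exact hE.of_replace_of_ne hj hσ ha hσ' ha' h1 h2

theorem surgery_of_potential {j : ℕ} {a : ℤ} (h : E.IsPotentialSurgery j a) [Decidable (E.replace j a).Orientable] :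
    surgery j a E = if (E.replace j a).Orientable then some (E.replace j a) else none := by
  unfold surgery
  simp only [h, true_and]

/-- Surgeries commute. -/
theorem Orientable.surgery_comm {j j' : ℕ} {a a' : ℤ} (hE : E.Orientable)
    (h : E.IsPotentialSurgery j a) (h' : E.IsPotentialSurgery j' a') :
    (surgery j' a' E).bind (surgery j a) = (surgery j a E).bind (surgery j' a') := by
  classical
  by_cases hne : j = j' ∧ a = a'
  · obtain ⟨rfl, rfl⟩ := hne
    rfl
  · have hne' : ¬ (j' = j ∧ a' = a) := fun h => hne ⟨h.1.symm, h.2.symm⟩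
    rw [surgery_of_potential h, surgery_of_potential h']
    have k1 := surgery_of_potential (h.replace h' hne)
    have k2 := surgery_of_potential (h'.replace h hne')
    have o1 := hE.of_replace_of_potential h h' hne
    have o2 := hE.of_replace_of_potential h' h hne'
    rw [← replace_comm h h'] at k2 o2
    -- If exactly one of the single surgeries gives an orientable diagram, the double surgery cannot
    -- be orientable, so both sides are zero.
    by_cases c1 : (E.replace j' a').Orientable <;> by_cases c2 : (E.replace j a).Orientable
    · rw [if_pos c1, if_pos c2, Option.bind_some, Option.bind_some, k1, k2]
    · rw [if_pos c1, if_neg c2, Option.bind_some, k1, if_neg fun h => c2 (o1 c1 h)]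
      rfl
    · rw [if_neg c1, if_pos c2, Option.bind_some, k2, if_neg fun h => c1 (o2 c2 h)]
      rfl
    · rw [if_neg c1, if_neg c2]
      rfl

/-- A section without cups can be removed. -/
theorem orientable_insert_trivial {b t : CupDiagram} {pre post : List CupDiagram} :
    (⟨b, pre ++ CupDiagram.trivial :: post, t⟩ : StackedDiagram).Orientable ↔
      (⟨b, pre ++ post, t⟩ : StackedDiagram).Orientable := by
  obtain ⟨j, hj⟩ : ∃ j, j = pre.length := ⟨_, rfl⟩
  have eF : ∀ i, (pre ++ CupDiagram.trivial :: post)[i]? = if i < j then pre[i]? else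
      if i = j then some CupDiagram.trivial else post[i - j - 1]? := by
    intro i
    rw [getElem?_insert, ← hj]
  have eE : ∀ i, (pre ++ post)[i]? = if i < j then pre[i]? else post[i - j]? := by
    intro i
    rw [List.getElem?_append, ← hj]
  have s : ∀ x, (⟨b, pre ++ CupDiagram.trivial :: post, t⟩ : StackedDiagram).Arc
      (j, x) (j + 1, x) := fun x => by
    refine .strand j CupDiagram.trivial (by simp [eF]) (false, x) (true, x)
      (.ray x x ⟨?_, rfl, le_rfl, fun z _ _ => by omega⟩)
    simp [CupDiagram.capMate, CupDiagram.trivial]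
  have mE : (⟨b, pre ++ post, t⟩ : StackedDiagram).middle.length = j + post.length := by
    simp only [List.length_append, ← hj]
  have mF : (⟨b, pre ++ CupDiagram.trivial :: post, t⟩ : StackedDiagram).middle.length =
      j + post.length + 1 := by
    simp only [List.length_append, List.length_cons, ← hj]
    omega
  obtain ⟨φ, φ1, φ2⟩ : ∃ φ : ℕ × ℤ → ℕ × ℤ, (∀ i x, i ≤ j → φ (i, x) = (i, x)) ∧
      ∀ i x, j < i → φ (i, x) = (i + 1, x) :=
    ⟨fun v => if v.1 ≤ j then v else (v.1 + 1, v.2), fun i x h => if_pos h,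
      fun i x h => if_neg (by dsimp only; omega)⟩
  obtain ⟨ψ, ψ1, ψ2⟩ : ∃ ψ : ℕ × ℤ → ℕ × ℤ, (∀ i x, i ≤ j → ψ (i, x) = (i, x)) ∧
      ∀ i x, j < i → ψ (i, x) = (i - 1, x) :=
    ⟨fun v => if v.1 ≤ j then v else (v.1 - 1, v.2), fun i x h => if_pos h,
      fun i x h => if_neg (by dsimp only; omega)⟩
  have φ3 : ∀ i x, j ≤ i → (⟨b, pre ++ CupDiagram.trivial :: post, t⟩ : StackedDiagram).Connected
      (φ (i, x)) (i + 1, x) := fun i x h => by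
    rcases h.lt_or_eq with h | rfl
    · rw [φ2 _ _ h]
      exact .refl _
    · rw [φ1 _ _ le_rfl]
      exact .rel _ _ (s x)
  have ψ3 : ∀ i x, j ≤ i → ψ (i + 1, x) = (i, x) := fun i x h => by
    rw [ψ2 _ _ (by omega)]
    rfl
  symm
  refine orientable_congr rfl rfl φ ψ ?_ ?_ ?_ ?_ (fun x => ?_) (fun x => ?_) ?_ ?_
  · rintro v w (⟨x, hx⟩ | ⟨i, τ, hi, u, v, h⟩ | ⟨x, hx⟩)
    · rw [φ1 _ _ (by omega), φ1 _ _ (by omega)]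
      exact .rel _ _ (.bottomCup x hx)
    · have hi : (pre ++ post)[i]? = some τ := hi
      rw [eE] at hi
      by_cases h1 : i < j
      · rw [if_pos h1] at hi
        have : ∀ s : Bool, i + s.toNat ≤ j := fun s => by have := s.toNat_le; omega
        rw [φ1 _ _ (this _), φ1 _ _ (this _)]
        refine .rel _ _ (.strand i τ ?_ u v h)
        rw [eF, if_pos h1, hi]
      · rw [if_neg h1] at hi
        refine .trans _ _ _ (φ3 _ _ (by omega)) (.trans _ _ _ ?_ (.symm _ _ (φ3 _ _ (by omega))))
        rw [add_right_comm, add_right_comm i v.1.toNat]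
        refine .rel _ _ (.strand (i + 1) τ ?_ u v h)
        rw [eF, if_neg (by omega), if_neg (by omega), ← hi]
        congr 1
        omega
    · rw [mE]
      refine .trans _ _ _ (φ3 _ _ (by omega)) (.trans _ _ _ ?_ (.symm _ _ (φ3 _ _ (by omega))))
      have := Arc.topCap (E := ⟨b, pre ++ CupDiagram.trivial :: post, t⟩) x hx
      rw [mF] at this
      exact .rel _ _ this
  · rintro v w (⟨x, hx⟩ | ⟨i, τ, hi, u, v, h⟩ | ⟨x, hx⟩)
    · rw [ψ1 _ _ (by omega), ψ1 _ _ (by omega)]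
      exact .rel _ _ (.bottomCup x hx)
    · have hi : (pre ++ CupDiagram.trivial :: post)[i]? = some τ := hi
      rw [eF] at hi
      rcases lt_trichotomy i j with h1 | rfl | h1
      · rw [if_pos h1] at hi
        have : ∀ s : Bool, i + s.toNat ≤ j := fun s => by have := s.toNat_le; omega
        rw [ψ1 _ _ (this _), ψ1 _ _ (this _)]
        refine .rel _ _ (.strand i τ ?_ u v h)
        rw [eE, if_pos h1, hi]
      · rw [if_neg (lt_irrefl _), if_pos rfl, Option.some.injEq] at hi
        subst hi
        rcases h with ⟨x, hx⟩ | ⟨x, hx⟩ | ⟨x, y, hx⟩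
        · exact absurd (sub_add_cancel x 1) hx
        · exact absurd rfl hx
        · obtain rfl : x = y := by
            obtain ⟨-, -, r3, r4⟩ := hx
            by_contra hxy
            exact r4 x le_rfl (by omega) rfl
          change Connected _ (ψ (i, x)) (ψ (i + 1, x))
          rw [ψ1 _ _ le_rfl, ψ3 _ _ le_rfl]
          exact .refl _
      · rw [if_neg (by omega), if_neg (by omega)] at hi
        rw [ψ2 _ _ (by omega), ψ2 _ _ (by omega)]
        have e : ∀ k, i + k - 1 = i - 1 + k := fun k => by omega
        rw [e, e]
        refine .rel _ _ (.strand (i - 1) τ ?_ u v h)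
        rw [eE, if_neg (by omega), ← hi]
        congr 1
        omega
    · rw [mF, ψ3 _ _ (by omega), ψ3 _ _ (by omega)]
      have := Arc.topCap (E := ⟨b, pre ++ post, t⟩) x hx
      rw [mE] at this
      exact .rel _ _ this
  · rintro ⟨i, x⟩
    by_cases h : i ≤ j
    · rw [φ1 _ _ h, ψ1 _ _ h]
    · rw [φ2 _ _ (by omega), ψ3 _ _ (by omega)]
  · rintro ⟨i, x⟩
    by_cases h : i ≤ j
    · rw [ψ1 _ _ h, φ1 _ _ h]
      exact .refl _
    · have := φ3 (i - 1) x (by omega)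
      rw [Nat.sub_add_cancel (by omega)] at this
      rw [ψ2 _ _ (by omega)]
      exact this
  · rw [φ1 _ _ (by omega)]
    exact .refl _
  · rw [mE, mF]
    exact φ3 _ _ (by omega)
  · rintro ⟨i, x⟩ hi
    rw [mE] at hi
    rw [mF]
    dsimp only at hi
    by_cases h : i ≤ j
    · rw [φ1 _ _ h]
      dsimp only
      omega
    · rw [φ2 _ _ (by omega)]
      dsimp only
      omega
  · rintro ⟨i, x⟩ hi
    rw [mF] at hi
    rw [mE]
    dsimp only at hi
    by_cases h : i ≤ j
    · rw [ψ1 _ _ h]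
      dsimp only
      omega
    · rw [ψ2 _ _ (by omega)]
      dsimp only
      omega

end StackedDiagram

/-! ### Gluing stacked diagrams. -/

/-- Shift a dart upwards. -/
def Dart.shift (m : ℕ) (d : Dart) : Dart := (d.1 + m, d.2.1, d.2.2)

namespace StackedDiagram

section Glue

variable {b μ t : CupDiagram} {l₁ l₂ : List CupDiagram}

theorem sec_glue_of_le {z : ℕ} (hz : z ≤ l₁.length + 1) :
    (⟨b, l₁ ++ μ :: l₂, t⟩ : StackedDiagram).sec z = (⟨b, l₁, μ⟩ : StackedDiagram).sec z := by
  unfold sec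
  dsimp only
  have : b :: (l₁ ++ μ :: l₂ ++ [t]) = (b :: (l₁ ++ [μ])) ++ (l₂ ++ [t]) := by simp
  rw [this, List.getD_append]
  simp
  omega

theorem sec_glue_of_ge {z : ℕ} (hz : z ≤ l₂.length + 1) :
    (⟨b, l₁ ++ μ :: l₂, t⟩ : StackedDiagram).sec (z + (l₁.length + 1)) =
      (⟨μ, l₂, t⟩ : StackedDiagram).sec z := by
  unfold sec
  dsimp only
  have : b :: (l₁ ++ μ :: l₂ ++ [t]) = (b :: l₁) ++ (μ :: (l₂ ++ [t])) := by simp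
  rw [this, List.getD_append_right _ _ _ _ (by simp)]
  simp only [List.length_cons, Nat.add_sub_cancel]
  rw [List.getD_eq_getElem _ _ (by simp; omega), List.getD_eq_getElem _ _ (by simp; omega)]

theorem length_glue : (⟨b, l₁ ++ μ :: l₂, t⟩ : StackedDiagram).middle.length =
    l₂.length + (l₁.length + 1) := by
  simp only [List.length_append, List.length_cons]
  omega

theorem zone_shift (m : ℕ) (d : Dart) : (d.shift m).zone = d.zone + m := by
  simp only [Dart.shift, Dart.zone]
  omega

theorem zone_le {d : Dart} {m : ℕ} (h : d.1 ≤ m) : d.zone ≤ m + 1 := by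
  have := d.2.1.toNat_le
  unfold Dart.zone
  omega

theorem rayDart_glue_of_le {d : Dart} (hd : d.1 ≤ l₁.length) :
    (⟨b, l₁ ++ μ :: l₂, t⟩ : StackedDiagram).rayDart d = (⟨b, l₁, μ⟩ : StackedDiagram).rayDart d := by
  unfold rayDart
  rw [sec_glue_of_le (zone_le hd)]

theorem rayDart_glue_of_ge {d : Dart} (hd : d.1 ≤ l₂.length) :
    (⟨b, l₁ ++ μ :: l₂, t⟩ : StackedDiagram).rayDart (d.shift (l₁.length + 1)) =
      ((⟨μ, l₂, t⟩ : StackedDiagram).rayDart d).shift (l₁.length + 1) := by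
  unfold rayDart
  rw [zone_shift, sec_glue_of_ge (zone_le hd)]
  rfl

variable {κ : ℤ → ℤ}

/-- The cap diagram of `μ` at the top of one diagram and its cup diagram at the bottom of the other
become a middle section; their cups stay, and their rays are joined with the usual shift by one. -/
theorem arcs_glue_topEnd (u : ℤ) : (⟨b, l₁ ++ μ :: l₂, t⟩ : StackedDiagram).arcs κ (fun n => n)
    ((⟨b, l₁, μ⟩ : StackedDiagram).topEnd u) =
      ((⟨μ, l₂, t⟩ : StackedDiagram).bottomEnd (u + 1)).shift (l₁.length + 1) := by
  rw [topEnd, ← rayDart_glue_of_le (b := b) (μ := μ) (t := t) (l₂ := l₂) (le_refl _), arcs_rayDart,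
    length_glue, bottomEnd, ← rayDart_glue_of_ge (b := b) (μ := μ) (l₁ := l₁) (Nat.zero_le _)]
  unfold joinRays
  have : l₁.length < l₂.length + (l₁.length + 1) := by omega
  simp [this, Dart.shift]

theorem arcs_glue_bottomEnd (v : ℤ) :
    (⟨b, l₁ ++ μ :: l₂, t⟩ : StackedDiagram).arcs κ (fun n => n)
      (((⟨μ, l₂, t⟩ : StackedDiagram).bottomEnd v).shift (l₁.length + 1)) =
        (⟨b, l₁, μ⟩ : StackedDiagram).topEnd (v - 1) := by
  rw [topEnd, ← rayDart_glue_of_le (b := b) (μ := μ) (t := t) (l₂ := l₂) (le_refl _), bottomEnd,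
    ← rayDart_glue_of_ge (b := b) (μ := μ) (l₁ := l₁) (Nat.zero_le _), arcs_rayDart,
    length_glue]
  unfold joinRays
  simp [Dart.shift]

theorem arcs_glue_of_le {d : Dart} (hd : d.1 ≤ l₁.length) :
    (⟨b, l₁ ++ μ :: l₂, t⟩ : StackedDiagram).arcs κ (fun n => n) d =
        (⟨b, l₁, μ⟩ : StackedDiagram).arcs κ (fun n => n) d ∨
      ∃ u, d = (⟨b, l₁, μ⟩ : StackedDiagram).topEnd u := by
  have hs := sec_glue_of_le (b := b) (μ := μ) (t := t) (l₂ := l₂) (zone_le hd)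
  by_cases hm : ((⟨b, l₁, μ⟩ : StackedDiagram).sec d.zone).mate d.2.2 = d.2.2
  · obtain ⟨⟨j, u, n⟩, rfl⟩ := exists_rayDart hm
    have hj : j ≤ l₁.length := hd
    by_cases h : j = l₁.length ∧ u = true
    · obtain ⟨rfl, rfl⟩ := h
      exact Or.inr ⟨n, rfl⟩
    · left
      have e : joinRays (l₂.length + (l₁.length + 1)) κ (fun n => n) (j, u, n) =
          joinRays l₁.length κ (fun n => n) (j, u, n) := by
        unfold joinRays
        dsimp only
        cases u
        · by_cases h0 : j = 0
          · simp [h0]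
          · have h1 : j ≤ l₂.length + (l₁.length + 1) := by omega
            simp [h0, h1, hj]
        · have h0 : j < l₁.length := by
            simp only [and_true] at h
            omega
          have h1 : j < l₂.length + (l₁.length + 1) := by omega
          simp [h0, h1]
      have hd' : (joinRays l₁.length κ (fun n => n) (j, u, n)).1 ≤ l₁.length := joinRays_le.2 hj
      rw [← rayDart_glue_of_le (b := b) (μ := μ) (t := t) (l₂ := l₂) (d := (j, u, n)) hj,
        arcs_rayDart, length_glue, e,
        rayDart_glue_of_le (b := b) (μ := μ) (t := t) (l₂ := l₂) (d := (j, u, n)) hj, arcs_rayDart,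
        rayDart_glue_of_le hd']
  · left
    rw [arcs_cup hm, arcs_cup (by rwa [hs]), hs]

theorem arcs_glue_of_ge {d : Dart} (hd : d.1 ≤ l₂.length) :
    (⟨b, l₁ ++ μ :: l₂, t⟩ : StackedDiagram).arcs κ (fun n => n) (d.shift (l₁.length + 1)) =
        ((⟨μ, l₂, t⟩ : StackedDiagram).arcs κ (fun n => n) d).shift (l₁.length + 1) ∨
      ∃ v, d = (⟨μ, l₂, t⟩ : StackedDiagram).bottomEnd v := by
  have hs := sec_glue_of_ge (b := b) (μ := μ) (t := t) (l₁ := l₁) (zone_le hd)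
  rw [← zone_shift] at hs
  by_cases hm : ((⟨μ, l₂, t⟩ : StackedDiagram).sec d.zone).mate d.2.2 = d.2.2
  · obtain ⟨⟨j, u, n⟩, rfl⟩ := exists_rayDart hm
    have hj : j ≤ l₂.length := hd
    by_cases h : j = 0 ∧ u = false
    · obtain ⟨rfl, rfl⟩ := h
      exact Or.inr ⟨n, rfl⟩
    · left
      have e : joinRays (l₂.length + (l₁.length + 1)) κ (fun n => n)
          (Dart.shift (l₁.length + 1) (j, u, n)) =
          (joinRays l₂.length κ (fun n => n) (j, u, n)).shift (l₁.length + 1) := by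
        unfold joinRays Dart.shift
        dsimp only
        cases u
        · have h0 : j ≠ 0 := by
            simp only [and_true] at h
            exact h
          have h1 : j + (l₁.length + 1) - 1 = j - 1 + (l₁.length + 1) := by omega
          simp only [Bool.false_eq_true, if_false, if_neg h0, if_pos hj, h1]
          rw [if_neg (by omega), if_pos (by omega)]
        · by_cases h0 : j < l₂.length
          · simp [h0]
            omega
          · obtain rfl : j = l₂.length := by omega
            simp
      have hd' : (joinRays l₂.length κ (fun n => n) (j, u, n)).1 ≤ l₂.length := joinRays_le.2 hj
      rw [← rayDart_glue_of_ge (d := (j, u, n)) hj, arcs_rayDart, arcs_rayDart, length_glue, e,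
        rayDart_glue_of_ge hd']
  · left
    have e : (d.shift (l₁.length + 1)).2.2 = d.2.2 := rfl
    rw [arcs_cup hm, arcs_cup (by rwa [hs, e]), hs]
    rfl

theorem topEnd_glue (u : ℤ) : (⟨b, l₁ ++ μ :: l₂, t⟩ : StackedDiagram).topEnd u =
    ((⟨μ, l₂, t⟩ : StackedDiagram).topEnd u).shift (l₁.length + 1) := by
  rw [topEnd_eq, topEnd_eq, length_glue]
  rfl

theorem link_glue_of_le {d e : Dart} (hd : d.1 ≤ l₁.length)
    (h : Link Dart.flip ((⟨b, l₁, μ⟩ : StackedDiagram).arcs κ fun n => n) d e) :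
    Link Dart.flip ((⟨b, l₁ ++ μ :: l₂, t⟩ : StackedDiagram).arcs κ fun n => n) d e := by
  refine Link.of_rel_on (f := Dart.flip) (p := fun d : Dart => d.1 ≤ l₁.length) (r := Link Dart.flip
    ((⟨b, l₁ ++ μ :: l₂, t⟩ : StackedDiagram).arcs κ fun n => n)) (fun _ => Iff.rfl)
    (arcs_le (E := ⟨b, l₁, μ⟩)) ⟨.refl, .symm, .trans⟩ (fun d _ => .left d) (fun d hd => ?_) h hd
  rcases arcs_glue_of_le (b := b) (μ := μ) (t := t) (l₂ := l₂) (κ := κ) hd with h | ⟨u, rfl⟩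
  · rw [← h]
    exact .right d
  · rw [arcs_topEnd]
    exact .refl _

/-- Each arc of the closing at the bottom of the upper diagram is replaced by a path through the
lower one: `v - 1` and `-v` are joined there by the standard matching. -/
theorem TopCrit.link_shift (h : (⟨b, l₁, μ⟩ : StackedDiagram).TopCrit) {d e : Dart}
    (hd : d.1 ≤ l₂.length)
    (hl : Link Dart.flip ((⟨μ, l₂, t⟩ : StackedDiagram).arcs (fun n => 1 - n) fun n => n) d e) :
    Link Dart.flip ((⟨b, l₁ ++ μ :: l₂, t⟩ : StackedDiagram).arcs (fun n => 1 - n) fun n => n)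
      (d.shift (l₁.length + 1)) (e.shift (l₁.length + 1)) := by
  refine Link.of_rel_on (f := Dart.flip) (p := fun d : Dart => d.1 ≤ l₂.length) (r := fun d e => Link Dart.flip
    ((⟨b, l₁ ++ μ :: l₂, t⟩ : StackedDiagram).arcs (fun n => 1 - n) fun n => n)
    (d.shift (l₁.length + 1)) (e.shift (l₁.length + 1))) (fun _ => Iff.rfl)
    (arcs_le (E := ⟨μ, l₂, t⟩)) ⟨fun _ => .refl _, .symm, .trans⟩ (fun d _ => ?_) (fun d hd => ?_)
    hl hd
  · exact .left (f := Dart.flip) (d.shift (l₁.length + 1))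
  · have r := Link.right (f := Dart.flip)
      (g := (⟨b, l₁ ++ μ :: l₂, t⟩ : StackedDiagram).arcs (fun n => 1 - n) fun n => n)
    rcases arcs_glue_of_ge (b := b) (μ := μ) (t := t) (l₁ := l₁) (κ := fun n => 1 - n) hd with
      h1 | ⟨v, rfl⟩
    · rw [← h1]
      exact r _
    · have r1 := r (((⟨μ, l₂, t⟩ : StackedDiagram).bottomEnd v).shift (l₁.length + 1))
      have r2 := link_glue_of_le (t := t) (l₂ := l₂) (topEnd_le (E := ⟨b, l₁, μ⟩) _) (h.2 (v - 1))
      have r3 := r (((⟨μ, l₂, t⟩ : StackedDiagram).bottomEnd (1 - v)).shift (l₁.length + 1))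
      rw [arcs_glue_bottomEnd] at r1 r3
      rw [arcs_bottomEnd]
      rw [show -1 - (v - 1) = 1 - v - 1 by ring] at r2
      exact (r1.trans r2).trans r3.symm

/-- Conversely the lower diagram is contracted onto the bottom ends of the upper one. -/
theorem TopCrit.link_of_shift (h : (⟨b, l₁, μ⟩ : StackedDiagram).TopCrit) {d e : Dart}
    (hd : d.1 ≤ l₂.length)
    (hl : Link Dart.flip ((⟨b, l₁ ++ μ :: l₂, t⟩ : StackedDiagram).arcs (fun n => 1 - n) fun n => n)
      (d.shift (l₁.length + 1)) (e.shift (l₁.length + 1))) :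
    Link Dart.flip ((⟨μ, l₂, t⟩ : StackedDiagram).arcs (fun n => 1 - n) fun n => n) d e := by
  classical
  obtain ⟨U, hU⟩ : ∃ U : Dart → ℤ, ∀ d : Dart, d.1 ≤ l₁.length →
      Link Dart.flip ((⟨b, l₁, μ⟩ : StackedDiagram).arcs (fun n => 1 - n) fun n => n) d
        ((⟨b, l₁, μ⟩ : StackedDiagram).topEnd (U d)) := by
    have h1 : ∀ d : Dart, ∃ u, d.1 ≤ l₁.length →
        Link Dart.flip ((⟨b, l₁, μ⟩ : StackedDiagram).arcs (fun n => 1 - n) fun n => n) d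
          ((⟨b, l₁, μ⟩ : StackedDiagram).topEnd u) := fun d => by
      by_cases hd : d.1 ≤ l₁.length
      · obtain ⟨u, hu⟩ := h.1 d hd
        exact ⟨u, fun _ => hu⟩
      · exact ⟨0, fun h => absurd h hd⟩
    choose U hU using h1
    exact ⟨U, hU⟩
  -- A point of the lower diagram is sent to the bottom end above a chosen top end of its component.
  -- The other choice differs by the closing, so `ρ` is well defined up to links.
  obtain ⟨ρ, ρ1, ρ2⟩ : ∃ ρ : Dart → Dart, (∀ d, d.1 ≤ l₁.length →
      ρ d = (⟨μ, l₂, t⟩ : StackedDiagram).bottomEnd (U d + 1)) ∧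
      ∀ d : Dart, ρ (d.shift (l₁.length + 1)) = d := by
    refine ⟨fun d => if d.1 ≤ l₁.length then (⟨μ, l₂, t⟩ : StackedDiagram).bottomEnd (U d + 1)
      else (d.1 - (l₁.length + 1), d.2.1, d.2.2), fun d hd => if_pos hd, fun d => ?_⟩
    have : ¬ (d.shift (l₁.length + 1)).1 ≤ l₁.length := by
      unfold Dart.shift
      dsimp only
      omega
    dsimp only
    rw [if_neg this]
    simp [Dart.shift]
  have uns : ∀ d : Dart, ¬ d.1 ≤ l₁.length → ∃ d' : Dart, d'.shift (l₁.length + 1) = d := fun d hd =>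
    ⟨(d.1 - (l₁.length + 1), d.2.1, d.2.2), by
      unfold Dart.shift
      dsimp only
      rw [Nat.sub_add_cancel (by omega)]⟩
  have bot : ∀ u w, w = u ∨ w = -1 - u →
      Link Dart.flip ((⟨μ, l₂, t⟩ : StackedDiagram).arcs (fun n => 1 - n) fun n => n)
        ((⟨μ, l₂, t⟩ : StackedDiagram).bottomEnd (u + 1))
        ((⟨μ, l₂, t⟩ : StackedDiagram).bottomEnd (w + 1)) := by
    rintro u w (rfl | rfl)
    · exact .refl _
    · have := Link.right (f := Dart.flip)
        (g := (⟨μ, l₂, t⟩ : StackedDiagram).arcs (fun n => 1 - n) fun n => n)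
        ((⟨μ, l₂, t⟩ : StackedDiagram).bottomEnd (u + 1))
      rwa [arcs_bottomEnd, show 1 - (u + 1) = -1 - u + 1 by ring] at this
  have wd : ∀ d e : Dart, d.1 ≤ l₁.length → e.1 ≤ l₁.length →
      Link Dart.flip ((⟨b, l₁, μ⟩ : StackedDiagram).arcs (fun n => 1 - n) fun n => n) d e →
      Link Dart.flip ((⟨μ, l₂, t⟩ : StackedDiagram).arcs (fun n => 1 - n) fun n => n) (ρ d) (ρ e) := by
    intro d e hd he hl
    rw [ρ1 d hd, ρ1 e he]
    exact bot _ _ (h.eq (((hU d hd).symm.trans hl).trans (hU e he)))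
  have ρtop : ∀ u, Link Dart.flip ((⟨μ, l₂, t⟩ : StackedDiagram).arcs (fun n => 1 - n) fun n => n)
      ((⟨μ, l₂, t⟩ : StackedDiagram).bottomEnd (u + 1))
      (ρ ((⟨b, l₁, μ⟩ : StackedDiagram).topEnd u)) := by
    intro u
    rw [ρ1 _ (topEnd_le _)]
    exact bot _ _ (h.eq (hU _ (topEnd_le _)))
  have key := Link.of_rel_on (f := Dart.flip) (p := fun d : Dart => d.1 ≤ l₂.length + (l₁.length + 1))
    (r := fun d e => Link Dart.flip
      ((⟨μ, l₂, t⟩ : StackedDiagram).arcs (fun n => 1 - n) fun n => n) (ρ d) (ρ e)) (fun _ => Iff.rfl)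
    (fun d => by
      have := arcs_le (E := ⟨b, l₁ ++ μ :: l₂, t⟩) (κ := fun n => 1 - n) (κ' := fun n => n) d
      rwa [length_glue] at this)
    ⟨fun _ => .refl _, .symm, .trans⟩ (fun d hd => ?_) (fun d hd => ?_) hl (by
      unfold Dart.shift
      dsimp only
      omega)
  · rwa [ρ2, ρ2] at key
  · by_cases h1 : d.1 ≤ l₁.length
    · exact wd d d.flip h1 h1 (.left d)
    · obtain ⟨d', rfl⟩ := uns d h1
      have e : (d'.shift (l₁.length + 1)).flip = d'.flip.shift (l₁.length + 1) := rfl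
      rw [e, ρ2, ρ2]
      exact .left d'
  · by_cases h1 : d.1 ≤ l₁.length
    · rcases arcs_glue_of_le (b := b) (μ := μ) (t := t) (l₂ := l₂) (κ := fun n => 1 - n) h1 with
        h2 | ⟨u, rfl⟩
      · rw [h2]
        exact wd _ _ h1 ((arcs_le (E := ⟨b, l₁, μ⟩) d).2 h1) (.right d)
      · rw [arcs_glue_topEnd, ρ2]
        exact (ρtop u).symm
    · obtain ⟨d', rfl⟩ := uns d h1
      have hd' : d'.1 ≤ l₂.length := by
        have : d'.1 + (l₁.length + 1) ≤ l₂.length + (l₁.length + 1) := hd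
        omega
      rcases arcs_glue_of_ge (b := b) (μ := μ) (t := t) (l₁ := l₁) (κ := fun n => 1 - n) hd' with
        h2 | ⟨v, rfl⟩
      · rw [h2, ρ2, ρ2]
        exact .right d'
      · rw [arcs_glue_bottomEnd, ρ2]
        have := ρtop (v - 1)
        rwa [sub_add_cancel] at this

/-- By the two preceding lemmas the lower diagram acts exactly like the closing at the bottom of the
upper diagram. -/
theorem TopCrit.glue (h : (⟨b, l₁, μ⟩ : StackedDiagram).TopCrit) :
    (⟨b, l₁ ++ μ :: l₂, t⟩ : StackedDiagram).TopCrit ↔ (⟨μ, l₂, t⟩ : StackedDiagram).TopCrit := by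
  constructor
  · rintro ⟨h1, h2⟩
    refine ⟨fun d hd => ?_, fun u => ?_⟩
    · obtain ⟨u, hu⟩ := h1 (d.shift (l₁.length + 1)) (by
        rw [length_glue]
        exact Nat.add_le_add_right hd _)
      rw [topEnd_glue] at hu
      exact ⟨u, h.link_of_shift hd hu⟩
    · have := h2 u
      rw [topEnd_glue, topEnd_glue] at this
      exact h.link_of_shift (topEnd_le (E := ⟨μ, l₂, t⟩) u) this
  · rintro ⟨h1, h2⟩
    have up : ∀ d : Dart, d.1 ≤ l₂.length → ∃ u, Link Dart.flip
        ((⟨b, l₁ ++ μ :: l₂, t⟩ : StackedDiagram).arcs (fun n => 1 - n) fun n => n)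
        (d.shift (l₁.length + 1)) ((⟨b, l₁ ++ μ :: l₂, t⟩ : StackedDiagram).topEnd u) := by
      intro d hd
      obtain ⟨u, hu⟩ := h1 d hd
      refine ⟨u, ?_⟩
      rw [topEnd_glue]
      exact h.link_shift hd hu
    refine ⟨fun d hd => ?_, fun u => ?_⟩
    · by_cases hd1 : d.1 ≤ l₁.length
      · obtain ⟨u, hu⟩ := h.1 d hd1
        have r1 := link_glue_of_le (t := t) (l₂ := l₂) hd1 hu
        obtain ⟨w, hw⟩ := up ((⟨μ, l₂, t⟩ : StackedDiagram).bottomEnd (u + 1)) (Nat.zero_le _)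
        have r2 := Link.right (f := Dart.flip)
          (g := (⟨b, l₁ ++ μ :: l₂, t⟩ : StackedDiagram).arcs (fun n => 1 - n) fun n => n)
          (((⟨μ, l₂, t⟩ : StackedDiagram).bottomEnd (u + 1)).shift (l₁.length + 1))
        rw [arcs_glue_bottomEnd, add_sub_cancel_right] at r2
        exact ⟨w, (r1.trans r2.symm).trans hw⟩
      · obtain ⟨d', rfl⟩ : ∃ d' : Dart, d'.shift (l₁.length + 1) = d :=
          ⟨(d.1 - (l₁.length + 1), d.2.1, d.2.2), by
            unfold Dart.shift
            dsimp only
            rw [Nat.sub_add_cancel (by omega)]⟩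
        rw [length_glue] at hd
        have hd : d'.1 + (l₁.length + 1) ≤ l₂.length + (l₁.length + 1) := hd
        exact up d' (by omega)
    · rw [topEnd_glue, topEnd_glue]
      exact h.link_shift (topEnd_le (E := ⟨μ, l₂, t⟩) u) (h2 u)

end Glue

theorem Orientable.rot_circleDiagram {lam mu : CupDiagram} (h : (circleDiagram lam mu).Orientable) :
    (circleDiagram mu.rot lam.rot).Orientable := h.rot

theorem TopCrit.of_isChain {t : CupDiagram} (l : List CupDiagram) : ∀ b,
    List.IsChain (fun lam mu => (circleDiagram lam mu).Orientable) (b :: (l ++ [t])) →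
      (⟨b, l, t⟩ : StackedDiagram).TopCrit := by
  induction l with
  | nil =>
    intro b h
    have h : (circleDiagram b t).Orientable := by simpa using h
    exact h.topCrit
  | cons σ l ih =>
    intro b h
    rw [List.cons_append, List.isChain_cons_cons] at h
    exact (TopCrit.glue (l₁ := []) (Orientable.topCrit h.1)).2 (ih σ h.2)

/-- Circle diagrams that are orientable can be stacked. -/
theorem IsStackOfOrientable.orientable {E : StackedDiagram} (h : E.IsStackOfOrientable) :
    E.Orientable := by
  rw [orientable_iff_topCrit]
  refine ⟨TopCrit.of_isChain _ _ h, TopCrit.of_isChain _ _ ?_⟩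
  unfold IsStackOfOrientable at h
  have e : E.rot.bottom :: (E.rot.middle ++ [E.rot.top]) =
      ((E.bottom :: (E.middle ++ [E.top])).map CupDiagram.rot).reverse := by
    simp [rot]
  change List.IsChain _ (E.rot.bottom :: (E.rot.middle ++ [E.rot.top]))
  rw [e, List.isChain_reverse, List.isChain_map]
  exact h.imp fun _ _ h => h.rot_circleDiagram

end StackedDiagram

/-! ### Outcomes of sequences of surgeries. -/

theorem CupDiagram.numCups_erase {σ : CupDiagram} {a : ℤ} (ha : σ.IsOutermost a) :
    (σ.erase a).numCups + 1 = σ.numCups := by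
  have e : {i | i < (σ.erase a).mate i} = {i | i < σ.mate i} \ {a} := by
    ext i
    have h1 := ha.1
    have h2 := σ.mate_mate a
    simp only [Set.mem_ofPred_eq, Set.mem_sdiff, Set.mem_singleton_iff, erase_mate _ ha]
    grind
  unfold numCups
  rw [e]
  exact Set.ncard_sdiff_singleton_add_one ha.1
    (σ.finite_cups.subset fun i (hi : i < σ.mate i) => hi.ne')

namespace StackedDiagram

variable {E F : StackedDiagram} {r r' : Option StackedDiagram}

variable (E) in
/-- The number of cups in the middle sections. -/
noncomputable def middleCups : ℕ := (E.middle.map CupDiagram.numCups).sum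

theorem middleCups_replace {j : ℕ} {a : ℤ} (h : E.IsPotentialSurgery j a) :
    (E.replace j a).middleCups + 1 = E.middleCups := by
  obtain ⟨σ, hσ, ha⟩ := h
  obtain ⟨pre, post, rfl, he⟩ := exists_split hσ
  rw [he, replace_mk]
  have := CupDiagram.numCups_erase ha
  simp only [middleCups, List.map_append, List.map_cons, List.sum_append, List.sum_cons]
  omega

theorem outcome_iff : Outcome E r ↔ ((∀ j a, ¬ E.IsPotentialSurgery j a) ∧ r = some E) ∨
    ∃ j a, E.IsPotentialSurgery j a ∧ ((¬ (E.replace j a).Orientable ∧ r = none) ∨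
      ((E.replace j a).Orientable ∧ Outcome (E.replace j a) r)) := by
  classical
  constructor
  · rintro (⟨_, h⟩ | ⟨_, j, a, h, h0⟩ | ⟨_, F, _, j, a, h, hF, hr⟩)
    · exact Or.inl ⟨h, rfl⟩
    · rw [surgery_of_potential h] at h0
      refine Or.inr ⟨j, a, h, Or.inl ⟨fun hc => ?_, rfl⟩⟩
      rw [if_pos hc] at h0
      exact absurd h0 (by simp)
    · rw [surgery_of_potential h] at hF
      split_ifs at hF with hc
      obtain rfl := Option.some.inj hF
      exact Or.inr ⟨j, a, h, Or.inr ⟨hc, hr⟩⟩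
  · rintro (⟨h, rfl⟩ | ⟨j, a, h, ⟨hc, rfl⟩ | ⟨hc, hr⟩⟩)
    · exact .done E h
    · exact .zero E j a h (by rw [surgery_of_potential h, if_neg hc])
    · exact .step E _ r j a h (by rw [surgery_of_potential h, if_pos hc]) hr

theorem exists_outcome (E : StackedDiagram) : ∃ r, Outcome E r := by
  induction hn : E.middleCups using Nat.strong_induction_on generalizing E with
  | _ n ih =>
    by_cases h : ∃ j a, E.IsPotentialSurgery j a
    · obtain ⟨j, a, h⟩ := h
      by_cases hc : (E.replace j a).Orientable
      · have := middleCups_replace h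
        obtain ⟨r, hr⟩ := ih _ (by omega) (E.replace j a) rfl
        exact ⟨r, outcome_iff.2 (Or.inr ⟨j, a, h, Or.inr ⟨hc, hr⟩⟩)⟩
      · exact ⟨none, outcome_iff.2 (Or.inr ⟨j, a, h, Or.inl ⟨hc, rfl⟩⟩)⟩
    · push Not at h
      exact ⟨some E, .done E h⟩

/-- The outcome does not depend on the order of the surgeries. -/
theorem Orientable.outcome_unique (hE : E.Orientable) (h : Outcome E r) (h' : Outcome E r') :
    r = r' := by
  induction hn : E.middleCups using Nat.strong_induction_on generalizing E r r' with
  | _ n ih =>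
    rw [outcome_iff] at h h'
    rcases h with ⟨h, rfl⟩ | ⟨j, a, h, hr⟩
    · rcases h' with ⟨-, rfl⟩ | ⟨j', a', h', -⟩
      · rfl
      · exact absurd h' (h j' a')
    · rcases h' with ⟨h', rfl⟩ | ⟨j', a', h', hr'⟩
      · exact absurd h (h' j a)
      · have n1 := middleCups_replace h
        have n2 := middleCups_replace h'
        by_cases hne : j = j' ∧ a = a'
        · obtain ⟨rfl, rfl⟩ := hne
          rcases hr with ⟨c, rfl⟩ | ⟨c, hr⟩ <;> rcases hr' with ⟨c', rfl⟩ | ⟨c', hr'⟩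
          · rfl
          · exact absurd c' c
          · exact absurd c c'
          · exact ih _ (by omega) c hr hr' rfl
        · have hne' : ¬ (j' = j ∧ a' = a) := fun h => hne ⟨h.1.symm, h.2.symm⟩
          have p1 := h.replace h' hne
          have p2 := h'.replace h hne'
          have o1 := hE.of_replace_of_potential h h' hne
          have o2 := hE.of_replace_of_potential h' h hne'
          have comm := replace_comm h h'
          -- If the double surgery fails, each single surgery that succeeds can still be continued
          -- to the outcome zero.
          have none1 : ¬ ((E.replace j' a').replace j a).Orientable →
              Outcome (E.replace j a) none ∧ Outcome (E.replace j' a') none := fun hc =>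
            ⟨outcome_iff.2 (Or.inr ⟨j', a', p2, Or.inl ⟨by rwa [← comm], rfl⟩⟩),
              outcome_iff.2 (Or.inr ⟨j, a, p1, Or.inl ⟨hc, rfl⟩⟩)⟩
          rcases hr with ⟨c, rfl⟩ | ⟨c, hr⟩ <;> rcases hr' with ⟨c', rfl⟩ | ⟨c', hr'⟩
          · rfl
          · exact ih _ (by omega) c' (none1 fun hc => c (o1 c' hc)).2 hr' rfl
          · exact ih _ (by omega) c hr (none1 fun hc => c' (o2 c (by rwa [← comm]))).1 rfl
          · by_cases hc : ((E.replace j' a').replace j a).Orientable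
            -- The diamond argument: any outcome of the double surgery is an outcome of both single
            -- ones, and these have unique outcomes by induction.
            · obtain ⟨s, hs⟩ := exists_outcome ((E.replace j' a').replace j a)
              have s1 : Outcome (E.replace j a) s := outcome_iff.2 (Or.inr ⟨j', a', p2, Or.inr
                ⟨by rwa [← comm], by rwa [← comm]⟩⟩)
              have s2 : Outcome (E.replace j' a') s :=
                outcome_iff.2 (Or.inr ⟨j, a, p1, Or.inr ⟨hc, hs⟩⟩)
              exact (ih _ (by omega) c hr s1 rfl).trans (ih _ (by omega) c' s2 hr' rfl)
            · exact (ih _ (by omega) c hr (none1 hc).1 rfl).trans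
                (ih _ (by omega) c' (none1 hc).2 hr' rfl)

variable (E) in
/-- The surgeries can be performed without the result becoming zero. -/
def NonZero : Prop := ∃ F, Outcome E (some F)

/-- Since the outcome is unique, any chosen surgery may be performed first. -/
theorem Orientable.nonZero_iff {j : ℕ} {a : ℤ} (hE : E.Orientable)
    (h : E.IsPotentialSurgery j a) :
    E.NonZero ↔ (E.replace j a).Orientable ∧ (E.replace j a).NonZero := by
  constructor
  · rintro ⟨F, hF⟩
    obtain ⟨r, hr⟩ := exists_outcome (E.replace j a)
    by_cases hc : (E.replace j a).Orientable
    · have := hE.outcome_unique hF (outcome_iff.2 (Or.inr ⟨j, a, h, Or.inr ⟨hc, hr⟩⟩))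
      exact ⟨hc, F, this ▸ hr⟩
    · have := hE.outcome_unique hF (outcome_iff.2 (Or.inr ⟨j, a, h, Or.inl ⟨hc, rfl⟩⟩))
      exact absurd this (by simp)
  · rintro ⟨hc, F, hF⟩
    exact ⟨F, outcome_iff.2 (Or.inr ⟨j, a, h, Or.inr ⟨hc, hF⟩⟩)⟩

theorem nonZero_of_trivial (h : ∀ σ ∈ E.middle, σ = CupDiagram.trivial) : E.NonZero :=
  ⟨E, .done E fun j a ⟨σ, hσ, ha⟩ => by
    rw [h σ (List.mem_of_getElem? hσ)] at ha
    exact CupDiagram.not_isOutermost_trivial ha⟩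

theorem Outcome.spec (h : Outcome E r) : E.Orientable → ∀ F, r = some F → F.Orientable ∧
    F.bottom = E.bottom ∧ F.top = E.top ∧ F.middle.length = E.middle.length ∧
      ∀ j a, ¬ F.IsPotentialSurgery j a := by
  induction hn : E.middleCups using Nat.strong_induction_on generalizing E with
  | _ n ih =>
    intro hE F hF
    rcases outcome_iff.1 h with ⟨h', rfl⟩ | ⟨j, a, h, ⟨c, rfl⟩ | ⟨c, hr⟩⟩
    · obtain rfl := Option.some.inj hF
      exact ⟨hE, rfl, rfl, rfl, h'⟩
    · exact absurd hF (by simp)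
    · have := middleCups_replace h
      obtain ⟨h1, h2, h3, h4, h5⟩ := ih _ (by omega) hr rfl c F hF
      exact ⟨h1, h2, h3, h4.trans (length_replace _ _ _), h5⟩

/-! ### Two middle sections, as a preparation for associativity. -/

theorem orientable_trivial {lam nu : CupDiagram} :
    (⟨lam, [CupDiagram.trivial], nu⟩ : StackedDiagram).Orientable ↔
      (circleDiagram lam nu).Orientable :=
  orientable_insert_trivial (pre := []) (post := [])

theorem Orientable.circle_of_nonZero {lam mu nu : CupDiagram}
    (hE : (⟨lam, [mu], nu⟩ : StackedDiagram).Orientable)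
    (h : (⟨lam, [mu], nu⟩ : StackedDiagram).NonZero) : (circleDiagram lam nu).Orientable := by
  obtain ⟨⟨b, m, t⟩, hF⟩ := h
  obtain ⟨h1, h2, h3, h4, h5⟩ := hF.spec hE _ rfl
  dsimp only at h2 h3 h4
  subst h2 h3
  obtain ⟨τ, rfl⟩ := List.length_eq_one_iff.1 h4
  have : τ = CupDiagram.trivial := CupDiagram.eq_trivial fun a ha => h5 0 a ⟨τ, rfl, ha⟩
  rwa [this, orientable_trivial] at h1

theorem orientable_stack₁ {lam mu nu : CupDiagram} (h : (circleDiagram lam mu).Orientable)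
    (h' : (circleDiagram mu nu).Orientable) : (⟨lam, [mu], nu⟩ : StackedDiagram).Orientable :=
  IsStackOfOrientable.orientable (by simpa [IsStackOfOrientable] using ⟨h, h'⟩)

/-- The two halves of the criterion are glued separately, the second one after rotation, where the
circle diagram is the lower part. -/
theorem orientable_glue {lam sig nu rho : CupDiagram}
    (h : (⟨lam, [sig], nu⟩ : StackedDiagram).Orientable)
    (h' : (circleDiagram nu rho).Orientable) :
    (⟨lam, [sig, nu], rho⟩ : StackedDiagram).Orientable := by
  rw [orientable_iff_topCrit] at *
  exact ⟨(TopCrit.glue (l₁ := [sig]) (l₂ := []) h.1).2 h'.1,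
    (TopCrit.glue (b := rho.rot) (μ := nu.rot) (t := lam.rot) (l₁ := []) (l₂ := [sig.rot]) h'.2).2
      h.2⟩

/-- Rotated, the circle diagram lies at the bottom and can be removed by `TopCrit.glue`. This gives
only one half of the criterion for the remaining diagram, but that half already implies
connectedness. -/
theorem connInf_of_glue {lam sig nu rho : CupDiagram} (h' : (circleDiagram nu rho).Orientable)
    (h : (⟨lam, [sig, nu], rho⟩ : StackedDiagram).Orientable) :
    (⟨lam, [sig], nu⟩ : StackedDiagram).ConnInf := by
  have := ((TopCrit.glue (b := rho.rot) (μ := nu.rot) (t := lam.rot) (l₁ := []) (l₂ := [sig.rot])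
    h'.rot.topCrit).1 h.rot.topCrit).connInf.rot
  have e : (⟨nu.rot, [sig.rot], lam.rot⟩ : StackedDiagram).rot = ⟨lam, [sig], nu⟩ :=
    rot_rot ⟨lam, [sig], nu⟩
  rwa [e] at this

theorem replace_single {lam sig nu : CupDiagram} {a : ℤ} :
    (⟨lam, [sig], nu⟩ : StackedDiagram).replace 0 a = ⟨lam, [sig.erase a], nu⟩ := rfl

/-- The surgeries at `sig` are performed first, simultaneously with and without the circle diagram
on top. At each step orientability of the two results is equivalent, so one procedure reaches zero
exactly when the other does. -/
theorem nonZero_glue_iff {lam sig nu rho : CupDiagram}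
    (h : (⟨lam, [sig], nu⟩ : StackedDiagram).Orientable)
    (h' : (circleDiagram nu rho).Orientable) :
    (⟨lam, [sig, nu], rho⟩ : StackedDiagram).NonZero ↔
      (⟨lam, [sig], nu⟩ : StackedDiagram).NonZero ∧
      (⟨lam, [CupDiagram.trivial, nu], rho⟩ : StackedDiagram).NonZero := by
  induction hn : sig.numCups generalizing sig with
  | zero =>
    obtain rfl : sig = CupDiagram.trivial := CupDiagram.eq_trivial fun a ha => by
      have := CupDiagram.numCups_erase ha
      omega
    exact (and_iff_right (nonZero_of_trivial (by simp))).symm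
  | succ n ih =>
    by_cases hs : ∃ a, sig.IsOutermost a
    · obtain ⟨a, ha⟩ := hs
      have p1 : (⟨lam, [sig], nu⟩ : StackedDiagram).IsPotentialSurgery 0 a := ⟨sig, rfl, ha⟩
      have p2 : (⟨lam, [sig, nu], rho⟩ : StackedDiagram).IsPotentialSurgery 0 a := ⟨sig, rfl, ha⟩
      have hA := orientable_glue h h'
      have e : (⟨lam, [sig, nu], rho⟩ : StackedDiagram).replace 0 a =
        ⟨lam, [sig.erase a, nu], rho⟩ := rfl
      rw [h.nonZero_iff p1, hA.nonZero_iff p2, replace_single, e]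
      have := CupDiagram.numCups_erase ha
      -- Removing the circle diagram loses one half of the criterion; as the diagram before the
      -- surgery is orientable, connectedness alone restores it.
      have key : (⟨lam, [sig.erase a, nu], rho⟩ : StackedDiagram).Orientable ↔
          (⟨lam, [sig.erase a], nu⟩ : StackedDiagram).Orientable :=
        ⟨fun hc => h.of_replace (j := 0) rfl ha (connInf_of_glue h' hc),
          fun hc => orientable_glue hc h'⟩
      rw [key, and_assoc]
      exact and_congr_right fun hc => ih hc (by omega)
    · push Not at hs
      obtain rfl := CupDiagram.eq_trivial hs
      exact (and_iff_right (nonZero_of_trivial (by simp))).symm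

theorem nonZero_trivial_iff {lam nu rho : CupDiagram}
    (h : (⟨lam, [nu], rho⟩ : StackedDiagram).Orientable) :
    (⟨lam, [CupDiagram.trivial, nu], rho⟩ : StackedDiagram).NonZero ↔
      (⟨lam, [nu], rho⟩ : StackedDiagram).NonZero := by
  have ot : ∀ nu, (⟨lam, [CupDiagram.trivial, nu], rho⟩ : StackedDiagram).Orientable ↔
      (⟨lam, [nu], rho⟩ : StackedDiagram).Orientable := fun nu =>
    orientable_insert_trivial (pre := []) (post := [nu])
  induction hn : nu.numCups generalizing nu with
  | zero =>
    obtain rfl : nu = CupDiagram.trivial := CupDiagram.eq_trivial fun a ha => by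
      have := CupDiagram.numCups_erase ha
      omega
    exact iff_of_true (nonZero_of_trivial (by simp)) (nonZero_of_trivial (by simp))
  | succ n ih =>
    by_cases hs : ∃ a, nu.IsOutermost a
    · obtain ⟨a, ha⟩ := hs
      have p1 : (⟨lam, [nu], rho⟩ : StackedDiagram).IsPotentialSurgery 0 a := ⟨nu, rfl, ha⟩
      have p2 : (⟨lam, [CupDiagram.trivial, nu], rho⟩ : StackedDiagram).IsPotentialSurgery 1 a :=
        ⟨nu, rfl, ha⟩
      have e : (⟨lam, [CupDiagram.trivial, nu], rho⟩ : StackedDiagram).replace 1 a =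
        ⟨lam, [CupDiagram.trivial, nu.erase a], rho⟩ := rfl
      rw [h.nonZero_iff p1, ((ot nu).2 h).nonZero_iff p2, replace_single, e, ot]
      have := CupDiagram.numCups_erase ha
      exact and_congr_right fun hc => ih hc (by omega)
    · push Not at hs
      obtain rfl := CupDiagram.eq_trivial hs
      exact iff_of_true (nonZero_of_trivial (by simp)) (nonZero_of_trivial (by simp))

/-- This is the bracketing in which the lower product is formed first: the emptied section is
dropped, and then the surgeries at `nu` remain. -/
theorem nonZero_stack_iff {lam sig nu rho : CupDiagram} (h1 : (circleDiagram lam sig).Orientable)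
    (h2 : (circleDiagram sig nu).Orientable) (h3 : (circleDiagram nu rho).Orientable) :
    (⟨lam, [sig, nu], rho⟩ : StackedDiagram).NonZero ↔
      (⟨lam, [sig], nu⟩ : StackedDiagram).NonZero ∧
      (⟨lam, [nu], rho⟩ : StackedDiagram).NonZero := by
  have h := orientable_stack₁ h1 h2
  rw [nonZero_glue_iff h h3]
  exact and_congr_right fun hn =>
    nonZero_trivial_iff (orientable_stack₁ (h.circle_of_nonZero hn) h3)

theorem NonZero.rot (h : E.NonZero) : E.rot.NonZero := by
  obtain ⟨F, hF⟩ := h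
  induction hn : E.middleCups using Nat.strong_induction_on generalizing E with
  | _ n ih =>
    rcases outcome_iff.1 hF with ⟨h, -⟩ | ⟨j, a, h, ⟨-, hc⟩ | ⟨c, hr⟩⟩
    · refine ⟨E.rot, .done _ fun j a ⟨σ, hσ, ha⟩ => ?_⟩
      obtain ⟨-, e⟩ := rot_replace hσ ha
      rw [rot_rot] at e
      exact h _ _ ⟨_, e, ha.rot⟩
    · exact absurd hc (by simp)
    · have := middleCups_replace h
      obtain ⟨G, hG⟩ := ih _ (by omega) hr rfl
      obtain ⟨σ, hσ, ha⟩ := h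
      obtain ⟨e1, e2⟩ := rot_replace hσ ha
      rw [e1] at hG
      exact ⟨G, outcome_iff.2 (Or.inr ⟨_, _, ⟨_, e2, ha.rot⟩, Or.inr ⟨e1 ▸ c.rot, hG⟩⟩)⟩

theorem nonZero_rot_iff : E.rot.NonZero ↔ E.NonZero :=
  ⟨fun h => by
    have := h.rot
    rwa [rot_rot] at this, fun h => h.rot⟩

/-- Rotation exchanges the two bracketings. -/
theorem nonZero_stack_iff' {lam sig nu rho : CupDiagram} (h1 : (circleDiagram lam sig).Orientable)
    (h2 : (circleDiagram sig nu).Orientable) (h3 : (circleDiagram nu rho).Orientable) :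
    (⟨lam, [sig, nu], rho⟩ : StackedDiagram).NonZero ↔
      (⟨sig, [nu], rho⟩ : StackedDiagram).NonZero ∧
      (⟨lam, [sig], rho⟩ : StackedDiagram).NonZero := by
  have := nonZero_stack_iff h3.rot_circleDiagram h2.rot_circleDiagram h1.rot_circleDiagram
  rw [← nonZero_rot_iff, ← nonZero_rot_iff (E := ⟨sig, [nu], rho⟩),
    ← nonZero_rot_iff (E := ⟨lam, [sig], rho⟩)]
  exact this

end StackedDiagram

/-! ### The algebra. -/

section Algebra

variable (k : Type*) [Field k]

open StackedDiagram

theorem OrientableCircleDiagram.stack_orientable (x y : OrientableCircleDiagram)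
    (h : x.upper = y.lower) : (⟨x.lower, [x.upper], y.upper⟩ : StackedDiagram).Orientable :=
  orientable_stack₁ x.orientable (h ▸ y.orientable)

open Classical in
/-- The product of two orientable circle diagrams. -/
noncomputable def surgeryProduct (x y : OrientableCircleDiagram) : KhovanovP k :=
  if h : x.upper = y.lower ∧ (⟨x.lower, [x.upper], y.upper⟩ : StackedDiagram).NonZero then
    KhovanovP.basisVec k ⟨x.lower, y.upper, (x.stack_orientable y h.1).circle_of_nonZero h.2⟩
  else 0

/-- The multiplication of the Khovanov algebra. -/
noncomputable def surgeryMul : KhovanovP k →ₗ[k] KhovanovP k →ₗ[k] KhovanovP k :=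
  Finsupp.linearCombination k fun x => Finsupp.linearCombination k fun y => surgeryProduct k x y

variable {k}

theorem surgeryMul_basisVec (x y : OrientableCircleDiagram) :
    surgeryMul k (KhovanovP.basisVec k x) (KhovanovP.basisVec k y) = surgeryProduct k x y := by
  simp [surgeryMul, KhovanovP.basisVec]

theorem surgeryProduct_eq_basisVec {x y z : OrientableCircleDiagram} (h : x.upper = y.lower)
    (hn : (⟨x.lower, [x.upper], y.upper⟩ : StackedDiagram).NonZero) (h1 : z.lower = x.lower)
    (h2 : z.upper = y.upper) : surgeryProduct k x y = KhovanovP.basisVec k z := by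
  unfold surgeryProduct
  rw [dif_pos ⟨h, hn⟩]
  congr 1
  exact OrientableCircleDiagram.ext h1.symm h2.symm

theorem surgeryProduct_eq_zero {x y : OrientableCircleDiagram} (h : ¬ (x.upper = y.lower ∧
    (⟨x.lower, [x.upper], y.upper⟩ : StackedDiagram).NonZero)) : surgeryProduct k x y = 0 := by
  unfold surgeryProduct
  rw [dif_neg h]

theorem isSurgeryMultiplication_surgeryMul : IsSurgeryMultiplication (surgeryMul k) := by
  intro x y
  rw [surgeryMul_basisVec]
  refine ⟨fun h => surgeryProduct_eq_zero fun hc => h hc.1, fun h => ⟨fun h0 => ?_, fun F hF => ?_⟩⟩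
  · refine surgeryProduct_eq_zero fun ⟨_, F, hF⟩ => ?_
    exact absurd ((x.stack_orientable y h).outcome_unique h0 hF) (by simp)
  · exact ⟨⟨x.lower, y.upper, (x.stack_orientable y h).circle_of_nonZero ⟨F, hF⟩⟩, rfl, rfl,
      surgeryProduct_eq_basisVec h ⟨F, hF⟩ rfl rfl⟩

theorem KhovanovP.bilin_ext {M : Type*} [AddCommMonoid M] [Module k M]
    {m m' : KhovanovP k →ₗ[k] KhovanovP k →ₗ[k] M}
    (h : ∀ x y, m (basisVec k x) (basisVec k y) = m' (basisVec k x) (basisVec k y)) : m = m' := by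
  refine Finsupp.lhom_ext' fun x => LinearMap.ext_ring (Finsupp.lhom_ext' fun y =>
    LinearMap.ext_ring ?_)
  exact h x y

/-- Every sequence of surgeries terminates, so some outcome exists, and it prescribes the product of
the two basis vectors. -/
theorem IsSurgeryMultiplication.eq {m m' : KhovanovP k →ₗ[k] KhovanovP k →ₗ[k] KhovanovP k}
    (h : IsSurgeryMultiplication m) (h' : IsSurgeryMultiplication m') : m = m' := by
  refine KhovanovP.bilin_ext fun x y => ?_
  obtain ⟨a1, a2⟩ := h x y
  obtain ⟨b1, b2⟩ := h' x y
  by_cases hxy : x.upper = y.lower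
  · obtain ⟨r, hr⟩ := exists_outcome ⟨x.lower, [x.upper], y.upper⟩
    cases r with
    | none => rw [(a2 hxy).1 hr, (b2 hxy).1 hr]
    | some F =>
      obtain ⟨z, z1, z2, hz⟩ := (a2 hxy).2 F hr
      obtain ⟨w, w1, w2, hw⟩ := (b2 hxy).2 F hr
      rw [hz, hw, OrientableCircleDiagram.ext (z1.trans w1.symm) (z2.trans w2.symm)]
  · rw [a1 hxy, b1 hxy]

/-- When the diagrams match, both bracketings are the same basis vector or zero, according to
whether the surgeries on the diagram with two middle sections end in a nonzero result. -/
theorem surgeryMul_assoc_basisVec (x y z : OrientableCircleDiagram) :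
    surgeryMul k (surgeryProduct k x y) (KhovanovP.basisVec k z) =
      surgeryMul k (KhovanovP.basisVec k x) (surgeryProduct k y z) := by
  by_cases hxy : x.upper = y.lower
  · by_cases hyz : y.upper = z.lower
    · have h1 := x.orientable
      have h2 : (circleDiagram x.upper y.upper).Orientable := hxy ▸ y.orientable
      have h3 : (circleDiagram y.upper z.upper).Orientable := hyz ▸ z.orientable
      have k1 := nonZero_stack_iff h1 h2 h3
      have k2 := nonZero_stack_iff' h1 h2 h3
      by_cases hn : (⟨x.lower, [x.upper, y.upper], z.upper⟩ : StackedDiagram).NonZero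
      · obtain ⟨n1, n2⟩ := k1.1 hn
        obtain ⟨n3, n4⟩ := k2.1 hn
        have o1 := (x.stack_orientable y hxy).circle_of_nonZero n1
        have o2 := (orientable_stack₁ o1 h3).circle_of_nonZero n2
        rw [hxy] at n3
        have o3 := (y.stack_orientable z hyz).circle_of_nonZero n3
        rw [surgeryProduct_eq_basisVec (z := ⟨x.lower, y.upper, o1⟩) hxy n1 rfl rfl,
          surgeryProduct_eq_basisVec (z := ⟨y.lower, z.upper, o3⟩) hyz n3 rfl rfl,
          surgeryMul_basisVec, surgeryMul_basisVec,
          surgeryProduct_eq_basisVec (x := ⟨x.lower, y.upper, o1⟩) (z := ⟨x.lower, z.upper, o2⟩)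
            hyz n2 rfl rfl,
          surgeryProduct_eq_basisVec (y := ⟨y.lower, z.upper, o3⟩) (z := ⟨x.lower, z.upper, o2⟩)
            hxy n4 rfl rfl]
      · have l : surgeryMul k (surgeryProduct k x y) (KhovanovP.basisVec k z) = 0 := by
          by_cases n1 : (⟨x.lower, [x.upper], y.upper⟩ : StackedDiagram).NonZero
          · have o1 := (x.stack_orientable y hxy).circle_of_nonZero n1
            rw [surgeryProduct_eq_basisVec (z := ⟨x.lower, y.upper, o1⟩) hxy n1 rfl rfl,
              surgeryMul_basisVec]
            exact surgeryProduct_eq_zero fun h => hn (k1.2 ⟨n1, h.2⟩)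
          · rw [surgeryProduct_eq_zero fun h => n1 h.2, map_zero, LinearMap.zero_apply]
        have r : surgeryMul k (KhovanovP.basisVec k x) (surgeryProduct k y z) = 0 := by
          by_cases n1 : (⟨y.lower, [y.upper], z.upper⟩ : StackedDiagram).NonZero
          · have o1 := (y.stack_orientable z hyz).circle_of_nonZero n1
            rw [surgeryProduct_eq_basisVec (z := ⟨y.lower, z.upper, o1⟩) hyz n1 rfl rfl,
              surgeryMul_basisVec]
            exact surgeryProduct_eq_zero fun h => hn (k2.2 ⟨hxy ▸ n1, h.2⟩)
          · rw [surgeryProduct_eq_zero fun h => n1 h.2, map_zero]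
        rw [l, r]
    · rw [surgeryProduct_eq_zero (x := y) fun h => hyz h.1, map_zero]
      by_cases n1 : (⟨x.lower, [x.upper], y.upper⟩ : StackedDiagram).NonZero
      · have o1 := (x.stack_orientable y hxy).circle_of_nonZero n1
        rw [surgeryProduct_eq_basisVec (z := ⟨x.lower, y.upper, o1⟩) hxy n1 rfl rfl,
          surgeryMul_basisVec]
        exact surgeryProduct_eq_zero fun h => hyz h.1
      · rw [surgeryProduct_eq_zero fun h => n1 h.2, map_zero, LinearMap.zero_apply]
  · rw [surgeryProduct_eq_zero (x := x) fun h => hxy h.1, map_zero, LinearMap.zero_apply]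
    by_cases hyz : y.upper = z.lower ∧ (⟨y.lower, [y.upper], z.upper⟩ : StackedDiagram).NonZero
    · have o1 := (y.stack_orientable z hyz.1).circle_of_nonZero hyz.2
      rw [surgeryProduct_eq_basisVec (z := ⟨y.lower, z.upper, o1⟩) hyz.1 hyz.2 rfl rfl,
        surgeryMul_basisVec]
      exact (surgeryProduct_eq_zero (y := ⟨y.lower, z.upper, o1⟩) fun h => hxy h.1).symm
    · rw [surgeryProduct_eq_zero hyz, map_zero]

theorem surgeryMul_assoc (x y z : KhovanovP k) :
    surgeryMul k (surgeryMul k x y) z = surgeryMul k x (surgeryMul k y z) := by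
  induction x using Finsupp.induction_linear with
  | zero => simp
  | add x x' hx hx' => simp [hx, hx']
  | single a r =>
    induction y using Finsupp.induction_linear with
    | zero => simp
    | add y y' hy hy' => simp [hy, hy']
    | single b s =>
      induction z using Finsupp.induction_linear with
      | zero => simp
      | add z z' hz hz' => simp only [map_add, hz, hz']
      | single c t =>
        have e : ∀ (d : OrientableCircleDiagram) (q : k),
            Finsupp.single d q = q • KhovanovP.basisVec k d := fun d q => by
          simp [KhovanovP.basisVec]
        rw [e, e, e]
        simp only [map_smul, LinearMap.smul_apply, surgeryMul_basisVec, surgeryMul_assoc_basisVec]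

end Algebra

theorem mainTheorem11 (k : Type*) [Field k] :
    (∀ E : StackedDiagram, E.IsStackOfOrientable → E.Orientable) ∧
    (∀ E : StackedDiagram, E.Orientable → ∀ (j j' : ℕ) (a a' : ℤ),
      E.IsPotentialSurgery j a → E.IsPotentialSurgery j' a' →
      (StackedDiagram.surgery j' a' E).bind (StackedDiagram.surgery j a) =
        (StackedDiagram.surgery j a E).bind (StackedDiagram.surgery j' a')) ∧
    ∃ m : KhovanovP k →ₗ[k] KhovanovP k →ₗ[k] KhovanovP k,
      IsSurgeryMultiplication m ∧
      (∀ m' : KhovanovP k →ₗ[k] KhovanovP k →ₗ[k] KhovanovP k,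
        IsSurgeryMultiplication m' → m' = m) ∧
      ∀ x y z : KhovanovP k, m (m x y) z = m x (m y z) :=
  ⟨fun _ hE => hE.orientable, fun _ hE _ _ _ _ h h' => hE.surgery_comm h h',
    surgeryMul k, isSurgeryMultiplication_surgeryMul,
    fun _ hm => hm.eq isSurgeryMultiplication_surgeryMul, surgeryMul_assoc⟩
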